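/- **Setting.** For $f=f(x,v)$ on $\mathbb R^3\times\mathbb R^3$ put $\rho_f(x)=\int_{\mathbb R^3} f(x,v)\,dv$ and $\phi_f=-\frac{1}{4\pi|x|}*\rho_f$. A function is called spherically symmetric if it depends only on $(|x|,|v|,x\cdot v)$. Let $Q$ be a continuous, nonnegative, nonzero, compactly supported, spherically symmetric stationary solution of the gravitational Vlasov–Poisson system, that is $v\cdot\nabla_xQ-\nabla\phi_Q\cdot\nabla_vQ=0$ in the sense of distributions. Assume that $$Q(x,v)=F\Big(\tfrac{|v|^2}{2}+\phi_Q(x),\,|x\times v|^2\Big)$$ with $F:\mathbb R\times\mathbb R_+\to\mathbb R_+$ continuous, and that for some $e_0<0$ the set $\mathcal O=\{(e,\ell)\in\mathbb R\times\mathbb R_+: F(e,\ell)>0\}$ is contained in $(-\infty,e_0)\times\mathbb R_+$ and $F$ is $\mathcal C^1$ on $\mathcal O$ with $\partial F/\partial e<0$ there. Let $\Omega=\{Q>0\}$ and $F'_e(x,v)=\frac{\partial F}{\partial e}\big(\frac{|v|^2}{2}+\phi_Q(x),|x\times v|^2\big)$ on $\Omega$. Let $L^{2,r}_{|F'_e|}$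 be the Hilbert space of spherically symmetric $f$ on $\Omega$ with $\int_\Omega \frac{|f|^2}{|F'_e|}\,dx\,dv<\infty$; functions are real-valued, except that self-adjointness is understood in the space of complex-valued functions. Denote by $L^{2,even}_{|F'_e|}$ and $L^{2,odd}_{|F'_e|}$ the subspaces of $f$ with $f(x,-v)=f(x,v)$, respectively $f(x,-v)=-f(x,v)$. Let $\mathcal T f=v\cdot\nabla_xf-\nabla\phi_Q\cdot\nabla_vf$ in the sense of distributions on $\Omega$, with domain $D(\mathcal T)=\{f\in L^{2,r}_{|F'_e|}:\mathcal Tf\in L^{2,r}_{|F'_e|}\}$ and kernel $N(\mathcal T)$. For real $g\in L^{2,r}_{|F'_e|}$, extended by $0$ outside $\Omega$, let $$\mathscr A(g,g)=\int_\Omega\frac{g^2}{|F'_e|}\,dx\,dv-\|\nabla\phi_g\|_{L^2(\mathbb R^3)}^2 .$$ **Proposition 5.1.** (i) $i\mathcal T$ is a self-adjoint operator, and its kernel is $$N(\mathcal T)=\Big\{f\in L^{2,r}_{|F'_e|}:\ f(x,v)=\tilde f\big(\tfrac{|v|^2}{2}+\phi_Q(x),|x\times v|^2\big)\ \text{a.e.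 on }\Omega\text{ for some measurable }\tilde f\Big\};$$ this description of the kernel holds for real-valued and for complex-valued functions. (ii) For every $g\in L^{2,r}_{|F'_e|}$ the functional $\mathscr A(g,g)$ is well defined: $g\in L^1$, $\phi_g$ is differentiable almost everywhere and $\nabla\phi_g\in L^2(\mathbb R^3)$. The map $g\mapsto\mathscr A(g,g)$ is continuous on $L^{2,r}_{|F'_e|}$. For every $\xi\in D(\mathcal T)\cap L^{2,odd}_{|F'_e|}$, $$\mathscr A(\mathcal T\xi,\mathcal T\xi)\ \ge\ \int_\Omega\frac{\xi^2}{|F'_e|}\,\frac{\phi_Q'(r)}{r}\,dx\,dv,\qquad r=|x|,$$ where the integral on the right converges. (iii) If $g\in N(\mathcal T)^\perp\cap L^{2,even}_{|F'_e|}$, then $\mathscr A(g,g)\ge0$, and $\mathscr A(g,g)=0$ if and only if $g=0$. -/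

import Mathlib

open MeasureTheory Set
open scoped ContDiff RealInnerProductSpace

noncomputable section

namespace VlasovPoisson

/-- Physical space `ℝ³` with the Euclidean norm. -/
abbrev E3 : Type := EuclideanSpace ℝ (Fin 3)

/-- Phase space `ℝ³ × ℝ³`, with points `z = (x, v)` and its Lebesgue measure. -/
abbrev Phase : Type := E3 × E3

/-- The spherical density `ρ_f(x) = ∫ f(x, v) dv`. -/
def density (f : Phase → ℝ) (x : E3) : ℝ := ∫ v : E3, f (x, v)

/-- The gravitational field `φ_f = -(1 / (4π|x|)) * ρ_f` (convolution). -/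
def potential (f : Phase → ℝ) (x : E3) : ℝ :=
  -(1 / (4 * Real.pi)) * ∫ y : E3, density f y / ‖x - y‖

/-- The radial derivative `φ'(r)` of a function on `ℝ³`, at a point `x` with `|x| = r`. -/
def radialDeriv (φ : E3 → ℝ) (x : E3) : ℝ := fderiv ℝ φ x (‖x‖⁻¹ • x)

/-- The squared angular momentum `ℓ(x, v) = |x × v|²`. -/
def angMom (z : Phase) : ℝ := ‖WithLp.toLp 2 (crossProduct z.1.ofLp z.2.ofLp)‖ ^ 2

/-- The microscopic energy `e(x, v) = |v|²/2 + φ(x)`. -/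
def energy (φ : E3 → ℝ) (z : Phase) : ℝ := ‖z.2‖ ^ 2 / 2 + φ z.1

/-- The rotational invariants `(|x|, |v|, x·v)` of a point of phase space. -/
def invariants (z : Phase) : ℝ × ℝ × ℝ := (‖z.1‖, ‖z.2‖, ⟪z.1, z.2⟫)

lemma measurable_invariants : Measurable invariants := by
  have : Continuous invariants := by unfold invariants; fun_prop
  exact this.measurable

/-- The σ-algebra generated by `(|x|, |v|, x·v)`: a function is measurable for it exactly when it
is a measurable function of `(|x|, |v|, x·v)`. -/
abbrev radialSigma : MeasurableSpace Phase := MeasurableSpace.comap invariants inferInstance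

instance radialSigma_le :
    Fact (radialSigma ≤ (inferInstance : MeasurableSpace Phase)) :=
  ⟨measurable_invariants.comap_le⟩

/-- Smooth functions with compact support contained in `U`. -/
def IsTest (U : Set Phase) (ψ : Phase → ℝ) : Prop :=
  ContDiff ℝ ∞ ψ ∧ HasCompactSupport ψ ∧ tsupport ψ ⊆ U

/-- The classical expression `v·∇ₓψ - ∇φ·∇ᵥψ` for a differentiable `ψ`. -/
def transportClassical (φ : E3 → ℝ) (ψ : Phase → ℝ) (z : Phase) : ℝ :=
  fderiv ℝ ψ z (z.2, -gradient φ z.1)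

/-- The set `𝒪 = {(e, ℓ) ∈ ℝ × ℝ₊ : F(e, ℓ) > 0}`. -/
def posSet (F : ℝ → ℝ → ℝ) : Set (ℝ × ℝ) := {p | 0 ≤ p.2 ∧ 0 < F p.1 p.2}

/-- The assumptions on the steady state `Q`, its profile `F` (of which only the values for `ℓ ≥ 0`
matter) and the cut-off energy `e₀`. -/
structure IsAdmissible (Q : Phase → ℝ) (F : ℝ → ℝ → ℝ) (e₀ : ℝ) : Prop where
  continuous : Continuous Q
  nonneg : ∀ z, 0 ≤ Q z
  ne_zero : Q ≠ 0
  hasCompactSupport : HasCompactSupport Q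
  spherical : ∃ q : ℝ → ℝ → ℝ → ℝ, ∀ z : Phase, Q z = q ‖z.1‖ ‖z.2‖ ⟪z.1, z.2⟫
  /-- `Q` is a stationary (distributional) solution of the Vlasov-Poisson system. -/
  steady : ∀ ψ, IsTest univ ψ → ∫ z, transportClassical (potential Q) ψ z * Q z = 0
  profile_continuous : ContinuousOn (Function.uncurry F) (univ ×ˢ Ici 0)
  profile_nonneg : ∀ e ℓ, 0 ≤ ℓ → 0 ≤ F e ℓ
  eq_profile : ∀ z, Q z = F (energy (potential Q) z) (angMom z)
  cutoff_neg : e₀ < 0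
  posSet_subset : ∀ p ∈ posSet F, p.1 < e₀
  profile_contDiffOn : ContDiffOn ℝ 1 (Function.uncurry F) (posSet F)
  profile_deriv_neg : ∀ p ∈ posSet F, deriv (fun e => F e p.2) p.1 < 0

/-- `Ω = {Q > 0}`. -/
def Omega (Q : Phase → ℝ) : Set Phase := {z | 0 < Q z}

/-- `F'_e(x, v) = (∂F/∂e)(|v|²/2 + φ_Q(x), |x × v|²)`. -/
def dF (Q : Phase → ℝ) (F : ℝ → ℝ → ℝ) (z : Phase) : ℝ :=
  deriv (fun e => F e (angMom z)) (energy (potential Q) z)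

/-- The measure `dx dv / |F'_e|` on `Ω`. -/
def weighted (Q : Phase → ℝ) (F : ℝ → ℝ → ℝ) : Measure Phase :=
  (volume.restrict (Omega Q)).withDensity (fun z => ENNReal.ofReal (1 / |dF Q F z|))

/-- The Hilbert space `L^{2,r}_{|F'_e|}` of spherically symmetric functions on `Ω` that are square
integrable with weight `1 / |F'_e|`, with scalars `𝕜 = ℝ` or `ℂ`. -/
abbrev L2r (𝕜 : Type) [RCLike 𝕜] (Q : Phase → ℝ) (F : ℝ → ℝ → ℝ) : Type :=
  lpMeas 𝕜 𝕜 radialSigma 2 (weighted Q F)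

/-- `𝒯 f = g` in the sense of distributions on `Ω`, where
`𝒯 f = v·∇ₓf - ∇φ_Q·∇ᵥf`. The two integrability requirements only say that the pairings make
sense. -/
def IsWeakTransport {𝕜 : Type} [RCLike 𝕜] (Q : Phase → ℝ) (f g : Phase → 𝕜) : Prop :=
  ∀ ψ, IsTest (Omega Q) ψ →
    IntegrableOn (fun z => transportClassical (potential Q) ψ z • f z) (Omega Q) ∧
    IntegrableOn (fun z => ψ z • g z) (Omega Q) ∧
    ∫ z in Omega Q, transportClassical (potential Q) ψ z • f z = -∫ z in Omega Q, ψ z • g z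

lemma IsWeakTransport.congr {𝕜 : Type} [RCLike 𝕜] {Q : Phase → ℝ} {f g f' g' : Phase → 𝕜}
    (h : IsWeakTransport Q f g) (hf : f =ᵐ[volume.restrict (Omega Q)] f')
    (hg : g =ᵐ[volume.restrict (Omega Q)] g') : IsWeakTransport Q f' g' := by
  intro ψ hψ
  obtain ⟨h1, h2, h3⟩ := h ψ hψ
  have e1 : (fun z => transportClassical (potential Q) ψ z • f z)
      =ᵐ[volume.restrict (Omega Q)] fun z => transportClassical (potential Q) ψ z • f' z := by
    filter_upwards [hf] with z hz using by rw [hz]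
  have e2 : (fun z => ψ z • g z) =ᵐ[volume.restrict (Omega Q)] fun z => ψ z • g' z := by
    filter_upwards [hg] with z hz using by rw [hz]
  exact ⟨h1.congr e1, h2.congr e2, by rw [← integral_congr_ae e1, ← integral_congr_ae e2, h3]⟩

/-! The weight is measurable and positive, so that equality almost everywhere for the weighted
measure implies equality almost everywhere on `Ω`. -/

lemma measurable_potential {Q : Phase → ℝ} (hQ : Measurable Q) : Measurable (potential Q) := by
  have h1 : StronglyMeasurable (density Q) := by
    unfold density
    exact hQ.stronglyMeasurable.integral_prod_right'
  have h2 : StronglyMeasurable (fun p : E3 × E3 => density Q p.2 / ‖p.1 - p.2‖) := by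
    have : Measurable (fun p : E3 × E3 => density Q p.2 / ‖p.1 - p.2‖) :=
      (h1.measurable.comp measurable_snd).div (measurable_fst.sub measurable_snd).norm
    exact this.stronglyMeasurable
  exact h2.integral_prod_right'.measurable.const_mul _

lemma angMom_nonneg (z : Phase) : 0 ≤ angMom z := by unfold angMom; positivity

lemma measurable_angMom : Measurable angMom := by
  have : Continuous angMom := by
    have h : Continuous fun z : Phase => crossProduct z.1.ofLp z.2.ofLp := by
      simp only [cross_apply]
      fun_prop
    unfold angMom
    fun_prop
  exact this.measurable

namespace IsAdmissible

variable {Q : Phase → ℝ} {F : ℝ → ℝ → ℝ} {e₀ : ℝ}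

lemma isOpen_Omega (h : IsAdmissible Q F e₀) : IsOpen (Omega Q) :=
  isOpen_lt continuous_const h.continuous

lemma dF_neg (h : IsAdmissible Q F e₀) {z : Phase} (hz : z ∈ Omega Q) : dF Q F z < 0 := by
  refine h.profile_deriv_neg (energy (potential Q) z, angMom z) ⟨angMom_nonneg z, ?_⟩
  have : 0 < Q z := hz
  rwa [h.eq_profile z] at this

lemma measurable_dF (h : IsAdmissible Q F e₀) : Measurable (dF Q F) := by
  have hc : Continuous (Function.uncurry fun ℓ e : ℝ => F e |ℓ|) := by
    have := h.profile_continuous.comp_continuous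
      (f := fun p : ℝ × ℝ => (p.2, |p.1|)) (by fun_prop) (fun p => ⟨mem_univ _, abs_nonneg p.1⟩)
    exact this
  have hd := measurable_deriv_with_param hc
  have he : Measurable (energy (potential Q)) := by
    have := (measurable_potential h.continuous.measurable).comp
      (measurable_fst : Measurable (Prod.fst : Phase → E3))
    unfold energy
    exact ((measurable_snd.norm.pow_const 2).div_const 2).add this
  have := hd.comp (measurable_angMom.prodMk he)
  have heq : dF Q F = (fun p : ℝ × ℝ => deriv (fun e => F e |p.1|) p.2) ∘
      fun z => (angMom z, energy (potential Q) z) := by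
    funext z
    simp [dF, abs_of_nonneg (angMom_nonneg z)]
  rw [heq]
  exact this

lemma absolutelyContinuous (h : IsAdmissible Q F e₀) :
    volume.restrict (Omega Q) ≪ weighted Q F := by
  refine withDensity_absolutelyContinuous' ?_ ?_
  · exact (measurable_const.div (measurable_norm.comp h.measurable_dF)).ennreal_ofReal.aemeasurable
  · filter_upwards [ae_restrict_mem h.isOpen_Omega.measurableSet] with z hz
    have : 0 < |dF Q F z| := abs_pos.mpr (h.dF_neg hz).ne
    simpa using h.dF_neg hz |>.ne

/-- The graph of `𝒯`: pairs `(f, g)` in `L^{2,r}_{|F'_e|}` with `𝒯 f = g` in the sense of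
distributions on `Ω`. -/
def transportGraph (𝕜 : Type) [RCLike 𝕜] (h : IsAdmissible Q F e₀) :
    Submodule 𝕜 (L2r 𝕜 Q F × L2r 𝕜 Q F) where
  carrier := {p | IsWeakTransport Q (p.1 : Phase → 𝕜) (p.2 : Phase → 𝕜)}
  zero_mem' := by
    have h0 : IsWeakTransport Q (0 : Phase → 𝕜) (0 : Phase → 𝕜) := by
      intro ψ _
      simp
    have e0 := h.absolutelyContinuous.ae_eq (Lp.coeFn_zero 𝕜 2 (weighted Q F))
    exact h0.congr e0.symm e0.symm
  add_mem' := by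
    rintro ⟨f, g⟩ ⟨f', g'⟩ H H'
    have hs : IsWeakTransport Q ((f : Phase → 𝕜) + (f' : Phase → 𝕜))
        ((g : Phase → 𝕜) + (g' : Phase → 𝕜)) := by
      intro ψ hψ
      obtain ⟨a, b, c⟩ := H ψ hψ
      obtain ⟨a', b', c'⟩ := H' ψ hψ
      simp only [Pi.add_apply, smul_add]
      refine ⟨a.add a', b.add b', ?_⟩
      rw [integral_add a a', integral_add b b', c, c', neg_add]
    exact hs.congr (h.absolutelyContinuous.ae_eq (Lp.coeFn_add (f : Lp 𝕜 2 _) f')).symm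
      (h.absolutelyContinuous.ae_eq (Lp.coeFn_add (g : Lp 𝕜 2 _) g')).symm
  smul_mem' := by
    rintro k ⟨f, g⟩ H
    have hs : IsWeakTransport Q (k • (f : Phase → 𝕜)) (k • (g : Phase → 𝕜)) := by
      intro ψ hψ
      obtain ⟨a, b, c⟩ := H ψ hψ
      simp only [Pi.smul_apply, smul_comm _ k]
      refine ⟨a.smul k, b.smul k, ?_⟩
      rw [integral_smul, integral_smul, c, smul_neg]
    exact hs.congr (h.absolutelyContinuous.ae_eq (Lp.coeFn_smul k (f : Lp 𝕜 2 _))).symm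
      (h.absolutelyContinuous.ae_eq (Lp.coeFn_smul k (g : Lp 𝕜 2 _))).symm

/-- `𝒯 f` is determined by `f`, so that `transportGraph` is the graph of an operator. -/
lemma transportGraph_functional (𝕜 : Type) [RCLike 𝕜] (h : IsAdmissible Q F e₀)
    (p : L2r 𝕜 Q F × L2r 𝕜 Q F) (hp : p ∈ h.transportGraph 𝕜) (h0 : p.1 = 0) : p.2 = 0 := by
  obtain ⟨f, g⟩ := p
  simp only at h0
  subst h0
  have hz : ∀ ψ, IsTest (Omega Q) ψ → ∫ z in Omega Q, ψ z • (g : Phase → 𝕜) z = 0 := by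
    intro ψ hψ
    obtain ⟨_, _, c⟩ := hp ψ hψ
    have e0 := h.absolutelyContinuous.ae_eq (Lp.coeFn_zero 𝕜 2 (weighted Q F))
    have : ∫ z in Omega Q, transportClassical (potential Q) ψ z •
        ((0 : L2r 𝕜 Q F) : Phase → 𝕜) z = 0 := by
      refine integral_eq_zero_of_ae ?_
      filter_upwards [e0] with z hz
      have hz' : ((0 : L2r 𝕜 Q F) : Phase → 𝕜) z = 0 := hz
      rw [hz', smul_zero]
      rfl
    rw [this] at c
    simpa using c.symm
  have hloc : LocallyIntegrableOn (g : Phase → 𝕜) (Omega Q) (volume.restrict (Omega Q)) := by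
    intro x hx
    obtain ⟨ψ, hψ1, hψ2, hψ3, _, hψ4⟩ := exists_contDiff_tsupport_subset (n := (⊤ : ℕ∞))
      (h.isOpen_Omega.mem_nhds hx)
    obtain ⟨_, b, _⟩ := hp ψ ⟨hψ3, hψ2, hψ1⟩
    have hU : {z | 1 / 2 < ψ z} ∈ nhds x :=
      (isOpen_lt continuous_const hψ3.continuous).mem_nhds (by simp [hψ4]; norm_num)
    refine ⟨{z | 1 / 2 < ψ z}, mem_nhdsWithin_of_mem_nhds hU, ?_⟩
    have hm : MeasurableSet {z | 1 / 2 < ψ z} :=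
      (isOpen_lt continuous_const hψ3.continuous).measurableSet
    have hgm : AEStronglyMeasurable (g : Phase → 𝕜) (volume.restrict (Omega Q)) :=
      (Lp.aestronglyMeasurable (g : Lp 𝕜 2 (weighted Q F))).mono_ac h.absolutelyContinuous
    refine Integrable.mono' ((b.norm.const_mul 2).mono_measure Measure.restrict_le_self)
      (hgm.mono_measure Measure.restrict_le_self) ?_
    filter_upwards [ae_restrict_mem hm] with z hz
    have hz' : 1 / 2 < ψ z := hz
    rw [norm_smul, Real.norm_eq_abs, abs_of_pos (by linarith)]
    nlinarith [norm_nonneg ((g : Phase → 𝕜) z)]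
  have hae := h.isOpen_Omega.ae_eq_zero_of_integral_contDiff_smul_eq_zero hloc
    (fun ψ a b c => hz ψ ⟨a, b, c⟩)
  have hae' : ∀ᵐ z ∂(volume.restrict (Omega Q)), (g : Phase → 𝕜) z = 0 := by
    filter_upwards [hae, ae_restrict_mem h.isOpen_Omega.measurableSet] with z h1 h2 using h1 h2
  have hw : ∀ᵐ z ∂(weighted Q F), (g : Phase → 𝕜) z = 0 :=
    (withDensity_absolutelyContinuous _ _).ae_le hae'
  refine Subtype.ext (Lp.ext ?_)
  filter_upwards [hw, Lp.coeFn_zero 𝕜 2 (weighted Q F)] with z h1 h2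
  rw [h1]
  exact h2.symm

/-- The unbounded operator `𝒯 f = v·∇ₓf - ∇φ_Q·∇ᵥf` on `L^{2,r}_{|F'_e|}`, with domain
`{f : 𝒯 f ∈ L^{2,r}_{|F'_e|}}`. -/
def transport (𝕜 : Type) [RCLike 𝕜] (h : IsAdmissible Q F e₀) :
    L2r 𝕜 Q F →ₗ.[𝕜] L2r 𝕜 Q F :=
  (h.transportGraph 𝕜).toLinearPMap

lemma mem_graph_transport (𝕜 : Type) [RCLike 𝕜] (h : IsAdmissible Q F e₀) (f g : L2r 𝕜 Q F) :
    (f, g) ∈ (h.transport 𝕜).graph ↔ IsWeakTransport Q (f : Phase → 𝕜) (g : Phase → 𝕜) := by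
  rw [transport, Submodule.toLinearPMap_graph_eq _ (h.transportGraph_functional 𝕜)]
  rfl

end IsAdmissible

/-- The kernel of an unbounded operator, as a subspace of the ambient space. -/
def pker {𝕜 E : Type} [RCLike 𝕜] [NormedAddCommGroup E] [InnerProductSpace 𝕜 E]
    (A : E →ₗ.[𝕜] E) : Submodule 𝕜 E :=
  (LinearMap.ker A.toFun).map A.domain.subtype

/-- `f` is of the form `f̃(|v|²/2 + φ_Q(x), |x × v|²)` on `Ω`, with `f̃` a measurable function. -/
def IsFunctionOfEnergyMomentum {𝕜 : Type} [RCLike 𝕜] (Q : Phase → ℝ) (f : Phase → 𝕜) : Prop :=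
  ∃ f' : ℝ × ℝ → 𝕜, Measurable f' ∧
    ∀ᵐ z ∂(volume.restrict (Omega Q)), f z = f' (energy (potential Q) z, angMom z)

/-- `f(x, -v) = f(x, v)` on `Ω`. -/
def IsEven (Q : Phase → ℝ) (f : Phase → ℝ) : Prop :=
  ∀ᵐ z ∂(volume.restrict (Omega Q)), f (z.1, -z.2) = f z

/-- `f(x, -v) = -f(x, v)` on `Ω`. -/
def IsOdd (Q : Phase → ℝ) (f : Phase → ℝ) : Prop :=
  ∀ᵐ z ∂(volume.restrict (Omega Q)), f (z.1, -z.2) = -f z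

/-- The extension of a function on `Ω` by zero. -/
def extend (Q : Phase → ℝ) (g : Phase → ℝ) : Phase → ℝ := (Omega Q).indicator g

/-- The Antonov functional `𝒜(g, g) = ∫_Ω g² / |F'_e| dx dv - |∇φ_g|²_{L²}`. -/
def antonov (Q : Phase → ℝ) (F : ℝ → ℝ → ℝ) (g : Phase → ℝ) : ℝ :=
  (∫ z in Omega Q, g z ^ 2 / |dF Q F z|) -
    ∫ x : E3, ‖gradient (potential (extend Q g)) x‖ ^ 2

end VlasovPoisson

end

open VlasovPoisson

/-! Everything rests on the characteristic flow of `Q`. Since `ρ_Q` is radial and bounded, Newton's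
theorem gives `∇φ_Q(x) = m(|x|) x`, where `m(r) = φ_Q'(r) / r` is the mass within `r` divided by
`4πr³`. This field is Lipschitz, so the flow is global; it preserves volume, and it preserves energy
and angular momentum on the set `|x × v| > 0` of full measure. Hence `Ω` and `F'_e` are invariant,
and composition with the flow is a strongly continuous group of isometries of the weighted space
(`koopman`).

(i) The generator of this group is exactly the distributional `𝒯` (`mem_graph_transport_iff`), so
self-adjointness of `i𝒯` is Stone's theorem. The kernel consists of the flow-invariant functions.
Every trajectory in `Ω` with `ℓ > 0` crosses outward the radius of the circular orbit of angular
momentum `ℓ`, and at such a crossing `|x|`, `|v|` and `x·v` are determined by `(e, ℓ)`. Up to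
rotation there is thus one orbit for each pair `(e, ℓ)`, and invariant functions depend on `(e, ℓ)`
only.

(ii) With `M(r)` the mass of `g` within radius `r`, the field energy is `(1/4π) ∫ M(r)² / r² dr`,
and Cauchy–Schwarz bounds it by `‖g‖² / 4π` times the integral of `|F'_e| / |x|` over `Ω`. That
integral is finite (`lintegral_dF_div_lt_top`): in the variables `(e, ℓ, s = 1/r)` the effective
potential is strongly convex with modulus `ℓ`, which bounds the radial periods by a multiple of
`1/√ℓ`.

The coercivity estimate is the difference of two inequalities for `ξ` odd. The first
(`norm_field_sq_le`) bounds the field energy of `𝒯ξ` by `∫ ρ_Q ξ² / |F'_e|`; it combines the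
continuity equation with the bound of the second moment of the radial velocity under `|F'_e| dv` by
`ρ_Q`. The second (`integral_stiffness_le`) is a Jacobi inequality, `∫ (ρ_Q + m) ξ² / |F'_e| ≤
‖𝒯ξ‖²`. Along the flow `y = x·v` solves `y'' = -V y` with `V = ρ_Q + m`, and an odd `ξ` vanishes
where `y` does. With `q = y'/y`, the square `(𝒯ξ - qξ)²` equals `(𝒯ξ)² - Vξ²` minus the flow
derivative of `qξ²`, and flow derivatives integrate to zero. Two regularizations make this rigorous:
time averages of truncations replace `ξ`, and `y y' / (y² + δ)` replaces `q`.

(iii) The range of `𝒯` is dense in `N(𝒯)^⊥`, and velocity reversal turns approximations of an even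
`g` into images `𝒯ξ_n` of odd functions, so `𝒜(g, g) ≥ 0` by continuity. If `𝒜(g, g) = 0`,
coercivity forces `∫ m ξ_n² / |F'_e| → 0`, whence `g = lim 𝒯ξ_n` vanishes as a distribution. -/

noncomputable section
namespace VlasovPoisson
open scoped ENNReal

/-! ### Cylindrical and spherical coordinates. -/

/-- Plane polar coordinates for a function of the squared radius. -/
lemma lintegral_sq_add_sq {H : ℝ → ℝ≥0∞} (hH : Measurable H) :
    ∫⁻ q : ℝ × ℝ, H (q.1 ^ 2 + q.2 ^ 2) = ENNReal.ofReal Real.pi * ∫⁻ p in Ioi (0 : ℝ), H p := by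
  have h1 := (lintegral_comp_polarCoord_symm (fun q : ℝ × ℝ => H (q.1 ^ 2 + q.2 ^ 2))).symm
  rw [h1]
  have h2 : ∀ p : ℝ × ℝ, (polarCoord.symm p).1 ^ 2 + (polarCoord.symm p).2 ^ 2 = p.1 ^ 2 := by
    intro p
    simp only [polarCoord_symm_apply]
    have := Real.sin_sq_add_cos_sq p.2
    linear_combination p.1 ^ 2 * this
  simp only [h2, polarCoord_target]
  rw [Measure.volume_eq_prod, setLIntegral_prod _ (by fun_prop)]
  -- The substitution `p = r²` absorbs the Jacobian `r` of polar coordinates up to a factor `1/2`,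
  -- which turns the angular length `2π` into `π`.
  have h3 : (fun r : ℝ => r ^ 2) '' Ioi 0 = Ioi 0 := by
    ext p
    constructor
    · rintro ⟨r, hr, rfl⟩
      exact pow_pos (mem_Ioi.1 hr) 2
    · intro hp
      exact ⟨√p, Real.sqrt_pos.2 hp, Real.sq_sqrt (le_of_lt hp)⟩
  have h4 := lintegral_image_eq_lintegral_abs_deriv_mul (s := Ioi (0 : ℝ))
    (f := fun r : ℝ => r ^ 2) (f' := fun r => 2 * r) measurableSet_Ioi
    (fun x _ => by simpa using (hasDerivAt_pow 2 x).hasDerivWithinAt)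
    (fun a ha b hb hab => by
      have ha' : (0 : ℝ) < a := ha
      have hb' : (0 : ℝ) < b := hb
      exact (sq_eq_sq₀ ha'.le hb'.le).1 hab) H
  rw [h3] at h4
  rw [h4, ← lintegral_const_mul _ (by fun_prop)]
  refine setLIntegral_congr_fun measurableSet_Ioi fun r hr => ?_
  have hr' : (0 : ℝ) < r := hr
  simp only [lintegral_const, Measure.restrict_apply MeasurableSet.univ, univ_inter,
    Real.volume_Ioo, smul_eq_mul]
  rw [abs_of_pos (by positivity), ← mul_assoc, ← ENNReal.ofReal_mul (by positivity), mul_right_comm,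
    ← ENNReal.ofReal_mul (by positivity)]
  ring_nf

/-- Cylindrical coordinates around the axis of a unit vector, with the squared distance to the axis
as radial coordinate. -/
lemma lintegral_cylindrical {e : E3} (he : ‖e‖ = 1) {G : ℝ × ℝ → ℝ≥0∞} (hG : Measurable G) :
    ∫⁻ v : E3, G (⟪e, v⟫, ‖v‖ ^ 2 - ⟪e, v⟫ ^ 2) =
      ENNReal.ofReal Real.pi * ∫⁻ p in Ioi (0 : ℝ), ∫⁻ u, G (u, p) := by
  set e0 : E3 := EuclideanSpace.single 0 1
  have he0 : ‖e0‖ = 1 := by simp [e0]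
  -- The reflection that exchanges the unit vectors `e0` and `e` preserves volume, so the axis may
  -- be taken to be the first coordinate axis.
  set A := (ℝ ∙ (e0 - e))ᗮ.reflection
  have hA : A e0 = e := Submodule.reflection_sub (he0.trans he.symm)
  have h1 := A.measurePreserving.lintegral_comp_emb A.toHomeomorph.measurableEmbedding
    (fun v => G (⟪e, v⟫, ‖v‖ ^ 2 - ⟪e, v⟫ ^ 2))
  rw [← h1]
  have h2 : ∀ v : E3, (⟪e, A v⟫ : ℝ) = v 0 := by
    intro v
    rw [← hA, A.inner_map_map]
    simp [e0, EuclideanSpace.inner_single_left]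
  have h3 : ∀ v : E3, ‖A v‖ ^ 2 - (v 0) ^ 2 = v 1 ^ 2 + v 2 ^ 2 := by
    intro v
    rw [A.norm_map, EuclideanSpace.norm_sq_eq]
    simp [Fin.sum_univ_three]
    ring
  simp only [h2, h3]
  have h4 := (EuclideanSpace.volume_preserving_symm_measurableEquiv_toLp (Fin 3)).lintegral_comp_emb
    (MeasurableEquiv.measurableEmbedding _)
    (fun w : Fin 3 → ℝ => G (w 0, w 1 ^ 2 + w 2 ^ 2))
  have h5 := (volume_preserving_piFinSuccAbove (fun _ : Fin 3 => ℝ) 0).symm.lintegral_comp_emb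
    (MeasurableEquiv.measurableEmbedding _) (fun w : Fin 3 → ℝ => G (w 0, w 1 ^ 2 + w 2 ^ 2))
  have h6 : ∀ u : ℝ, ∫⁻ w : Fin 2 → ℝ, G (u, w 0 ^ 2 + w 1 ^ 2) =
      ENNReal.ofReal Real.pi * ∫⁻ p in Ioi (0 : ℝ), G (u, p) := by
    intro u
    have h7 := (volume_preserving_finTwoArrow ℝ).lintegral_comp_emb
      (MeasurableEquiv.measurableEmbedding _)
      (fun q : ℝ × ℝ => G (u, q.1 ^ 2 + q.2 ^ 2))
    rw [← lintegral_sq_add_sq (by fun_prop), ← h7]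
    rfl
  refine (h4.trans h5.symm).trans ?_
  rw [Measure.volume_eq_prod, lintegral_prod _ (by
    refine Measurable.aemeasurable ?_
    have : Measurable fun w : Fin 3 → ℝ => G (w 0, w 1 ^ 2 + w 2 ^ 2) := by fun_prop
    exact this.comp (MeasurableEquiv.measurable _))]
  have h8 : ∀ u : ℝ, ∫⁻ w : Fin 2 → ℝ, G (((MeasurableEquiv.piFinSuccAbove (fun _ : Fin 3 => ℝ) 0).symm (u, w)) 0,
      ((MeasurableEquiv.piFinSuccAbove (fun _ : Fin 3 => ℝ) 0).symm (u, w)) 1 ^ 2 +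
      ((MeasurableEquiv.piFinSuccAbove (fun _ : Fin 3 => ℝ) 0).symm (u, w)) 2 ^ 2) =
      ENNReal.ofReal Real.pi * ∫⁻ p in Ioi (0 : ℝ), G (u, p) := fun u => h6 u
  rw [lintegral_congr h8, lintegral_const_mul _ (by
    exact Measurable.lintegral_prod_right' (f := G) hG), lintegral_lintegral_swap]
  exact hG.aemeasurable

/-- Integration of a radial function in spherical coordinates. -/
lemma lintegral_radial {h : ℝ → ℝ≥0∞} (hh : Measurable h) :
    ∫⁻ x : E3, h ‖x‖ = ENNReal.ofReal (4 * Real.pi) *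
      ∫⁻ r in Ioi (0 : ℝ), ENNReal.ofReal (r ^ 2) * h r := by
  calc
    ∫⁻ x : E3, h ‖x‖ = ∫⁻ x : ({(0)}ᶜ : Set E3), h ‖x.1‖ ∂((volume : Measure E3).comap (↑)) := by
      rw [lintegral_subtype_comap (measurableSet_singleton _).compl fun x : E3 ↦ h ‖x‖,
        restrict_compl_singleton]
    _ = ∫⁻ x, h x.2 ∂(volume : Measure E3).toSphere.prod (.volumeIoiPow 2) := by
      have := (volume : Measure E3).measurePreserving_homeomorphUnitSphereProd.lintegral_comp_emb
        (Homeomorph.measurableEmbedding _) (h ∘ Subtype.val ∘ Prod.snd)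
      simpa using this
    _ = (volume : Measure E3).toSphere univ * ∫⁻ x : Ioi (0 : ℝ), h x ∂.volumeIoiPow 2 := by
      have hm : Measurable fun x : Ioi (0 : ℝ) => h x := hh.comp measurable_subtype_coe
      rw [lintegral_prod (fun x : (Metric.sphere (0 : E3) 1) × Ioi (0 : ℝ) => h x.2)
        (hm.comp measurable_snd).aemeasurable]
      simp [mul_comm]
    _ = _ := by
      rw [Measure.toSphere_apply_univ, EuclideanSpace.volume_ball_fin_three, Measure.volumeIoiPow,
        lintegral_withDensity_eq_lintegral_mul _ (by fun_prop)
          (show Measurable fun x : Ioi (0 : ℝ) => h x from hh.comp measurable_subtype_coe)]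
      have := lintegral_subtype_comap (μ := (volume : Measure ℝ)) (s := Ioi (0 : ℝ))
        measurableSet_Ioi (fun r => ENNReal.ofReal (r ^ 2) * h r)
      rw [← this]
      congr 1
      rw [finrank_euclideanSpace]
      rw [ENNReal.ofReal_one, one_pow, one_mul, ← ENNReal.ofReal_natCast,
        ← ENNReal.ofReal_mul (by positivity)]
      congr 1
      simp only [Fintype.card_fin]
      push_cast
      ring

end VlasovPoisson
end

/-! ### Newton's shell theorem and the field of a radial density. -/

noncomputable section
namespace VlasovPoisson
open scoped ENNReal

/-- Integration of a function of `⟪e, v⟫` and `‖v‖ ^ 2`, for a unit vector `e`. -/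
lemma lintegral_axis {e : E3} (he : ‖e‖ = 1) {G : ℝ × ℝ → ℝ≥0∞} (hG : Measurable G) :
    ∫⁻ v : E3, G (⟪e, v⟫, ‖v‖ ^ 2) =
      ENNReal.ofReal Real.pi * ∫⁻ w, ∫⁻ u in {u : ℝ | u ^ 2 < w}, G (u, w) := by
  have h := lintegral_cylindrical he (G := fun q => G (q.1, q.2 + q.1 ^ 2)) (by fun_prop)
  simp only [sub_add_cancel] at h
  rw [h]
  congr 1
  rw [lintegral_lintegral_swap (by fun_prop)]
  -- Shifting `p` by `u²` makes `w = ‖v‖²` the variable; the condition `p > 0` becomes `u² < w`.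
  have h1 : ∀ u : ℝ, ∫⁻ p in Ioi (0 : ℝ), G (u, p + u ^ 2) =
      ∫⁻ w, {q : ℝ × ℝ | q.1 ^ 2 < q.2}.indicator G (u, w) := by
    intro u
    rw [← lintegral_indicator measurableSet_Ioi,
      ← lintegral_add_right_eq_self (fun w => {q : ℝ × ℝ | q.1 ^ 2 < q.2}.indicator G (u, w)) (u ^ 2)]
    refine lintegral_congr fun p => ?_
    by_cases hp : 0 < p
    · rw [indicator_of_mem (mem_Ioi.2 hp), indicator_of_mem (by simpa using hp)]
    · rw [indicator_of_notMem (by simpa using hp), indicator_of_notMem (by simpa using hp)]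
  have hm : MeasurableSet {q : ℝ × ℝ | q.1 ^ 2 < q.2} :=
    measurableSet_lt (by fun_prop) (by fun_prop)
  rw [lintegral_congr h1, lintegral_lintegral_swap
    (f := fun u w => {q : ℝ × ℝ | q.1 ^ 2 < q.2}.indicator G (u, w)) (hG.indicator hm).aemeasurable]
  refine lintegral_congr fun w => ?_
  rw [← lintegral_indicator (measurableSet_lt (by fun_prop) (by fun_prop))]
  rfl

lemma setOf_sq_lt_eq_Ioo {w : ℝ} : {u : ℝ | u ^ 2 < w} = Ioo (-√w) √w := by
  ext u
  simp only [mem_ofPred_eq, mem_Ioo]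
  rw [← abs_lt, Real.lt_sqrt (abs_nonneg u), sq_abs]

/-- The average of `1 / ‖x - y‖` over the sphere `‖y‖ = s`, up to normalization. -/
lemma lintegral_inv_sqrt {r w : ℝ} (hr : 0 < r) (hw : 0 < w) :
    ∫⁻ u in {u : ℝ | u ^ 2 < w}, ENNReal.ofReal (1 / √(r ^ 2 + w - 2 * r * u)) =
      ∫⁻ _u in {u : ℝ | u ^ 2 < w}, ENNReal.ofReal (1 / max r √w) := by
  rw [setOf_sq_lt_eq_Ioo]
  set s := √w
  have hs : 0 < s := Real.sqrt_pos.2 hw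
  have hws : w = s ^ 2 := (Real.sq_sqrt hw.le).symm
  rw [hws]
  have hpos : ∀ u ∈ Ioo (-s) s, 0 < r ^ 2 + s ^ 2 - 2 * r * u := by
    intro u hu
    nlinarith [sq_nonneg (r - s), mul_pos hr (sub_pos.2 hu.2)]
  -- The primitive is `-‖x - y‖ / r`. Its increment from `u = -s` to `u = s` is `(r + s - |r - s|) /
  -- r = 2s / max r s`, the same as for the constant integrand `1 / max r s`.
  have hderiv : ∀ u ∈ Ioo (-s) s,
      HasDerivAt (fun u => -(1 / r) * √(r ^ 2 + s ^ 2 - 2 * r * u))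
        (1 / √(r ^ 2 + s ^ 2 - 2 * r * u)) u := by
    intro u hu
    have h1 : HasDerivAt (fun u => r ^ 2 + s ^ 2 - 2 * r * u) (-(2 * r)) u := by
      simpa using ((hasDerivAt_id u).const_mul (2 * r)).const_sub (r ^ 2 + s ^ 2)
    have h2 := (h1.sqrt (hpos u hu).ne').const_mul (-(1 / r))
    refine h2.congr_deriv ?_
    have := Real.sqrt_pos.2 (hpos u hu)
    field_simp
  have hcont : ContinuousOn (fun u => -(1 / r) * √(r ^ 2 + s ^ 2 - 2 * r * u)) (Icc (-s) s) := by
    fun_prop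
  have hint := intervalIntegral.integrableOn_deriv_of_nonneg hcont hderiv
    (fun _ _ => by positivity)
  have hle : -s ≤ s := by linarith
  have hFTC := intervalIntegral.integral_eq_sub_of_hasDerivAt_of_le hle hcont hderiv
    ((intervalIntegrable_iff_integrableOn_Ioc_of_le hle).2 hint)
  rw [← ofReal_integral_eq_lintegral_ofReal (hint.mono_set Ioo_subset_Ioc_self)
    (Filter.Eventually.of_forall fun u => by positivity), ← integral_Ioc_eq_integral_Ioo,
    ← intervalIntegral.integral_of_le hle, hFTC]
  simp only [lintegral_const, Measure.restrict_apply MeasurableSet.univ, univ_inter,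
    Real.volume_Ioo]
  rw [← ENNReal.ofReal_mul (by positivity)]
  congr 1
  have h1 : √(r ^ 2 + s ^ 2 - 2 * r * s) = |r - s| := by
    rw [← Real.sqrt_sq_eq_abs]
    congr 1
    ring
  have h2 : √(r ^ 2 + s ^ 2 - 2 * r * -s) = r + s := by
    rw [← Real.sqrt_sq (by positivity : 0 ≤ r + s)]
    congr 1
    ring
  rw [h1, h2]
  rcases le_total r s with h | h
  · rw [max_eq_right h, abs_of_nonpos (by linarith)]
    field_simp
    ring
  · rw [max_eq_left h, abs_of_nonneg (by linarith)]
    field_simp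
    ring

/-- Newton's shell theorem for a nonnegative radial density. -/
lemma lintegral_shell {x : E3} (hx : x ≠ 0) {R : ℝ → ℝ≥0∞} (hR : Measurable R) :
    ∫⁻ y : E3, R ‖y‖ * ENNReal.ofReal (1 / ‖x - y‖) =
      ∫⁻ y : E3, R ‖y‖ * ENNReal.ofReal (1 / max ‖x‖ ‖y‖) := by
  set r := ‖x‖
  have hr : 0 < r := norm_pos_iff.2 hx
  set e : E3 := r⁻¹ • x
  have he : ‖e‖ = 1 := by
    rw [norm_smul, norm_inv, Real.norm_of_nonneg hr.le]
    exact inv_mul_cancel₀ hr.ne'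
  have h1 := lintegral_axis he
    (G := fun q => R √q.2 * ENNReal.ofReal (1 / √(r ^ 2 + q.2 - 2 * r * q.1))) (by fun_prop)
  have h2 := lintegral_axis he
    (G := fun q => R √q.2 * ENNReal.ofReal (1 / max r √q.2)) (by fun_prop)
  have h3 : ∀ y : E3, r ^ 2 + ‖y‖ ^ 2 - 2 * r * ⟪e, y⟫ = ‖x - y‖ ^ 2 := by
    intro y
    rw [norm_sub_sq_real]
    simp only [e, real_inner_smul_left]
    field_simp
    ring
  simp only [h3, Real.sqrt_sq (norm_nonneg _)] at h1 h2
  rw [h1, h2]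
  congr 1
  refine lintegral_congr fun w => ?_
  rw [lintegral_const_mul _ (by fun_prop), lintegral_const_mul _ (by fun_prop)]
  rcases le_or_gt w 0 with hw | hw
  · have : {u : ℝ | u ^ 2 < w} = ∅ := by
      ext u
      simp only [mem_ofPred_eq, mem_empty_iff_false, iff_false, not_lt]
      exact hw.trans (sq_nonneg u)
    simp [this]
  · rw [lintegral_inv_sqrt hr hw]

/-- The potential of a mass density. -/
def newton (ρ : E3 → ℝ) (x : E3) : ℝ := -(1 / (4 * Real.pi)) * ∫ y : E3, ρ y / ‖x - y‖

/-- The mass contained in the ball of radius `r`. -/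
def ballMass (ρ : E3 → ℝ) (r : ℝ) : ℝ := ∫ y in Metric.ball (0 : E3) r, ρ y

variable {ρ : E3 → ℝ} {R : ℝ → ℝ}

lemma integrable_div_max (hi : Integrable ρ) {r : ℝ} (hr : 0 < r) :
    Integrable fun y : E3 => ρ y / max r ‖y‖ := by
  have h : Integrable fun y : E3 => (1 / max r ‖y‖) * ρ y := by
    refine hi.bdd_mul (c := 1 / r) (Measurable.aestronglyMeasurable (by fun_prop)) (Filter.Eventually.of_forall fun y => ?_)
    rw [Real.norm_of_nonneg (by positivity)]
    exact one_div_le_one_div_of_le hr (le_max_left _ _)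
  refine h.congr (Filter.Eventually.of_forall fun y => ?_)
  simp only
  ring

/-- The shell theorem for densities of either sign: it is applied to `|R|` for integrability, then
to the positive and negative parts for the value. -/
lemma integral_shell (hR : Measurable R) (hρ : ∀ y, ρ y = R ‖y‖) (hi : Integrable ρ)
    {x : E3} (hx : x ≠ 0) :
    Integrable (fun y => ρ y / ‖x - y‖) ∧
      ∫ y : E3, ρ y / ‖x - y‖ = ∫ y : E3, ρ y / max ‖x‖ ‖y‖ := by
  have hr : 0 < ‖x‖ := norm_pos_iff.2 hx
  have hi2 := integrable_div_max hi hr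
  have hmeas : Measurable ρ := by
    have : ρ = fun y => R ‖y‖ := funext hρ
    rw [this]
    fun_prop
  have key : ∀ S : ℝ → ℝ, Measurable S →
      ∫⁻ y : E3, ENNReal.ofReal (S ‖y‖ / ‖x - y‖) =
        ∫⁻ y : E3, ENNReal.ofReal (S ‖y‖ / max ‖x‖ ‖y‖) := by
    intro S hS
    have h := lintegral_shell hx (R := fun s => ENNReal.ofReal (S s)) (by fun_prop)
    convert h using 3 with y y
    · rw [← ENNReal.ofReal_mul' (by positivity), mul_one_div]
    · rw [← ENNReal.ofReal_mul' (by positivity), mul_one_div]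
  have hint : Integrable fun y => ρ y / ‖x - y‖ := by
    refine ⟨(Measurable.aestronglyMeasurable (by fun_prop)), ?_⟩
    rw [hasFiniteIntegral_iff_norm]
    have h2 := hi2.2
    rw [hasFiniteIntegral_iff_norm] at h2
    have h3 := key (fun s => |R s|) (by fun_prop)
    calc ∫⁻ y, ENNReal.ofReal ‖ρ y / ‖x - y‖‖ = ∫⁻ y, ENNReal.ofReal (|R ‖y‖| / ‖x - y‖) := by
          refine lintegral_congr fun y => ?_
          rw [norm_div, norm_norm, hρ, Real.norm_eq_abs]
      _ = ∫⁻ y, ENNReal.ofReal ‖ρ y / max ‖x‖ ‖y‖‖ := by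
          rw [h3]
          refine lintegral_congr fun y => ?_
          rw [norm_div, hρ, Real.norm_eq_abs, Real.norm_of_nonneg (by positivity)]
      _ < ⊤ := h2
  refine ⟨hint, ?_⟩
  rw [integral_eq_lintegral_pos_part_sub_lintegral_neg_part hint,
    integral_eq_lintegral_pos_part_sub_lintegral_neg_part hi2]
  have h3 := key R hR
  have h4 := key (fun s => -R s) (by fun_prop)
  simp only [neg_div] at h4
  simp only [hρ]
  rw [h3, h4]

lemma newton_eq (hR : Measurable R) (hρ : ∀ y, ρ y = R ‖y‖) (hi : Integrable ρ)
    {x : E3} (hx : x ≠ 0) :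
    newton ρ x = -(1 / (4 * Real.pi)) * ∫ y : E3, ρ y / max ‖x‖ ‖y‖ := by
  rw [newton, (integral_shell hR hρ hi hx).2]

/-- Differentiation under the integral sign. As a function of `s`, the kernel `1 / max s ‖y‖` is
constant below `‖y‖` and equal to `1/s` above it, with its only kink on the null sphere `‖y‖ = r`;
no continuity of `ρ` is needed. For `s > r/2` the maxima are at least `r/2`, whence the Lipschitz
constant `4 / r²`. -/
lemma hasDerivAt_integral_div_max (hi : Integrable ρ) {r : ℝ} (hr : 0 < r) :
    HasDerivAt (fun s => ∫ y : E3, ρ y / max s ‖y‖) (-(ballMass ρ r / r ^ 2)) r := by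
  have hnull : ∀ᵐ y : E3, ‖y‖ ≠ r := by
    have : volume (Metric.sphere (0 : E3) r) = 0 := Measure.addHaar_sphere _ _ _
    rw [ae_iff]
    convert this using 2
    ext y
    simp
  have h := hasDerivAt_integral_of_dominated_loc_of_lip (μ := (volume : Measure E3))
    (F := fun s y => ρ y / max s ‖y‖)
    (F' := fun y => (Metric.ball (0 : E3) r).indicator (fun y => -(ρ y / r ^ 2)) y)
    (x₀ := r) (s := Ioi (r / 2)) (bound := fun y => |ρ y| * (4 / r ^ 2)) (Ioi_mem_nhds (by linarith)) ?_ ?_ ?_ ?_ ?_ ?_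
  · refine h.2.congr_deriv ?_
    rw [integral_indicator measurableSet_ball, ballMass, integral_neg, integral_div]
  · filter_upwards [Ioi_mem_nhds hr] with s hs
    exact (integrable_div_max hi hs).1
  · exact integrable_div_max hi hr
  · refine AEStronglyMeasurable.indicator ?_ measurableSet_ball
    exact (hi.1.mul_const (1 / r ^ 2)).neg.congr
      (Filter.Eventually.of_forall fun y => by simp [div_eq_mul_inv])
  · refine Filter.Eventually.of_forall fun y => ?_
    refine LipschitzOnWith.of_dist_le_mul fun a ha b hb => ?_
    have ha' : r / 2 < a := ha
    have hb' : r / 2 < b := hb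
    have hA : r / 2 ≤ max a ‖y‖ := ha'.le.trans (le_max_left _ _)
    have hB : r / 2 ≤ max b ‖y‖ := hb'.le.trans (le_max_left _ _)
    have hA0 : 0 < max a ‖y‖ := by linarith
    have hB0 : 0 < max b ‖y‖ := by linarith
    have hAB : |max b ‖y‖ - max a ‖y‖| ≤ |b - a| := abs_max_sub_max_le_abs b a ‖y‖
    rw [Real.dist_eq, Real.dist_eq, Real.coe_nnabs, abs_of_nonneg (a := |ρ y| * (4 / r ^ 2)) (by positivity)]
    have : ρ y / max a ‖y‖ - ρ y / max b ‖y‖ =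
        ρ y * ((max b ‖y‖ - max a ‖y‖) / (max a ‖y‖ * max b ‖y‖)) := by
      field_simp
    rw [this, abs_mul, mul_assoc, abs_div, abs_of_pos (mul_pos hA0 hB0)]
    refine mul_le_mul_of_nonneg_left ?_ (abs_nonneg _)
    rw [div_le_iff₀ (mul_pos hA0 hB0), abs_sub_comm a b]
    have h4 : r ^ 2 / 4 ≤ max a ‖y‖ * max b ‖y‖ := by nlinarith
    have h5 : 1 ≤ 4 / r ^ 2 * (max a ‖y‖ * max b ‖y‖) := by
      rw [div_mul_eq_mul_div, le_div_iff₀ (by positivity)]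
      linarith
    nlinarith [abs_nonneg (b - a)]
  · exact hi.abs.mul_const _
  · filter_upwards [hnull] with y hy
    rcases lt_or_gt_of_ne hy with h | h
    · rw [indicator_of_mem (by simpa using h)]
      have h1 : HasDerivAt (fun s => ρ y / s) (-(ρ y / r ^ 2)) r := by
        have := (hasDerivAt_inv hr.ne').const_mul (ρ y)
        refine this.congr_deriv ?_
        field_simp
      refine h1.congr_of_eventuallyEq ?_
      filter_upwards [Ioi_mem_nhds h] with s hs
      rw [max_eq_left (le_of_lt hs)]
    · rw [indicator_of_notMem (by simpa using h.le)]
      refine (hasDerivAt_const r (ρ y / ‖y‖)).congr_of_eventuallyEq ?_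
      filter_upwards [Iio_mem_nhds h] with s hs
      rw [max_eq_right (le_of_lt hs)]

/-- The gravitational field of a radial density. -/
lemma hasGradientAt_newton (hR : Measurable R) (hρ : ∀ y, ρ y = R ‖y‖) (hi : Integrable ρ)
    {x : E3} (hx : x ≠ 0) :
    HasGradientAt (newton ρ) ((ballMass ρ ‖x‖ / (4 * Real.pi * ‖x‖ ^ 3)) • x) x := by
  have hr : 0 < ‖x‖ := norm_pos_iff.2 hx
  have h1 : HasFDerivAt (fun y : E3 => ‖y‖) (‖x‖⁻¹ • innerSL ℝ x) x := by
    have := ((hasStrictFDerivAt_norm_sq x).hasFDerivAt.sqrt (by positivity))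
    simp only [Real.sqrt_sq (norm_nonneg _)] at this
    refine this.congr_fderiv ?_
    ext y
    simp
    field_simp
  have h2 := ((hasDerivAt_integral_div_max hi hr).const_mul (-(1 / (4 * Real.pi)))).comp_hasFDerivAt x h1
  have h3 : HasFDerivAt (newton ρ) _ x := h2.congr_of_eventuallyEq (by
    filter_upwards [isOpen_ne.mem_nhds hx] with y hy
    exact newton_eq hR hρ hi hy)
  rw [hasGradientAt_iff_hasFDerivAt]
  refine h3.congr_fderiv ?_
  ext y
  simp
  field_simp

lemma newton_neg (hρ : ∀ y, ρ (-y) = ρ y) (x : E3) : newton ρ (-x) = newton ρ x := by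
  unfold newton
  congr 1
  rw [← integral_neg_eq_self]
  refine integral_congr_ae (Filter.Eventually.of_forall fun y => ?_)
  simp only [hρ]
  rw [← norm_neg (x - y)]
  congr 2
  abel

/-- The formula for the field is proved only away from the origin. At the origin evenness makes the
derivative equal to its own negative; if there is no derivative, `gradient` is zero by convention.
-/
lemma gradient_newton_zero (hρ : ∀ y, ρ (-y) = ρ y) : gradient (newton ρ) 0 = 0 := by
  by_cases hd : DifferentiableAt ℝ (newton ρ) 0
  · have h1 := hd.hasFDerivAt
    have h2 : HasFDerivAt (fun x => newton ρ (-x)) (-fderiv ℝ (newton ρ) 0) 0 := by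
      have h3 : HasFDerivAt (newton ρ) (fderiv ℝ (newton ρ) 0) (-(0 : E3)) := by simpa using h1
      have := h3.comp (0 : E3) (hasFDerivAt_id (0 : E3)).neg
      refine this.congr_fderiv ?_
      ext
      simp
    simp only [newton_neg hρ] at h2
    have h4 := h1.unique h2
    have h5 : fderiv ℝ (newton ρ) 0 = 0 := by
      ext y
      have := congrArg (fun L : E3 →L[ℝ] ℝ => L y) h4
      simp only [neg_apply] at this
      simp only [zero_apply]
      linarith
    simp [gradient, h5]
  · simp [gradient, fderiv_zero_of_not_differentiableAt hd]

end VlasovPoisson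
end

/-! ### Global flow of a Lipschitz vector field. -/

noncomputable section
namespace VlasovPoisson
open scoped ENNReal NNReal Topology

section GlobalFlow

variable {E : Type*} [NormedAddCommGroup E] [NormedSpace ℝ E]

/-- The gain `1/l` makes the weighted Picard operator contract: for `l = 2K + 1` its Lipschitz
constant is at most `K / (2K + 1) ≤ 1/2`. -/
lemma norm_integral_le_exp {f : ℝ → E} {C l : ℝ} (hl : 0 < l)
    (hf : ∀ s, ‖f s‖ ≤ C * Real.exp (l * |s|)) (t : ℝ) :
    ‖∫ s in (0 : ℝ)..t, f s‖ ≤ C / l * Real.exp (l * |t|) := by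
  have hC : 0 ≤ C := by simpa using (norm_nonneg _).trans (hf 0)
  have main : ∀ (g : ℝ → E), (∀ s, ‖g s‖ ≤ C * Real.exp (l * |s|)) → ∀ t, 0 ≤ t →
      ‖∫ s in (0 : ℝ)..t, g s‖ ≤ C / l * Real.exp (l * t) := by
    intro g hg t ht
    have hd : ∀ s ∈ uIcc 0 t, HasDerivAt (fun s => C / l * Real.exp (l * s))
        (C * Real.exp (l * s)) s := by
      intro s _
      have h1 : HasDerivAt (fun s => l * s) l s := by simpa using (hasDerivAt_id s).const_mul l
      refine (h1.exp.const_mul (C / l)).congr_deriv ?_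
      field_simp
    have hint : IntervalIntegrable (fun s => C * Real.exp (l * s)) volume 0 t :=
      Continuous.intervalIntegrable (by fun_prop) _ _
    have h2 := intervalIntegral.integral_eq_sub_of_hasDerivAt hd hint
    have h3 := intervalIntegral.norm_integral_le_of_norm_le (f := g) ht
      (Filter.Eventually.of_forall fun s hs => by
        have := hg s
        rwa [abs_of_pos hs.1] at this) hint
    rw [h2] at h3
    have : 0 ≤ C / l * Real.exp (l * 0) := by positivity
    linarith
  rcases le_total 0 t with ht | ht
  · rw [abs_of_nonneg ht]
    exact main f hf t ht
  · rw [abs_of_nonpos ht]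
    have h1 := main (fun s => f (-s)) (fun s => by simpa using hf (-s)) (-t) (by linarith)
    rw [intervalIntegral.integral_comp_neg, neg_neg, neg_zero, intervalIntegral.integral_symm,
      norm_neg] at h1
    exact h1

variable {b : E → E} {K : ℝ≥0}

/-- The Picard operator, in exponentially weighted form. -/
def weightedPicard (hb : LipschitzWith K b) (z : E) (η : BoundedContinuousFunction ℝ E) :
    BoundedContinuousFunction ℝ E :=
  BoundedContinuousFunction.ofNormedAddCommGroup
    -- The unknown is the bounded function `η t = exp(-(2K + 1)|t|) γ t`. In this form a single
    -- fixed point yields the integral curve on all of `ℝ`, without gluing local solutions.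
    (fun t => Real.exp (-((2 * K + 1) * |t|)) •
      (z + ∫ s in (0 : ℝ)..t, b (Real.exp ((2 * K + 1) * |s|) • η s)))
    (by
      have h1 : Continuous fun s => b (Real.exp ((2 * K + 1) * |s|) • η s) :=
        hb.continuous.comp (by fun_prop)
      have h2 : Continuous fun t => ∫ s in (0 : ℝ)..t, b (Real.exp ((2 * K + 1) * |s|) • η s) :=
        intervalIntegral.continuous_primitive (fun a b => h1.intervalIntegrable a b) 0
      fun_prop)
    (‖z‖ + (‖b 0‖ + K * ‖η‖) / (2 * K + 1))
    (by
      intro t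
      have hf : ∀ s, ‖b (Real.exp ((2 * K + 1) * |s|) • η s)‖ ≤
          (‖b 0‖ + K * ‖η‖) * Real.exp ((2 * K + 1) * |s|) := by
        intro s
        have h1 := hb.dist_le_mul (Real.exp ((2 * K + 1) * |s|) • η s) 0
        rw [dist_eq_norm, dist_zero_right, norm_smul, Real.norm_of_nonneg (Real.exp_pos _).le] at h1
        have h2 := norm_le_norm_add_norm_sub' (b (Real.exp ((2 * K + 1) * |s|) • η s)) (b 0)
        have h3 : 1 ≤ Real.exp ((2 * K + 1) * |s|) := Real.one_le_exp (by positivity)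
        have h4 : (K : ℝ) * (Real.exp ((2 * K + 1) * |s|) * ‖η s‖) ≤
            K * (Real.exp ((2 * K + 1) * |s|) * ‖η‖) := by
          gcongr
          exact η.norm_coe_le_norm s
        nlinarith [norm_nonneg (b 0)]
      have h := norm_integral_le_exp (l := 2 * K + 1) (by positivity) hf t
      rw [norm_smul, Real.norm_of_nonneg (Real.exp_pos _).le, Real.exp_neg,
        inv_mul_le_iff₀ (Real.exp_pos _)]
      have h3 : 1 ≤ Real.exp ((2 * K + 1) * |t|) := Real.one_le_exp (by positivity)
      refine (norm_add_le _ _).trans ?_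
      nlinarith [norm_nonneg z])

lemma contracting_weightedPicard (hb : LipschitzWith K b) (z : E) :
    ContractingWith (1 / 2) (weightedPicard hb z) := by
  refine ⟨by rw [one_div]; exact two_inv_lt_one, ?_⟩
  refine LipschitzWith.of_dist_le_mul fun η ξ => ?_
  rw [BoundedContinuousFunction.dist_le (by positivity)]
  intro t
  have hcont : ∀ η : BoundedContinuousFunction ℝ E, IntervalIntegrable
      (fun s => b (Real.exp ((2 * K + 1) * |s|) • η s)) volume 0 t := fun η =>
    (hb.continuous.comp (by fun_prop)).intervalIntegrable _ _
  have hf : ∀ s, ‖b (Real.exp ((2 * K + 1) * |s|) • η s) -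
      b (Real.exp ((2 * K + 1) * |s|) • ξ s)‖ ≤
      (K * dist η ξ) * Real.exp ((2 * K + 1) * |s|) := by
    intro s
    have h1 := hb.dist_le_mul (Real.exp ((2 * K + 1) * |s|) • η s)
      (Real.exp ((2 * K + 1) * |s|) • ξ s)
    rw [dist_eq_norm, dist_smul₀, Real.norm_of_nonneg (Real.exp_pos _).le] at h1
    refine h1.trans ?_
    rw [mul_assoc, mul_comm (dist η ξ)]
    gcongr
    exact BoundedContinuousFunction.dist_coe_le_dist s
  have h := norm_integral_le_exp (l := 2 * K + 1) (by positivity) hf t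
  rw [intervalIntegral.integral_sub (hcont η) (hcont ξ)] at h
  have h1 : weightedPicard hb z η t - weightedPicard hb z ξ t =
      Real.exp (-((2 * K + 1) * |t|)) • ((∫ s in (0 : ℝ)..t, b (Real.exp ((2 * K + 1) * |s|) • η s)) -
      ∫ s in (0 : ℝ)..t, b (Real.exp ((2 * K + 1) * |s|) • ξ s)) := by
    simp only [weightedPicard, BoundedContinuousFunction.coe_ofNormedAddCommGroup]
    rw [← smul_sub]
    congr 1
    abel
  rw [dist_eq_norm, h1, norm_smul, Real.norm_of_nonneg (Real.exp_pos _).le, Real.exp_neg,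
    inv_mul_le_iff₀ (Real.exp_pos _)]
  refine h.trans ?_
  rw [mul_comm]
  gcongr
  rw [div_le_iff₀ (by positivity)]
  have : 0 ≤ dist η ξ := dist_nonneg
  push_cast
  nlinarith

variable [CompleteSpace E]

/-- A globally Lipschitz vector field has global integral curves. -/
theorem exists_global_solution (hb : LipschitzWith K b) (z : E) :
    ∃ γ : ℝ → E, γ 0 = z ∧ ∀ t, HasDerivAt γ (b (γ t)) t := by
  obtain ⟨η, hη, -⟩ := (contracting_weightedPicard hb z).exists_fixedPoint 0 (edist_ne_top _ _)
  set γ : ℝ → E := fun t => Real.exp ((2 * K + 1) * |t|) • η t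
  have hγ : ∀ t, γ t = z + ∫ s in (0 : ℝ)..t, b (γ s) := by
    intro t
    have h1 : η t = weightedPicard hb z η t := by rw [hη]
    simp only [γ]
    conv_lhs => rw [h1]
    simp only [weightedPicard, BoundedContinuousFunction.coe_ofNormedAddCommGroup]
    rw [smul_smul, ← Real.exp_add]
    simp
  have hγc : Continuous fun t => b (γ t) := hb.continuous.comp (by fun_prop)
  refine ⟨γ, by simpa using hγ 0, fun t => ?_⟩
  have h1 := (intervalIntegral.integral_hasDerivAt_right (hγc.intervalIntegrable 0 t)
    (hγc.stronglyMeasurableAtFilter _ _) hγc.continuousAt).const_add z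
  have : γ = fun t => z + ∫ s in (0 : ℝ)..t, b (γ s) := funext hγ
  rw [this]
  convert h1 using 1
  rw [← this]

/-- The global flow of a globally Lipschitz vector field. -/
def lipFlow (hb : LipschitzWith K b) (t : ℝ) (z : E) : E :=
  (exists_global_solution hb z).choose t

variable (hb : LipschitzWith K b)

lemma lipFlow_zero (z : E) : lipFlow hb 0 z = z := (exists_global_solution hb z).choose_spec.1

lemma hasDerivAt_lipFlow (t : ℝ) (z : E) :
    HasDerivAt (fun t => lipFlow hb t z) (b (lipFlow hb t z)) t :=
  (exists_global_solution hb z).choose_spec.2 t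

lemma eq_lipFlow {γ : ℝ → E} (hγ : ∀ t, HasDerivAt γ (b (γ t)) t) (t : ℝ) :
    γ t = lipFlow hb t (γ 0) := by
  have := ODE_solution_unique_univ (v := fun _ => b) (s := fun _ => univ) (K := K) (t₀ := 0)
    (f := γ) (g := fun t => lipFlow hb t (γ 0)) (fun _ => hb.lipschitzOnWith)
    (fun t => ⟨hγ t, mem_univ _⟩) (fun t => ⟨hasDerivAt_lipFlow hb t _, mem_univ _⟩)
    (lipFlow_zero hb _).symm
  exact congrFun this t

lemma lipFlow_add (s t : ℝ) (z : E) : lipFlow hb (s + t) z = lipFlow hb s (lipFlow hb t z) := by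
  have := eq_lipFlow hb (γ := fun s => lipFlow hb (s + t) z)
    (fun s => (hasDerivAt_lipFlow hb (s + t) z).comp_add_const s t) s
  simpa using this

lemma lipFlow_neg_apply (t : ℝ) (z : E) : lipFlow hb (-t) (lipFlow hb t z) = z := by
  rw [← lipFlow_add, neg_add_cancel, lipFlow_zero]

lemma lipFlow_apply_neg (t : ℝ) (z : E) : lipFlow hb t (lipFlow hb (-t) z) = z := by
  rw [← lipFlow_add, add_neg_cancel, lipFlow_zero]

/-- Grönwall's inequality forward in time. For negative times the reversed curves solve the equation
with field `-b`, which has the same Lipschitz constant. -/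
lemma dist_lipFlow_le (t : ℝ) (z w : E) :
    dist (lipFlow hb t z) (lipFlow hb t w) ≤ dist z w * Real.exp (K * |t|) := by
  have main : ∀ (c : E → E) (hc : LipschitzWith K c) (f g : ℝ → E),
      (∀ t, HasDerivAt f (c (f t)) t) → (∀ t, HasDerivAt g (c (g t)) t) → ∀ t, 0 ≤ t →
      dist (f t) (g t) ≤ dist (f 0) (g 0) * Real.exp (K * t) := by
    intro c hc f g hf hg t ht
    have := dist_le_of_trajectories_ODE (v := fun _ => c) (K := K) (a := 0) (b := t)
      (fun _ => hc) (fun t _ => (hf t).continuousAt.continuousWithinAt)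
      (fun t _ => (hf t).hasDerivWithinAt) (fun t _ => (hg t).continuousAt.continuousWithinAt)
      (fun t _ => (hg t).hasDerivWithinAt) le_rfl t ⟨ht, le_rfl⟩
    simpa using this
  rcases le_total 0 t with ht | ht
  · rw [abs_of_nonneg ht]
    have := main b hb _ _ (fun t => hasDerivAt_lipFlow hb t z) (fun t => hasDerivAt_lipFlow hb t w)
      t ht
    simpa [lipFlow_zero] using this
  · rw [abs_of_nonpos ht]
    have hneg : ∀ z t, HasDerivAt (fun t => lipFlow hb (-t) z) (-b (lipFlow hb (-t) z)) t := by
      intro z t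
      have := (hasDerivAt_lipFlow hb (-t) z).scomp t (hasDerivAt_neg t)
      rw [neg_one_smul] at this
      exact this
    have := main (fun z => -b z) hb.neg _ _ (hneg z) (hneg w) (-t) (by linarith)
    simpa [lipFlow_zero] using this

lemma continuous_lipFlow : Continuous fun p : ℝ × E => lipFlow hb p.1 p.2 := by
  rw [continuous_iff_continuousAt]
  rintro ⟨t₀, z₀⟩
  rw [ContinuousAt, tendsto_iff_dist_tendsto_zero]
  have h1 : Filter.Tendsto (fun p : ℝ × E => dist p.2 z₀ * Real.exp (K * |p.1|) +
      dist (lipFlow hb p.1 z₀) (lipFlow hb t₀ z₀)) (𝓝 (t₀, z₀)) (𝓝 0) := by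
    have hc : Continuous fun t => lipFlow hb t z₀ :=
      continuous_iff_continuousAt.2 fun t => (hasDerivAt_lipFlow hb t z₀).continuousAt
    have : Continuous fun p : ℝ × E => dist p.2 z₀ * Real.exp (K * |p.1|) +
      dist (lipFlow hb p.1 z₀) (lipFlow hb t₀ z₀) := by fun_prop
    simpa using this.tendsto (t₀, z₀)
  refine squeeze_zero (fun _ => dist_nonneg) (fun p => ?_) h1
  exact (dist_triangle _ (lipFlow hb p.1 z₀) _).trans (by gcongr; exact dist_lipFlow_le hb _ _ _)

lemma continuous_lipFlow_apply (t : ℝ) : Continuous (lipFlow hb t) :=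
  (continuous_lipFlow hb).comp (by fun_prop : Continuous fun z : E => (t, z))

lemma continuous_lipFlow_time (z : E) : Continuous fun t => lipFlow hb t z :=
  (continuous_lipFlow hb).comp (by fun_prop : Continuous fun t : ℝ => (t, z))

end GlobalFlow

end VlasovPoisson
end

/-! ### Liouville's theorem by the symplectic Euler scheme. -/

noncomputable section
namespace VlasovPoisson
open scoped ENNReal NNReal Topology

section Liouville

variable {a : E3 → E3} {K : ℝ≥0}

/-- The vector field of the characteristic system `x' = v`, `v' = -a x`. -/
def charField (a : E3 → E3) (z : Phase) : Phase := (z.2, -a z.1)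

lemma lipschitzWith_charField (ha : LipschitzWith K a) :
    LipschitzWith (max 1 K) (charField a) := by
  have h1 : LipschitzWith 1 fun z : Phase => z.2 := LipschitzWith.prod_snd
  have h2 : LipschitzWith K fun z : Phase => -a z.1 := by
    have := (ha.comp (LipschitzWith.prod_fst (α := E3) (β := E3))).neg
    rw [mul_one] at this
    exact this
  exact h1.prodMk h2

/-- Flow of the characteristic system. -/
def charFlow (ha : LipschitzWith K a) (t : ℝ) (z : Phase) : Phase :=
  lipFlow (lipschitzWith_charField ha) t z

/-- One step of the symplectic Euler scheme. -/
def eulerStep (a : E3 → E3) (h : ℝ) (z : Phase) : Phase :=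
  (z.1 + h • z.2, z.2 - h • a (z.1 + h • z.2))

/-- A step is a drift followed by a kick. Each translates one variable by a function of the other,
so volume is preserved exactly, whether or not `a` is differentiable. -/
lemma measurePreserving_eulerStep (ha : LipschitzWith K a) (h : ℝ) :
    MeasurePreserving (eulerStep a h) := by
  have hac : Continuous a := ha.continuous
  have kick : MeasurePreserving (fun z : Phase => (z.1, z.2 - h • a z.1)) := by
    refine (MeasurePreserving.id (volume : Measure E3)).skew_product
      (g := fun x v => v - h • a x) (by fun_prop) (Filter.Eventually.of_forall fun x => ?_)
    exact (measurePreserving_sub_right volume (h • a x)).map_eq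
  have drift' : MeasurePreserving (fun z : Phase => (z.1, z.2 + h • z.1)) := by
    refine (MeasurePreserving.id (volume : Measure E3)).skew_product
      (g := fun x v => v + h • x) (by fun_prop) (Filter.Eventually.of_forall fun x => ?_)
    exact (measurePreserving_add_right volume (h • x)).map_eq
  have swap : MeasurePreserving (Prod.swap : Phase → Phase) := Measure.measurePreserving_swap
  exact kick.comp (swap.comp (drift'.comp swap))

lemma dist_eulerStep_le (ha : LipschitzWith K a) {h : ℝ} (h0 : 0 ≤ h) (h1 : h ≤ 1) (z w : Phase) :
    dist (eulerStep a h z) (eulerStep a h w) ≤ (1 + 2 * ((max 1 K : ℝ≥0) : ℝ) * h) * dist z w := by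
  set L : ℝ := ((max 1 K : ℝ≥0) : ℝ)
  have hL1 : 1 ≤ L := by simp [L]
  have hLK : (K : ℝ) ≤ L := by simp [L]
  have hd := dist_nonneg (x := z) (y := w)
  have hx : dist z.1 w.1 ≤ dist z w := by rw [Prod.dist_eq]; exact le_max_left _ _
  have hv : dist z.2 w.2 ≤ dist z w := by rw [Prod.dist_eq]; exact le_max_right _ _
  have e1 : dist (z.1 + h • z.2) (w.1 + h • w.2) ≤ (1 + h) * dist z w := by
    refine (dist_add_add_le _ _ _ _).trans ?_
    rw [dist_smul₀, Real.norm_of_nonneg h0]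
    nlinarith
  have e2 : dist (a (z.1 + h • z.2)) (a (w.1 + h • w.2)) ≤ L * ((1 + h) * dist z w) := by
    refine (ha.dist_le_mul _ _).trans ?_
    gcongr
  have e3 : dist (z.2 - h • a (z.1 + h • z.2)) (w.2 - h • a (w.1 + h • w.2)) ≤
      dist z w + h * (L * ((1 + h) * dist z w)) := by
    refine (dist_sub_sub_le _ _ _ _).trans ?_
    rw [dist_smul₀, Real.norm_of_nonneg h0]
    gcongr
  rw [Prod.dist_eq]
  refine max_le ?_ ?_
  · refine e1.trans ?_
    have : 0 ≤ (L - 1) * (h * dist z w) := by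
      have := mul_nonneg h0 hd
      exact mul_nonneg (by linarith) this
    have h2 : 0 ≤ L * (h * dist z w) := by positivity
    nlinarith
  · refine e3.trans ?_
    have h2 : 0 ≤ L * (h * dist z w) * (1 - h) := by
      have : 0 ≤ 1 - h := by linarith
      positivity
    nlinarith

/-- Consistency of the scheme: both the flow and the Euler step differ from the explicit step `z + h
b(z)` by at most `M L h²`, where `b` is the field, `M = max 1 K` and `L` bounds the speed along the
trajectory. -/
lemma dist_flow_eulerStep_le (ha : LipschitzWith K a) {h L : ℝ} (h0 : 0 ≤ h) (z : Phase)
    (hL : ∀ s ∈ Icc 0 h, ‖charField a (charFlow ha s z)‖ ≤ L) :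
    dist (charFlow ha h z) (eulerStep a h z) ≤ 2 * ((max 1 K : ℝ≥0) : ℝ) * L * h ^ 2 := by
  set M : ℝ := ((max 1 K : ℝ≥0) : ℝ)
  have hLip := lipschitzWith_charField ha
  have hL0 : 0 ≤ L := (norm_nonneg _).trans (hL 0 ⟨le_rfl, h0⟩)
  have hz0 : charFlow ha 0 z = z := lipFlow_zero _ z
  have hder : ∀ s, HasDerivAt (fun s => charFlow ha s z) (charField a (charFlow ha s z)) s :=
    fun s => hasDerivAt_lipFlow hLip s z
  have e1 : ∀ s ∈ Icc 0 h, ‖charFlow ha s z - z‖ ≤ L * s := by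
    intro s hs
    have := norm_image_sub_le_of_norm_deriv_le_segment' (f := fun s => charFlow ha s z)
      (f' := fun s => charField a (charFlow ha s z)) (C := L) (a := 0) (b := s)
      (fun x _ => (hder x).hasDerivWithinAt)
      (fun x hx => hL x ⟨hx.1, hx.2.le.trans hs.2⟩) s ⟨hs.1, le_rfl⟩
    simpa [hz0] using this
  have e2 : ‖charFlow ha h z - z - h • charField a z‖ ≤ M * L * h ^ 2 := by
    have := norm_image_sub_le_of_norm_deriv_le_segment'
      (f := fun s => charFlow ha s z - s • charField a z)
      (f' := fun s => charField a (charFlow ha s z) - charField a z) (C := M * (L * h))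
      (a := 0) (b := h)
      (fun x _ => by
        have h2 : HasDerivAt (fun s : ℝ => s • charField a z) (charField a z) x := by
          simpa using (hasDerivAt_id x).smul_const (charField a z)
        exact ((hder x).sub h2).hasDerivWithinAt)
      (fun x hx => by
        have h3 := hLip.dist_le_mul (charFlow ha x z) z
        rw [dist_eq_norm, dist_eq_norm] at h3
        refine h3.trans ?_
        have h4 := e1 x ⟨hx.1, hx.2.le⟩
        have : L * x ≤ L * h := mul_le_mul_of_nonneg_left hx.2.le hL0
        exact mul_le_mul_of_nonneg_left (h4.trans this) (NNReal.coe_nonneg _)) h ⟨h0, le_rfl⟩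
    simp only [hz0, zero_smul, sub_zero] at this
    rw [sub_right_comm] at this
    refine this.trans (le_of_eq ?_)
    ring
  have e3 : ‖eulerStep a h z - z - h • charField a z‖ ≤ M * L * h ^ 2 := by
    have hz : eulerStep a h z - z - h • charField a z = (0, -(h • (a (z.1 + h • z.2) - a z.1))) := by
      ext1
      · simp [eulerStep, charField]
      · simp only [eulerStep, charField, Prod.snd_sub, Prod.smul_snd, smul_neg, smul_sub]
        abel
    rw [hz, Prod.norm_mk, norm_zero, norm_neg, max_eq_right (norm_nonneg _), norm_smul,
      Real.norm_of_nonneg h0]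
    have h3 := ha.dist_le_mul (z.1 + h • z.2) z.1
    rw [dist_eq_norm, dist_eq_norm, add_sub_cancel_left, norm_smul, Real.norm_of_nonneg h0] at h3
    have h4 : ‖z.2‖ ≤ L := by
      have := hL 0 ⟨le_rfl, h0⟩
      rw [hz0] at this
      exact (le_max_left _ _).trans this
    have hKM : (K : ℝ) ≤ M := by simp [M]
    calc h * ‖a (z.1 + h • z.2) - a z.1‖ ≤ h * (K * (h * ‖z.2‖)) := by gcongr
      _ ≤ h * (M * (h * L)) := by gcongr
      _ = M * L * h ^ 2 := by ring
  rw [dist_eq_norm]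
  have : charFlow ha h z - eulerStep a h z = (charFlow ha h z - z - h • charField a z) -
      (eulerStep a h z - z - h • charField a z) := by abel
  rw [this]
  refine (norm_sub_le _ _).trans ?_
  linarith

/-- Each of the `n` steps adds an error of order `h² = T² / n²`, and stability amplifies the
accumulated error by at most `(1 + 2Mh)^n ≤ exp(2MT)`; the total is of order `1/n`. -/
lemma tendsto_eulerStep_iterate (ha : LipschitzWith K a) {T : ℝ} (hT : 0 ≤ T) (z : Phase) :
    Filter.Tendsto (fun n : ℕ => (eulerStep a (T / n))^[n] z) Filter.atTop
      (𝓝 (charFlow ha T z)) := by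
  set M : ℝ := ((max 1 K : ℝ≥0) : ℝ)
  have hM : 0 ≤ M := NNReal.coe_nonneg _
  have hcont : Continuous fun s => ‖charField a (charFlow ha s z)‖ :=
    ((lipschitzWith_charField ha).continuous.comp (continuous_lipFlow_time _ z)).norm
  obtain ⟨L, hL⟩ := (isCompact_Icc (a := (0 : ℝ)) (b := T)).bddAbove_image hcont.continuousOn
  have hL' : ∀ s ∈ Icc 0 T, ‖charField a (charFlow ha s z)‖ ≤ L :=
    fun s hs => hL (mem_image_of_mem _ hs)
  have hL0 : 0 ≤ L := (norm_nonneg _).trans (hL' 0 ⟨le_rfl, hT⟩)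
  have key : ∀ n : ℕ, 0 < n → T / n ≤ 1 →
      dist (charFlow ha T z) ((eulerStep a (T / n))^[n] z) ≤
        (2 * M * L * T ^ 2 * Real.exp (2 * M * T)) / n := by
    intro n hn hn1
    set h := T / n
    have hn' : (0 : ℝ) < n := by exact_mod_cast hn
    have h0 : 0 ≤ h := by positivity
    have hnh : n * h = T := by simp only [h]; field_simp
    have step : ∀ k : ℕ, k ≤ n → dist (charFlow ha (k * h) z) ((eulerStep a h)^[k] z) ≤
        k * (2 * M * L * h ^ 2) * (1 + 2 * M * h) ^ k := by
      intro k
      induction k with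
      | zero =>
        intro _
        have : charFlow ha 0 z = z := lipFlow_zero _ z
        simp [this]
      | succ k ih =>
        intro hk
        have ih' := ih (by omega)
        have e1 : charFlow ha ((k + 1 : ℕ) * h) z = charFlow ha h (charFlow ha (k * h) z) := by
          have : ((k + 1 : ℕ) : ℝ) * h = h + k * h := by push_cast; ring
          rw [this]
          exact lipFlow_add _ _ _ _
        rw [e1, Function.iterate_succ_apply']
        have hkn : ((k : ℝ) + 1) * h ≤ T := by
          rw [← hnh]
          have : (k : ℝ) + 1 ≤ n := by exact_mod_cast hk
          gcongr
        have e2 := dist_flow_eulerStep_le ha h0 (charFlow ha (k * h) z) (L := L) (by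
          intro s hs
          have : charFlow ha s (charFlow ha (k * h) z) = charFlow ha (s + k * h) z :=
            (lipFlow_add _ _ _ _).symm
          rw [this]
          refine hL' _ ⟨by have := hs.1; positivity, ?_⟩
          have := hs.2
          linarith)
        have e3 := dist_eulerStep_le ha h0 hn1 (charFlow ha (k * h) z) ((eulerStep a h)^[k] z)
        have hq : 1 ≤ (1 + 2 * M * h) ^ (k + 1) := one_le_pow₀ (by
          have : 0 ≤ 2 * M * h := by positivity
          linarith)
        have hc : 0 ≤ 2 * M * L * h ^ 2 := by positivity
        calc _ ≤ 2 * M * L * h ^ 2 + (1 + 2 * M * h) *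
              (k * (2 * M * L * h ^ 2) * (1 + 2 * M * h) ^ k) := by
              refine (dist_triangle _ _ _).trans (add_le_add e2 (e3.trans ?_))
              gcongr
          _ ≤ _ := by
              have := mul_le_mul_of_nonneg_left hq hc
              push_cast
              generalize 2 * M * L * h ^ 2 = c at *
              rw [pow_succ (1 + 2 * M * h)] at this ⊢
              linarith
    have hfin := step n le_rfl
    rw [hnh] at hfin
    refine hfin.trans ?_
    have hexp : (1 + 2 * M * h) ^ n ≤ Real.exp (2 * M * T) := by
      have h1 : 1 + 2 * M * h ≤ Real.exp (2 * M * h) := by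
        linarith [Real.add_one_le_exp (2 * M * h)]
      calc (1 + 2 * M * h) ^ n ≤ Real.exp (2 * M * h) ^ n := by gcongr
        _ = Real.exp (2 * M * T) := by
            rw [← Real.exp_nat_mul]
            congr 1
            rw [← hnh]
            ring
    calc n * (2 * M * L * h ^ 2) * (1 + 2 * M * h) ^ n
        ≤ n * (2 * M * L * h ^ 2) * Real.exp (2 * M * T) := by gcongr
      _ = _ := by
          simp only [h]
          field_simp
  rw [tendsto_iff_dist_tendsto_zero]
  refine squeeze_zero' (Filter.Eventually.of_forall fun _ => dist_nonneg) ?_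
    (tendsto_const_div_atTop_nhds_zero_nat (2 * M * L * T ^ 2 * Real.exp (2 * M * T)))
  obtain ⟨N, hN⟩ := exists_nat_ge T
  filter_upwards [Filter.eventually_gt_atTop 0, Filter.eventually_ge_atTop N] with n hn hn2
  rw [dist_comm]
  refine key n hn ?_
  rw [div_le_one (by exact_mod_cast hn)]
  exact hN.trans (by exact_mod_cast hn2)

lemma charFlow_reverse (ha : LipschitzWith K a) (t : ℝ) (z : Phase) :
    charFlow ha t (z.1, -z.2) = ((charFlow ha (-t) z).1, -(charFlow ha (-t) z).2) := by
  have h := eq_lipFlow (lipschitzWith_charField ha)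
    (γ := fun t => ((charFlow ha (-t) z).1, -(charFlow ha (-t) z).2)) (fun t => ?_) t
  · have h0 : charFlow ha 0 z = z := lipFlow_zero _ z
    simp only [neg_zero, h0] at h
    exact h.symm
  · have h1 : HasDerivAt (fun t => charFlow ha (-t) z) (-charField a (charFlow ha (-t) z)) t := by
      have := (hasDerivAt_lipFlow (lipschitzWith_charField ha) (-t) z).scomp t (hasDerivAt_neg t)
      rw [neg_one_smul] at this
      exact this
    set R : Phase →L[ℝ] Phase :=
      (ContinuousLinearMap.fst ℝ E3 E3).prod (-ContinuousLinearMap.snd ℝ E3 E3)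
    refine (R.hasFDerivAt.comp_hasDerivAt t h1).congr_deriv ?_
    simp [charField, R]

lemma measurePreserving_reverse :
    MeasurePreserving (fun z : Phase => (z.1, -z.2)) :=
  (MeasurePreserving.id (volume : Measure E3)).prod (Measure.measurePreserving_neg volume)

/-- Liouville's theorem. -/
theorem measurePreserving_charFlow (ha : LipschitzWith K a) (t : ℝ) :
    MeasurePreserving (charFlow ha t) := by
  have hc : ∀ t, Continuous (charFlow ha t) := fun t =>
    continuous_lipFlow_apply (lipschitzWith_charField ha) t
  -- If the flow sends `z` into the open set `U`, so do all late Euler approximations. Fatou's lemma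
  -- then gives one inequality between the volumes, without differentiating the flow with respect to
  -- `z`.
  have h1 : ∀ t, 0 ≤ t → ∀ U : Set Phase, IsOpen U → volume (charFlow ha t ⁻¹' U) ≤ volume U := by
    intro t ht U hU
    have hind : ∀ z, (charFlow ha t ⁻¹' U).indicator (1 : Phase → ℝ≥0∞) z ≤
        Filter.liminf (fun n : ℕ => ((eulerStep a (t / n))^[n] ⁻¹' U).indicator
          (1 : Phase → ℝ≥0∞) z) Filter.atTop := by
      intro z
      by_cases hz : charFlow ha t z ∈ U
      · refine Filter.le_liminf_of_le (by isBoundedDefault) ?_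
        filter_upwards [(tendsto_eulerStep_iterate ha ht z).eventually (hU.mem_nhds hz)] with n hn
        rw [indicator_of_mem (show z ∈ charFlow ha t ⁻¹' U from hz), indicator_of_mem
          (show z ∈ (eulerStep a (t / n))^[n] ⁻¹' U from hn)]
      · rw [indicator_of_notMem (show z ∉ charFlow ha t ⁻¹' U from hz)]
        exact zero_le
    have hmp : ∀ n : ℕ, MeasurePreserving (eulerStep a (t / n))^[n] :=
      fun n => (measurePreserving_eulerStep ha _).iterate n
    calc volume (charFlow ha t ⁻¹' U) = ∫⁻ z, (charFlow ha t ⁻¹' U).indicator 1 z := by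
          rw [lintegral_indicator_one (hU.measurableSet.preimage (hc t).measurable)]
      _ ≤ ∫⁻ z, Filter.liminf (fun n : ℕ => ((eulerStep a (t / n))^[n] ⁻¹' U).indicator
          (1 : Phase → ℝ≥0∞) z) Filter.atTop := lintegral_mono hind
      _ ≤ Filter.liminf (fun n : ℕ => ∫⁻ z, ((eulerStep a (t / n))^[n] ⁻¹' U).indicator
          (1 : Phase → ℝ≥0∞) z) Filter.atTop := by
          refine lintegral_liminf_le fun n => ?_
          exact measurable_one.indicator (hU.measurableSet.preimage (hmp n).measurable)
      _ = volume U := by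
          have : ∀ n : ℕ, ∫⁻ z, ((eulerStep a (t / n))^[n] ⁻¹' U).indicator (1 : Phase → ℝ≥0∞) z =
              volume U := by
            intro n
            rw [lintegral_indicator_one (hU.measurableSet.preimage (hmp n).measurable)]
            exact (hmp n).measure_preimage hU.measurableSet.nullMeasurableSet
          simp [this]
  -- Velocity reversal preserves volume and conjugates the flow to its inverse, which settles
  -- negative times.
  have h2 : ∀ t, ∀ U : Set Phase, IsOpen U → volume (charFlow ha t ⁻¹' U) ≤ volume U := by
    intro t U hU
    rcases le_total 0 t with ht | ht
    · exact h1 t ht U hU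
    · set r : Phase → Phase := fun z => (z.1, -z.2)
      have hr : Continuous r := by fun_prop
      have hset : charFlow ha t ⁻¹' U = r ⁻¹' (charFlow ha (-t) ⁻¹' (r ⁻¹' U)) := by
        ext z
        simp only [mem_preimage]
        have := charFlow_reverse ha (-t) z
        rw [neg_neg] at this
        simp only [r, this, neg_neg]
      rw [hset, measurePreserving_reverse.measure_preimage
        ((hU.preimage hr).preimage (hc _)).measurableSet.nullMeasurableSet]
      refine (h1 (-t) (by linarith) _ (hU.preimage hr)).trans (le_of_eq ?_)
      exact measurePreserving_reverse.measure_preimage hU.measurableSet.nullMeasurableSet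
  -- Outer regularity carries the inequality from open sets to all sets. The opposite inequality is
  -- the same statement at time `-t`, applied to the preimage of `B`.
  have h3 : ∀ t, ∀ B : Set Phase, volume (charFlow ha t ⁻¹' B) ≤ volume B := by
    intro t B
    rw [B.measure_eq_iInf_isOpen volume]
    refine le_iInf fun U => le_iInf fun hBU => le_iInf fun hU => ?_
    exact (measure_mono (preimage_mono hBU)).trans (h2 t U hU)
  refine ⟨(hc t).measurable, Measure.ext fun B hB => ?_⟩
  rw [Measure.map_apply (hc t).measurable hB]
  refine le_antisymm (h3 t B) ?_
  have h4 := h3 (-t) (charFlow ha t ⁻¹' B)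
  rw [← preimage_comp] at h4
  have h5 : charFlow ha t ∘ charFlow ha (-t) = id := by
    ext1 z
    exact lipFlow_apply_neg _ t z
  rwa [h5, preimage_id] at h4

end Liouville

end VlasovPoisson
end

/-! ### Rotational invariants and exceptional null sets. -/

noncomputable section
namespace VlasovPoisson
open scoped ENNReal NNReal Topology

section Invariants

/-- Two pairs of vectors with the same Gram matrix are related by a linear isometry. -/
lemma exists_isometry_of_invariants_eq {z z' : Phase} (h : invariants z = invariants z') :
    ∃ A : E3 ≃ₗᵢ[ℝ] E3, A z.1 = z'.1 ∧ A z.2 = z'.2 := by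
  simp only [invariants, Prod.mk.injEq] at h
  obtain ⟨h1, h2, h3⟩ := h
  set A := (ℝ ∙ (z.1 - z'.1))ᗮ.reflection
  have hA : A z.1 = z'.1 := Submodule.reflection_sub h1
  have hn : ‖A z.2‖ = ‖z'.2‖ := by rw [A.norm_map, h2]
  set B := (ℝ ∙ (A z.2 - z'.2))ᗮ.reflection
  have hB : B (A z.2) = z'.2 := Submodule.reflection_sub hn
  -- Equality of the inner products makes `z'.1` orthogonal to `A z.2 - z'.2`, so the second
  -- reflection does not undo the first.
  have hB1 : B z'.1 = z'.1 := by
    rw [Submodule.reflection_eq_self_iff, Submodule.mem_orthogonal_singleton_iff_inner_right,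
      inner_sub_left, sub_eq_zero, ← hA, A.inner_map_map, real_inner_comm, h3, hA,
      real_inner_comm]
  exact ⟨A.trans B, by simp [hA, hB1], by simp [hB]⟩

lemma invariants_map (A : E3 ≃ₗᵢ[ℝ] E3) (z : Phase) :
    invariants (A z.1, A z.2) = invariants z := by
  simp [invariants]

lemma angMom_eq (z : Phase) : angMom z = ‖z.1‖ ^ 2 * ‖z.2‖ ^ 2 - ⟪z.1, z.2⟫ ^ 2 := by
  obtain ⟨x, v⟩ := z
  simp only [angMom, EuclideanSpace.norm_sq_eq, Real.norm_eq_abs, sq_abs, Fin.sum_univ_three,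
    cross_apply, PiLp.inner_apply, RCLike.inner_apply, conj_trivial]
  simp
  ring

lemma ne_zero_of_angMom_pos {z : Phase} (hz : 0 < angMom z) : z.1 ≠ 0 := by
  intro h
  rw [angMom_eq, h] at hz
  simp at hz

lemma ae_fst_ne_zero : ∀ᵐ x : E3, x ≠ 0 := by
  rw [ae_iff]
  simp

/-- For `x ≠ 0` the angular momentum vanishes only for `v` on the line through `x`, a null set. On
the complement trajectories never meet the origin, where `φ_Q` has not been differentiated. -/
lemma ae_angMom_pos : ∀ᵐ z : Phase, 0 < angMom z := by
  have hm : MeasurableSet {z : Phase | 0 < angMom z} :=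
    measurableSet_lt measurable_const measurable_angMom
  rw [Measure.volume_eq_prod, Measure.ae_prod_iff_ae_ae hm]
  filter_upwards [ae_fst_ne_zero] with x hx
  have h0 : volume ((ℝ ∙ x : Submodule ℝ E3) : Set E3) = 0 := by
    refine Measure.addHaar_submodule _ _ fun htop => ?_
    have h1 := finrank_span_singleton (K := ℝ) hx
    rw [htop, finrank_top, finrank_euclideanSpace_fin] at h1
    norm_num at h1
  filter_upwards [compl_mem_ae_iff.2 h0] with v hv
  refine (angMom_nonneg _).lt_of_ne' fun h => hv ?_
  rw [angMom_eq] at h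
  have hx2 : ‖x‖ ^ 2 ≠ 0 := by simpa using hx
  have h1 : ‖(‖x‖ ^ 2) • v - (⟪x, v⟫ : ℝ) • x‖ ^ 2 = 0 := by
    rw [norm_sub_sq_real, norm_smul, norm_smul, inner_smul_left, inner_smul_right,
      real_inner_comm x v]
    simp only [mul_pow, Real.norm_eq_abs, sq_abs, conj_trivial]
    linear_combination ‖x‖ ^ 2 * h
  have h2 : (‖x‖ ^ 2) • v = (⟪x, v⟫ : ℝ) • x := by
    rw [← sub_eq_zero, ← norm_eq_zero]
    exact pow_eq_zero_iff two_ne_zero |>.1 h1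
  refine Submodule.mem_span_singleton.2 ⟨(‖x‖ ^ 2)⁻¹ * ⟪x, v⟫, ?_⟩
  rw [mul_smul, ← h2, smul_smul, inv_mul_cancel₀ hx2, one_smul]

/-- For `x ≠ 0` the exceptional velocities form the plane orthogonal to `x`. The zeros of `x·v` are
the singularities of the Riccati substitution, so they have to be negligible. -/
lemma ae_inner_ne_zero : ∀ᵐ z : Phase, (⟪z.1, z.2⟫ : ℝ) ≠ 0 := by
  have hm : MeasurableSet {z : Phase | (⟪z.1, z.2⟫ : ℝ) ≠ 0} :=
    (isOpen_ne_fun (by fun_prop) (by fun_prop)).measurableSet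
  rw [Measure.volume_eq_prod, Measure.ae_prod_iff_ae_ae hm]
  filter_upwards [ae_fst_ne_zero] with x hx
  have h0 : volume (((ℝ ∙ x)ᗮ : Submodule ℝ E3) : Set E3) = 0 := by
    refine Measure.addHaar_submodule _ _ fun htop => ?_
    have h1 : x ∈ (ℝ ∙ x)ᗮ := htop ▸ Submodule.mem_top
    rw [Submodule.mem_orthogonal_singleton_iff_inner_right] at h1
    exact hx (inner_self_eq_zero.1 h1)
  filter_upwards [compl_mem_ae_iff.2 h0] with v hv h
  exact hv (Submodule.mem_orthogonal_singleton_iff_inner_right.2 h)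

lemma dense_angMom_pos : Dense {z : Phase | 0 < angMom z} :=
  Measure.dense_of_ae ae_angMom_pos

/-- The density of a spherically symmetric function is radial. -/
lemma exists_radial_density {f : Phase → ℝ} (hf : Measurable f)
    (hA : ∀ (A : E3 ≃ₗᵢ[ℝ] E3) (z : Phase), f (A z.1, A z.2) = f z) :
    ∃ R : ℝ → ℝ, Measurable R ∧ (∀ x, density f x = R ‖x‖) ∧
      (Continuous (density f) → Continuous R) := by
  set e0 : E3 := EuclideanSpace.single 0 1
  have he0 : ‖e0‖ = 1 := by simp [e0]
  refine ⟨fun s => density f (s • e0), ?_, fun x => ?_, fun h => h.comp (by fun_prop)⟩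
  · have h1 : StronglyMeasurable (density f) := hf.stronglyMeasurable.integral_prod_right'
    exact h1.measurable.comp (by fun_prop)
  · have hn : ‖x‖ = ‖‖x‖ • e0‖ := by simp [norm_smul, he0]
    set A := (ℝ ∙ (x - ‖x‖ • e0))ᗮ.reflection
    have hAx : A x = ‖x‖ • e0 := Submodule.reflection_sub hn
    simp only [density]
    have h := A.measurePreserving.integral_comp A.toHomeomorph.measurableEmbedding
      (fun v => f (A x, v))
    rw [← hAx, ← h]
    refine integral_congr_ae (Filter.Eventually.of_forall fun v => ?_)
    exact (hA A (x, v)).symm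

end Invariants

/-! ### Mass in balls and Lipschitz continuity of the field. -/

section BallMass

variable {ρ : E3 → ℝ} {C : ℝ}

lemma ballMass_nonneg (h0 : ∀ x, 0 ≤ ρ x) (r : ℝ) : 0 ≤ ballMass ρ r :=
  integral_nonneg h0

lemma ballMass_zero : ballMass ρ 0 = 0 := by simp [ballMass]

lemma ballMass_sub (hi : Integrable ρ) {r s : ℝ} (hrs : r ≤ s) :
    ballMass ρ s - ballMass ρ r = ∫ x in Metric.ball (0 : E3) s \ Metric.ball 0 r, ρ x := by
  have := setIntegral_sdiff (s := Metric.ball (0 : E3) s) (f := ρ) (μ := volume) (measurableSet_ball (x := (0 : E3)) (ε := r))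
    hi.integrableOn (Metric.ball_subset_ball hrs)
  rw [this, ballMass, ballMass]

lemma ballMass_mono (h0 : ∀ x, 0 ≤ ρ x) (hi : Integrable ρ) : Monotone (ballMass ρ) := by
  intro r s hrs
  rw [← sub_nonneg, ballMass_sub hi hrs]
  exact integral_nonneg h0

lemma ballMass_sub_le (hC : ∀ x, ρ x ≤ C) (hi : Integrable ρ) {r s : ℝ} (hr : 0 ≤ r)
    (hrs : r ≤ s) : ballMass ρ s - ballMass ρ r ≤ C * (4 * Real.pi / 3 * (s ^ 3 - r ^ 3)) := by
  rw [ballMass_sub hi hrs]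
  have hfin : volume (Metric.ball (0 : E3) s \ Metric.ball 0 r) ≠ ⊤ :=
    ((measure_mono sdiff_subset).trans_lt measure_ball_lt_top).ne
  calc ∫ x in Metric.ball (0 : E3) s \ Metric.ball 0 r, ρ x
      ≤ ∫ x in Metric.ball (0 : E3) s \ Metric.ball 0 r, C := by
        refine integral_mono hi.integrableOn (integrableOn_const hfin) hC
    _ = C * (4 * Real.pi / 3 * (s ^ 3 - r ^ 3)) := by
        have hv : ∀ t : ℝ, 0 ≤ t → volume.real (Metric.ball (0 : E3) t) = 4 * Real.pi / 3 * t ^ 3 := by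
          intro t ht
          rw [Measure.real, EuclideanSpace.volume_ball_fin_three, ENNReal.toReal_mul,
            ENNReal.toReal_pow, ENNReal.toReal_ofReal ht, ENNReal.toReal_ofReal (by positivity)]
          ring
        rw [setIntegral_const, smul_eq_mul, measureReal_sdiff
          (Metric.ball_subset_ball hrs) measurableSet_ball, hv s (hr.trans hrs), hv r hr]
        ring

/-- The mean field strength `φ' / r` of a radial density. -/
def meanField (ρ : E3 → ℝ) (r : ℝ) : ℝ := ballMass ρ r / (4 * Real.pi * r ^ 3)

lemma meanField_nonneg (h0 : ∀ x, 0 ≤ ρ x) {r : ℝ} (hr : 0 ≤ r) : 0 ≤ meanField ρ r :=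
  div_nonneg (ballMass_nonneg h0 r) (by positivity)

lemma meanField_le (hC0 : 0 ≤ C) (hC : ∀ x, ρ x ≤ C) (hi : Integrable ρ) {r : ℝ} (hr : 0 ≤ r) :
    meanField ρ r ≤ C / 3 := by
  rcases hr.eq_or_lt with rfl | hr
  · simp [meanField]
    positivity
  · have := ballMass_sub_le hC hi le_rfl hr.le
    rw [ballMass_zero] at this
    rw [meanField, div_le_iff₀ (by positivity)]
    linarith

/-- The difference is a gain from the change of volume minus a gain from the added mass. Both are
nonnegative and at most `(C/3)(s³ - r³)/s³`, because masses are at most `C` times volumes; and `(s³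
- r³) r ≤ 3 (s - r) s³`. -/
lemma abs_meanField_sub_mul_le (h0 : ∀ x, 0 ≤ ρ x) (hC : ∀ x, ρ x ≤ C)
    (hi : Integrable ρ) {r s : ℝ} (hr : 0 < r) (hrs : r ≤ s) :
    |meanField ρ r - meanField ρ s| * r ≤ C * (s - r) := by
  have hs : 0 < s := hr.trans_le hrs
  have hC0 : 0 ≤ C := (h0 0).trans (hC 0)
  have h1 := ballMass_sub_le hC hi hr.le hrs
  have h2 := ballMass_sub_le hC hi le_rfl hr.le
  rw [ballMass_zero] at h2
  have h3 := ballMass_mono h0 hi hrs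
  have h4 := ballMass_nonneg h0 r
  have hpi := Real.pi_pos
  have hcube : r ^ 3 ≤ s ^ 3 := by gcongr
  have e : meanField ρ r - meanField ρ s = ballMass ρ r * (s ^ 3 - r ^ 3) / (4 * Real.pi * r ^ 3 * s ^ 3) -
      (ballMass ρ s - ballMass ρ r) / (4 * Real.pi * s ^ 3) := by
    simp only [meanField]
    field_simp
    ring
  have hA0 : 0 ≤ ballMass ρ r * (s ^ 3 - r ^ 3) / (4 * Real.pi * r ^ 3 * s ^ 3) :=
    div_nonneg (mul_nonneg h4 (by linarith)) (by positivity)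
  have hB0 : 0 ≤ (ballMass ρ s - ballMass ρ r) / (4 * Real.pi * s ^ 3) :=
    div_nonneg (by linarith) (by positivity)
  have hA : ballMass ρ r * (s ^ 3 - r ^ 3) / (4 * Real.pi * r ^ 3 * s ^ 3) ≤
      C / 3 * ((s ^ 3 - r ^ 3) / s ^ 3) := by
    rw [div_le_iff₀ (by positivity)]
    have : C / 3 * ((s ^ 3 - r ^ 3) / s ^ 3) * (4 * Real.pi * r ^ 3 * s ^ 3) =
      (C * (4 * Real.pi / 3 * r ^ 3)) * (s ^ 3 - r ^ 3) := by field_simp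
    rw [this]
    exact mul_le_mul_of_nonneg_right (by linarith) (by linarith)
  have hB : (ballMass ρ s - ballMass ρ r) / (4 * Real.pi * s ^ 3) ≤
      C / 3 * ((s ^ 3 - r ^ 3) / s ^ 3) := by
    rw [div_le_iff₀ (by positivity)]
    have : C / 3 * ((s ^ 3 - r ^ 3) / s ^ 3) * (4 * Real.pi * s ^ 3) =
      C * (4 * Real.pi / 3 * (s ^ 3 - r ^ 3)) := by field_simp
    linarith
  have hD : |meanField ρ r - meanField ρ s| ≤ C / 3 * ((s ^ 3 - r ^ 3) / s ^ 3) := by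
    rw [e, abs_le]
    constructor <;> linarith
  have hE : (s ^ 3 - r ^ 3) / s ^ 3 * r ≤ 3 * (s - r) := by
    rw [div_mul_eq_mul_div, div_le_iff₀ (by positivity)]
    have hp : 0 ≤ s - r := by linarith
    have : (s ^ 2 + s * r + r ^ 2) * r ≤ 3 * s ^ 3 := by nlinarith [mul_pos hr hs, mul_self_nonneg (s - r), pow_pos hs 2, pow_pos hr 2, mul_nonneg hp hs.le, mul_nonneg hp hr.le, mul_nonneg hp (sq_nonneg s), mul_nonneg hp (mul_pos hr hs).le, mul_nonneg hp (sq_nonneg r)]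
    nlinarith
  calc _ ≤ C / 3 * ((s ^ 3 - r ^ 3) / s ^ 3) * r := by gcongr
    _ = C / 3 * ((s ^ 3 - r ^ 3) / s ^ 3 * r) := by ring
    _ ≤ C / 3 * (3 * (s - r)) := by gcongr
    _ = C * (s - r) := by ring

/-- For `‖x‖ ≤ ‖y‖` the increment splits into a change of the mean field at fixed `x` and a change
of the vector at fixed mean field. These cost at most `C‖x - y‖` and `(C/3)‖x - y‖`. -/
lemma lipschitzWith_meanField_smul (h0 : ∀ x, 0 ≤ ρ x) (hC : ∀ x, ρ x ≤ C) (hi : Integrable ρ) :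
    LipschitzWith (Real.toNNReal (2 * C)) fun x : E3 => meanField ρ ‖x‖ • x := by
  have hC0 : 0 ≤ C := (h0 0).trans (hC 0)
  refine LipschitzWith.of_dist_le_mul fun x y => ?_
  rw [Real.coe_toNNReal _ (by linarith)]
  wlog hxy : ‖x‖ ≤ ‖y‖ generalizing x y
  · rw [dist_comm, dist_comm x y]
    exact this y x (le_of_not_ge hxy)
  rw [dist_eq_norm, dist_eq_norm]
  have h1 := meanField_le hC0 hC hi (norm_nonneg y)
  have h2 := meanField_nonneg h0 (norm_nonneg y)
  have e : meanField ρ ‖x‖ • x - meanField ρ ‖y‖ • y =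
      (meanField ρ ‖x‖ - meanField ρ ‖y‖) • x + meanField ρ ‖y‖ • (x - y) := by
    module
  rw [e]
  refine (norm_add_le _ _).trans ?_
  rw [norm_smul, norm_smul, Real.norm_eq_abs, Real.norm_of_nonneg h2]
  have h3 : |meanField ρ ‖x‖ - meanField ρ ‖y‖| * ‖x‖ ≤ C * ‖x - y‖ := by
    rcases (norm_nonneg x).eq_or_lt with hx | hx
    · rw [← hx, mul_zero]
      positivity
    · refine (abs_meanField_sub_mul_le h0 hC hi hx hxy).trans ?_
      gcongr
      rw [norm_sub_rev]
      exact norm_sub_norm_le y x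
  nlinarith [norm_nonneg (x - y)]

lemma ballMass_eq_integral {R : ℝ → ℝ} (hρ : ∀ x, ρ x = R ‖x‖) {r : ℝ} (hr : 0 ≤ r) :
    ballMass ρ r = 4 * Real.pi * ∫ s in (0 : ℝ)..r, s ^ 2 * R s := by
  have h1 := integral_fun_norm_addHaar (volume : Measure E3) ((Iio r).indicator R)
  have h2 : (fun x : E3 => (Iio r).indicator R ‖x‖) = (Metric.ball (0 : E3) r).indicator ρ := by
    ext x
    by_cases hx : ‖x‖ < r
    · rw [indicator_of_mem (show ‖x‖ ∈ Iio r from hx), indicator_of_mem (by simpa using hx), hρ]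
    · rw [indicator_of_notMem (by simpa using hx), indicator_of_notMem (by simpa using hx)]
  rw [h2, integral_indicator measurableSet_ball] at h1
  rw [ballMass, h1, finrank_euclideanSpace, Measure.real, EuclideanSpace.volume_ball_fin_three]
  have h3 : ∫ y in Ioi (0 : ℝ), y ^ (Fintype.card (Fin 3) - 1) • (Iio r).indicator R y =
      ∫ s in (0 : ℝ)..r, s ^ 2 * R s := by
    rw [intervalIntegral.integral_of_le hr, integral_Ioc_eq_integral_Ioo,
      ← Ioi_inter_Iio, ← setIntegral_indicator measurableSet_Iio]
    refine setIntegral_congr_fun measurableSet_Ioi fun y _ => ?_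
    by_cases hy : y < r
    · simp [hy]
    · simp [hy]
  rw [h3]
  simp
  ring_nf
  rw [ENNReal.toReal_ofReal (by positivity)]
  ring

lemma hasDerivAt_ballMass {R : ℝ → ℝ} (hR : Continuous R) (hρ : ∀ x, ρ x = R ‖x‖) {r : ℝ}
    (hr : 0 < r) : HasDerivAt (ballMass ρ) (4 * Real.pi * (r ^ 2 * R r)) r := by
  have hc : Continuous fun s => s ^ 2 * R s := by fun_prop
  have h1 := (intervalIntegral.integral_hasDerivAt_right (hc.intervalIntegrable 0 r)
    (hc.stronglyMeasurableAtFilter _ _) hc.continuousAt).const_mul (4 * Real.pi)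
  refine h1.congr_of_eventuallyEq ?_
  filter_upwards [Ioi_mem_nhds hr] with s hs
  exact ballMass_eq_integral hρ (le_of_lt hs)

end BallMass

end VlasovPoisson
end

/-! ### The steady state, its characteristic flow and the conserved quantities. -/

noncomputable section
namespace VlasovPoisson
open scoped ENNReal NNReal Topology

namespace IsAdmissible

variable {Q : Phase → ℝ} {F : ℝ → ℝ → ℝ} {e₀ : ℝ}

lemma eq_of_invariants (h : IsAdmissible Q F e₀) {z z' : Phase} (hz : invariants z = invariants z') :
    Q z = Q z' := by
  obtain ⟨q, hq⟩ := h.spherical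
  simp only [invariants, Prod.mk.injEq] at hz
  rw [hq, hq, hz.1, hz.2.1, hz.2.2]

lemma map_isometry (h : IsAdmissible Q F e₀) (A : E3 ≃ₗᵢ[ℝ] E3) (z : Phase) :
    Q (A z.1, A z.2) = Q z := h.eq_of_invariants (invariants_map A z)

lemma exists_radius (h : IsAdmissible Q F e₀) : ∃ r : ℝ, 0 < r ∧ ∀ z, r ≤ ‖z‖ → Q z = 0 := by
  obtain ⟨r, hr⟩ := h.hasCompactSupport.isCompact.isBounded.exists_pos_norm_le
  refine ⟨r + 1, by linarith [hr.1], fun z hz => ?_⟩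
  by_contra hne
  have := hr.2 z (subset_tsupport _ hne)
  linarith

/-- A radius of a ball containing `Ω`. -/
def radius (h : IsAdmissible Q F e₀) : ℝ := h.exists_radius.choose

lemma radius_pos (h : IsAdmissible Q F e₀) : 0 < h.radius := h.exists_radius.choose_spec.1

lemma eq_zero_of_radius_le (h : IsAdmissible Q F e₀) {z : Phase} (hz : h.radius ≤ ‖z‖) : Q z = 0 :=
  h.exists_radius.choose_spec.2 z hz

lemma norm_lt_radius (h : IsAdmissible Q F e₀) {z : Phase} (hz : z ∈ Omega Q) : ‖z‖ < h.radius := by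
  by_contra hne
  have h1 : 0 < Q z := hz
  rw [h.eq_zero_of_radius_le (not_lt.1 hne)] at h1
  exact lt_irrefl _ h1

lemma norm_fst_lt_radius (h : IsAdmissible Q F e₀) {z : Phase} (hz : z ∈ Omega Q) :
    ‖z.1‖ < h.radius := (norm_fst_le z).trans_lt (h.norm_lt_radius hz)

lemma norm_snd_lt_radius (h : IsAdmissible Q F e₀) {z : Phase} (hz : z ∈ Omega Q) :
    ‖z.2‖ < h.radius := (norm_snd_le z).trans_lt (h.norm_lt_radius hz)

lemma density_nonneg (h : IsAdmissible Q F e₀) (x : E3) : 0 ≤ density Q x :=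
  integral_nonneg fun _ => h.nonneg _

lemma density_continuous (h : IsAdmissible Q F e₀) : Continuous (density Q) := by
  have hc := continuous_parametric_integral_of_continuous (X := E3) (μ := (volume : Measure E3))
    (f := fun x v => Q (x, v)) (by exact h.continuous)
    (isCompact_closedBall (0 : E3) h.radius)
  refine hc.congr fun x => ?_
  simp only [density]
  refine setIntegral_eq_integral_of_forall_compl_eq_zero fun v hv => ?_
  refine h.eq_zero_of_radius_le ?_
  have : h.radius < ‖v‖ := by simpa using hv
  exact this.le.trans (norm_snd_le (x, v))

lemma integrable_slice (h : IsAdmissible Q F e₀) (x : E3) : Integrable fun v => Q (x, v) := by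
  refine Continuous.integrable_of_hasCompactSupport (h.continuous.comp (by fun_prop)) ?_
  refine HasCompactSupport.intro (isCompact_closedBall (0 : E3) h.radius) fun v hv => ?_
  refine h.eq_zero_of_radius_le ?_
  have : h.radius < ‖v‖ := by simpa using hv
  exact this.le.trans (norm_snd_le (x, v))

lemma density_eq_zero (h : IsAdmissible Q F e₀) {x : E3} (hx : h.radius ≤ ‖x‖) :
    density Q x = 0 := by
  refine integral_eq_zero_of_ae (Filter.Eventually.of_forall fun v => ?_)
  exact h.eq_zero_of_radius_le (hx.trans (norm_fst_le (x, v)))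

lemma density_integrable (h : IsAdmissible Q F e₀) : Integrable (density Q) := by
  refine h.density_continuous.integrable_of_hasCompactSupport ?_
  refine HasCompactSupport.intro (isCompact_closedBall (0 : E3) h.radius) fun x hx => ?_
  refine h.density_eq_zero ?_
  have : h.radius < ‖x‖ := by simpa using hx
  exact this.le

lemma exists_density_bound (h : IsAdmissible Q F e₀) : ∃ C, ∀ x, density Q x ≤ C := by
  have hs : HasCompactSupport (density Q) :=
    HasCompactSupport.intro (isCompact_closedBall (0 : E3) h.radius) fun x hx => by
      refine h.density_eq_zero ?_
      have : h.radius < ‖x‖ := by simpa using hx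
      exact this.le
  obtain ⟨C, hC⟩ := hs.exists_bound_of_continuous h.density_continuous
  exact ⟨C, fun z => (le_abs_self _).trans (hC z)⟩

lemma exists_profile (h : IsAdmissible Q F e₀) :
    ∃ R : ℝ → ℝ, Continuous R ∧ ∀ x, density Q x = R ‖x‖ := by
  obtain ⟨R, -, h2, h3⟩ := exists_radial_density h.continuous.measurable h.map_isometry
  exact ⟨R, h3 h.density_continuous, h2⟩

lemma density_pos (h : IsAdmissible Q F e₀) {z : Phase} (hz : z ∈ Omega Q) : 0 < density Q z.1 := by
  have hc : Continuous fun v => Q (z.1, v) := h.continuous.comp (by fun_prop)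
  rw [density, integral_pos_iff_support_of_nonneg (fun v => h.nonneg _) (h.integrable_slice z.1)]
  refine (hc.isOpen_support).measure_pos _ ⟨z.2, ?_⟩
  exact (show 0 < Q z from hz).ne'

/-- The mean field `φ' / r` of the steady state. -/
def mean (_ : IsAdmissible Q F e₀) (r : ℝ) : ℝ := meanField (density Q) r

lemma hasGradientAt_potential (h : IsAdmissible Q F e₀) {x : E3} (hx : x ≠ 0) :
    HasGradientAt (potential Q) (h.mean ‖x‖ • x) x := by
  obtain ⟨R, hR, hR2⟩ := h.exists_profile
  exact hasGradientAt_newton hR.measurable hR2 h.density_integrable hx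

lemma gradient_potential (h : IsAdmissible Q F e₀) (x : E3) :
    gradient (potential Q) x = h.mean ‖x‖ • x := by
  by_cases hx : x = 0
  · subst hx
    obtain ⟨R, -, hR2⟩ := h.exists_profile
    rw [smul_zero]
    exact gradient_newton_zero (ρ := density Q) fun y => by rw [hR2, hR2, norm_neg]
  · exact (h.hasGradientAt_potential hx).gradient

lemma exists_lipschitz_gradient (h : IsAdmissible Q F e₀) :
    ∃ K : ℝ≥0, LipschitzWith K (gradient (potential Q)) := by
  obtain ⟨C, hC⟩ := h.exists_density_bound
  refine ⟨Real.toNNReal (2 * C), ?_⟩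
  rw [funext h.gradient_potential]
  exact lipschitzWith_meanField_smul h.density_nonneg hC h.density_integrable

/-- A Lipschitz constant of the gravitational field of the steady state. -/
def lipConst (h : IsAdmissible Q F e₀) : ℝ≥0 := h.exists_lipschitz_gradient.choose

lemma lipschitz_gradient (h : IsAdmissible Q F e₀) :
    LipschitzWith h.lipConst (gradient (potential Q)) := h.exists_lipschitz_gradient.choose_spec

/-- The characteristic flow of the steady state. -/
def flow (h : IsAdmissible Q F e₀) (t : ℝ) (z : Phase) : Phase :=
  charFlow h.lipschitz_gradient t z

variable (h : IsAdmissible Q F e₀)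
include h

lemma lipschitz_field : LipschitzWith (max 1 h.lipConst) (charField (gradient (potential Q))) :=
  lipschitzWith_charField h.lipschitz_gradient

lemma flow_zero (z : Phase) : h.flow 0 z = z := lipFlow_zero h.lipschitz_field z

lemma flow_add (s t : ℝ) (z : Phase) : h.flow (s + t) z = h.flow s (h.flow t z) :=
  lipFlow_add h.lipschitz_field s t z

lemma flow_neg_apply (t : ℝ) (z : Phase) : h.flow (-t) (h.flow t z) = z :=
  lipFlow_neg_apply h.lipschitz_field t z

lemma flow_apply_neg (t : ℝ) (z : Phase) : h.flow t (h.flow (-t) z) = z :=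
  lipFlow_apply_neg h.lipschitz_field t z

lemma continuous_flow : Continuous fun p : ℝ × Phase => h.flow p.1 p.2 :=
  continuous_lipFlow h.lipschitz_field

lemma continuous_flow_apply (t : ℝ) : Continuous (h.flow t) :=
  continuous_lipFlow_apply h.lipschitz_field t

lemma continuous_flow_time (z : Phase) : Continuous fun t => h.flow t z :=
  continuous_lipFlow_time h.lipschitz_field z

lemma dist_flow_le (t : ℝ) (z w : Phase) :
    dist (h.flow t z) (h.flow t w) ≤ dist z w * Real.exp ((max 1 h.lipConst : ℝ≥0) * |t|) :=
  dist_lipFlow_le h.lipschitz_field t z w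

lemma measurePreserving_flow (t : ℝ) : MeasurePreserving (h.flow t) :=
  measurePreserving_charFlow h.lipschitz_gradient t

/-- The flow maps as homeomorphisms. -/
def flowHomeo (h : IsAdmissible Q F e₀) (t : ℝ) : Phase ≃ₜ Phase where
  toFun := h.flow t
  invFun := h.flow (-t)
  left_inv := h.flow_neg_apply t
  right_inv := h.flow_apply_neg t
  continuous_toFun := h.continuous_flow_apply t
  continuous_invFun := h.continuous_flow_apply (-t)

lemma flow_reverse (t : ℝ) (z : Phase) :
    h.flow t (z.1, -z.2) = ((h.flow (-t) z).1, -(h.flow (-t) z).2) :=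
  charFlow_reverse h.lipschitz_gradient t z

lemma hasDerivAt_flow (t : ℝ) (z : Phase) : HasDerivAt (fun t => h.flow t z)
    (charField (gradient (potential Q)) (h.flow t z)) t :=
  hasDerivAt_lipFlow h.lipschitz_field t z

lemma hasDerivAt_flow_fst (t : ℝ) (z : Phase) :
    HasDerivAt (fun t => (h.flow t z).1) (h.flow t z).2 t :=
  (ContinuousLinearMap.fst ℝ E3 E3).hasFDerivAt.comp_hasDerivAt t (h.hasDerivAt_flow t z)

lemma hasDerivAt_flow_snd (t : ℝ) (z : Phase) :
    HasDerivAt (fun t => (h.flow t z).2) (-(h.mean ‖(h.flow t z).1‖ • (h.flow t z).1)) t := by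
  have := (ContinuousLinearMap.snd ℝ E3 E3).hasFDerivAt.comp_hasDerivAt t (h.hasDerivAt_flow t z)
  rw [← h.gradient_potential]
  exact this

lemma flow_map (A : E3 ≃ₗᵢ[ℝ] E3) (t : ℝ) (z : Phase) :
    h.flow t (A z.1, A z.2) = (A (h.flow t z).1, A (h.flow t z).2) := by
  have key := eq_lipFlow h.lipschitz_field (γ := fun t => (A (h.flow t z).1, A (h.flow t z).2))
    (fun t => ?_) t
  · simp only [h.flow_zero] at key
    exact key.symm
  · set B : Phase →L[ℝ] Phase :=
      ((A : E3 →L[ℝ] E3).comp (ContinuousLinearMap.fst ℝ E3 E3)).prod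
        ((A : E3 →L[ℝ] E3).comp (ContinuousLinearMap.snd ℝ E3 E3))
    refine (B.hasFDerivAt.comp_hasDerivAt t (h.hasDerivAt_flow t z)).congr_deriv ?_
    simp [charField, B, h.gradient_potential]

lemma invariants_flow_congr {z z' : Phase} (hz : invariants z = invariants z') (t : ℝ) :
    invariants (h.flow t z) = invariants (h.flow t z') := by
  obtain ⟨A, h1, h2⟩ := exists_isometry_of_invariants_eq hz
  have : z' = (A z.1, A z.2) := by rw [h1, h2]
  rw [this, h.flow_map, invariants_map]

lemma hasDerivAt_inner (t : ℝ) (z : Phase) :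
    HasDerivAt (fun t => (⟪(h.flow t z).1, (h.flow t z).2⟫ : ℝ))
      (‖(h.flow t z).2‖ ^ 2 - h.mean ‖(h.flow t z).1‖ * ‖(h.flow t z).1‖ ^ 2) t := by
  refine ((h.hasDerivAt_flow_fst t z).inner ℝ (h.hasDerivAt_flow_snd t z)).congr_deriv ?_
  rw [inner_neg_right, real_inner_smul_right, real_inner_self_eq_norm_sq,
    real_inner_self_eq_norm_sq]
  ring

lemma hasDerivAt_normSq_fst (t : ℝ) (z : Phase) :
    HasDerivAt (fun t => ‖(h.flow t z).1‖ ^ 2) (2 * ⟪(h.flow t z).1, (h.flow t z).2⟫) t :=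
  (h.hasDerivAt_flow_fst t z).norm_sq

lemma hasDerivAt_normSq_snd (t : ℝ) (z : Phase) :
    HasDerivAt (fun t => ‖(h.flow t z).2‖ ^ 2)
      (-(2 * h.mean ‖(h.flow t z).1‖ * ⟪(h.flow t z).1, (h.flow t z).2⟫)) t := by
  refine (h.hasDerivAt_flow_snd t z).norm_sq.congr_deriv ?_
  rw [inner_neg_right, real_inner_smul_right, real_inner_comm]
  ring

lemma angMom_flow (t : ℝ) (z : Phase) : angMom (h.flow t z) = angMom z := by
  have hd : ∀ t, HasDerivAt (fun t => angMom (h.flow t z)) 0 t := by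
    intro t
    have := ((h.hasDerivAt_normSq_fst t z).mul (h.hasDerivAt_normSq_snd t z)).sub
      ((h.hasDerivAt_inner t z).pow 2)
    simp only [angMom_eq]
    refine this.congr_deriv ?_
    push_cast
    ring
  have := is_const_of_deriv_eq_zero (fun t => (hd t).differentiableAt) (fun t => (hd t).deriv) t 0
  rw [this, h.flow_zero]

lemma fst_flow_ne_zero {z : Phase} (hz : 0 < angMom z) (t : ℝ) : (h.flow t z).1 ≠ 0 :=
  ne_zero_of_angMom_pos (by rwa [h.angMom_flow])

/-- Positive angular momentum keeps the trajectory away from the origin, where the chain rule for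
the potential is available. -/
lemma energy_flow {z : Phase} (hz : 0 < angMom z) (t : ℝ) :
    energy (potential Q) (h.flow t z) = energy (potential Q) z := by
  have hd : ∀ t, HasDerivAt (fun t => energy (potential Q) (h.flow t z)) 0 t := by
    intro t
    have h1 := (h.hasGradientAt_potential (h.fst_flow_ne_zero hz t)).hasFDerivAt.comp_hasDerivAt t
      (h.hasDerivAt_flow_fst t z)
    have h2 := ((h.hasDerivAt_normSq_snd t z).div_const 2).add h1
    refine h2.congr_deriv ?_
    simp
    ring
  have := is_const_of_deriv_eq_zero (fun t => (hd t).differentiableAt) (fun t => (hd t).deriv) t 0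
  rw [this, h.flow_zero]

/-- Where `ℓ > 0`, `Q` is a function of two conserved quantities. That set is dense, and continuity
of `Q` and of the flow extends the identity to the remaining trajectories. -/
lemma apply_flow (t : ℝ) (z : Phase) : Q (h.flow t z) = Q z := by
  have hc : Continuous fun z => Q (h.flow t z) := h.continuous.comp (h.continuous_flow_apply t)
  refine congrFun (hc.ext_on dense_angMom_pos h.continuous fun z hz => ?_) z
  simp only [h.eq_profile, h.angMom_flow, h.energy_flow hz]

lemma flow_mem_Omega {t : ℝ} {z : Phase} : h.flow t z ∈ Omega Q ↔ z ∈ Omega Q := by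
  simp [Omega, h.apply_flow]

lemma dF_flow {z : Phase} (hz : 0 < angMom z) (t : ℝ) : dF Q F (h.flow t z) = dF Q F z := by
  simp only [dF, h.angMom_flow, h.energy_flow hz]

lemma measurableSet_Omega : MeasurableSet (Omega Q) := h.isOpen_Omega.measurableSet

lemma reverse_mem_Omega {z : Phase} : ((z.1, -z.2) : Phase) ∈ Omega Q ↔ z ∈ Omega Q := by
  have : Q (z.1, -z.2) = Q z := by
    rw [h.eq_profile, h.eq_profile]
    simp [energy, angMom_eq]
  simp [Omega, this]

lemma measurePreserving_flow_Omega (t : ℝ) :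
    MeasurePreserving (h.flow t) (volume.restrict (Omega Q)) (volume.restrict (Omega Q)) := by
  have := (h.measurePreserving_flow t).restrict_preimage h.measurableSet_Omega
  have e : h.flow t ⁻¹' Omega Q = Omega Q := by
    ext z
    exact h.flow_mem_Omega
  rwa [e] at this

lemma volume_Omega_lt_top : volume (Omega Q) < ⊤ := by
  refine (measure_mono fun z hz => ?_).trans_lt
    (measure_closedBall_lt_top (x := (0 : Phase)) (r := h.radius))
  simpa using (h.norm_lt_radius hz).le

end IsAdmissible

end VlasovPoisson
end

/-! ### Integrability of `|F'_e| / |x|²` on `Ω`. -/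

noncomputable section
namespace VlasovPoisson
open scoped ENNReal NNReal Topology

section OneDim

/-- A continuous nonnegative function with negative derivative where it is positive is
nonincreasing. -/
lemma antitone_of_deriv_neg_of_pos {f : ℝ → ℝ} (hc : Continuous f) (h0 : ∀ x, 0 ≤ f x)
    (hd : ∀ x, 0 < f x → deriv f x < 0) : Antitone f := by
  intro e1 e2 h12
  by_contra! hlt
  have hne : e1 ≠ e2 := by rintro rfl; exact lt_irrefl _ hlt
  -- At the first point `c` of `S` the function is positive, so its derivative there is negative and
  -- points just to the left of `c` have larger values. They also lie in `S`, a contradiction.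
  set S := {x ∈ Icc e1 e2 | f e2 ≤ f x}
  have hS : IsCompact S := isCompact_Icc.inter_right (isClosed_le continuous_const hc)
  have hcS : sInf S ∈ S := hS.sInf_mem ⟨e2, ⟨h12, le_rfl⟩, le_rfl⟩
  set c := sInf S
  have hec : e1 < c := by
    refine lt_of_le_of_ne hcS.1.1 fun h => ?_
    have := hcS.2
    rw [← h] at this
    linarith
  have hpos : 0 < f c := (h0 e1).trans_lt (hlt.trans_le hcS.2)
  have hdc := hd c hpos
  have hder : HasDerivAt f (deriv f c) c := (differentiableAt_of_deriv_ne_zero hdc.ne).hasDerivAt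
  have h1 := (hasDerivAt_iff_tendsto_slope.1 hder).eventually (gt_mem_nhds hdc)
  have h2 : ∀ᶠ x in 𝓝[<] c, slope f c x < 0 :=
    h1.filter_mono (nhdsWithin_mono _ fun x hx => (ne_of_lt hx))
  obtain ⟨x, hx1, hx2⟩ := (h2.and (Ioo_mem_nhdsLT hec)).exists
  rw [slope_def_field, div_neg_iff] at hx1
  have hxc : f c < f x := by
    rcases hx1 with h | h
    · linarith [h.1]
    · linarith [h.2, hx2.2]
  have : c ≤ x := csInf_le hS.bddBelow ⟨⟨hx2.1.le, hx2.2.le.trans hcS.1.2⟩, hcS.2.trans hxc.le⟩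
  exact absurd hx2.2 (not_lt.2 this)

/-- For a monotone function the derivative integrates to at most the increment; no absolute
continuity is required. -/
lemma lintegral_abs_deriv_le {f : ℝ → ℝ} (hf : Antitone f) {a b : ℝ} (hab : a ≤ b) :
    ∫⁻ e in Ioc a b, ENNReal.ofReal |deriv f e| ≤ ENNReal.ofReal (f a - f b) := by
  have hm : MonotoneOn (fun x => -f x) (uIcc a b) := fun x _ y _ hxy => neg_le_neg (hf hxy)
  have h1 := hm.intervalIntegrable_deriv
  have h2 := hm.intervalIntegral_deriv_mem_uIcc
  have h3 : ∀ e, deriv (fun x => -f x) e = |deriv f e| := by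
    intro e
    rw [deriv.fun_neg, abs_of_nonpos hf.deriv_nonpos]
  have h3' : (deriv fun x => -f x) = fun e => |deriv f e| := funext h3
  rw [h3'] at h1 h2
  rw [← ofReal_integral_eq_lintegral_ofReal
    ((intervalIntegrable_iff_integrableOn_Ioc_of_le hab).1 h1)
    (Filter.Eventually.of_forall fun _ => abs_nonneg _), ← intervalIntegral.integral_of_le hab]
  refine ENNReal.ofReal_le_ofReal ?_
  have h4 : 0 ≤ -f b - -f a := by linarith [hf hab]
  rw [uIcc_of_le h4] at h2
  linarith [h2.2]

lemma lintegral_comp_half_sq {H : ℝ → ℝ≥0∞} :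
    ∫⁻ u in Ioi (0 : ℝ), H (u ^ 2 / 2) =
      ∫⁻ e in Ioi (0 : ℝ), H e * ENNReal.ofReal (1 / √(2 * e)) := by
  have himg : (fun u : ℝ => u ^ 2 / 2) '' Ioi 0 = Ioi 0 := by
    ext e
    constructor
    · rintro ⟨u, hu, rfl⟩
      have : (0 : ℝ) < u := hu
      exact mem_Ioi.2 (by positivity)
    · intro he
      have he' : (0 : ℝ) < e := he
      refine ⟨√(2 * e), Real.sqrt_pos.2 (by linarith), ?_⟩
      simp only
      rw [Real.sq_sqrt (by linarith)]
      ring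
  have h := lintegral_image_eq_lintegral_abs_deriv_mul (s := Ioi (0 : ℝ))
    (f := fun u : ℝ => u ^ 2 / 2) (f' := fun u => u) measurableSet_Ioi
    (fun x _ => by
      have := ((hasDerivAt_pow 2 x).div_const 2).hasDerivWithinAt (s := Ioi 0)
      refine this.congr_deriv ?_
      simp)
    (fun a ha b hb hab => by
      have ha' : (0 : ℝ) < a := ha
      have hb' : (0 : ℝ) < b := hb
      have : a ^ 2 = b ^ 2 := by simpa using hab
      exact (sq_eq_sq₀ ha'.le hb'.le).1 this) (fun e => H e * ENNReal.ofReal (1 / √(2 * e)))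
  rw [himg] at h
  rw [h]
  refine setLIntegral_congr_fun measurableSet_Ioi fun u hu => ?_
  have hu' : (0 : ℝ) < u := hu
  have e1 : √(2 * (u ^ 2 / 2)) = u := by
    rw [mul_div_cancel₀ _ two_ne_zero, Real.sqrt_sq hu'.le]
  rw [e1, mul_left_comm, ← ENNReal.ofReal_mul (abs_nonneg u), abs_of_pos hu',
    mul_one_div_cancel hu'.ne', ENNReal.ofReal_one, mul_one]

lemma lintegral_of_even {K : ℝ → ℝ≥0∞} (hK : ∀ u, K (-u) = K u) :
    ∫⁻ u, K u = 2 * ∫⁻ u in Ioi (0 : ℝ), K u := by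
  rw [← lintegral_add_compl _ (measurableSet_Ioi (a := (0 : ℝ))), compl_Ioi, two_mul,
    setLIntegral_congr (Iio_ae_eq_Iic (a := (0 : ℝ))).symm]
  congr 1
  have := (Measure.measurePreserving_neg (volume : Measure ℝ)).setLIntegral_comp_preimage_emb
    (Homeomorph.neg ℝ).measurableEmbedding K (Ioi 0)
  simpa [hK] using this

lemma lintegral_Ioi_abs_deriv_le {f : ℝ → ℝ} (hf : Antitone f) (h0 : ∀ x, 0 ≤ f x) (a : ℝ) :
    ∫⁻ e in Ioi a, ENNReal.ofReal |deriv f e| ≤ ENNReal.ofReal (f a) := by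
  have hU : Ioi a = ⋃ n : ℕ, Ioc a (a + n) := by
    ext x
    simp only [mem_Ioi, mem_iUnion, mem_Ioc, exists_and_left, iff_self_and]
    intro _
    obtain ⟨n, hn⟩ := exists_nat_ge (x - a)
    exact ⟨n, by linarith⟩
  rw [hU, setLIntegral_iUnion_of_directed _ (Monotone.directed_le fun m n hmn =>
    Ioc_subset_Ioc_right (by have : (m : ℝ) ≤ n := Nat.cast_le.2 hmn
                             linarith))]
  refine iSup_le fun n => (lintegral_abs_deriv_le hf (by linarith [n.cast_nonneg (α := ℝ)])).trans ?_
  exact ENNReal.ofReal_le_ofReal (by linarith [h0 (a + n)])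

/-- Integration by parts for nonincreasing functions. -/
lemma lintegral_mul_abs_deriv_le {f : ℝ → ℝ} (hf : Antitone f) (h0 : ∀ x, 0 ≤ f x) :
    ∫⁻ u in Ioi (0 : ℝ), ENNReal.ofReal u * ENNReal.ofReal |deriv f u| ≤
      ∫⁻ s in Ioi (0 : ℝ), ENNReal.ofReal (f s) := by
  have hd := measurable_deriv f
  have hm : Measurable fun p : ℝ × ℝ =>
      (Iio p.1).indicator (fun _ => ENNReal.ofReal |deriv f p.1|) p.2 := by
    have : (fun p : ℝ × ℝ => (Iio p.1).indicator (fun _ => ENNReal.ofReal |deriv f p.1|) p.2) =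
        {p : ℝ × ℝ | p.2 < p.1}.indicator fun p => ENNReal.ofReal |deriv f p.1| := by
      funext p
      simp only [indicator, mem_Iio, mem_ofPred_eq]
    rw [this]
    exact (by fun_prop : Measurable fun p : ℝ × ℝ => ENNReal.ofReal |deriv f p.1|).indicator
      (measurableSet_lt measurable_snd measurable_fst)
  -- The factor `u` is written as the length of `{s : 0 < s < u}`, and Tonelli exchanges the order
  -- of integration.
  have e1 : ∀ u ∈ Ioi (0 : ℝ), ENNReal.ofReal u * ENNReal.ofReal |deriv f u| =
      ∫⁻ s in Ioi (0 : ℝ), (Iio u).indicator (fun _ => ENNReal.ofReal |deriv f u|) s := by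
    intro u hu
    rw [lintegral_indicator measurableSet_Iio, setLIntegral_const, Measure.restrict_apply
      measurableSet_Iio, inter_comm, Ioi_inter_Iio, Real.volume_Ioo, sub_zero, mul_comm]
  rw [setLIntegral_congr_fun measurableSet_Ioi e1, lintegral_lintegral_swap
    (f := fun u s => (Iio u).indicator (fun _ => ENNReal.ofReal |deriv f u|) s) hm.aemeasurable]
  refine setLIntegral_mono' measurableSet_Ioi fun s hs => ?_
  refine le_trans ?_ (lintegral_Ioi_abs_deriv_le hf h0 s)
  rw [← lintegral_indicator measurableSet_Ioi, ← lintegral_indicator measurableSet_Ioi]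
  refine lintegral_mono fun u => ?_
  by_cases hu : s < u
  · rw [indicator_of_mem (mem_Ioi.2 hu)]
    refine (indicator_le_self _ _ _).trans ?_
    exact indicator_le_self _ _ _
  · have : (Ioi (0:ℝ)).indicator (fun u => (Iio u).indicator
        (fun _ => ENNReal.ofReal |deriv f u|) s) u = 0 := by
      simp only [indicator, mem_Iio, hu, if_false, ite_self]
    rw [this]
    exact zero_le

lemma lintegral_comp_half_sq_add (G : ℝ → ℝ≥0∞) (c : ℝ) :
    ∫⁻ u, G (u ^ 2 / 2 + c) =
      2 * ∫⁻ e in Ioi c, G e * ENNReal.ofReal (1 / √(2 * (e - c))) := by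
  rw [lintegral_of_even (K := fun u => G (u ^ 2 / 2 + c)) (fun u => by rw [neg_sq]),
    lintegral_comp_half_sq (H := fun e => G (e + c))]
  congr 1
  rw [← lintegral_indicator measurableSet_Ioi, ← lintegral_indicator measurableSet_Ioi,
    ← lintegral_add_right_eq_self
      ((Ioi c).indicator fun e => G e * ENNReal.ofReal (1 / √(2 * (e - c)))) c]
  refine lintegral_congr fun e => ?_
  by_cases he : 0 < e
  · rw [indicator_of_mem (mem_Ioi.2 he), indicator_of_mem (by simpa using he)]
    simp
  · rw [indicator_of_notMem (by simpa using he), indicator_of_notMem (by simpa using he)]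

/-- The primitive is an arcsine, whose range has length `π` whatever the interval. -/
lemma lintegral_inv_sqrt_mul_le {a b : ℝ} (hab : a < b) :
    ∫⁻ s in Ioo a b, ENNReal.ofReal (1 / √((s - a) * (b - s))) ≤ ENNReal.ofReal Real.pi := by
  have hba : 0 < b - a := by linarith
  have hderiv : ∀ s ∈ Ioo a b, HasDerivAt (fun s => Real.arcsin ((2 * s - a - b) / (b - a)))
      (1 / √((s - a) * (b - s))) s := by
    intro s hs
    have hs1 : 0 < s - a := by linarith [hs.1]
    have hs2 : 0 < b - s := by linarith [hs.2]
    have h1 : HasDerivAt (fun s => (2 * s - a - b) / (b - a)) (2 / (b - a)) s := by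
      simpa using ((((hasDerivAt_id s).const_mul 2).sub_const a).sub_const b).div_const (b - a)
    have h2 : (2 * s - a - b) / (b - a) ≠ -1 := by
      rw [ne_eq, div_eq_iff hba.ne']
      intro h
      linarith
    have h3 : (2 * s - a - b) / (b - a) ≠ 1 := by
      rw [ne_eq, div_eq_iff hba.ne']
      intro h
      linarith
    refine ((Real.hasDerivAt_arcsin h2 h3).comp s h1).congr_deriv ?_
    have h4 : 1 - ((2 * s - a - b) / (b - a)) ^ 2 = ((s - a) * (b - s)) * (2 / (b - a)) ^ 2 := by
      field_simp
      ring
    rw [h4, Real.sqrt_mul (by positivity), Real.sqrt_sq (by positivity)]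
    have : 0 < √((s - a) * (b - s)) := Real.sqrt_pos.2 (by positivity)
    field_simp
  have hcont : ContinuousOn (fun s => Real.arcsin ((2 * s - a - b) / (b - a))) (Icc a b) :=
    (Real.continuous_arcsin.comp (by fun_prop)).continuousOn
  have hint := intervalIntegral.integrableOn_deriv_of_nonneg hcont hderiv
    (fun s _ => by positivity)
  have hFTC := intervalIntegral.integral_eq_sub_of_hasDerivAt_of_le hab.le hcont hderiv
    ((intervalIntegrable_iff_integrableOn_Ioc_of_le hab.le).2 hint)
  rw [← ofReal_integral_eq_lintegral_ofReal (hint.mono_set Ioo_subset_Ioc_self)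
    (Filter.Eventually.of_forall fun u => by positivity), ← integral_Ioc_eq_integral_Ioo,
    ← intervalIntegral.integral_of_le hab.le, hFTC]
  refine ENNReal.ofReal_le_ofReal ?_
  have h1 := Real.arcsin_le_pi_div_two ((2 * b - a - b) / (b - a))
  have h2 := Real.neg_pi_div_two_le_arcsin ((2 * a - a - b) / (b - a))
  linarith

/-- Period bound for a strongly concave function. -/
lemma lintegral_inv_sqrt_le_of_strongConcave {I : Set ℝ} {k : ℝ → ℝ} {l : ℝ} (hl : 0 < l)
    (hI : MeasurableSet I)
    (hk : ∀ x ∈ I, ∀ y ∈ I, ∀ s ∈ I, x < s → s < y → l / 2 * ((s - x) * (y - s)) ≤ k s) :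
    ∫⁻ s in I, ENNReal.ofReal (1 / √(2 * k s)) ≤ ENNReal.ofReal (Real.pi / √l) := by
  rcases I.subsingleton_or_nontrivial with hs | hs
  · rw [Measure.restrict_eq_zero.2 (hs.measure_zero _)]
    simp
  obtain ⟨p, hp, q, hq, hpq⟩ := hs.exists_lt
  -- If `I` were unbounded, fixing `p < q` in `I` and sending the right end `y` to infinity would
  -- make the lower bound at `q` exceed the number `k q`.
  have hA : BddAbove I := by
    by_contra hb
    rw [not_bddAbove_iff] at hb
    obtain ⟨y, hy, hy2⟩ := hb (max q (q + 2 * (|k q| + 1) / (l * (q - p))))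
    have h1 := hk p hp y hy q hq hpq ((le_max_left _ _).trans_lt hy2)
    have h2 := (le_max_right _ _).trans_lt hy2
    have h3 : 0 < l * (q - p) := mul_pos hl (by linarith)
    have h4 : 2 * (|k q| + 1) / (l * (q - p)) < y - q := by linarith
    rw [div_lt_iff₀ h3] at h4
    nlinarith [le_abs_self (k q)]
  have hB : BddBelow I := by
    by_contra hb
    rw [not_bddBelow_iff] at hb
    obtain ⟨x, hx, hx2⟩ := hb (min p (p - 2 * (|k p| + 1) / (l * (q - p))))
    have h1 := hk x hx q hq p hp (hx2.trans_le (min_le_left _ _)) hpq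
    have h2 := hx2.trans_le (min_le_right _ _)
    have h3 : 0 < l * (q - p) := mul_pos hl (by linarith)
    have h4 : 2 * (|k p| + 1) / (l * (q - p)) < p - x := by linarith
    rw [div_lt_iff₀ h3] at h4
    nlinarith [le_abs_self (k p)]
  set a := sInf I
  set b := sSup I
  have hab : a < b := (csInf_le hB hp).trans_lt (hpq.trans_le (le_csSup hA hq))
  have hne : I.Nonempty := ⟨p, hp⟩
  have hIcc : I ⊆ Icc a b := fun s hs => ⟨csInf_le hB hs, le_csSup hA hs⟩
  -- The hypothesis compares with points of `I` only; the end points `a` and `b` are reached along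
  -- sequences in `I`.
  have hkey : ∀ s ∈ I, a < s → s < b → l / 2 * ((s - a) * (b - s)) ≤ k s := by
    intro s hs h1 h2
    obtain ⟨u, -, hu1, hu2⟩ := exists_seq_tendsto_sInf hne hB
    obtain ⟨w, -, hw1, hw2⟩ := exists_seq_tendsto_sSup hne hA
    have hlim : Filter.Tendsto (fun n => l / 2 * ((s - u n) * (w n - s))) Filter.atTop
        (𝓝 (l / 2 * ((s - a) * (b - s)))) :=
      (((tendsto_const_nhds.sub hu1).mul (hw1.sub tendsto_const_nhds)).const_mul _)
    refine le_of_tendsto hlim ?_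
    filter_upwards [hu1.eventually (gt_mem_nhds h1), hw1.eventually (lt_mem_nhds h2)] with n hn1 hn2
    exact hk _ (hu2 n) _ (hw2 n) s hs hn1 hn2
  calc ∫⁻ s in I, ENNReal.ofReal (1 / √(2 * k s))
      ≤ ∫⁻ s in I ∩ Ioo a b, ENNReal.ofReal (1 / √(2 * k s)) := by
        have hz : volume ({a, b} : Set ℝ) = 0 := (Set.toFinite _).measure_zero _
        have hsub : I ⊆ (I ∩ Ioo a b) ∪ {a, b} := by
          intro s hs
          have := hIcc hs
          rcases this.1.eq_or_lt with h | h
          · exact Or.inr (Or.inl h.symm)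
          · rcases this.2.eq_or_lt with h' | h'
            · exact Or.inr (Or.inr h')
            · exact Or.inl ⟨hs, h, h'⟩
        refine (lintegral_mono_set hsub).trans ((lintegral_union_le _ _ _).trans ?_)
        rw [Measure.restrict_eq_zero.2 hz]
        simp
    _ ≤ ∫⁻ s in Ioo a b, ENNReal.ofReal (1 / √l) * ENNReal.ofReal (1 / √((s - a) * (b - s))) := by
        refine (setLIntegral_mono' (hI.inter measurableSet_Ioo) fun s hs => ?_).trans
          (lintegral_mono_set inter_subset_right)
        have h1 : 0 < s - a := by linarith [hs.2.1]
        have h2 : 0 < b - s := by linarith [hs.2.2]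
        have h3 := hkey s hs.1 hs.2.1 hs.2.2
        rw [← ENNReal.ofReal_mul (by positivity)]
        refine ENNReal.ofReal_le_ofReal ?_
        rw [one_div_mul_one_div, ← Real.sqrt_mul hl.le]
        refine one_div_le_one_div_of_le (Real.sqrt_pos.2 (by positivity)) ?_
        exact Real.sqrt_le_sqrt (by linarith)
    _ = ENNReal.ofReal (1 / √l) * ∫⁻ s in Ioo a b, ENNReal.ofReal (1 / √((s - a) * (b - s))) :=
        lintegral_const_mul _ (by fun_prop)
    _ ≤ ENNReal.ofReal (1 / √l) * ENNReal.ofReal Real.pi := by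
        gcongr
        exact lintegral_inv_sqrt_mul_le hab
    _ = ENNReal.ofReal (Real.pi / √l) := by
        rw [← ENNReal.ofReal_mul (by positivity)]
        congr 1
        ring

/-- In the plane of `u` and `s`, the level sets of `u ^ 2 / 2 + ψ s` with `ψ` strongly convex carry
an area of at most `C / √l` per unit of energy. -/
lemma lintegral_energy_le {ψ : ℝ → ℝ} {l : ℝ} (hl : 0 < l) (hψ : Measurable ψ)
    (hconv : ConvexOn ℝ (Ioi 0) fun s => ψ s - l * s ^ 2 / 2) {G : ℝ → ℝ≥0∞} (hG : Measurable G) :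
    ∫⁻ s in Ioi (0 : ℝ), ∫⁻ u, G (u ^ 2 / 2 + ψ s) ≤
      2 * ENNReal.ofReal (Real.pi / √l) * ∫⁻ e, G e := by
  have hm : Measurable fun p : ℝ × ℝ =>
      {q : ℝ × ℝ | ψ q.1 < q.2}.indicator (fun q => G q.2 * ENNReal.ofReal (1 / √(2 * (q.2 - ψ q.1)))) p := by
    refine Measurable.indicator (by fun_prop) (measurableSet_lt (by fun_prop) (by fun_prop))
  have h1 : ∀ s, ∫⁻ u, G (u ^ 2 / 2 + ψ s) = 2 * ∫⁻ e, {q : ℝ × ℝ | ψ q.1 < q.2}.indicator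
      (fun q => G q.2 * ENNReal.ofReal (1 / √(2 * (q.2 - ψ q.1)))) (s, e) := by
    intro s
    rw [lintegral_comp_half_sq_add, ← lintegral_indicator measurableSet_Ioi]
    rfl
  simp only [h1]
  rw [lintegral_const_mul _ (hm.lintegral_prod_right'), lintegral_lintegral_swap hm.aemeasurable,
    mul_assoc, ← lintegral_const_mul _ hG]
  gcongr with e
  have hI : MeasurableSet (Ioi (0 : ℝ) ∩ {s | ψ s < e}) :=
    measurableSet_Ioi.inter (measurableSet_lt hψ measurable_const)
  have h2 : ∫⁻ s in Ioi (0 : ℝ), {q : ℝ × ℝ | ψ q.1 < q.2}.indicator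
      (fun q => G q.2 * ENNReal.ofReal (1 / √(2 * (q.2 - ψ q.1)))) (s, e) =
      G e * ∫⁻ s in Ioi (0 : ℝ) ∩ {s | ψ s < e}, ENNReal.ofReal (1 / √(2 * (e - ψ s))) := by
    rw [← lintegral_const_mul _ (by fun_prop), ← lintegral_indicator measurableSet_Ioi,
      ← lintegral_indicator hI]
    refine lintegral_congr fun s => ?_
    rw [← indicator_indicator]
    rfl
  rw [h2, mul_comm]
  gcongr
  -- On the sublevel set `I` of `ψ`, the function `k = e - ψ` is positive and strongly concave with
  -- modulus `l`. Hence it dominates the parabola `(l/2)(s - x)(y - s)` between any two points `x <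
  -- y` of `I`.
  refine lintegral_inv_sqrt_le_of_strongConcave hl hI fun x hx y hy s hs hxs hsy => ?_
  have hxy : 0 < y - x := by linarith
  have h3 := hconv.2 hx.1 hy.1
    (show 0 ≤ (y - s) / (y - x) from div_nonneg (by linarith) hxy.le)
    (show 0 ≤ (s - x) / (y - x) from div_nonneg (by linarith) hxy.le) (by field_simp; ring)
  have h4 : ((y - s) / (y - x)) • x + ((s - x) / (y - x)) • y = s := by
    simp only [smul_eq_mul]
    field_simp
    ring
  rw [h4] at h3
  simp only [smul_eq_mul] at h3
  have hx2 : ψ x < e := hx.2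
  have hy2 : ψ y < e := hy.2
  have h5 : (y - s) / (y - x) * (ψ x - l * x ^ 2 / 2) + (s - x) / (y - x) * (ψ y - l * y ^ 2 / 2) ≤
      (y - s) / (y - x) * (e - l * x ^ 2 / 2) + (s - x) / (y - x) * (e - l * y ^ 2 / 2) := by
    have : 0 ≤ (y - s) / (y - x) := div_nonneg (by linarith) hxy.le
    have : 0 ≤ (s - x) / (y - x) := div_nonneg (by linarith) hxy.le
    gcongr
  have h6 : (y - s) / (y - x) * (e - l * x ^ 2 / 2) + (s - x) / (y - x) * (e - l * y ^ 2 / 2) =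
      e - l * s ^ 2 / 2 - l / 2 * ((s - x) * (y - s)) := by
    field_simp
    ring
  linarith

lemma lintegral_comp_mul_left_Ioi {c : ℝ} (hc : 0 < c) (k : ℝ → ℝ≥0∞) :
    ∫⁻ p in Ioi (0 : ℝ), k (c * p) = ENNReal.ofReal (1 / c) * ∫⁻ l in Ioi (0 : ℝ), k l := by
  have himg : (fun p : ℝ => c * p) '' Ioi 0 = Ioi 0 := by
    rw [Set.image_mul_left_Ioi hc, mul_zero]
  have h := lintegral_image_eq_lintegral_abs_deriv_mul (s := Ioi (0 : ℝ))
    (f := fun p : ℝ => c * p) (f' := fun _ => c) measurableSet_Ioi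
    (fun x _ => by simpa using ((hasDerivAt_id x).const_mul c).hasDerivWithinAt)
    ((mul_right_injective₀ hc.ne').injOn) k
  rw [himg] at h
  rw [h, lintegral_const_mul' _ _ ENNReal.ofReal_ne_top, ← mul_assoc, abs_of_pos hc,
    ← ENNReal.ofReal_mul (by positivity), one_div_mul_cancel hc.ne', ENNReal.ofReal_one, one_mul]

lemma lintegral_comp_inv_Ioi (k : ℝ → ℝ≥0∞) :
    ∫⁻ r in Ioi (0 : ℝ), ENNReal.ofReal (1 / r ^ 2) * k r⁻¹ = ∫⁻ s in Ioi (0 : ℝ), k s := by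
  have himg : (fun r : ℝ => r⁻¹) '' Ioi 0 = Ioi 0 := by
    ext s
    constructor
    · rintro ⟨r, hr, rfl⟩
      exact inv_pos.2 (mem_Ioi.1 hr)
    · intro hs
      exact ⟨s⁻¹, inv_pos.2 (mem_Ioi.1 hs), inv_inv s⟩
  have h := lintegral_image_eq_lintegral_abs_deriv_mul (s := Ioi (0 : ℝ))
    (f := fun r : ℝ => r⁻¹) (f' := fun r => -(r ^ 2)⁻¹) measurableSet_Ioi
    (fun x hx => (hasDerivAt_inv (ne_of_gt (mem_Ioi.1 hx))).hasDerivWithinAt)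
    (inv_injective.injOn) k
  rw [himg] at h
  rw [h]
  refine setLIntegral_congr_fun measurableSet_Ioi fun r _ => ?_
  rw [abs_neg, abs_of_nonneg (by positivity), one_div]

lemma lintegral_inv_sqrt_lt_top (L : ℝ) :
    ∫⁻ l in Ioo 0 L, ENNReal.ofReal (1 / √l) < ⊤ := by
  have hint := intervalIntegral.integrableOn_deriv_of_nonneg (a := 0) (b := L)
    (g := fun l => 2 * √l) (g' := fun l => 1 / √l) (by fun_prop) (fun l hl => by
      refine ((Real.hasDerivAt_sqrt hl.1.ne').const_mul 2).congr_deriv ?_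
      have := Real.sqrt_pos.2 hl.1
      field_simp) (fun l _ => by positivity)
  rw [← ofReal_integral_eq_lintegral_ofReal (hint.mono_set Ioo_subset_Ioc_self)
    (Filter.Eventually.of_forall fun u => by positivity)]
  exact ENNReal.ofReal_lt_top

end OneDim

namespace IsAdmissible

variable {Q : Phase → ℝ} {F : ℝ → ℝ → ℝ} {e₀ : ℝ} (h : IsAdmissible Q F e₀)
include h

lemma continuous_profile {l : ℝ} (hl : 0 ≤ l) : Continuous fun e => F e l :=
  h.profile_continuous.comp_continuous (f := fun e : ℝ => (e, l)) (by fun_prop)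
    fun _ => ⟨mem_univ _, hl⟩

lemma antitone_profile {l : ℝ} (hl : 0 ≤ l) : Antitone fun e => F e l :=
  antitone_of_deriv_neg_of_pos (h.continuous_profile hl) (fun e => h.profile_nonneg e l hl)
    fun e he => h.profile_deriv_neg (e, l) ⟨hl, he⟩

lemma potential_eq {x : E3} (hx : x ≠ 0) :
    potential Q x = -(1 / (4 * Real.pi)) * ∫ y : E3, density Q y / max ‖x‖ ‖y‖ := by
  obtain ⟨R, hR, hR2⟩ := h.exists_profile
  exact newton_eq hR.measurable hR2 h.density_integrable hx

/-- The potential of the steady state as a function of the radius. -/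
def radialPotential (_ : IsAdmissible Q F e₀) (r : ℝ) : ℝ :=
  -(1 / (4 * Real.pi)) * ∫ y : E3, density Q y / max r ‖y‖

lemma potential_eq_radial {x : E3} (hx : x ≠ 0) : potential Q x = h.radialPotential ‖x‖ :=
  h.potential_eq hx

lemma measurable_radialPotential : Measurable h.radialPotential := by
  have h2 : StronglyMeasurable (fun p : ℝ × E3 => density Q p.2 / max p.1 ‖p.2‖) := by
    have := h.density_continuous.measurable
    exact Measurable.stronglyMeasurable (by fun_prop)
  exact h2.integral_prod_right'.measurable.const_mul _

lemma hasDerivAt_radialPotential {r : ℝ} (hr : 0 < r) :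
    HasDerivAt h.radialPotential (h.mean r * r) r := by
  refine ((hasDerivAt_integral_div_max h.density_integrable hr).const_mul
    (-(1 / (4 * Real.pi)))).congr_deriv ?_
  simp only [mean, meanField]
  field_simp

lemma mean_nonneg {r : ℝ} (hr : 0 ≤ r) : 0 ≤ h.mean r := meanField_nonneg h.density_nonneg hr

lemma exists_mean_bound : ∃ C, 0 ≤ C ∧ ∀ r, 0 ≤ r → h.mean r ≤ C := by
  obtain ⟨C, hC⟩ := h.exists_density_bound
  have hC0 : 0 ≤ C := (h.density_nonneg 0).trans (hC 0)
  exact ⟨C / 3, by positivity, fun r hr => meanField_le hC0 hC h.density_integrable hr⟩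

/-- The potential is nondecreasing in `r`, and its slope `m(r) r` is bounded on `(0, 1]`, so it
falls by a bounded amount between `r = 1` and the origin. -/
lemma exists_potential_lower_bound : ∃ B, ∀ x : E3, x ≠ 0 → -B < potential Q x := by
  obtain ⟨C, hC0, hC⟩ := h.exists_mean_bound
  refine ⟨-h.radialPotential 1 + C + 1, fun x hx => ?_⟩
  rw [h.potential_eq_radial hx]
  have hr : 0 < ‖x‖ := norm_pos_iff.2 hx
  rcases le_total 1 ‖x‖ with h1 | h1
  · have hm : MonotoneOn h.radialPotential (Ioi 0) := by
      refine monotoneOn_of_deriv_nonneg (convex_Ioi 0)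
        (fun r hr => (h.hasDerivAt_radialPotential hr).continuousAt.continuousWithinAt) ?_ ?_
      · rw [interior_Ioi]
        exact fun r hr => (h.hasDerivAt_radialPotential hr).differentiableAt.differentiableWithinAt
      · rw [interior_Ioi]
        intro r hr
        have hr' : (0 : ℝ) < r := hr
        rw [(h.hasDerivAt_radialPotential hr).deriv]
        exact mul_nonneg (h.mean_nonneg hr'.le) hr'.le
    have := hm (mem_Ioi.2 one_pos) (mem_Ioi.2 hr) h1
    linarith
  · have := (convex_Icc ‖x‖ 1).norm_image_sub_le_of_norm_hasDerivWithin_le (f := h.radialPotential)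
      (f' := fun r => h.mean r * r) (C := C)
      (fun r hr' => (h.hasDerivAt_radialPotential (hr.trans_le hr'.1)).hasDerivWithinAt)
      (fun r hr' => by
        have h0 : 0 ≤ r := hr.le.trans hr'.1
        rw [Real.norm_of_nonneg (mul_nonneg (h.mean_nonneg h0) h0)]
        calc h.mean r * r ≤ C * 1 := mul_le_mul (hC r h0) hr'.2 h0 hC0
          _ = C := mul_one C) (left_mem_Icc.2 h1) (right_mem_Icc.2 h1)
    rw [Real.norm_eq_abs, Real.norm_of_nonneg (by linarith)] at this
    have h2 := (abs_le.1 this).2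
    nlinarith

/-- In the variable `s = 1/r` a shell of radius `‖w‖` has kernel `1 / max (1/s) ‖w‖ = min s
(1/‖w‖)`, which is concave; the potential is a superposition of these with nonpositive weights.
Adding the centrifugal term `ℓ s² / 2` gives strong convexity with modulus `ℓ`. -/
lemma convexOn_radialPotential_inv : ConvexOn ℝ (Ioi 0) fun s => h.radialPotential s⁻¹ := by
  have hi : ∀ s : ℝ, 0 < s → Integrable fun y => density Q y / max s⁻¹ ‖y‖ :=
    fun s hs => integrable_div_max h.density_integrable (inv_pos.2 hs)
  refine ⟨convex_Ioi 0, fun x hx y hy a b ha hb hab => ?_⟩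
  have hx' : 0 < x := hx
  have hy' : 0 < y := hy
  have hs : 0 < a • x + b • y := (convex_Ioi (0 : ℝ)) hx hy ha hb hab
  simp only [radialPotential]
  have key : a * (∫ w, density Q w / max x⁻¹ ‖w‖) + b * (∫ w, density Q w / max y⁻¹ ‖w‖) ≤
      ∫ w, density Q w / max (a • x + b • y)⁻¹ ‖w‖ := by
    rw [← integral_const_mul, ← integral_const_mul, ← integral_add ((hi x hx').const_mul a)
      ((hi y hy').const_mul b)]
    refine integral_mono (((hi x hx').const_mul a).add ((hi y hy').const_mul b)) (hi _ hs)
      fun w => ?_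
    have e1 : ∀ s : ℝ, 0 < s → 1 / max s⁻¹ ‖w‖ ≤ s := by
      intro s hs
      rw [div_le_iff₀ (lt_max_of_lt_left (inv_pos.2 hs))]
      calc 1 = s * s⁻¹ := (mul_inv_cancel₀ hs.ne').symm
        _ ≤ s * max s⁻¹ ‖w‖ := by gcongr; exact le_max_left _ _
    have e2 : a * (1 / max x⁻¹ ‖w‖) + b * (1 / max y⁻¹ ‖w‖) ≤
        1 / max (a • x + b • y)⁻¹ ‖w‖ := by
      rcases le_total ‖w‖ (a • x + b • y)⁻¹ with hw | hw
      · rw [max_eq_left hw, one_div (a • x + b • y)⁻¹, inv_inv, smul_eq_mul, smul_eq_mul]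
        exact add_le_add (mul_le_mul_of_nonneg_left (e1 x hx') ha)
          (mul_le_mul_of_nonneg_left (e1 y hy') hb)
      · have hw0 : 0 < ‖w‖ := (inv_pos.2 hs).trans_le hw
        rw [max_eq_right hw]
        have e3 : ∀ s : ℝ, 1 / max s ‖w‖ ≤ 1 / ‖w‖ := fun s =>
          one_div_le_one_div_of_le hw0 (le_max_right _ _)
        calc _ ≤ a * (1 / ‖w‖) + b * (1 / ‖w‖) := add_le_add
              (mul_le_mul_of_nonneg_left (e3 _) ha) (mul_le_mul_of_nonneg_left (e3 _) hb)
          _ = 1 / ‖w‖ := by rw [← add_mul, hab, one_mul]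
    have := mul_le_mul_of_nonneg_left e2 (h.density_nonneg w)
    simp only [div_eq_mul_inv, one_mul] at this ⊢
    linarith
  have hpi : 0 ≤ 1 / (4 * Real.pi) := by positivity
  have := mul_le_mul_of_nonneg_left key hpi
  simp only [smul_eq_mul] at this ⊢
  linarith

/-- The density of `|∂F / ∂e|` in the coordinates `(e, ℓ)`, cut off to a bounded region. -/
def slopeDensity (_ : IsAdmissible Q F e₀) (B L : ℝ) : ℝ × ℝ → ℝ≥0∞ :=
  {p : ℝ × ℝ | -B < p.1 ∧ |p.2| < L ∧ 0 < F p.1 |p.2|}.indicator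
    fun p => ENNReal.ofReal |deriv (fun e => F e |p.2|) p.1|

lemma continuous_profile_abs : Continuous fun p : ℝ × ℝ => F p.1 |p.2| :=
  h.profile_continuous.comp_continuous (f := fun p : ℝ × ℝ => (p.1, |p.2|)) (by fun_prop)
    fun p => ⟨mem_univ _, abs_nonneg p.2⟩

lemma measurable_slopeDensity (B L : ℝ) : Measurable (h.slopeDensity B L) := by
  have hc : Continuous (Function.uncurry fun l e : ℝ => F e |l|) :=
    h.continuous_profile_abs.comp (by fun_prop : Continuous fun p : ℝ × ℝ => (p.2, p.1))
  have hd := (measurable_deriv_with_param hc).comp measurable_swap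
  refine Measurable.indicator ?_ ?_
  · exact ENNReal.measurable_ofReal.comp (measurable_norm.comp hd)
  · have m1 : MeasurableSet {p : ℝ × ℝ | -B < p.1} := measurableSet_lt (by fun_prop) (by fun_prop)
    have m2 : MeasurableSet {p : ℝ × ℝ | |p.2| < L} := measurableSet_lt (by fun_prop) (by fun_prop)
    have m3 : MeasurableSet {p : ℝ × ℝ | 0 < F p.1 |p.2|} :=
      measurableSet_lt (by fun_prop) h.continuous_profile_abs.measurable
    exact m1.inter (m2.inter m3)

/-- At fixed `ℓ` the profile is nonincreasing in `e`, so the integral is at most `F(-B, ℓ)`, which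
is bounded for `ℓ` in a compact interval. -/
lemma exists_slopeDensity_bound (B L : ℝ) :
    ∃ C : ℝ, ∀ l, 0 ≤ l → ∫⁻ e, h.slopeDensity B L (e, l) ≤ ENNReal.ofReal C := by
  obtain ⟨C, hC⟩ := ((isCompact_Icc (a := (0 : ℝ)) (b := L)).bddAbove_image
    ((h.continuous_profile_abs.comp (by fun_prop : Continuous fun l : ℝ => (-B, l))).continuousOn))
  refine ⟨C, fun l hl => ?_⟩
  by_cases hL : l < L
  · have h1 : ∀ e, h.slopeDensity B L (e, l) ≤
        (Ioc (-B) (max (-B) e₀)).indicator (fun e => ENNReal.ofReal |deriv (fun e => F e l) e|) e := by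
      intro e
      by_cases he : -B < e ∧ |l| < L ∧ 0 < F e |l|
      · have h2 := he.2.2
        rw [abs_of_nonneg hl] at h2
        have h3 : e < e₀ := h.posSet_subset (e, l) ⟨hl, h2⟩
        rw [indicator_of_mem (mem_Ioc.2 ⟨he.1, h3.le.trans (le_max_right _ _)⟩)]
        rw [slopeDensity, indicator_of_mem (by exact he)]
        simp only [abs_of_nonneg hl, le_refl]
      · rw [slopeDensity, indicator_of_notMem (by exact he)]
        exact zero_le
    refine (lintegral_mono h1).trans ?_
    rw [lintegral_indicator measurableSet_Ioc]
    refine (lintegral_abs_deriv_le (h.antitone_profile hl) (le_max_left _ _)).trans ?_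
    refine ENNReal.ofReal_le_ofReal ?_
    have h2 := h.profile_nonneg (max (-B) e₀) l hl
    have h3 : F (-B) |l| ≤ C := hC (mem_image_of_mem _ ⟨hl, hL.le⟩)
    rw [abs_of_nonneg hl] at h3
    linarith
  · have : ∀ e, h.slopeDensity B L (e, l) = 0 := by
      intro e
      rw [slopeDensity, indicator_of_notMem]
      intro hp
      have := hp.2.1
      simp only [abs_of_nonneg hl] at this
      exact hL this
    simp [this]

/-- The function `|∂F / ∂e|` is integrable on `Ω`, even with the singular weight `1 / |x| ^ 2`. -/
lemma lintegral_dF_div_lt_top :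
    ∫⁻ z in Omega Q, ENNReal.ofReal (|dF Q F z| / ‖z.1‖ ^ 2) < ⊤ := by
  obtain ⟨B, hB⟩ := h.exists_potential_lower_bound
  -- On `Ω` one has `ℓ ≤ |x|² |v|²`, and both factors are below `h.radius ^ 2`.
  set L : ℝ := h.radius ^ 4
  set g := h.slopeDensity B L
  have hg : Measurable g := h.measurable_slopeDensity B L
  have hP := h.measurable_radialPotential
  obtain ⟨C, hC⟩ := h.exists_slopeDensity_bound B L
  set J : ℝ → ℝ≥0∞ := fun r => ENNReal.ofReal Real.pi * ∫⁻ p in Ioi (0 : ℝ), ∫⁻ u,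
    g (u ^ 2 / 2 + (p / 2 + h.radialPotential r), r ^ 2 * p) with hJdef
  have hJ : Measurable J := by
    refine Measurable.const_mul ?_ _
    have : Measurable fun q : (ℝ × ℝ) × ℝ =>
        g (q.2 ^ 2 / 2 + (q.1.2 / 2 + h.radialPotential q.1.1), q.1.1 ^ 2 * q.1.2) := by fun_prop
    exact (this.lintegral_prod_right' (ν := volume)).lintegral_prod_right'
  -- In cylindrical velocity coordinates around `x`, with `u` the radial velocity and `p` the
  -- squared tangential speed, `e = u²/2 + p/2 + φ_Q` and `ℓ = r² p`.
  have step1 : ∫⁻ z in Omega Q, ENNReal.ofReal (|dF Q F z| / ‖z.1‖ ^ 2) ≤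
      ∫⁻ x : E3, ENNReal.ofReal (1 / ‖x‖ ^ 2) * J ‖x‖ := by
    rw [← lintegral_indicator h.measurableSet_Omega, Measure.volume_eq_prod, lintegral_prod _ (by
      refine (Measurable.indicator ?_ h.measurableSet_Omega).aemeasurable
      have := h.measurable_dF
      fun_prop)]
    refine lintegral_mono_ae ?_
    filter_upwards [ae_fst_ne_zero] with x hx
    have hr : 0 < ‖x‖ := norm_pos_iff.2 hx
    set e : E3 := ‖x‖⁻¹ • x
    have he : ‖e‖ = 1 := by
      rw [norm_smul, norm_inv, norm_norm]
      exact inv_mul_cancel₀ hr.ne'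
    have hcyl := lintegral_cylindrical he
      (G := fun q => g (q.1 ^ 2 / 2 + (q.2 / 2 + h.radialPotential ‖x‖), ‖x‖ ^ 2 * q.2))
      (by fun_prop)
    simp only [hJdef]
    rw [← hcyl, ← lintegral_const_mul _ (by fun_prop)]
    refine lintegral_mono fun v => ?_
    by_cases hv : ((x, v) : Phase) ∈ Omega Q
    · have e1 : (⟪e, v⟫ : ℝ) ^ 2 / 2 + ((‖v‖ ^ 2 - ⟪e, v⟫ ^ 2) / 2 + h.radialPotential ‖x‖) =
          energy (potential Q) (x, v) := by
        rw [energy, h.potential_eq_radial hx]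
        ring
      have e2 : ‖x‖ ^ 2 * (‖v‖ ^ 2 - ⟪e, v⟫ ^ 2) = angMom (x, v) := by
        rw [angMom_eq]
        simp only [e, real_inner_smul_left]
        field_simp
      rw [e1, e2, indicator_of_mem hv]
      have hQ : 0 < Q (x, v) := hv
      rw [h.eq_profile] at hQ
      have hmem : (energy (potential Q) (x, v), angMom (x, v)) ∈
          {p : ℝ × ℝ | -B < p.1 ∧ |p.2| < L ∧ 0 < F p.1 |p.2|} := by
        refine ⟨?_, ?_, ?_⟩
        · have := hB x hx
          simp only [energy]
          nlinarith [sq_nonneg ‖v‖]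
        · simp only [abs_of_nonneg (angMom_nonneg _)]
          have h1 := h.norm_fst_lt_radius hv
          have h2 := h.norm_snd_lt_radius hv
          simp only at h1 h2
          calc angMom (x, v) ≤ ‖x‖ ^ 2 * ‖v‖ ^ 2 := by
                rw [angMom_eq]
                simp only
                nlinarith [sq_nonneg (⟪x, v⟫ : ℝ)]
            _ < h.radius ^ 2 * h.radius ^ 2 := by gcongr
            _ = L := by simp only [L]; ring
        · simpa only [abs_of_nonneg (angMom_nonneg _)] using hQ
      simp only [g]
      rw [slopeDensity, indicator_of_mem hmem, ← ENNReal.ofReal_mul (by positivity)]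
      refine ENNReal.ofReal_le_ofReal (le_of_eq ?_)
      simp only [abs_of_nonneg (angMom_nonneg _), dF]
      ring
    · rw [indicator_of_notMem hv]
      exact zero_le
  -- Passing from `p` to `ℓ = r² p` costs the factor `1/r²`.
  have step2 : ∀ r : ℝ, 0 < r → J r = ENNReal.ofReal (1 / r ^ 2) * (ENNReal.ofReal Real.pi *
      ∫⁻ l in Ioi (0 : ℝ), ∫⁻ u, g (u ^ 2 / 2 + (l * r⁻¹ ^ 2 / 2 + h.radialPotential r), l)) := by
    intro r hr
    simp only [hJdef]
    rw [mul_left_comm, ← lintegral_comp_mul_left_Ioi (pow_pos hr 2)]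
    congr 1
    refine lintegral_congr fun p => lintegral_congr fun u => ?_
    congr 4
    field_simp
  -- The factor `r²` of spherical coordinates cancels the weight `1/|x|²`. What is left is the
  -- `1/r²` from the change to `ℓ`, precisely the Jacobian of `s = 1/r`.
  have step3 : ∫⁻ x : E3, ENNReal.ofReal (1 / ‖x‖ ^ 2) * J ‖x‖ =
      ENNReal.ofReal (4 * Real.pi) * (ENNReal.ofReal Real.pi * ∫⁻ l in Ioi (0 : ℝ),
        ∫⁻ s in Ioi (0 : ℝ), ∫⁻ u, g (u ^ 2 / 2 + (l * s ^ 2 / 2 + h.radialPotential s⁻¹), l)) := by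
    have hm : Measurable fun q : (ℝ × ℝ) × ℝ =>
        g (q.2 ^ 2 / 2 + (q.1.2 * q.1.1 ^ 2 / 2 + h.radialPotential q.1.1⁻¹), q.1.2) := by fun_prop
    have hm2 := hm.lintegral_prod_right' (ν := volume)
    rw [lintegral_radial (h := fun r => ENNReal.ofReal (1 / r ^ 2) * J r) (by fun_prop),
      lintegral_lintegral_swap (f := fun l s => ∫⁻ u,
        g (u ^ 2 / 2 + (l * s ^ 2 / 2 + h.radialPotential s⁻¹), l))
        (hm2.comp measurable_swap).aemeasurable, ← lintegral_const_mul _ (hm2.lintegral_prod_right'),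
      ← lintegral_comp_inv_Ioi fun s => ENNReal.ofReal Real.pi * ∫⁻ l in Ioi (0 : ℝ), ∫⁻ u,
        g (u ^ 2 / 2 + (l * s ^ 2 / 2 + h.radialPotential s⁻¹), l)]
    congr 1
    refine setLIntegral_congr_fun measurableSet_Ioi fun r hr => ?_
    have hr' : (0 : ℝ) < r := hr
    simp only [inv_inv]
    rw [step2 r hr', ← mul_assoc, ← ENNReal.ofReal_mul (by positivity), mul_one_div_cancel
      (by positivity), ENNReal.ofReal_one, one_mul]
  -- At fixed `ℓ` the period bound for the strongly convex effective potential contributes a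
  -- multiple of `1/√ℓ`, which is integrable on `(0, L)`.
  have step4 : ∀ l ∈ Ioi (0 : ℝ), ∫⁻ s in Ioi (0 : ℝ), ∫⁻ u,
      g (u ^ 2 / 2 + (l * s ^ 2 / 2 + h.radialPotential s⁻¹), l) ≤
      (Ioo 0 L).indicator (fun l => 2 * ENNReal.ofReal (Real.pi * C) * ENNReal.ofReal (1 / √l)) l := by
    intro l hl
    have hl' : (0 : ℝ) < l := hl
    by_cases hL : l < L
    · have hcv : ConvexOn ℝ (Ioi 0) fun s =>
          (l * s ^ 2 / 2 + h.radialPotential s⁻¹) - l * s ^ 2 / 2 := by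
        simpa using h.convexOn_radialPotential_inv
      refine (lintegral_energy_le hl' (by fun_prop) hcv (G := fun e => g (e, l))
        (by fun_prop)).trans ?_
      rw [indicator_of_mem (mem_Ioo.2 ⟨hl', hL⟩)]
      calc 2 * ENNReal.ofReal (Real.pi / √l) * ∫⁻ e, g (e, l)
          ≤ 2 * ENNReal.ofReal (Real.pi / √l) * ENNReal.ofReal C := by
            gcongr
            exact hC l hl'.le
        _ = 2 * ENNReal.ofReal (Real.pi * C) * ENNReal.ofReal (1 / √l) := by
            rw [mul_assoc, mul_assoc, ← ENNReal.ofReal_mul (by positivity),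
              ← ENNReal.ofReal_mul' (by positivity)]
            congr 2
            ring
    · have : ∀ e, g (e, l) = 0 := by
        intro e
        simp only [g]
        rw [slopeDensity, indicator_of_notMem]
        intro hp
        have := hp.2.1
        simp only [abs_of_nonneg hl'.le] at this
        exact hL this
      simp [this]
  refine step1.trans_lt ?_
  rw [step3]
  refine ENNReal.mul_lt_top ENNReal.ofReal_lt_top (ENNReal.mul_lt_top ENNReal.ofReal_lt_top ?_)
  refine (setLIntegral_mono' measurableSet_Ioi step4).trans_lt ?_
  refine (setLIntegral_le_lintegral _ _).trans_lt ?_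
  rw [lintegral_indicator measurableSet_Ioo, lintegral_const_mul _ (by fun_prop)]
  exact ENNReal.mul_lt_top (ENNReal.mul_lt_top ENNReal.ofNat_lt_top ENNReal.ofReal_lt_top)
    (lintegral_inv_sqrt_lt_top L)

end IsAdmissible

end VlasovPoisson
end

/-! ### One-parameter groups of isometries and Stone's theorem. -/

noncomputable section
namespace VlasovPoisson
open scoped ENNReal NNReal Topology

lemma mem_pker_iff {𝕜 H : Type} [RCLike 𝕜] [NormedAddCommGroup H] [InnerProductSpace 𝕜 H]
    {A : H →ₗ.[𝕜] H} {f : H} : f ∈ pker A ↔ (f, (0:H)) ∈ A.graph := by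
  rw [LinearPMap.mem_graph_iff]
  unfold pker
  simp only [Submodule.mem_map, LinearMap.mem_ker, Submodule.subtype_apply]
  exact ⟨fun ⟨y, h1, h2⟩ => ⟨y, h2, h1⟩, fun ⟨y, h2, h1⟩ => ⟨y, h1, h2⟩⟩

/-- A strongly continuous one-parameter group of isometries. -/
structure IsometryGroup (𝕜 H : Type) [RCLike 𝕜] [NormedAddCommGroup H] [InnerProductSpace 𝕜 H]
    where
  toFun : ℝ → H →ₗᵢ[𝕜] H
  zero_apply : ∀ f, toFun 0 f = f
  add_apply : ∀ s t f, toFun (s + t) f = toFun s (toFun t f)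
  continuous_apply : ∀ f, Continuous fun t => toFun t f

namespace IsometryGroup

set_option linter.unusedSectionVars false

variable {𝕜 H : Type} [RCLike 𝕜] [NormedAddCommGroup H] [InnerProductSpace 𝕜 H]
  [NormedSpace ℝ H] [IsScalarTower ℝ 𝕜 H] [CompleteSpace H]

/-- `(f, g)` belongs to the graph of the infinitesimal generator. -/
def IsGenerator (U : IsometryGroup 𝕜 H) (f g : H) : Prop :=
  HasDerivAt (fun t => U.toFun t f) g 0

lemma neg_apply_apply (U : IsometryGroup 𝕜 H) (t : ℝ) (f : H) :
    U.toFun (-t) (U.toFun t f) = f := by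
  rw [← U.add_apply, neg_add_cancel, U.zero_apply]

lemma inner_apply_left (U : IsometryGroup 𝕜 H) (t : ℝ) (f g : H) :
    inner 𝕜 (U.toFun t f) g = inner 𝕜 f (U.toFun (-t) g) := by
  rw [← (U.toFun (-t)).inner_map_map, U.neg_apply_apply]

lemma IsGenerator.hasDerivAt {U : IsometryGroup 𝕜 H} {f g : H} (h : U.IsGenerator f g) (t : ℝ) :
    HasDerivAt (fun t => U.toFun t f) (U.toFun t g) t := by
  have h1 : HasDerivAt (fun s => U.toFun s f) g (t - t) := by rw [sub_self]; exact h
  have h2 := h1.comp_sub_const t t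
  have h3 := ((U.toFun t).toContinuousLinearMap.restrictScalars ℝ).hasFDerivAt.comp_hasDerivAt t h2
  refine h3.congr_of_eventuallyEq (Filter.Eventually.of_forall fun s => ?_)
  change U.toFun s f = U.toFun t (U.toFun (s - t) f)
  rw [← U.add_apply]
  congr 2
  ring

lemma IsGenerator.apply {U : IsometryGroup 𝕜 H} {f g : H} (h : U.IsGenerator f g) (s : ℝ) :
    U.IsGenerator (U.toFun s f) (U.toFun s g) := by
  have h3 := ((U.toFun s).toContinuousLinearMap.restrictScalars ℝ).hasFDerivAt.comp_hasDerivAt 0 h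
  refine h3.congr_of_eventuallyEq (Filter.Eventually.of_forall fun t => ?_)
  change U.toFun t (U.toFun s f) = U.toFun s (U.toFun t f)
  rw [← U.add_apply, ← U.add_apply, add_comm]

lemma IsGenerator.sub_eq_integral {U : IsometryGroup 𝕜 H} {f g : H} (h : U.IsGenerator f g)
    (t : ℝ) : U.toFun t f - f = ∫ s in (0:ℝ)..t, U.toFun s g := by
  rw [intervalIntegral.integral_eq_sub_of_hasDerivAt (fun s _ => h.hasDerivAt s)
    ((U.continuous_apply g).intervalIntegrable _ _), U.zero_apply]

lemma isGenerator_of_sub_eq_integral {U : IsometryGroup 𝕜 H} {f g : H}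
    (h : ∀ t, U.toFun t f - f = ∫ s in (0:ℝ)..t, U.toFun s g) : U.IsGenerator f g := by
  have h1 := intervalIntegral.integral_hasDerivAt_right
    ((U.continuous_apply g).intervalIntegrable 0 0)
    (U.continuous_apply g).stronglyMeasurable.stronglyMeasurableAtFilter
    (U.continuous_apply g).continuousAt
  rw [U.zero_apply] at h1
  refine (h1.add_const f).congr_of_eventuallyEq (Filter.Eventually.of_forall fun t => ?_)
  change U.toFun t f = (∫ s in (0:ℝ)..t, U.toFun s g) + f
  rw [← h t, sub_add_cancel]

lemma IsGenerator.eq_of_zero {U : IsometryGroup 𝕜 H} {f : H} (h : U.IsGenerator f 0) (t : ℝ) :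
    U.toFun t f = f := by
  have := h.sub_eq_integral t
  simpa [sub_eq_zero] using this

lemma isGenerator_zero {U : IsometryGroup 𝕜 H} {f : H} (h : ∀ t, U.toFun t f = f) :
    U.IsGenerator f 0 :=
  isGenerator_of_sub_eq_integral fun t => by simp [h]

/-- Time averages belong to the domain of the generator. -/
lemma isGenerator_integral (U : IsometryGroup 𝕜 H) (f : H) (a : ℝ) :
    U.IsGenerator (∫ s in (0:ℝ)..a, U.toFun s f) (U.toFun a f - f) := by
  have hc := U.continuous_apply f
  have hd : ∀ b, HasDerivAt (fun u => ∫ s in (0:ℝ)..u, U.toFun s f) (U.toFun b f) b := fun b =>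
    intervalIntegral.integral_hasDerivAt_right (hc.intervalIntegrable 0 b)
      hc.stronglyMeasurable.stronglyMeasurableAtFilter hc.continuousAt
  have h1 : HasDerivAt (fun t => ∫ s in (0:ℝ)..(a + t), U.toFun s f) (U.toFun a f) 0 := by
    have := (hd (a + 0)).comp_const_add a 0
    rwa [add_zero] at this
  have h2 := h1.sub (hd 0)
  rw [U.zero_apply] at h2
  refine h2.congr_of_eventuallyEq (Filter.Eventually.of_forall fun t => ?_)
  change U.toFun t (∫ s in (0:ℝ)..a, U.toFun s f) =
    (∫ s in (0:ℝ)..(a + t), U.toFun s f) - ∫ s in (0:ℝ)..t, U.toFun s f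
  have e1 : U.toFun t (∫ s in (0:ℝ)..a, U.toFun s f) = ∫ s in (0:ℝ)..a, U.toFun (s + t) f := by
    have := ((U.toFun t).toContinuousLinearMap.restrictScalars ℝ).intervalIntegral_comp_comm
      (hc.intervalIntegrable (μ := volume) 0 a)
    refine this.symm.trans (intervalIntegral.integral_congr fun s _ => ?_)
    change U.toFun t (U.toFun s f) = U.toFun (s + t) f
    rw [← U.add_apply, add_comm]
  rw [e1, intervalIntegral.integral_comp_add_right (fun s => U.toFun s f), zero_add,
    eq_sub_iff_add_eq, add_comm]
  exact intervalIntegral.integral_add_adjacent_intervals (hc.intervalIntegrable _ _)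
    (hc.intervalIntegrable _ _)

/-- The averages `t⁻¹ ∫₀ᵗ U_s f ds` lie in the domain of the generator and tend to `f` as `t → 0`.
-/
lemma dense_isGenerator (U : IsometryGroup 𝕜 H) : Dense {f | ∃ g, U.IsGenerator f g} := by
  intro f
  have hc := U.continuous_apply f
  have hd : HasDerivAt (fun u => ∫ s in (0:ℝ)..u, U.toFun s f) (U.toFun 0 f) 0 :=
    intervalIntegral.integral_hasDerivAt_right (hc.intervalIntegrable 0 0)
      hc.stronglyMeasurable.stronglyMeasurableAtFilter hc.continuousAt
  rw [U.zero_apply, hasDerivAt_iff_tendsto_slope_zero] at hd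
  refine mem_closure_of_tendsto hd (Filter.Eventually.of_forall fun t => ?_)
  simp only [zero_add, intervalIntegral.integral_same, sub_zero]
  refine ⟨t⁻¹ • (U.toFun t f - f), ?_⟩
  refine ((U.isGenerator_integral f t).const_smul (t⁻¹)).congr_of_eventuallyEq
    (Filter.Eventually.of_forall fun s => ?_)
  exact ((U.toFun s).toContinuousLinearMap.restrictScalars ℝ).map_smul t⁻¹ _

lemma IsGenerator.skew {U : IsometryGroup 𝕜 H} {f g f' g' : H} (h : U.IsGenerator f g)
    (h' : U.IsGenerator f' g') : inner 𝕜 g f' = -inner 𝕜 f g' := by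
  have h1 := HasDerivAt.inner 𝕜 h h'
  have h2 : HasDerivAt (fun _ : ℝ => inner 𝕜 f f') (0:𝕜) 0 := hasDerivAt_const _ _
  have h3 := (h2.congr_of_eventuallyEq (Filter.Eventually.of_forall fun t =>
    (U.toFun t).inner_map_map f f')).unique h1
  rw [U.zero_apply, U.zero_apply] at h3
  rw [eq_neg_iff_add_eq_zero, add_comm]
  exact h3.symm

/-- The generator is maximally skew. -/
lemma isGenerator_of_inner_eq {U : IsometryGroup 𝕜 H} {k l : H}
    (hkl : ∀ f g, U.IsGenerator f g → inner 𝕜 g k = inner 𝕜 f l) : U.IsGenerator k (-l) := by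
  -- The identity is tested against the dense domain: for `f` there, `⟨U_s f, k⟩` has derivative
  -- `⟨U_s f, l⟩`, because `U_s f` stays in the domain. Integrating and moving `U_s` to the other
  -- side gives the claim.
  have key : ∀ t, U.toFun (-t) k - k = ∫ s in (0:ℝ)..t, U.toFun (-s) l := by
    intro t
    have hcl : Continuous fun s => U.toFun (-s) l := (U.continuous_apply l).comp continuous_neg
    refine U.dense_isGenerator.eq_of_inner_right (𝕜 := 𝕜) ?_
    rintro f ⟨g, hfg⟩
    have h1 : ∀ s, HasDerivAt (fun s => inner 𝕜 (U.toFun s f) k) (inner 𝕜 (U.toFun s f) l) s := by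
      intro s
      have := HasDerivAt.inner 𝕜 (hfg.hasDerivAt s) (hasDerivAt_const s k)
      simp only [inner_zero_right, zero_add] at this
      rwa [hkl _ _ (hfg.apply s)] at this
    have hci : Continuous fun s => inner 𝕜 (U.toFun s f) l :=
      (U.continuous_apply f).inner continuous_const
    have h2 := intervalIntegral.integral_eq_sub_of_hasDerivAt (fun s _ => h1 s)
      (hci.intervalIntegrable 0 t)
    rw [U.zero_apply] at h2
    rw [inner_sub_right, ← U.inner_apply_left, ← h2]
    have h3 := ((innerSL 𝕜 f).restrictScalars ℝ).intervalIntegral_comp_comm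
      (hcl.intervalIntegrable (μ := volume) 0 t)
    refine Eq.trans (intervalIntegral.integral_congr fun s _ => ?_) h3
    exact U.inner_apply_left s f l
  refine isGenerator_of_sub_eq_integral fun t => ?_
  have h1 := key (-t)
  rw [neg_neg] at h1
  have h2 := intervalIntegral.integral_comp_neg (a := 0) (b := t) (fun s => U.toFun (-s) l)
  simp only [neg_neg, neg_zero] at h2
  rw [h1, intervalIntegral.integral_symm, ← h2, ← intervalIntegral.integral_neg]
  exact intervalIntegral.integral_congr fun s _ => ((U.toFun s).map_neg l).symm

variable {T : H →ₗ.[𝕜] H} {U : IsometryGroup 𝕜 H}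

lemma dense_domain (hT : ∀ f g, (f, g) ∈ T.graph ↔ U.IsGenerator f g) :
    Dense (T.domain : Set H) := by
  refine U.dense_isGenerator.mono ?_
  rintro f ⟨g, hfg⟩
  exact LinearPMap.mem_domain_of_mem_graph ((hT f g).2 hfg)

/-- Stone's theorem in the form needed here. -/
lemma isSelfAdjoint_I_smul {H : Type} [NormedAddCommGroup H] [InnerProductSpace ℂ H]
    [NormedSpace ℝ H] [IsScalarTower ℝ ℂ H] [CompleteSpace H] {T : H →ₗ.[ℂ] H}
    {U : IsometryGroup ℂ H} (hT : ∀ f g, (f, g) ∈ T.graph ↔ U.IsGenerator f g) :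
    IsSelfAdjoint (Complex.I • T) := by
  have hd : Dense ((Complex.I • T).domain : Set H) :=
    dense_domain (T := T) (U := U) hT
  have hg : ∀ f g, (f, g) ∈ (Complex.I • T).graph ↔ U.IsGenerator f (-(Complex.I • g)) := by
    intro f g
    rw [LinearPMap.smul_graph, Submodule.mem_map]
    constructor
    · rintro ⟨⟨f', g'⟩, h1, h2⟩
      simp only [LinearMap.prodMap_apply, LinearMap.id_coe, id, LinearMap.smul_apply,
        Prod.mk.injEq] at h2
      obtain ⟨rfl, rfl⟩ := h2
      rw [smul_smul, Complex.I_mul_I, neg_one_smul, neg_neg]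
      exact (hT _ _).1 h1
    · intro h1
      refine ⟨(f, -(Complex.I • g)), (hT _ _).2 h1, ?_⟩
      simp [smul_smul]
  rw [LinearPMap.isSelfAdjoint_def]
  refine LinearPMap.eq_of_eq_graph ?_
  rw [LinearPMap.adjoint_graph_eq_graph_adjoint hd]
  ext ⟨k, l⟩
  rw [Submodule.mem_adjoint_iff, hg]
  -- The adjoint is contained in `i𝒯` by maximal skewness of the generator, and contains it by skew
  -- symmetry.
  constructor
  · intro h1
    refine isGenerator_of_inner_eq fun f g hfg => ?_
    have := h1 f (Complex.I • g) ((hg _ _).2 (by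
      rwa [smul_smul, Complex.I_mul_I, neg_one_smul, neg_neg]))
    simp only [sub_eq_zero] at this
    rw [inner_smul_left, Complex.conj_I] at this
    rw [inner_smul_right, ← this, ← mul_assoc]
    simp
  · intro h1 a b hab
    have := ((hg a b).1 hab).skew h1
    simp only [inner_neg_left, inner_neg_right, inner_smul_left, inner_smul_right,
      Complex.conj_I, neg_mul, neg_neg] at this
    rw [sub_eq_zero]
    exact mul_left_cancel₀ Complex.I_ne_zero this

/-- A vector orthogonal to the range satisfies the hypothesis of maximal skewness with `l = 0`,
hence lies in the kernel. Taking orthogonal complements of this inclusion gives the claim. -/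
lemma mem_closure_range (hT : ∀ f g, (f, g) ∈ T.graph ↔ U.IsGenerator f g) {f : H}
    (hf : f ∈ (pker T)ᗮ) : f ∈ closure {g | ∃ f', (f', g) ∈ T.graph} := by
  have hset : {g | ∃ f', (f', g) ∈ T.graph} = (LinearMap.range T.toFun : Set H) := by
    ext g
    simp only [LinearPMap.mem_graph_iff, mem_ofPred_eq, SetLike.mem_coe, LinearMap.mem_range]
    exact ⟨fun ⟨_, y, _, h⟩ => ⟨y, h⟩, fun ⟨y, h⟩ => ⟨y, y, rfl, h⟩⟩
  rw [hset, ← Submodule.topologicalClosure_coe, SetLike.mem_coe,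
    ← Submodule.orthogonal_orthogonal_eq_closure]
  refine Submodule.orthogonal_le ?_ hf
  intro k hk
  rw [mem_pker_iff, hT]
  have := isGenerator_of_inner_eq (U := U) (k := k) (l := 0) fun f g hfg => by
    rw [inner_zero_right]
    have : g ∈ LinearMap.range T.toFun := by
      rw [← SetLike.mem_coe, ← hset]
      exact ⟨f, (hT f g).2 hfg⟩
    exact (Submodule.mem_orthogonal _ _).1 hk g this
  rwa [neg_zero] at this

end IsometryGroup

end VlasovPoisson
end

/-! ### The Koopman group on the weighted space. -/

noncomputable section
namespace VlasovPoisson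
open scoped ENNReal NNReal Topology

/-- A point of phase space with prescribed invariants. -/
def invariantsSection (p : ℝ × ℝ × ℝ) : Phase :=
  (!₂[p.1, 0, 0], !₂[p.2.2 / p.1, Real.sqrt (p.2.1 ^ 2 - (p.2.2 / p.1) ^ 2), 0])

lemma measurable_invariantsSection : Measurable invariantsSection := by
  unfold invariantsSection
  refine Measurable.prodMk ?_ ?_
  · refine (WithLp.measurable_toLp 2 (Fin 3 → ℝ)).comp (measurable_pi_iff.2 fun i => ?_)
    fin_cases i <;> simp
    fun_prop
  · refine (WithLp.measurable_toLp 2 (Fin 3 → ℝ)).comp (measurable_pi_iff.2 fun i => ?_)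
    fin_cases i <;> simp <;> fun_prop

/-- Cauchy–Schwarz makes the argument of the square root nonnegative. For `x = 0` the inner product
vanishes and division by zero returns zero, so the formula remains correct. -/
lemma invariants_invariantsSection (z : Phase) :
    invariants (invariantsSection (invariants z)) = invariants z := by
  obtain ⟨x, v⟩ := z
  have hcs := abs_real_inner_le_norm x v
  have hx := norm_nonneg x
  have hv := norm_nonneg v
  have hle : (⟪x, v⟫ / ‖x‖) ^ 2 ≤ ‖v‖ ^ 2 := by
    rcases hx.eq_or_lt with h0 | h0
    · rw [← h0]
      simp
    · rw [sq_le_sq, abs_div, abs_norm, abs_norm, div_le_iff₀ h0, mul_comm]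
      exact hcs
  have hin : ‖x‖ * (⟪x, v⟫ / ‖x‖) = ⟪x, v⟫ := by
    rcases hx.eq_or_lt with h0 | h0
    · have : x = 0 := norm_eq_zero.1 h0.symm
      simp [this]
    · field_simp
  simp only [invariants, invariantsSection, Prod.mk.injEq]
  refine ⟨?_, ?_, ?_⟩
  · simp [EuclideanSpace.norm_eq, Fin.sum_univ_three]
  · rw [EuclideanSpace.norm_eq]
    simp only [Fin.sum_univ_three, Real.norm_eq_abs, sq_abs]
    simp [Real.sq_sqrt (sub_nonneg.2 hle)]
  · simp only [PiLp.inner_apply, Fin.sum_univ_three]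
    simp only [PiLp.inner_apply, Fin.sum_univ_three] at hin
    simpa [mul_comm] using hin

namespace IsAdmissible

variable {Q : Phase → ℝ} {F : ℝ → ℝ → ℝ} {e₀ : ℝ} (h : IsAdmissible Q F e₀)
include h

/-- The flow commutes with linear isometries, so the invariants at time `t` depend on the initial
invariants alone; the Borel section makes the dependence measurable. -/
lemma measurable_flow_radialSigma (t : ℝ) :
    Measurable[radialSigma, radialSigma] (h.flow t) := by
  refine measurable_comap_iff.2 ?_
  have : invariants ∘ h.flow t = (fun p => invariants (h.flow t (invariantsSection p))) ∘
      invariants := by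
    funext z
    exact h.invariants_flow_congr (invariants_invariantsSection z).symm t
  rw [this]
  exact (measurable_invariants.comp ((h.continuous_flow_apply t).measurable.comp
    measurable_invariantsSection)).comp (comap_measurable _)

lemma measurable_weight : Measurable fun z => ENNReal.ofReal (1 / |dF Q F z|) :=
  (measurable_const.div (measurable_norm.comp h.measurable_dF)).ennreal_ofReal

lemma measurePreserving_flow_weighted (t : ℝ) :
    MeasurePreserving (h.flow t) (weighted Q F) (weighted Q F) := by
  refine ⟨(h.continuous_flow_apply t).measurable, Measure.ext fun s hs => ?_⟩
  have hp := (h.continuous_flow_apply t).measurable hs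
  rw [Measure.map_apply (h.continuous_flow_apply t).measurable hs, weighted,
    withDensity_apply _ hp, withDensity_apply _ hs,
    ← (h.measurePreserving_flow_Omega t).setLIntegral_comp_preimage hs h.measurable_weight]
  refine lintegral_congr_ae ?_
  filter_upwards [ae_restrict_of_ae (ae_restrict_of_ae ae_angMom_pos)] with z hz
  rw [h.dF_flow hz]

lemma ae_weighted_iff {p : Phase → Prop} :
    (∀ᵐ z ∂(weighted Q F), p z) ↔ ∀ᵐ z ∂(volume.restrict (Omega Q)), p z :=
  ⟨fun H => h.absolutelyContinuous.ae_le H,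
    fun H => (withDensity_absolutelyContinuous _ _).ae_le H⟩

lemma integrableOn_dF : IntegrableOn (dF Q F) (Omega Q) := by
  refine ⟨h.measurable_dF.aestronglyMeasurable, ?_⟩
  rw [hasFiniteIntegral_iff_norm]
  have h1 := h.lintegral_dF_div_lt_top
  refine lt_of_le_of_lt (b := ∫⁻ z in Omega Q, ENNReal.ofReal (h.radius ^ 2) *
    ENNReal.ofReal (|dF Q F z| / ‖z.1‖ ^ 2)) ?_ ?_
  · refine lintegral_mono_ae ?_
    filter_upwards [ae_restrict_mem h.measurableSet_Omega, ae_restrict_of_ae ae_angMom_pos]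
      with z hz hz'
    rw [← ENNReal.ofReal_mul (by positivity)]
    refine ENNReal.ofReal_le_ofReal ?_
    have hx : 0 < ‖z.1‖ := norm_pos_iff.2 (ne_zero_of_angMom_pos hz')
    rw [← mul_div_assoc, le_div_iff₀ (by positivity), mul_comm]
    exact mul_le_mul_of_nonneg_right
      (pow_le_pow_left₀ hx.le (h.norm_fst_lt_radius hz).le 2) (norm_nonneg _)
  · rw [lintegral_const_mul' _ _ ENNReal.ofReal_ne_top]
    exact ENNReal.mul_lt_top ENNReal.ofReal_lt_top h1

section Field

variable {𝕜 : Type} [RCLike 𝕜]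

lemma integral_weighted (G : Phase → 𝕜) :
    ∫ z, G z ∂(weighted Q F) = ∫ z in Omega Q, (1 / |dF Q F z|) • G z := by
  rw [weighted, integral_withDensity_eq_integral_toReal_smul h.measurable_weight
    (Filter.Eventually.of_forall fun _ => ENNReal.ofReal_lt_top)]
  refine integral_congr_ae (Filter.Eventually.of_forall fun z => ?_)
  simp only
  rw [ENNReal.toReal_ofReal (by positivity)]

lemma integrable_weighted_iff {G : Phase → 𝕜} :
    Integrable G (weighted Q F) ↔ IntegrableOn (fun z => (1 / |dF Q F z|) • G z) (Omega Q) := by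
  rw [weighted, integrable_withDensity_iff_integrable_smul' h.measurable_weight
    (Filter.Eventually.of_forall fun _ => ENNReal.ofReal_lt_top)]
  refine integrable_congr (Filter.Eventually.of_forall fun z => ?_)
  simp only
  rw [ENNReal.toReal_ofReal (by positivity)]

lemma memLp_weight {ψ : Phase → ℝ} (hψ : AEStronglyMeasurable ψ (volume.restrict (Omega Q)))
    {C : ℝ} (hC : ∀ z ∈ Omega Q, |ψ z| ≤ C) :
    MemLp (fun z => ((ψ z * |dF Q F z| : ℝ) : 𝕜)) 2 (weighted Q F) := by
  have hm : AEStronglyMeasurable (fun z => ψ z * |dF Q F z|) (weighted Q F) :=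
    (hψ.mono_ac (withDensity_absolutelyContinuous _ _)).mul
      (measurable_norm.comp h.measurable_dF).aestronglyMeasurable
  refine MemLp.ofReal ?_
  rw [memLp_two_iff_integrable_sq hm, h.integrable_weighted_iff]
  refine Integrable.mono' (h.integrableOn_dF.norm.const_mul (C ^ 2)) ?_ ?_
  · exact ((measurable_const.div (measurable_norm.comp h.measurable_dF)).aestronglyMeasurable).smul
      ((hψ.mul (measurable_norm.comp h.measurable_dF).aestronglyMeasurable).pow 2)
  · filter_upwards [ae_restrict_mem h.measurableSet_Omega] with z hz
    have hd : 0 < |dF Q F z| := abs_pos.2 (h.dF_neg hz).ne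
    have h2 : ψ z ^ 2 ≤ C ^ 2 := by rw [← sq_abs]; exact pow_le_pow_left₀ (abs_nonneg _) (hC z hz) 2
    have e : (1 / |dF Q F z|) • (ψ z * |dF Q F z|) ^ 2 = ψ z ^ 2 * |dF Q F z| := by
      rw [smul_eq_mul]; field_simp
    rw [e, norm_mul, norm_pow, Real.norm_eq_abs, Real.norm_eq_abs, sq_abs, Real.norm_eq_abs, abs_abs]
    exact mul_le_mul_of_nonneg_right h2 hd.le

/-- The vector that represents the functional `f ↦ ∫ ψ f`. -/
lemma exists_pairing {ψ : Phase → ℝ} (hψ : AEStronglyMeasurable ψ (volume.restrict (Omega Q)))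
    {C : ℝ} (hC : ∀ z ∈ Omega Q, |ψ z| ≤ C) :
    ∃ k : Lp 𝕜 2 (weighted Q F),
      (∀ᵐ z ∂(volume.restrict (Omega Q)), k z = ((ψ z * |dF Q F z| : ℝ) : 𝕜)) ∧
      ∀ f : Lp 𝕜 2 (weighted Q F), IntegrableOn (fun z => ψ z • f z) (Omega Q) ∧
      inner 𝕜 k f = ∫ z in Omega Q, ψ z • f z := by
  refine ⟨(h.memLp_weight (𝕜 := 𝕜) hψ hC).toLp _,
    h.ae_weighted_iff.1 (h.memLp_weight (𝕜 := 𝕜) hψ hC).coeFn_toLp, fun f => ?_⟩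
  have hi := L2.integrable_inner (𝕜 := 𝕜) ((h.memLp_weight (𝕜 := 𝕜) hψ hC).toLp _) f
  have e : (fun z => (1 / |dF Q F z|) • inner 𝕜 (((h.memLp_weight (𝕜 := 𝕜) hψ hC).toLp _ :
      Phase → 𝕜) z) (f z)) =ᵐ[volume.restrict (Omega Q)] fun z => ψ z • f z := by
    filter_upwards [h.ae_weighted_iff.1 (h.memLp_weight (𝕜 := 𝕜) hψ hC).coeFn_toLp,
      ae_restrict_mem h.measurableSet_Omega] with z h1 hz
    have hd : |dF Q F z| ≠ 0 := (abs_pos.2 (h.dF_neg hz).ne).ne'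
    rw [h1, RCLike.inner_apply, RCLike.conj_ofReal, mul_comm, ← RCLike.real_smul_eq_coe_mul,
      smul_smul]
    congr 1
    field_simp
  constructor
  · exact ((h.integrable_weighted_iff).1 hi).congr e
  · rw [L2.inner_def, h.integral_weighted, integral_congr_ae e]

lemma integrableOn_coe (f : Lp 𝕜 2 (weighted Q F)) : IntegrableOn (f : Phase → 𝕜) (Omega Q) := by
  obtain ⟨k, _, hk⟩ := h.exists_pairing (𝕜 := 𝕜) (ψ := fun _ => 1)
    aestronglyMeasurable_const (C := 1) (by simp)
  simpa using (hk f).1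

lemma eLpNorm_weighted (u : Phase → 𝕜) :
    eLpNorm u 2 (weighted Q F) =
      eLpNorm (fun z => Real.sqrt (1 / |dF Q F z|) • u z) 2 (volume.restrict (Omega Q)) := by
  rw [eLpNorm_eq_lintegral_rpow_enorm_toReal (by norm_num) (by norm_num),
    eLpNorm_eq_lintegral_rpow_enorm_toReal (by norm_num) (by norm_num), weighted,
    lintegral_withDensity_eq_lintegral_mul_non_measurable _ h.measurable_weight
      (Filter.Eventually.of_forall fun _ => ENNReal.ofReal_lt_top)]
  congr 1
  refine lintegral_congr fun z => ?_
  simp only [ENNReal.toReal_ofNat, ENNReal.rpow_ofNat, Pi.mul_apply, enorm_smul, mul_pow]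
  congr 1
  rw [Real.enorm_eq_ofReal (Real.sqrt_nonneg _), ← ENNReal.ofReal_pow (Real.sqrt_nonneg _),
    Real.sq_sqrt (by positivity)]

variable (𝕜) in
/-- Composition with the flow, as an isometry of the weighted space. -/
def koopmanMap (t : ℝ) : L2r 𝕜 Q F →ₗᵢ[𝕜] L2r 𝕜 Q F where
  toFun f := ⟨Lp.compMeasurePreserving (h.flow t) (h.measurePreserving_flow_weighted t) f.1, by
    rw [mem_lpMeas_iff_aestronglyMeasurable]
    obtain ⟨f', h1, h2⟩ := mem_lpMeas_iff_aestronglyMeasurable.1 f.2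
    refine ⟨f' ∘ h.flow t, h1.comp_measurable (h.measurable_flow_radialSigma t), ?_⟩
    exact (Lp.coeFn_compMeasurePreserving _ _).trans
      ((h.measurePreserving_flow_weighted t).quasiMeasurePreserving.ae_eq_comp h2)⟩
  map_add' f g := Subtype.ext (map_add _ _ _)
  map_smul' c f := Subtype.ext
    ((Lp.compMeasurePreservingₗ 𝕜 (h.flow t) (h.measurePreserving_flow_weighted t)).map_smul c f.1)
  norm_map' f := Lp.norm_compMeasurePreserving f.1 (h.measurePreserving_flow_weighted t)

lemma koopmanMap_ae (t : ℝ) (f : L2r 𝕜 Q F) :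
    (h.koopmanMap 𝕜 t f : Phase → 𝕜) =ᵐ[weighted Q F] fun z => (f : Phase → 𝕜) (h.flow t z) :=
  Lp.coeFn_compMeasurePreserving f.1 (h.measurePreserving_flow_weighted t)

/-- Multiplication by `|F'_e|^{-1/2}` maps isometrically into the unweighted `L²(Ω)`. It commutes
with the flow because `F'_e` is invariant, and there strong continuity follows from continuity of
the flow and finiteness of the volume of `Ω`. -/
lemma continuous_koopmanMap (f : L2r 𝕜 Q F) : Continuous fun t => h.koopmanMap 𝕜 t f := by
  have : IsFiniteMeasure (volume.restrict (Omega Q)) := ⟨by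
    rw [Measure.restrict_apply_univ]; exact h.volume_Omega_lt_top⟩
  set w : Phase → 𝕜 := fun z => Real.sqrt (1 / |dF Q F z|) • (f : Phase → 𝕜) z
  have hwm : AEStronglyMeasurable w (volume.restrict (Omega Q)) :=
    ((measurable_const.div (measurable_norm.comp h.measurable_dF)).sqrt.aestronglyMeasurable).smul
      ((Lp.aestronglyMeasurable f.1).mono_ac h.absolutelyContinuous)
  have hw : MemLp w 2 (volume.restrict (Omega Q)) :=
    ⟨hwm, by rw [← h.eLpNorm_weighted]; exact (Lp.memLp f.1).2⟩
  let fl : C(ℝ, C(Phase, Phase)) := ContinuousMap.curry ⟨fun p => h.flow p.1 p.2, h.continuous_flow⟩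
  have hc : Continuous fun t => Lp.compMeasurePreserving (fl t)
      (h.measurePreserving_flow_Omega t) (hw.toLp w) :=
    (continuous_const (y := hw.toLp w)).compMeasurePreservingLp fl.continuous
      (fun t => h.measurePreserving_flow_Omega t) (by norm_num)
  have hdist : ∀ s t, dist (h.koopmanMap 𝕜 s f) (h.koopmanMap 𝕜 t f) =
      dist (Lp.compMeasurePreserving (fl s) (h.measurePreserving_flow_Omega s) (hw.toLp w))
        (Lp.compMeasurePreserving (fl t) (h.measurePreserving_flow_Omega t) (hw.toLp w)) := by
    intro s t
    rw [Subtype.dist_eq, Lp.dist_def, Lp.dist_def, h.eLpNorm_weighted]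
    congr 1
    refine eLpNorm_congr_ae ?_
    filter_upwards [h.ae_weighted_iff.1 (h.koopmanMap_ae s f),
      h.ae_weighted_iff.1 (h.koopmanMap_ae t f), ae_restrict_of_ae ae_angMom_pos,
      Lp.coeFn_compMeasurePreserving (hw.toLp w) (h.measurePreserving_flow_Omega s),
      Lp.coeFn_compMeasurePreserving (hw.toLp w) (h.measurePreserving_flow_Omega t),
      (h.measurePreserving_flow_Omega s).quasiMeasurePreserving.ae_eq_comp hw.coeFn_toLp,
      (h.measurePreserving_flow_Omega t).quasiMeasurePreserving.ae_eq_comp hw.coeFn_toLp]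
      with z h1 h2 hz h3 h4 h5 h6
    simp only [Pi.sub_apply]
    have e3 : (Lp.compMeasurePreserving (fl s) (h.measurePreserving_flow_Omega s) (hw.toLp w) :
      Phase → 𝕜) z = w (h.flow s z) := h3.trans h5
    have e4 : (Lp.compMeasurePreserving (fl t) (h.measurePreserving_flow_Omega t) (hw.toLp w) :
      Phase → 𝕜) z = w (h.flow t z) := h4.trans h6
    rw [e3, e4]
    simp only [w, h.dF_flow hz]
    rw [← smul_sub]
    congr 2
  rw [Metric.continuous_iff] at hc ⊢
  intro b ε hε
  obtain ⟨δ, h1, h2⟩ := hc b ε hε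
  exact ⟨δ, h1, fun a ha => by rw [hdist]; exact h2 a ha⟩

variable (𝕜) in
/-- The one-parameter group of the flow on the weighted space. -/
def koopman : IsometryGroup 𝕜 (L2r 𝕜 Q F) where
  toFun := h.koopmanMap 𝕜
  zero_apply f := by
    refine Subtype.ext (Lp.ext ((h.koopmanMap_ae 0 f).trans ?_))
    simp [h.flow_zero]
  add_apply s t f := by
    refine Subtype.ext (Lp.ext ((h.koopmanMap_ae (s + t) f).trans ?_))
    refine Filter.EventuallyEq.trans ?_ (h.koopmanMap_ae s _).symm
    refine Filter.EventuallyEq.trans ?_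
      ((h.measurePreserving_flow_weighted s).quasiMeasurePreserving.ae_eq_comp
        (h.koopmanMap_ae t f)).symm
    refine Filter.Eventually.of_forall fun z => ?_
    simp only [Function.comp_apply, ← h.flow_add]
    rw [add_comm]
  continuous_apply := h.continuous_koopmanMap

lemma koopman_ae (t : ℝ) (f : L2r 𝕜 Q F) :
    ((h.koopman 𝕜).toFun t f : Phase → 𝕜) =ᵐ[volume.restrict (Omega Q)]
      fun z => (f : Phase → 𝕜) (h.flow t z) :=
  h.ae_weighted_iff.1 (h.koopmanMap_ae t f)

end Field

end IsAdmissible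

end VlasovPoisson
end

/-! ### The distributional operator `𝒯` is the generator of the Koopman group. -/

noncomputable section
namespace VlasovPoisson
open scoped ENNReal NNReal Topology

instance isAddHaarMeasure_volume_phase : (volume : Measure Phase).IsAddHaarMeasure :=
  Measure.prod.instIsAddHaarMeasure (volume : Measure E3) (volume : Measure E3)

instance isNegInvariant_volume_phase : (volume : Measure Phase).IsNegInvariant :=
  Measure.IsAddHaarMeasure.isNegInvariant_of_regular _

lemma IsTest.continuous_fderiv {U : Set Phase} {ψ : Phase → ℝ} (hψ : IsTest U ψ) :
    Continuous (fderiv ℝ ψ) := hψ.1.continuous_fderiv (by simp)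

lemma IsTest.exists_lipschitz {U : Set Phase} {ψ : Phase → ℝ} (hψ : IsTest U ψ) :
    ∃ C, LipschitzWith C ψ :=
  hψ.1.lipschitzWith_of_hasCompactSupport hψ.2.1 (by simp)

lemma exists_bound_of_hasCompactSupport {ψ : Phase → ℝ} (hc : Continuous ψ)
    (hs : HasCompactSupport ψ) : ∃ C, ∀ z, |ψ z| ≤ C :=
  hs.exists_bound_of_continuous hc

/-- A function in `L¹(Ω)` is determined by its pairings with test functions. -/
lemma ae_eq_zero_of_forall_test {𝕜 : Type} [RCLike 𝕜] {Ω : Set Phase} (hΩ : IsOpen Ω)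
    {u : Phase → 𝕜} (hu : IntegrableOn u Ω)
    (hz : ∀ ψ, IsTest Ω ψ → ∫ z in Ω, ψ z • u z = 0) : ∀ᵐ z ∂(volume.restrict Ω), u z = 0 := by
  have := hΩ.ae_eq_zero_of_integral_contDiff_smul_eq_zero (μ := volume.restrict Ω) (f := u)
    (fun x _ => ⟨Set.univ, Filter.univ_mem, by rwa [IntegrableOn, Measure.restrict_univ]⟩)
    (fun ψ a b c => hz ψ ⟨a, b, c⟩)
  filter_upwards [this, ae_restrict_mem hΩ.measurableSet] with z h1 h2 using h1 h2

namespace IsAdmissible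

variable {Q : Phase → ℝ} {F : ℝ → ℝ → ℝ} {e₀ : ℝ} (h : IsAdmissible Q F e₀)

lemma hasDerivAt_comp_flow {ψ ψ' : Phase → ℝ}
    (hd : ∀ z, HasDerivAt (fun t => ψ (h.flow t z)) (ψ' z) 0) (t : ℝ) (z : Phase) :
    HasDerivAt (fun t => ψ (h.flow t z)) (ψ' (h.flow t z)) t := by
  have h1 : HasDerivAt (fun s => ψ (h.flow s (h.flow t z))) (ψ' (h.flow t z)) (t - t) := by
    rw [sub_self]; exact hd _
  refine (h1.comp_sub_const t t).congr_of_eventuallyEq (Filter.Eventually.of_forall fun s => ?_)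
  change ψ (h.flow s z) = ψ (h.flow (s - t) (h.flow t z))
  rw [← h.flow_add, sub_add_cancel]

include h in
lemma hasDerivAt_test {U : Set Phase} {ψ : Phase → ℝ} (hψ : IsTest U ψ) (z : Phase) :
    HasDerivAt (fun t => ψ (h.flow t z)) (transportClassical (potential Q) ψ z) 0 := by
  have h1 := h.hasDerivAt_flow 0 z
  have h2 : HasFDerivAt ψ (fderiv ℝ ψ (h.flow 0 z)) (h.flow 0 z) :=
    (hψ.1.differentiable (by simp) _).hasFDerivAt
  refine (h2.comp_hasDerivAt 0 h1).congr_deriv ?_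
  rw [h.flow_zero]
  rfl

include h in
lemma continuous_transportClassical {U : Set Phase} {ψ : Phase → ℝ} (hψ : IsTest U ψ) :
    Continuous (transportClassical (potential Q) ψ) := by
  unfold transportClassical
  exact hψ.continuous_fderiv.clm_apply
    (continuous_snd.prodMk (h.lipschitz_gradient.continuous.comp continuous_fst).neg)

lemma hasCompactSupport_transportClassical {U : Set Phase} {ψ : Phase → ℝ} (hψ : IsTest U ψ) :
    HasCompactSupport (transportClassical (potential Q) ψ) := by
  refine (hψ.2.1.fderiv (𝕜 := ℝ)).mono fun z hz hz' => hz ?_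
  simp [transportClassical, hz']

/-- Lipschitz functions that are differentiable along the flow are approximated by test functions,
together with their derivative along the flow. -/
lemma exists_test_approx {ψ ψ' : Phase → ℝ} {C : ℝ≥0} (hψ : LipschitzWith C ψ)
    (hc : HasCompactSupport ψ) (hs : tsupport ψ ⊆ Omega Q) (hψ' : UniformContinuous ψ')
    (hd : ∀ z, HasDerivAt (fun t => ψ (h.flow t z)) (ψ' z) 0) {δ : ℝ} (hδ : 0 < δ) :
    ∃ χ, IsTest (Omega Q) χ ∧ (∀ z, |χ z - ψ z| ≤ δ) ∧
      ∀ z, |transportClassical (potential Q) χ z - ψ' z| ≤ δ := by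
  set L : ℝ≥0 := max 1 h.lipConst
  obtain ⟨ε₁, hε₁, hsub⟩ := hc.isCompact.exists_cthickening_subset_open h.isOpen_Omega hs
  obtain ⟨ε₂, hε₂, huc⟩ := Metric.uniformContinuous_iff.1 hψ' (δ / 2) (by positivity)
  -- `M ε ≤ δ/2` controls both the displacement error `C ε` and the commutator error `2 C L ε`; the
  -- summand `1` keeps `M` positive.
  set M : ℝ := C * L * 2 + C + 1
  have hM : 0 < M := by positivity
  set ε : ℝ := min (min ε₁ (ε₂ / 2)) (δ / 2 / M)
  have hε : 0 < ε := by positivity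
  have hεδ : M * ε ≤ δ / 2 := by
    have : ε ≤ δ / 2 / M := min_le_right _ _
    calc M * ε ≤ M * (δ / 2 / M) := by gcongr
      _ = δ / 2 := by field_simp
  have hb1 : C * L * (2 * ε) ≤ δ / 2 := by
    refine le_trans ?_ hεδ
    have : (0:ℝ) ≤ (C + 1) * ε := by positivity
    simp only [M]; linarith
  have hb2 : C * ε ≤ δ := by
    have : (0:ℝ) ≤ (C * L * 2 + 1) * ε := by positivity
    simp only [M] at hεδ; linarith
  let η : ContDiffBump (0 : Phase) := ⟨ε / 2, ε, by positivity, by linarith⟩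
  have hηs : Function.support (η.normed volume) ⊆ Metric.ball (0:Phase) ε :=
    (η.support_normed_eq (μ := volume)).subset
  have hηc : Continuous (η.normed volume) := η.continuous_normed
  have hηcs : HasCompactSupport (η.normed (volume : Measure Phase)) := η.hasCompactSupport_normed
  set χ : Phase → ℝ := convolution (η.normed volume) ψ (ContinuousLinearMap.lsmul ℝ ℝ) volume
  have hsm : ContDiff ℝ ∞ χ := hηcs.contDiff_convolution_left _ η.contDiff_normed
    hψ.continuous.locallyIntegrable
  have hconv : ∀ g : Phase → ℝ, Continuous g → ∀ z₀ δ' z, 0 ≤ δ' →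
      (∀ w ∈ Metric.ball z ε, |g w - z₀| ≤ δ') →
      |convolution (η.normed volume) g (ContinuousLinearMap.lsmul ℝ ℝ) volume z - z₀| ≤ δ' := by
    intro g hg z₀ δ' z hδ' hw
    exact dist_convolution_le hδ' hηs η.nonneg_normed η.integral_normed
      hg.aestronglyMeasurable hw
  refine ⟨χ, ⟨hsm, hηcs.convolution _ hc, ?_⟩, fun z => ?_, fun z => ?_⟩
  · refine Subset.trans ?_ hsub
    refine closure_minimal ?_ Metric.isClosed_cthickening
    intro z hz
    obtain ⟨a, ha, b, hb, rfl⟩ := Set.mem_add.1 (support_convolution_subset _ hz)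
    refine Metric.mem_cthickening_of_dist_le (a + b) b ε₁ _ (subset_tsupport _ hb) ?_
    have := hηs ha
    rw [mem_ball_zero_iff] at this
    rw [dist_eq_norm, add_sub_cancel_right]
    exact this.le.trans ((min_le_left _ _).trans (min_le_left _ _))
  · refine hconv ψ hψ.continuous (ψ z) δ z hδ.le fun w hw => ?_
    rw [← Real.dist_eq]
    refine (hψ.dist_le_mul w z).trans (le_trans ?_ hb2)
    exact mul_le_mul_of_nonneg_left (Metric.mem_ball.1 hw).le C.2
  -- The derivative of the mollification uses the field frozen at `z`, while `ψ` is differentiated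
  -- along the flow. For starting points within `ε` of `z` the two displacements differ by at most
  -- `2εL|τ|`, which costs `δ/2` since `ψ` is Lipschitz; uniform continuity of `ψ'` costs the other
  -- half. No derivative of `ψ` in another direction enters.
  · set b : Phase := charField (gradient (potential Q)) z
    have hline : Filter.Tendsto (fun τ : ℝ => τ⁻¹ • (χ (z + τ • b) - χ z)) (𝓝[≠] 0)
        (𝓝 (transportClassical (potential Q) χ z)) := by
      have := (hsm.differentiable (by simp) z).hasFDerivAt.hasLineDerivAt b
      have := hasDerivAt_iff_tendsto_slope_zero.1 this
      simp only [zero_add, zero_smul, add_zero] at this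
      exact this
    have hnear : ∀ᶠ τ in 𝓝 (0:ℝ), ε * Real.exp (L * |τ|) + dist (h.flow τ z) z < 2 * ε := by
      have hcont : Continuous fun τ : ℝ => ε * Real.exp (L * |τ|) + dist (h.flow τ z) z :=
        (by fun_prop : Continuous fun τ : ℝ => ε * Real.exp (L * |τ|)).add
          ((h.continuous_flow_time z).dist continuous_const)
      refine hcont.continuousAt.eventually (gt_mem_nhds ?_)
      simp [h.flow_zero]
      linarith
    obtain ⟨η₀, hη₀, hball⟩ := Metric.eventually_nhds_iff_ball.1 hnear
    have hclose : ∀ w ∈ Metric.ball z ε, ∀ τ ∈ Metric.ball (0:ℝ) η₀,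
        dist (h.flow τ w) z < 2 * ε := by
      intro w hw τ hτ
      refine lt_of_le_of_lt ((dist_triangle _ (h.flow τ z) _).trans ?_) (hball τ hτ)
      gcongr
      exact (h.dist_flow_le τ w z).trans (mul_le_mul_of_nonneg_right (Metric.mem_ball.1 hw).le
        (Real.exp_pos _).le)
    rw [← Real.dist_eq]
    refine le_of_tendsto (hline.dist tendsto_const_nhds) ?_
    filter_upwards [nhdsWithin_le_nhds (Metric.ball_mem_nhds (0:ℝ) hη₀), self_mem_nhdsWithin]
      with τ hτ hτ0
    have hτ0' : τ ≠ 0 := hτ0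
    have hexist : ∀ g : Phase → ℝ, Continuous g → Integrable fun y => η.normed volume y * g (z - y) :=
      fun g hg => (hηc.mul (hg.comp (continuous_const.sub continuous_id))).integrable_of_hasCompactSupport
        hηcs.mul_right
    have hquot : τ⁻¹ • (χ (z + τ • b) - χ z) = convolution (η.normed volume)
        (fun w => τ⁻¹ * (ψ (w + τ • b) - ψ w)) (ContinuousLinearMap.lsmul ℝ ℝ) volume z := by
      simp only [χ, convolution_def, ContinuousLinearMap.lsmul_apply, smul_eq_mul]
      have e1 : (fun y => η.normed volume y * ψ (z + τ • b - y)) =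
          fun y => η.normed volume y * ψ (z - y + τ • b) := by
        funext y
        congr 2
        abel
      rw [e1, ← integral_sub (hexist (fun w => ψ (w + τ • b))
        (hψ.continuous.comp (continuous_id.add continuous_const))) (hexist ψ hψ.continuous),
        ← integral_const_mul]
      refine integral_congr_ae (Filter.Eventually.of_forall fun y => ?_)
      simp only
      ring
    rw [hquot, Real.dist_eq]
    refine hconv (fun w => τ⁻¹ * (ψ (w + τ • b) - ψ w)) (continuous_const.mul ((hψ.continuous.comp
      (continuous_id.add continuous_const)).sub hψ.continuous)) _ δ z hδ.le fun w hw => ?_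
    have m1 : ‖(h.flow τ w - τ • b) - (h.flow 0 w - (0:ℝ) • b)‖ ≤ (L * (2 * ε)) * ‖τ - 0‖ := by
      refine (convex_ball (0:ℝ) η₀).norm_image_sub_le_of_norm_hasDerivWithin_le
        (f := fun τ => h.flow τ w - τ • b)
        (f' := fun τ => charField (gradient (potential Q)) (h.flow τ w) - (1:ℝ) • b)
        (fun s _ => ((h.hasDerivAt_flow s w).sub ((hasDerivAt_id s).smul_const b)).hasDerivWithinAt)
        (fun s hs => ?_) (Metric.mem_ball_self hη₀) hτ
      rw [one_smul, ← dist_eq_norm]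
      exact (h.lipschitz_field.dist_le_mul _ _).trans
        (mul_le_mul_of_nonneg_left (hclose w hw s hs).le L.2)
    have m2 : ‖(ψ (h.flow τ w) - τ * ψ' z) - (ψ (h.flow 0 w) - 0 * ψ' z)‖ ≤ (δ / 2) * ‖τ - 0‖ := by
      refine (convex_ball (0:ℝ) η₀).norm_image_sub_le_of_norm_hasDerivWithin_le
        (f := fun τ => ψ (h.flow τ w) - τ * ψ' z)
        (f' := fun τ => ψ' (h.flow τ w) - 1 * ψ' z)
        (fun s _ => ((h.hasDerivAt_comp_flow hd s w).sub
          ((hasDerivAt_id s).mul_const (ψ' z))).hasDerivWithinAt)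
        (fun s hs => ?_) (Metric.mem_ball_self hη₀) hτ
      rw [one_mul, ← dist_eq_norm]
      refine (huc ((hclose w hw s hs).trans_le ?_)).le
      have : ε ≤ ε₂ / 2 := (min_le_left _ _).trans (min_le_right _ _)
      linarith
    rw [h.flow_zero, zero_mul, sub_zero, sub_zero, Real.norm_eq_abs, Real.norm_eq_abs] at m2
    rw [h.flow_zero, zero_smul, sub_zero, sub_zero, Real.norm_eq_abs] at m1
    have m3 : |ψ (w + τ • b) - ψ (h.flow τ w)| ≤ C * ((L * (2 * ε)) * |τ|) := by
      rw [← Real.dist_eq]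
      refine (hψ.dist_le_mul _ _).trans (mul_le_mul_of_nonneg_left ?_ C.2)
      rw [dist_comm, dist_eq_norm]
      refine le_trans (le_of_eq ?_) m1
      congr 1
      abel
    have habs : 0 < |τ| := abs_pos.2 hτ0'
    have e : τ⁻¹ * (ψ (w + τ • b) - ψ w) - ψ' z =
        τ⁻¹ * ((ψ (w + τ • b) - ψ (h.flow τ w)) + (ψ (h.flow τ w) - τ * ψ' z - ψ w)) := by
      field_simp
      ring
    rw [e, abs_mul, abs_inv, inv_mul_le_iff₀ habs]
    refine (abs_add_le _ _).trans ((add_le_add m3 m2).trans ?_)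
    nlinarith

section Field

variable {𝕜 : Type} [RCLike 𝕜]

/-- The flow of a Lipschitz field does not preserve smoothness: a test function carried along it is
only Lipschitz, though still differentiable along trajectories. The weak equation has to be extended
to such functions before the flow can act on it. -/
lemma integral_transport_eq_of_weak {f g : Phase → 𝕜} (hf : IntegrableOn f (Omega Q))
    (hg : IntegrableOn g (Omega Q)) (hw : IsWeakTransport Q f g)
    {ψ ψ' : Phase → ℝ} {C : ℝ≥0} (hψ : LipschitzWith C ψ)
    (hc : HasCompactSupport ψ) (hs : tsupport ψ ⊆ Omega Q) (hψ' : UniformContinuous ψ')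
    (hd : ∀ z, HasDerivAt (fun t => ψ (h.flow t z)) (ψ' z) 0) :
    ∫ z in Omega Q, ψ' z • f z = -∫ z in Omega Q, ψ z • g z := by
  rw [eq_neg_iff_add_eq_zero, ← norm_le_zero_iff]
  set K : ℝ := (∫ z in Omega Q, ‖f z‖) + ∫ z in Omega Q, ‖g z‖
  have key : ∀ δ : ℝ, 0 < δ →
      ‖(∫ z in Omega Q, ψ' z • f z) + ∫ z in Omega Q, ψ z • g z‖ ≤ δ * K := by
    intro δ hδ
    obtain ⟨χ, h1, h2, h3⟩ := h.exists_test_approx hψ hc hs hψ' hd hδ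
    obtain ⟨a, b, c⟩ := hw χ h1
    have i1 : IntegrableOn (fun z => (ψ' z - transportClassical (potential Q) χ z) • f z)
        (Omega Q) := by
      refine Integrable.mono' (hf.norm.const_mul δ)
        ((hψ'.continuous.sub (h.continuous_transportClassical h1)).aestronglyMeasurable.smul
          hf.aestronglyMeasurable) (Filter.Eventually.of_forall fun z => ?_)
      rw [norm_smul, Real.norm_eq_abs, abs_sub_comm]
      exact mul_le_mul_of_nonneg_right (h3 z) (norm_nonneg _)
    have i2 : IntegrableOn (fun z => (ψ z - χ z) • g z) (Omega Q) := by
      refine Integrable.mono' (hg.norm.const_mul δ)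
        ((hψ.continuous.sub h1.1.continuous).aestronglyMeasurable.smul
          hg.aestronglyMeasurable) (Filter.Eventually.of_forall fun z => ?_)
      rw [norm_smul, Real.norm_eq_abs, abs_sub_comm]
      exact mul_le_mul_of_nonneg_right (h2 z) (norm_nonneg _)
    have e1 : ∫ z in Omega Q, ψ' z • f z =
        (∫ z in Omega Q, (ψ' z - transportClassical (potential Q) χ z) • f z) +
          ∫ z in Omega Q, transportClassical (potential Q) χ z • f z := by
      rw [← integral_add i1 a]
      refine integral_congr_ae (Filter.Eventually.of_forall fun z => ?_)
      simp only
      rw [← add_smul, sub_add_cancel]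
    have e2 : ∫ z in Omega Q, ψ z • g z =
        (∫ z in Omega Q, (ψ z - χ z) • g z) + ∫ z in Omega Q, χ z • g z := by
      rw [← integral_add i2 b]
      refine integral_congr_ae (Filter.Eventually.of_forall fun z => ?_)
      simp only
      rw [← add_smul, sub_add_cancel]
    have e3 : (∫ z in Omega Q, ψ' z • f z) + ∫ z in Omega Q, ψ z • g z =
        (∫ z in Omega Q, (ψ' z - transportClassical (potential Q) χ z) • f z) +
          ∫ z in Omega Q, (ψ z - χ z) • g z := by
      rw [e1, e2, c]; ring
    rw [e3, mul_add]
    refine (norm_add_le _ _).trans (add_le_add ?_ ?_)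
    · rw [← integral_const_mul]
      refine norm_integral_le_of_norm_le (hf.norm.const_mul δ)
        (Filter.Eventually.of_forall fun z => ?_)
      rw [norm_smul, Real.norm_eq_abs, abs_sub_comm]
      exact mul_le_mul_of_nonneg_right (h3 z) (norm_nonneg _)
    · rw [← integral_const_mul]
      refine norm_integral_le_of_norm_le (hg.norm.const_mul δ)
        (Filter.Eventually.of_forall fun z => ?_)
      rw [norm_smul, Real.norm_eq_abs, abs_sub_comm]
      exact mul_le_mul_of_nonneg_right (h2 z) (norm_nonneg _)
  have hlim : Filter.Tendsto (fun δ : ℝ => δ * K) (𝓝[>] 0) (𝓝 0) := by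
    have : Filter.Tendsto (fun δ : ℝ => δ * K) (𝓝 0) (𝓝 (0 * K)) :=
      Filter.tendsto_id.mul_const K
    rw [zero_mul] at this
    exact this.mono_left nhdsWithin_le_nhds
  refine ge_of_tendsto hlim ?_
  filter_upwards [self_mem_nhdsWithin] with δ hδ using key δ hδ

lemma hasDerivAt_integral_test {f : Phase → 𝕜} (hf : IntegrableOn f (Omega Q)) {U : Set Phase}
    {ψ : Phase → ℝ} (hψ : IsTest U ψ) (t : ℝ) :
    HasDerivAt (fun t => ∫ z in Omega Q, ψ (h.flow t z) • f z)
      (∫ z in Omega Q, transportClassical (potential Q) ψ (h.flow t z) • f z) t := by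
  obtain ⟨M, hM⟩ := exists_bound_of_hasCompactSupport (h.continuous_transportClassical hψ)
    (hasCompactSupport_transportClassical hψ)
  obtain ⟨B, hB⟩ := exists_bound_of_hasCompactSupport hψ.1.continuous hψ.2.1
  refine (hasDerivAt_integral_of_dominated_loc_of_deriv_le (s := univ)
    (F := fun t z => ψ (h.flow t z) • f z)
    (F' := fun t z => transportClassical (potential Q) ψ (h.flow t z) • f z)
    (bound := fun z => M * ‖f z‖) Filter.univ_mem
    (Filter.Eventually.of_forall fun s =>
      (hψ.1.continuous.comp (h.continuous_flow_apply s)).aestronglyMeasurable.smul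
        hf.aestronglyMeasurable) ?_
    (((h.continuous_transportClassical hψ).comp
      (h.continuous_flow_apply t)).aestronglyMeasurable.smul hf.aestronglyMeasurable)
    (Filter.Eventually.of_forall fun z s _ => ?_) (hf.norm.const_mul M)
    (Filter.Eventually.of_forall fun z s _ => ?_)).2
  · refine Integrable.mono' (hf.norm.const_mul B)
      ((hψ.1.continuous.comp (h.continuous_flow_apply t)).aestronglyMeasurable.smul
        hf.aestronglyMeasurable) (Filter.Eventually.of_forall fun z => ?_)
    rw [norm_smul, Real.norm_eq_abs]
    exact mul_le_mul_of_nonneg_right (hB _) (norm_nonneg _)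
  · rw [norm_smul, Real.norm_eq_abs]
    exact mul_le_mul_of_nonneg_right (hM _) (norm_nonneg _)
  · exact (h.hasDerivAt_comp_flow (h.hasDerivAt_test hψ) s z).smul_const (f z)

lemma integral_comp_flow {G : Phase → 𝕜} (t : ℝ) :
    ∫ z in Omega Q, G (h.flow t z) = ∫ z in Omega Q, G z :=
  (h.measurePreserving_flow_Omega t).integral_comp (h.flowHomeo t).measurableEmbedding G

lemma integral_koopman (f : L2r 𝕜 Q F) (ψ : Phase → ℝ) (t : ℝ) :
    ∫ z in Omega Q, ψ z • ((h.koopman 𝕜).toFun t f : Phase → 𝕜) z =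
      ∫ z in Omega Q, ψ (h.flow (-t) z) • (f : Phase → 𝕜) z := by
  have e : ∫ z in Omega Q, ψ z • ((h.koopman 𝕜).toFun t f : Phase → 𝕜) z =
      ∫ z in Omega Q, ψ z • (f : Phase → 𝕜) (h.flow t z) := by
    refine integral_congr_ae ?_
    filter_upwards [h.koopman_ae t f] with z hz
    rw [hz]
  rw [e, ← h.integral_comp_flow (-t)]
  simp only [h.flow_apply_neg]

/-- By volume preservation `∫ ψ U_t f = ∫ (ψ ∘ Φ_{-t}) f` for the flow `Φ`. The two sides are
differentiated at `t = 0`, one by the generator and the other under the integral. -/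
lemma isWeakTransport_of_isGenerator {f g : L2r 𝕜 Q F} (hfg : (h.koopman 𝕜).IsGenerator f g) :
    IsWeakTransport Q (f : Phase → 𝕜) (g : Phase → 𝕜) := by
  intro ψ hψ
  obtain ⟨M, hM⟩ := exists_bound_of_hasCompactSupport (h.continuous_transportClassical hψ)
    (hasCompactSupport_transportClassical hψ)
  obtain ⟨B, hB⟩ := exists_bound_of_hasCompactSupport hψ.1.continuous hψ.2.1
  obtain ⟨k', _, hk'⟩ := h.exists_pairing (𝕜 := 𝕜)
    (h.continuous_transportClassical hψ).aestronglyMeasurable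
    fun z _ => hM z
  obtain ⟨k, _, hk⟩ := h.exists_pairing (𝕜 := 𝕜) hψ.1.continuous.aestronglyMeasurable
      fun z _ => hB z
  refine ⟨(hk' f.1).1, (hk g.1).1, ?_⟩
  have d1 := (((innerSL 𝕜 k).comp (lpMeas 𝕜 𝕜 radialSigma 2 (weighted Q F)).subtypeL).restrictScalars
    ℝ).hasFDerivAt.comp_hasDerivAt 0 hfg
  have d2 : HasDerivAt (fun t => ∫ z in Omega Q, ψ (h.flow (-t) z) • (f : Phase → 𝕜) z)
      (∫ z in Omega Q, ψ z • (g : Phase → 𝕜) z) 0 := by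
    refine (d1.congr_deriv (hk g.1).2).congr_of_eventuallyEq (Filter.Eventually.of_forall fun t => ?_)
    exact ((hk ((h.koopman 𝕜).toFun t f).1).2.trans (h.integral_koopman f ψ t)).symm
  have d3 := (h.hasDerivAt_integral_test (h.integrableOn_coe f.1) hψ (-0)).scomp 0
    (hasDerivAt_neg (0:ℝ))
  have := d3.unique d2
  rw [neg_zero, neg_one_smul] at this
  simp only [h.flow_zero] at this
  rw [← this, neg_neg]

/-- The pairing of `ψ` with `U_s f` is that of `ψ ∘ Φ_{-s}` with `f`. The extended weak equation,
applied to `ψ ∘ Φ_{-s}`, shows that its derivative is the pairing of `ψ` with `U_s g`. Integrating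
in `s` and varying `ψ` identifies `U_t f - f` with `∫₀ᵗ U_s g ds`. -/
lemma isGenerator_of_isWeakTransport {f g : L2r 𝕜 Q F}
    (hfg : IsWeakTransport Q (f : Phase → 𝕜) (g : Phase → 𝕜)) :
    (h.koopman 𝕜).IsGenerator f g := by
  refine IsometryGroup.isGenerator_of_sub_eq_integral fun t => ?_
  rw [← sub_eq_zero]
  set u := (h.koopman 𝕜).toFun t f - f - ∫ s in (0:ℝ)..t, (h.koopman 𝕜).toFun s g with hu
  have hpair : ∀ ψ, IsTest (Omega Q) ψ → ∫ z in Omega Q, ψ z • (u : Phase → 𝕜) z = 0 := by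
    intro ψ hψ
    obtain ⟨B, hB⟩ := exists_bound_of_hasCompactSupport hψ.1.continuous hψ.2.1
    obtain ⟨C, hC⟩ := hψ.exists_lipschitz
    obtain ⟨k, _, hk⟩ := h.exists_pairing (𝕜 := 𝕜) hψ.1.continuous.aestronglyMeasurable
      fun z _ => hB z
    set Λ : L2r 𝕜 Q F →L[𝕜] 𝕜 :=
      (innerSL 𝕜 k).comp (lpMeas 𝕜 𝕜 radialSigma 2 (weighted Q F)).subtypeL
    have hΛ : ∀ w : L2r 𝕜 Q F, Λ w = ∫ z in Omega Q, ψ z • (w : Phase → 𝕜) z := fun w => (hk w.1).2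
    rw [← hΛ, hu, map_sub, map_sub, sub_eq_zero]
    have hcg := (h.koopman 𝕜).continuous_apply g
    have hint := (Λ.restrictScalars ℝ).intervalIntegral_comp_comm
      (hcg.intervalIntegrable (μ := volume) 0 t)
    refine Eq.trans ?_ hint
    have hder : ∀ s, HasDerivAt (fun s => Λ ((h.koopman 𝕜).toFun s f))
        (Λ ((h.koopman 𝕜).toFun s g)) s := by
      intro s
      have d3 := (h.hasDerivAt_integral_test (h.integrableOn_coe f.1) hψ (-s)).scomp s
        (hasDerivAt_neg s)
      refine (d3.congr_deriv ?_).congr_of_eventuallyEq (Filter.Eventually.of_forall fun s' => ?_)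
      · have hlip : LipschitzWith (C * Real.toNNReal (Real.exp ((max 1 h.lipConst : ℝ≥0) * |-s|)))
            (fun z => ψ (h.flow (-s) z)) := by
          refine hC.comp (LipschitzWith.of_dist_le_mul fun z w => ?_)
          rw [Real.coe_toNNReal _ (Real.exp_pos _).le, mul_comm]
          exact h.dist_flow_le (-s) z w
        have hcs : HasCompactSupport (fun z => ψ (h.flow (-s) z)) :=
          hψ.2.1.comp_homeomorph (h.flowHomeo (-s))
        have hsupp : tsupport (fun z => ψ (h.flow (-s) z)) ⊆ Omega Q := by
          intro z hz
          have : h.flow (-s) z ∈ tsupport ψ :=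
            tsupport_comp_subset_preimage ψ (h.continuous_flow_apply (-s)) hz
          exact h.flow_mem_Omega.1 (hψ.2.2 this)
        have huc : UniformContinuous fun z => transportClassical (potential Q) ψ (h.flow (-s) z) := by
          exact HasCompactSupport.uniformContinuous_of_continuous
            ((hasCompactSupport_transportClassical hψ).comp_homeomorph (h.flowHomeo (-s)))
            ((h.continuous_transportClassical hψ).comp (h.continuous_flow_apply (-s)))
        have hw := h.integral_transport_eq_of_weak (h.integrableOn_coe f.1)
          (h.integrableOn_coe g.1) hfg hlip hcs hsupp huc (fun z => by
            have := h.hasDerivAt_comp_flow (h.hasDerivAt_test hψ) (-s) z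
            have h2 : HasDerivAt (fun t => ψ (h.flow t z))
              (transportClassical (potential Q) ψ (h.flow (-s) z)) (-s + 0) := by rwa [add_zero]
            have h3 := h2.comp_const_add (-s) 0
            refine h3.congr_of_eventuallyEq (Filter.Eventually.of_forall fun t => ?_)
            change ψ (h.flow (-s) (h.flow t z)) = ψ (h.flow (-s + t) z)
            rw [h.flow_add])
        rw [hw, neg_one_smul, neg_neg, hΛ, h.integral_koopman]
      · exact (hΛ _).trans (h.integral_koopman f ψ s')
    have := intervalIntegral.integral_eq_sub_of_hasDerivAt (fun s _ => hder s)
      ((Λ.continuous.comp hcg).intervalIntegrable 0 t)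
    rw [(h.koopman 𝕜).zero_apply] at this
    exact this.symm
  refine Subtype.ext (Lp.ext ?_)
  have := ae_eq_zero_of_forall_test h.isOpen_Omega (h.integrableOn_coe u.1) hpair
  filter_upwards [h.ae_weighted_iff.2 this, Lp.coeFn_zero 𝕜 2 (weighted Q F)] with z h1 h2
  rw [h1]
  exact h2.symm

theorem mem_graph_transport_iff (f g : L2r 𝕜 Q F) :
    (f, g) ∈ (h.transport 𝕜).graph ↔ (h.koopman 𝕜).IsGenerator f g := by
  rw [h.mem_graph_transport 𝕜]
  exact ⟨h.isGenerator_of_isWeakTransport, h.isWeakTransport_of_isGenerator⟩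

end Field

end IsAdmissible

end VlasovPoisson
end

/-! ### Radial oscillations and the kernel of `𝒯`. -/

noncomputable section
namespace VlasovPoisson
open scoped ENNReal NNReal Topology

section Oscillation

variable {a p w : ℝ → ℝ} {M : ℝ}

lemma le_add_mul_of_hasDerivAt_le {f f' : ℝ → ℝ} (hf : ∀ t, HasDerivAt f (f' t) t) {s t C : ℝ}
    (hst : s ≤ t) (hC : ∀ u ∈ Ioo s t, f' u ≤ C) : f t ≤ f s + C * (t - s) := by
  have := (convex_Icc s t).image_sub_le_mul_sub_of_deriv_le
    (fun u _ => (hf u).continuousAt.continuousWithinAt)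
    (fun u _ => (hf u).differentiableAt.differentiableWithinAt) (C := C)
    (fun u hu => by rw [interior_Icc] at hu; rw [(hf u).deriv]; exact hC u hu)
    s (left_mem_Icc.2 hst) t (right_mem_Icc.2 hst) hst
  linarith

/-- A negative slope could only become more negative, so over the time `(2M + 1) / (-p t)` the
function would fall by at least `2M + 1`, more than the bound `|a| ≤ M` allows. -/
lemma nonneg_deriv_of_bounded (ha : ∀ t, HasDerivAt a (p t) t) (hM : ∀ t, |a t| ≤ M) {T : ℝ}
    (hp : AntitoneOn p (Ici T)) {t : ℝ} (ht : T ≤ t) : 0 ≤ p t := by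
  by_contra! hneg
  have hM0 : 0 ≤ M := (abs_nonneg _).trans (hM 0)
  set u := t + (2 * M + 1) / (-p t)
  have hu : t ≤ u := le_add_of_nonneg_right (div_nonneg (by linarith) (by linarith))
  have := le_add_mul_of_hasDerivAt_le ha hu (C := p t)
    (fun s hs => hp ht (ht.trans hs.1.le) hs.1.le)
  have e : p t * (u - t) = -(2 * M + 1) := by
    have hne : p t ≠ 0 := hneg.ne
    simp only [u, add_sub_cancel_left]
    field_simp
  have h1 := abs_le.1 (hM u)
  have h2 := abs_le.1 (hM t)
  rw [e] at this
  linarith [h1.1, h2.2]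

lemma antitoneOn_of_hasDerivAt_nonpos (hp : ∀ t, HasDerivAt p (w t) t) {T : ℝ}
    (hw : ∀ t, T ≤ t → w t ≤ 0) : AntitoneOn p (Ici T) := by
  intro s hs t _ hst
  have := le_add_mul_of_hasDerivAt_le hp hst (C := 0) (fun u hu => hw u (le_trans hs hu.1.le))
  linarith

/-- A bounded trajectory under an attractive force cannot stay on one side for ever. -/
lemma not_eventually_pos (ha : ∀ t, HasDerivAt a (p t) t) (hp : ∀ t, HasDerivAt p (w t) t)
    (hM : ∀ t, |a t| ≤ M) (hpos : ∀ c, 0 < c → ∃ d, 0 < d ∧ ∀ t, c ≤ a t → w t ≤ -d) (T : ℝ) :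
    ∃ t, T ≤ t ∧ a t ≤ 0 := by
  by_contra! hcon
  have hw : ∀ t, T ≤ t → w t ≤ 0 := fun t ht => by
    obtain ⟨d, hd, hdt⟩ := hpos (a t) (hcon t ht)
    linarith [hdt t le_rfl]
  have hanti := antitoneOn_of_hasDerivAt_nonpos hp hw
  have hp0 : ∀ t, T ≤ t → 0 ≤ p t := fun t ht => nonneg_deriv_of_bounded ha hM hanti ht
  obtain ⟨d, hd, hdt⟩ := hpos (a T) (hcon T le_rfl)
  have hmono : ∀ t, T ≤ t → a T ≤ a t := fun t ht => by
    have := le_add_mul_of_hasDerivAt_le (f := fun t => -a t) (fun t => (ha t).neg) ht (C := 0)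
      (fun u hu => by have := hp0 u hu.1.le; linarith)
    linarith
  -- As long as `a` stays above `a T` the force is at most `-d`, so `p` would have reached `-1` by
  -- time `u`.
  set u := T + (p T + 1) / d
  have hu : T ≤ u := le_add_of_nonneg_right (div_nonneg (by linarith [hp0 T le_rfl]) hd.le)
  have := le_add_mul_of_hasDerivAt_le hp hu (C := -d) (fun s hs => hdt s (hmono s hs.1.le))
  have e : -d * (u - T) = -(p T + 1) := by
    simp only [u, add_sub_cancel_left]
    field_simp
  linarith [hp0 u hu]

/-- If `a` is eventually nonnegative, it must touch zero, and boundedness makes the slope there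
nonnegative. Otherwise `a` is negative at some time and nonnegative later; at the first return to
zero the slope is nonnegative. The zero-force hypothesis at `a = 0` includes circular orbits. -/
lemma exists_outward_crossing (ha : ∀ t, HasDerivAt a (p t) t) (hp : ∀ t, HasDerivAt p (w t) t)
    (hM : ∀ t, |a t| ≤ M) (hpos : ∀ c, 0 < c → ∃ d, 0 < d ∧ ∀ t, c ≤ a t → w t ≤ -d)
    (hneg : ∀ c, 0 < c → ∃ d, 0 < d ∧ ∀ t, a t ≤ -c → d ≤ w t) (hzero : ∀ t, a t = 0 → w t = 0) :
    ∃ t, a t = 0 ∧ 0 ≤ p t := by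
  have hc : Continuous a := continuous_iff_continuousAt.2 fun t => (ha t).continuousAt
  by_cases hcase : ∃ T, ∀ t, T ≤ t → 0 ≤ a t
  · obtain ⟨T, hT⟩ := hcase
    obtain ⟨t, ht, hat⟩ := not_eventually_pos ha hp hM hpos T
    have hw : ∀ t, T ≤ t → w t ≤ 0 := fun t ht => by
      rcases (hT t ht).eq_or_lt with h0 | h0
      · exact (hzero t h0.symm).le
      · obtain ⟨d, hd, hdt⟩ := hpos (a t) h0
        linarith [hdt t le_rfl]
    exact ⟨t, le_antisymm hat (hT t ht),
      nonneg_deriv_of_bounded ha hM (antitoneOn_of_hasDerivAt_nonpos hp hw) ht⟩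
  · push Not at hcase
    obtain ⟨t, _, hat⟩ := hcase 0
    obtain ⟨t', htt', hat'⟩ := not_eventually_pos (a := fun t => -a t) (p := fun t => -p t)
      (w := fun t => -w t) (M := M) (fun t => (ha t).neg) (fun t => (hp t).neg)
      (fun t => by rw [abs_neg]; exact hM t)
      (fun c hc => by
        obtain ⟨d, hd, hdt⟩ := hneg c hc
        exact ⟨d, hd, fun t ht => neg_le_neg (hdt t (by linarith))⟩) t
    have hat'' : 0 ≤ a t' := by linarith
    set S : Set ℝ := Icc t t' ∩ a ⁻¹' Ici 0
    have hS : IsCompact S := isCompact_Icc.inter_right (isClosed_Ici.preimage hc)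
    obtain ⟨s, hs, hmin⟩ := hS.exists_isLeast ⟨t', ⟨htt', le_rfl⟩, hat''⟩
    have hts : t < s := lt_of_le_of_ne hs.1.1 (by
      rintro rfl
      exact absurd hs.2 (not_le.2 hat))
    have hbelow : ∀ u ∈ Ico t s, a u < 0 := fun u hu => by
      by_contra! hge
      exact absurd (hmin ⟨⟨hu.1, hu.2.le.trans hs.1.2⟩, hge⟩) (not_le.2 hu.2)
    have hleft : Ico t s ∈ 𝓝[<] s := Ico_mem_nhdsLT hts
    have has : a s = 0 := by
      refine le_antisymm ?_ hs.2
      refine le_of_tendsto (hc.continuousAt.tendsto.mono_left nhdsWithin_le_nhds :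
        Filter.Tendsto a (𝓝[<] s) (𝓝 (a s))) ?_
      filter_upwards [hleft] with u hu using (hbelow u hu).le
    refine ⟨s, has, ?_⟩
    have hsl := (hasDerivAt_iff_tendsto_slope.1 (ha s)).mono_left
      (nhdsWithin_mono s (fun u (hu : u < s) => ne_of_lt hu) : 𝓝[<] s ≤ 𝓝[≠] s)
    refine ge_of_tendsto hsl ?_
    filter_upwards [hleft] with u hu
    rw [slope_def_field, has, sub_zero]
    exact div_nonneg_of_nonpos (hbelow u hu).le (by linarith [hu.2])

end Oscillation

namespace IsAdmissible

variable {Q : Phase → ℝ} {F : ℝ → ℝ → ℝ} {e₀ : ℝ} (h : IsAdmissible Q F e₀)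
include h

/-- The squared angular momentum of the circular orbit of radius `r`. -/
lemma mean_mul_pow_four {r : ℝ} (hr : 0 < r) :
    h.mean r * r ^ 4 = ballMass (density Q) r * r / (4 * Real.pi) := by
  have := Real.pi_pos
  unfold mean meanField
  field_simp

lemma ballMass_mono {r s : ℝ} (hrs : r ≤ s) :
    ballMass (density Q) r ≤ ballMass (density Q) s :=
  VlasovPoisson.ballMass_mono h.density_nonneg h.density_integrable hrs

lemma exists_ballMass_pos : ∃ r, 0 < r ∧ 0 < ballMass (density Q) r := by
  obtain ⟨z, hz⟩ : ∃ z, Q z ≠ 0 := Function.ne_iff.1 h.ne_zero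
  have hz' : z ∈ Omega Q := lt_of_le_of_ne (h.nonneg z) hz.symm
  have hd := h.density_pos hz'
  refine ⟨‖z.1‖ + 1, by positivity, ?_⟩
  unfold ballMass
  rw [setIntegral_pos_iff_support_of_nonneg_ae (Filter.Eventually.of_forall h.density_nonneg)
    h.density_integrable.integrableOn]
  have ho : IsOpen (Function.support (density Q) ∩ Metric.ball (0 : E3) (‖z.1‖ + 1)) :=
    (h.density_continuous.isOpen_support).inter Metric.isOpen_ball
  exact ho.measure_pos volume ⟨z.1, hd.ne', by simp⟩

lemma continuousOn_ballMass : ContinuousOn (ballMass (density Q)) (Ioi 0) := by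
  obtain ⟨R, hR, hρ⟩ := h.exists_profile
  exact fun r hr => (hasDerivAt_ballMass hR hρ hr).continuousAt.continuousWithinAt

/-- Up to a constant `m(r) r⁴` is `r` times the mass within `r`. It is continuous, small for small
`r` and unbounded for large `r`, and the intermediate value theorem applies. -/
lemma exists_circRadius {l : ℝ} (hl : 0 < l) : ∃ r, 0 < r ∧ h.mean r * r ^ 4 = l := by
  have hpi := Real.pi_pos
  obtain ⟨R, hR, hm⟩ := h.exists_ballMass_pos
  set m : ℝ → ℝ := fun r => ballMass (density Q) r * r / (4 * Real.pi)
  have hmc : ContinuousOn m (Ioi 0) := (h.continuousOn_ballMass.mul continuousOn_id).div_const _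
  set A := ballMass (density Q) R
  set r₂ := max R (4 * Real.pi * l / A)
  have hr2 : 0 < r₂ := lt_max_of_lt_left hR
  have hm2 : l ≤ m r₂ := by
    have h1 : A ≤ ballMass (density Q) r₂ := h.ballMass_mono (le_max_left _ _)
    have h2 : 4 * Real.pi * l / A ≤ r₂ := le_max_right _ _
    rw [div_le_iff₀ hm] at h2
    simp only [m]
    rw [le_div_iff₀ (by positivity)]
    nlinarith
  set B := ballMass (density Q) r₂
  have hB : 0 < B := hm.trans_le (h.ballMass_mono (le_max_left _ _))
  set r₁ := min r₂ (4 * Real.pi * l / B)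
  have hr1 : 0 < r₁ := by positivity
  have hm1 : m r₁ ≤ l := by
    have h1 : ballMass (density Q) r₁ ≤ B := h.ballMass_mono (min_le_left _ _)
    have h2 : r₁ ≤ 4 * Real.pi * l / B := min_le_right _ _
    rw [le_div_iff₀ hB] at h2
    simp only [m]
    rw [div_le_iff₀ (by positivity)]
    nlinarith
  obtain ⟨r, hr, hre⟩ := intermediate_value_Icc (min_le_left _ _ : r₁ ≤ r₂)
    (hmc.mono fun x hx => hr1.trans_le hx.1) ⟨hm1, hm2⟩
  have hr0 : 0 < r := hr1.trans_le hr.1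
  exact ⟨r, hr0, by rw [h.mean_mul_pow_four hr0]; exact hre⟩

/-- Past a circular orbit, the squared angular momentum of circular orbits increases strictly. -/
lemma mean_mul_pow_four_lt {r s : ℝ} (hr : 0 < r) (hrs : r < s) (hs : 0 < h.mean s * s ^ 4) :
    h.mean r * r ^ 4 < h.mean s * s ^ 4 := by
  have hpi := Real.pi_pos
  have hs0 := hr.trans hrs
  rw [h.mean_mul_pow_four hs0] at hs ⊢
  rw [h.mean_mul_pow_four hr]
  have h1 : 0 < ballMass (density Q) s * s := by
    by_contra! hc
    exact absurd hs (not_lt.2 (div_nonpos_of_nonpos_of_nonneg hc (by positivity)))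
  have h2 : 0 < ballMass (density Q) s := (pos_iff_pos_of_mul_pos h1).2 hs0
  refine div_lt_div_of_pos_right ?_ (by positivity)
  calc ballMass (density Q) r * r ≤ ballMass (density Q) s * r :=
        mul_le_mul_of_nonneg_right (h.ballMass_mono hrs.le) hr.le
    _ < _ := mul_lt_mul_of_pos_left hrs h2

lemma mean_mul_pow_four_le {r s : ℝ} (hr : 0 < r) (hrs : r ≤ s) :
    h.mean r * r ^ 4 ≤ h.mean s * s ^ 4 := by
  have hpi := Real.pi_pos
  rw [h.mean_mul_pow_four hr, h.mean_mul_pow_four (hr.trans_le hrs)]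
  gcongr
  · exact ballMass_nonneg h.density_nonneg s
  · exact h.ballMass_mono hrs

omit h in
/-- The radius of the circular orbits with squared angular momentum `l`. -/
def circRadius (h : IsAdmissible Q F e₀) (l : ℝ) : ℝ := sInf {r | 0 < r ∧ l ≤ h.mean r * r ^ 4}

lemma circRadius_eq {l r : ℝ} (hr : 0 < r) (hl : 0 < l) (hrl : h.mean r * r ^ 4 = l) :
    h.circRadius l = r := by
  have : {r | 0 < r ∧ l ≤ h.mean r * r ^ 4} = Ici r := by
    ext s
    constructor
    · rintro ⟨hs, hls⟩
      by_contra! hc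
      have := h.mean_mul_pow_four_lt hs (not_le.1 hc) (by rwa [hrl])
      linarith
    · intro hs
      exact ⟨hr.trans_le hs, hrl ▸ h.mean_mul_pow_four_le hr hs⟩
  rw [circRadius, this, csInf_Ici]

lemma circRadius_pos {l : ℝ} (hl : 0 < l) : 0 < h.circRadius l := by
  obtain ⟨r, hr, hrl⟩ := h.exists_circRadius hl
  rwa [h.circRadius_eq hr hl hrl]

lemma mean_circRadius {l : ℝ} (hl : 0 < l) :
    h.mean (h.circRadius l) * h.circRadius l ^ 4 = l := by
  obtain ⟨r, hr, hrl⟩ := h.exists_circRadius hl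
  rwa [h.circRadius_eq hr hl hrl]

lemma measurable_circRadius : Measurable h.circRadius := by
  refine Monotone.measurable fun l l' hll' => ?_
  -- The maximum with `1` supplies a point of the set even when `l'` is not positive, so that the
  -- infima compare.
  obtain ⟨r, hr, hrl⟩ := h.exists_circRadius (l := max l' 1) (by positivity)
  exact csInf_le_csInf ⟨0, fun r hr => hr.1.le⟩ ⟨r, hr, hrl ▸ le_max_left _ _⟩
    fun r hr => ⟨hr.1, hll'.trans hr.2⟩

section Orbit

variable {z : Phase} (hz : 0 < angMom z)
include hz

lemma norm_fst_flow_pos (t : ℝ) : 0 < ‖(h.flow t z).1‖ := norm_pos_iff.2 (h.fst_flow_ne_zero hz t)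

lemma hasDerivAt_norm_fst (t : ℝ) : HasDerivAt (fun t => ‖(h.flow t z).1‖)
    (⟪(h.flow t z).1, (h.flow t z).2⟫ / ‖(h.flow t z).1‖) t := by
  have hp := h.norm_fst_flow_pos hz t
  have := (h.hasDerivAt_normSq_fst t z).sqrt (by positivity)
  refine (this.congr_deriv ?_).congr_of_eventuallyEq (Filter.Eventually.of_forall fun s => ?_)
  · rw [Real.sqrt_sq hp.le]
    field_simp
  · exact (Real.sqrt_sq (norm_nonneg _)).symm

lemma hasDerivAt_radialVelocity (t : ℝ) :
    HasDerivAt (fun t => ⟪(h.flow t z).1, (h.flow t z).2⟫ / ‖(h.flow t z).1‖)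
      ((angMom z - h.mean ‖(h.flow t z).1‖ * ‖(h.flow t z).1‖ ^ 4) / ‖(h.flow t z).1‖ ^ 3) t := by
  have hp := h.norm_fst_flow_pos hz t
  refine ((h.hasDerivAt_inner t z).div (h.hasDerivAt_norm_fst hz t) hp.ne').congr_deriv ?_
  rw [← h.angMom_flow t z, angMom_eq]
  field_simp
  ring

end Orbit

/-- The radius obeys `r'' = (ℓ - m(r) r⁴) / r³`, a force directed towards the circular radius by
monotonicity of `m(r) r⁴`. At a given distance from that radius the force is bounded below, since `r
< h.radius` on `Ω`, so the oscillation lemma applies to `r` minus the circular radius. -/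
lemma exists_flow_circRadius {z : Phase} (hz : z ∈ Omega Q) (hl : 0 < angMom z) :
    ∃ t, ‖(h.flow t z).1‖ = h.circRadius (angMom z) ∧
      0 ≤ ⟪(h.flow t z).1, (h.flow t z).2⟫ := by
  set l := angMom z
  set ρ := h.circRadius l
  have hρ : 0 < ρ := h.circRadius_pos hl
  have hρl : h.mean ρ * ρ ^ 4 = l := h.mean_circRadius hl
  have hR := h.radius_pos
  have hlt : ∀ t, ‖(h.flow t z).1‖ < h.radius := fun t =>
    h.norm_fst_lt_radius (h.flow_mem_Omega.2 hz)
  obtain ⟨t, h1, h2⟩ := exists_outward_crossing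
    (a := fun t => ‖(h.flow t z).1‖ - ρ) (M := h.radius + ρ)
    (fun t => (h.hasDerivAt_norm_fst hl t).sub_const ρ) (h.hasDerivAt_radialVelocity hl)
    (fun t => by
      have := norm_nonneg (h.flow t z).1
      have := hlt t
      rw [abs_le]; constructor <;> linarith)
    (fun c hc => by
      have hd : l < h.mean (ρ + c) * (ρ + c) ^ 4 := by
        rw [← hρl]
        refine h.mean_mul_pow_four_lt hρ (by linarith) ?_
        exact hl.trans_le (hρl ▸ h.mean_mul_pow_four_le hρ (by linarith))
      refine ⟨(h.mean (ρ + c) * (ρ + c) ^ 4 - l) / h.radius ^ 3,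
        div_pos (by linarith) (by positivity), fun t ht => ?_⟩
      have hp := h.norm_fst_flow_pos hl t
      have hm : h.mean (ρ + c) * (ρ + c) ^ 4 ≤
          h.mean ‖(h.flow t z).1‖ * ‖(h.flow t z).1‖ ^ 4 :=
        h.mean_mul_pow_four_le (by linarith) (by linarith)
      rw [← neg_div_neg_eq, div_neg, neg_sub]
      refine neg_le_neg ?_
      refine div_le_div₀ (by linarith) (by linarith) (by positivity) ?_
      exact pow_le_pow_left₀ hp.le (hlt t).le 3)
    (fun c hc => by
      by_cases hcρ : ρ ≤ c
      · refine ⟨1, one_pos, fun t ht => ?_⟩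
        have hp := h.norm_fst_flow_pos hl t
        linarith
      · push Not at hcρ
        have hd : h.mean (ρ - c) * (ρ - c) ^ 4 < l := by
          conv_rhs => rw [← hρl]
          exact h.mean_mul_pow_four_lt (by linarith) (by linarith) (by rwa [hρl])
        refine ⟨(l - h.mean (ρ - c) * (ρ - c) ^ 4) / h.radius ^ 3,
          div_pos (by linarith) (by positivity), fun t ht => ?_⟩
        have hp := h.norm_fst_flow_pos hl t
        have hm : h.mean ‖(h.flow t z).1‖ * ‖(h.flow t z).1‖ ^ 4 ≤
            h.mean (ρ - c) * (ρ - c) ^ 4 :=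
          h.mean_mul_pow_four_le hp (by linarith)
        refine div_le_div₀ (by linarith) (by linarith) (by positivity) ?_
        exact pow_le_pow_left₀ hp.le (hlt t).le 3)
    (fun t ht => by
      have e : ‖(h.flow t z).1‖ = ρ := by linarith
      rw [e, hρl, sub_self, zero_div])
  refine ⟨t, by linarith, ?_⟩
  have hp := h.norm_fst_flow_pos hl t
  have := mul_nonneg h2 hp.le
  rwa [div_mul_cancel₀ _ hp.ne'] at this

omit h in
/-- A representative of the orbits with given energy and angular momentum. -/
def orbitPoint (h : IsAdmissible Q F e₀) (p : ℝ × ℝ) : Phase :=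
  invariantsSection (h.circRadius p.2,
    Real.sqrt (2 * (p.1 - h.radialPotential (h.circRadius p.2))),
    Real.sqrt (h.circRadius p.2 ^ 2 * (2 * (p.1 - h.radialPotential (h.circRadius p.2))) - p.2))

lemma measurable_orbitPoint : Measurable h.orbitPoint := by
  have h1 : Measurable fun p : ℝ × ℝ => h.circRadius p.2 :=
    h.measurable_circRadius.comp measurable_snd
  have h2 := h.measurable_radialPotential.comp h1
  have h3 : Measurable fun p : ℝ × ℝ => 2 * (p.1 - h.radialPotential (h.circRadius p.2)) :=
    (measurable_fst.sub h2).const_mul 2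
  exact measurable_invariantsSection.comp
    (h1.prodMk (h3.sqrt.prodMk (((h1.pow_const 2).mul h3).sub measurable_snd).sqrt))

/-- At the crossing `|x|` is the circular radius, conservation of energy gives `|v|`, and
conservation of `ℓ` gives `(x·v)²`. The outward direction fixes the sign of the root. -/
lemma exists_flow_orbitPoint {z : Phase} (hz : z ∈ Omega Q) (hl : 0 < angMom z) :
    ∃ t, invariants (h.flow t z) =
      invariants (h.orbitPoint (energy (potential Q) z, angMom z)) := by
  obtain ⟨t, h1, h2⟩ := h.exists_flow_circRadius hz hl
  refine ⟨t, ?_⟩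
  rw [← invariants_invariantsSection (h.flow t z)]
  congr 2
  have he := h.energy_flow hl t
  have hv : ‖(h.flow t z).2‖ ^ 2 =
      2 * (energy (potential Q) z - h.radialPotential (h.circRadius (angMom z))) := by
    rw [← h1, ← h.potential_eq_radial (h.fst_flow_ne_zero hl t), ← he]
    unfold energy
    ring
  have ha := h.angMom_flow t z
  rw [angMom_eq] at ha
  simp only [invariants, Prod.mk.injEq]
  refine ⟨h1, ?_, ?_⟩
  · rw [← hv, Real.sqrt_sq (norm_nonneg _)]
  · rw [← hv, ← h1, ← ha, sub_sub_cancel, Real.sqrt_sq h2]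

section Field

variable {𝕜 : Type} [RCLike 𝕜]

/-- Invariance holds almost everywhere for each time, so by Fubini almost every `z` has `f₀`
constant along its trajectory for almost all times. A single representative point may be
exceptional; hence `f̃` is the mean of `f₀` over unit time from the representative. A time shift
preserves null sets and identifies this mean with `f₀ z`. -/
lemma isFunctionOfEnergyMomentum_of_invariant {f : L2r 𝕜 Q F}
    (hf : ∀ t, (h.koopman 𝕜).toFun t f = f) :
    IsFunctionOfEnergyMomentum Q (f : Phase → 𝕜) := by
  obtain ⟨f₀, hm, hff⟩ := mem_lpMeas_iff_aestronglyMeasurable.1 f.2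
  have hff' : (f : Phase → 𝕜) =ᵐ[volume.restrict (Omega Q)] f₀ := h.ae_weighted_iff.1 hff
  have hinv : ∀ a b, invariants a = invariants b → f₀ a = f₀ b := fun a b hab =>
    hm.factorsThrough hab
  have hm' : StronglyMeasurable f₀ := hm.mono radialSigma_le.out
  have hall : ∀ t, ∀ᵐ z ∂(volume.restrict (Omega Q)), f₀ (h.flow t z) = f₀ z := by
    intro t
    have h1 := h.koopman_ae t f
    rw [hf t] at h1
    filter_upwards [h1, hff', (h.measurePreserving_flow_Omega t).quasiMeasurePreserving.ae_eq_comp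
      hff'] with z a b c
    have c' : (f : Phase → 𝕜) (h.flow t z) = f₀ (h.flow t z) := c
    rw [← c', ← a, b]
  have hms : MeasurableSet {q : ℝ × Phase | f₀ (h.flow q.1 q.2) = f₀ q.2} :=
    measurableSet_eq_fun (hm'.measurable.comp h.continuous_flow.measurable)
      (hm'.measurable.comp measurable_snd)
  have hae : ∀ᵐ z ∂(volume.restrict (Omega Q)), ∀ᵐ t : ℝ, f₀ (h.flow t z) = f₀ z :=
    (Measure.ae_ae_comm hms).1 (Filter.Eventually.of_forall hall)
  refine ⟨fun p => ∫ s in Ioc (0:ℝ) 1, f₀ (h.flow s (h.orbitPoint p)), ?_, ?_⟩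
  · have : StronglyMeasurable fun q : (ℝ × ℝ) × ℝ => f₀ (h.flow q.2 (h.orbitPoint q.1)) :=
      hm'.comp_measurable (h.continuous_flow.measurable.comp
        (measurable_snd.prodMk (h.measurable_orbitPoint.comp measurable_fst)))
    exact this.integral_prod_right'.measurable
  · filter_upwards [hae, hff', ae_restrict_mem h.measurableSet_Omega,
      ae_restrict_of_ae ae_angMom_pos] with z h1 h2 hz hl
    obtain ⟨t, ht⟩ := h.exists_flow_orbitPoint hz hl
    have h3 : ∀ᵐ s : ℝ, f₀ (h.flow s (h.orbitPoint (energy (potential Q) z, angMom z))) = f₀ z := by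
      filter_upwards [(measurePreserving_add_right volume t).quasiMeasurePreserving.ae h1] with s hs
      rw [← hinv _ _ (h.invariants_flow_congr ht s), ← h.flow_add]
      exact hs
    rw [h2, integral_congr_ae (ae_restrict_of_ae h3)]
    simp

lemma invariant_of_isFunctionOfEnergyMomentum {f : L2r 𝕜 Q F}
    (hf : IsFunctionOfEnergyMomentum Q (f : Phase → 𝕜)) (t : ℝ) :
    (h.koopman 𝕜).toFun t f = f := by
  obtain ⟨f', _, hf'⟩ := hf
  refine Subtype.ext (Lp.ext (h.ae_weighted_iff.2 ?_))
  filter_upwards [h.koopman_ae t f, hf',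
    (h.measurePreserving_flow_Omega t).quasiMeasurePreserving.ae hf',
    ae_restrict_of_ae ae_angMom_pos] with z h1 h2 h3 hl
  rw [h1, h2, h3, h.energy_flow hl, h.angMom_flow]

theorem mem_pker_transport_iff (f : L2r 𝕜 Q F) :
    f ∈ pker (h.transport 𝕜) ↔ IsFunctionOfEnergyMomentum Q (f : Phase → 𝕜) := by
  rw [mem_pker_iff, h.mem_graph_transport_iff]
  exact ⟨fun H => h.isFunctionOfEnergyMomentum_of_invariant H.eq_of_zero,
    fun H => IsometryGroup.isGenerator_zero (h.invariant_of_isFunctionOfEnergyMomentum H)⟩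

end Field

lemma isSelfAdjoint_transport : IsSelfAdjoint (Complex.I • h.transport ℂ) :=
  IsometryGroup.isSelfAdjoint_I_smul h.mem_graph_transport_iff

omit h in
lemma pker_I_smul {E : Type} [NormedAddCommGroup E] [InnerProductSpace ℂ E] (A : E →ₗ.[ℂ] E) :
    pker (Complex.I • A) = pker A := by
  ext f
  rw [mem_pker_iff, mem_pker_iff, LinearPMap.mem_graph_iff,
    LinearPMap.mem_graph_iff]
  refine exists_congr fun y => and_congr_right fun _ => ?_
  rw [LinearPMap.smul_apply, smul_eq_zero]
  simp [Complex.I_ne_zero]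

end IsAdmissible
end VlasovPoisson
end

/-! ### The second moment of the radial velocity. -/

noncomputable section
namespace VlasovPoisson
open scoped ENNReal NNReal Topology

namespace IsAdmissible

variable {Q : Phase → ℝ} {F : ℝ → ℝ → ℝ} {e₀ : ℝ} (h : IsAdmissible Q F e₀)

/-- The density of `|∂F / ∂e|` in the coordinates `(e, ℓ)`. -/
def slope (_ : IsAdmissible Q F e₀) : ℝ × ℝ → ℝ≥0∞ :=
  {p : ℝ × ℝ | 0 < F p.1 |p.2|}.indicator
    fun p => ENNReal.ofReal |deriv (fun e => F e |p.2|) p.1|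

include h

lemma measurable_slope : Measurable h.slope := by
  have hc : Continuous (Function.uncurry fun l e : ℝ => F e |l|) :=
    h.continuous_profile_abs.comp (by fun_prop : Continuous fun p : ℝ × ℝ => (p.2, p.1))
  have hd := (measurable_deriv_with_param hc).comp measurable_swap
  exact (ENNReal.measurable_ofReal.comp (measurable_norm.comp hd)).indicator
    (measurableSet_lt (by fun_prop) h.continuous_profile_abs.measurable)

/-- Integration by parts in the radial velocity: `u² ∂_e F` is `u` times the `u`-derivative of
`F(u²/2 + c, ℓ)`, and that function is nonincreasing for `u > 0`. -/
lemma lintegral_sq_mul_slope_le {l : ℝ} (hl : 0 ≤ l) (c : ℝ) :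
    ∫⁻ u : ℝ, ENNReal.ofReal (u ^ 2) * h.slope (u ^ 2 / 2 + c, l) ≤
      ∫⁻ u : ℝ, ENNReal.ofReal (F (u ^ 2 / 2 + c) l) := by
  -- Replacing `u` by its positive part gives a function nonincreasing on the whole line, as the
  -- integration by parts requires.
  set H : ℝ → ℝ := fun u => F ((max u 0) ^ 2 / 2 + c) l
  have hH : Antitone H := fun u u' huu' => by
    refine h.antitone_profile hl ?_
    have : max u 0 ≤ max u' 0 := max_le_max_right 0 huu'
    gcongr
  rw [lintegral_of_even (K := fun u => ENNReal.ofReal (u ^ 2) * h.slope (u ^ 2 / 2 + c, l))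
      (fun u => by rw [neg_sq]),
    lintegral_of_even (K := fun u => ENNReal.ofReal (F (u ^ 2 / 2 + c) l))
      (fun u => by rw [neg_sq])]
  refine mul_le_mul_right ?_ _
  have h1 := lintegral_mul_abs_deriv_le hH (fun u => h.profile_nonneg _ l hl)
  refine (setLIntegral_mono' measurableSet_Ioi fun u hu => ?_).trans
    (h1.trans (le_of_eq (setLIntegral_congr_fun measurableSet_Ioi fun u hu => ?_)))
  · have hu' : (0 : ℝ) < u := hu
    by_cases hF : 0 < F (u ^ 2 / 2 + c) l
    · have hne := (h.profile_deriv_neg (u ^ 2 / 2 + c, l) ⟨hl, hF⟩).ne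
      have hd : HasDerivAt (fun e => F e l) (deriv (fun e => F e l) (u ^ 2 / 2 + c))
          (u ^ 2 / 2 + c) := (differentiableAt_of_deriv_ne_zero hne).hasDerivAt
      have hin : HasDerivAt (fun u : ℝ => u ^ 2 / 2 + c) u u := by
        refine (((hasDerivAt_pow 2 u).div_const 2).add_const c).congr_deriv ?_
        simp
      have hcomp := hd.comp u hin
      have hHd : HasDerivAt H (deriv (fun e => F e l) (u ^ 2 / 2 + c) * u) u := by
        refine hcomp.congr_of_eventuallyEq ?_
        filter_upwards [Ioi_mem_nhds hu'] with s hs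
        have hs' : (0:ℝ) < s := hs
        simp only [H, max_eq_left hs'.le, Function.comp_apply]
      rw [hHd.deriv, slope, indicator_of_mem (by simpa [abs_of_nonneg hl] using hF),
        ← ENNReal.ofReal_mul (by positivity), ← ENNReal.ofReal_mul hu'.le]
      simp only [abs_of_nonneg hl]
      rw [abs_mul, abs_of_pos hu']
      exact ENNReal.ofReal_le_ofReal (le_of_eq (by ring))
    · rw [slope, indicator_of_notMem (by simpa [abs_of_nonneg hl] using hF), mul_zero]
      exact zero_le
  · have hu' : (0 : ℝ) < u := hu
    simp only [H, max_eq_left hu'.le]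

/-- The radial velocity has second moment `ρ_Q` with respect to `|F'_e|`. -/
lemma lintegral_radialVelocity_sq_le {x : E3} (hx : x ≠ 0) :
    ∫⁻ v : E3, (Omega Q).indicator
      (fun z => ENNReal.ofReal (⟪z.1, z.2⟫ ^ 2 / ‖z.1‖ ^ 2 * |dF Q F z|)) (x, v) ≤
      ENNReal.ofReal (density Q x) := by
  have hr : 0 < ‖x‖ := norm_pos_iff.2 hx
  set e : E3 := ‖x‖⁻¹ • x
  have he : ‖e‖ = 1 := by
    rw [norm_smul, norm_inv, norm_norm]
    exact inv_mul_cancel₀ hr.ne'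
  have hsl := h.measurable_slope
  have hcp := h.continuous_profile_abs
  set φ := h.radialPotential ‖x‖
  have e1 : ∀ v : E3, (⟪e, v⟫ : ℝ) ^ 2 / 2 + ((‖v‖ ^ 2 - ⟪e, v⟫ ^ 2) / 2 + φ) =
      energy (potential Q) (x, v) := fun v => by
    rw [energy, h.potential_eq_radial hx]
    ring
  have e2 : ∀ v : E3, ‖x‖ ^ 2 * (‖v‖ ^ 2 - ⟪e, v⟫ ^ 2) = angMom (x, v) := fun v => by
    rw [angMom_eq]
    simp only [e, real_inner_smul_left]
    field_simp
  have hG1 : Measurable fun q : ℝ × ℝ => ENNReal.ofReal (q.1 ^ 2) *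
      h.slope (q.1 ^ 2 / 2 + (q.2 / 2 + φ), ‖x‖ ^ 2 * q.2) := by fun_prop
  have hG2 : Measurable fun q : ℝ × ℝ => ENNReal.ofReal
      (F (q.1 ^ 2 / 2 + (q.2 / 2 + φ)) |‖x‖ ^ 2 * q.2|) :=
    ENNReal.measurable_ofReal.comp (hcp.comp (by fun_prop : Continuous fun q : ℝ × ℝ =>
      (q.1 ^ 2 / 2 + (q.2 / 2 + φ), ‖x‖ ^ 2 * q.2))).measurable
  have hrhs : ENNReal.ofReal (density Q x) = ENNReal.ofReal Real.pi * ∫⁻ p in Ioi (0 : ℝ), ∫⁻ u,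
      ENNReal.ofReal (F (u ^ 2 / 2 + (p / 2 + φ)) |‖x‖ ^ 2 * p|) := by
    rw [density, ofReal_integral_eq_lintegral_ofReal (h.integrable_slice x)
      (Filter.Eventually.of_forall fun v => h.nonneg _), ← lintegral_cylindrical he
      (G := fun q => ENNReal.ofReal (F (q.1 ^ 2 / 2 + (q.2 / 2 + φ)) |‖x‖ ^ 2 * q.2|)) hG2]
    refine lintegral_congr fun v => ?_
    rw [e1, e2, abs_of_nonneg (angMom_nonneg _), ← h.eq_profile]
  rw [hrhs]
  refine le_trans (b := ENNReal.ofReal Real.pi * ∫⁻ p in Ioi (0 : ℝ), ∫⁻ u,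
      ENNReal.ofReal (u ^ 2) * h.slope (u ^ 2 / 2 + (p / 2 + φ), ‖x‖ ^ 2 * p)) ?_ ?_
  · rw [← lintegral_cylindrical he (G := fun q => ENNReal.ofReal (q.1 ^ 2) *
      h.slope (q.1 ^ 2 / 2 + (q.2 / 2 + φ), ‖x‖ ^ 2 * q.2)) hG1]
    refine lintegral_mono fun v => ?_
    rw [e1, e2]
    by_cases hv : ((x, v) : Phase) ∈ Omega Q
    · have hQ : 0 < Q (x, v) := hv
      rw [h.eq_profile] at hQ
      rw [indicator_of_mem hv, slope, indicator_of_mem (by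
        simpa [abs_of_nonneg (angMom_nonneg _)] using hQ), ← ENNReal.ofReal_mul (by positivity)]
      refine ENNReal.ofReal_le_ofReal (le_of_eq ?_)
      simp only [abs_of_nonneg (angMom_nonneg _), dF, e, real_inner_smul_left]
      field_simp
    · rw [indicator_of_notMem hv]
      exact zero_le
  · refine mul_le_mul_right (setLIntegral_mono' measurableSet_Ioi fun p hp => ?_) _
    have hp' : (0 : ℝ) < p := hp
    rw [abs_of_nonneg (by positivity)]
    exact h.lintegral_sq_mul_slope_le (by positivity) _

end IsAdmissible

end VlasovPoisson
end

/-! ### Field energy and continuity of the Antonov functional. -/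

noncomputable section
namespace VlasovPoisson
open scoped ENNReal NNReal Topology

/-- The indicator function of the region `|x| < r` of phase space. -/
def cylinder (r : ℝ) : Phase → ℝ := {z : Phase | ‖z.1‖ < r}.indicator fun _ => 1

/-- The mass of `g` within the radius `r`. -/
def massIn (Q g : Phase → ℝ) (r : ℝ) : ℝ := ∫ z in Omega Q, cylinder r z * g z

lemma measurable_cylinder (r : ℝ) : Measurable (cylinder r) :=
  measurable_const.indicator (measurableSet_lt measurable_fst.norm measurable_const)

lemma abs_cylinder_le (r : ℝ) (z : Phase) : |cylinder r z| ≤ 1 := by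
  unfold cylinder indicator
  split_ifs <;> simp

lemma ae_norm_fst_ne (r : ℝ) : ∀ᵐ z : Phase, ‖z.1‖ ≠ r := by
  have h1 : ∀ᵐ x : E3, ‖x‖ ≠ r := by
    rw [ae_iff]
    have : {x : E3 | ¬ ‖x‖ ≠ r} = Metric.sphere 0 r := by ext; simp
    rw [this]
    exact Measure.addHaar_sphere volume 0 r
  exact (Measure.quasiMeasurePreserving_fst (μ := (volume : Measure E3))
    (ν := (volume : Measure E3))).ae h1

lemma continuous_massIn {Q g : Phase → ℝ} (hg : IntegrableOn g (Omega Q)) :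
    Continuous (massIn Q g) := by
  refine continuous_iff_continuousAt.2 fun r => ?_
  refine continuousAt_of_dominated (bound := fun z => ‖g z‖)
    (Filter.Eventually.of_forall fun s => (measurable_cylinder s).aestronglyMeasurable.mul
      hg.aestronglyMeasurable) (Filter.Eventually.of_forall fun s =>
      Filter.Eventually.of_forall fun z => ?_) hg.norm ?_
  · rw [norm_mul]
    exact mul_le_of_le_one_left (norm_nonneg _) (abs_cylinder_le s z)
  · filter_upwards [ae_restrict_of_ae (ae_norm_fst_ne r)] with z hz
    refine ContinuousAt.mul ?_ continuousAt_const
    rcases lt_or_gt_of_ne hz with hlt | hlt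
    · refine (continuousAt_const (y := (1 : ℝ))).congr ?_
      filter_upwards [Ioi_mem_nhds hlt] with s hs
      exact (indicator_of_mem (s := {z : Phase | ‖z.1‖ < s}) (f := fun _ => (1:ℝ)) hs).symm
    · refine (continuousAt_const (y := (0 : ℝ))).congr ?_
      filter_upwards [Iio_mem_nhds hlt] with s hs
      have hs' : ¬ ‖z.1‖ < s := not_lt.2 (le_of_lt hs)
      exact (indicator_of_notMem (s := {z : Phase | ‖z.1‖ < s}) (f := fun _ => (1:ℝ)) hs').symm

lemma massIn_congr {Q f g : Phase → ℝ} (hfg : f =ᵐ[volume.restrict (Omega Q)] g) (r : ℝ) :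
    massIn Q f r = massIn Q g r := by
  refine integral_congr_ae ?_
  filter_upwards [hfg] with z hz
  rw [hz]

lemma massIn_sub {Q f g : Phase → ℝ} (hf : IntegrableOn f (Omega Q))
    (hg : IntegrableOn g (Omega Q)) (r : ℝ) :
    massIn Q (f - g) r = massIn Q f r - massIn Q g r := by
  unfold massIn
  have hb : ∀ {k : Phase → ℝ}, IntegrableOn k (Omega Q) →
      IntegrableOn (fun z => cylinder r z * k z) (Omega Q) := fun {k} hk =>
    hk.bdd_mul (measurable_cylinder r).aestronglyMeasurable
      (Filter.Eventually.of_forall fun z => abs_cylinder_le r z)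
  rw [← integral_sub (hb hf) (hb hg)]
  refine integral_congr_ae (Filter.Eventually.of_forall fun z => ?_)
  simp only [Pi.sub_apply, mul_sub]

lemma lintegral_inv_sq_Ioi_le {a : ℝ} (ha : 0 < a) :
    ∫⁻ r in Ioi a, ENNReal.ofReal (1 / r ^ 2) = ENNReal.ofReal (1 / a) := by
  have hi := integrableOn_Ioi_rpow_of_lt (a := -2) (by norm_num) ha
  have e : ∀ r ∈ Ioi a, r ^ (-2 : ℝ) = 1 / r ^ 2 := fun r hr => by
    have : (0 : ℝ) < r := ha.trans hr
    rw [Real.rpow_neg this.le, one_div]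
    norm_cast
  rw [← setLIntegral_congr_fun measurableSet_Ioi fun r hr => by rw [← e r hr],
    ← ofReal_integral_eq_lintegral_ofReal hi ?_, integral_Ioi_rpow_of_lt (by norm_num) ha]
  · congr 1
    norm_num [Real.rpow_neg_one]
  · filter_upwards [ae_restrict_mem measurableSet_Ioi] with r hr
    exact Real.rpow_nonneg (ha.trans hr).le _

namespace IsAdmissible

variable {Q : Phase → ℝ} {F : ℝ → ℝ → ℝ} {e₀ : ℝ} (h : IsAdmissible Q F e₀)
include h

lemma integrable_extend {g : Phase → ℝ} (hg : IntegrableOn g (Omega Q)) :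
    Integrable (extend Q g) := hg.integrable_indicator h.measurableSet_Omega

lemma ballMass_density_extend {g : Phase → ℝ} (hg : IntegrableOn g (Omega Q)) (r : ℝ) :
    ballMass (density (extend Q g)) r = massIn Q g r := by
  have hi := h.integrable_extend hg
  have hi2 : Integrable fun z => cylinder r z * extend Q g z :=
    hi.bdd_mul (measurable_cylinder r).aestronglyMeasurable
      (Filter.Eventually.of_forall fun z => abs_cylinder_le r z)
  rw [massIn, ← integral_indicator h.measurableSet_Omega, ballMass,
    ← integral_indicator measurableSet_ball]
  have e : (Omega Q).indicator (fun z => cylinder r z * g z) =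
      fun z => cylinder r z * extend Q g z := by
    funext z
    by_cases hz : z ∈ Omega Q <;> simp [extend, hz]
  rw [e, Measure.volume_eq_prod, integral_prod _ hi2]
  refine integral_congr_ae (Filter.Eventually.of_forall fun x => ?_)
  simp only
  by_cases hx : x ∈ Metric.ball (0 : E3) r
  · have : ∀ v, cylinder r (x, v) = 1 := fun v =>
      indicator_of_mem (s := {z : Phase | ‖z.1‖ < r}) (by simpa using hx) _
    rw [indicator_of_mem hx]
    simp [this, density]
  · have : ∀ v, cylinder r (x, v) = 0 := fun v =>
      indicator_of_notMem (s := {z : Phase | ‖z.1‖ < r}) (by simpa using hx) _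
    rw [indicator_of_notMem hx]
    simp [this]

/-- Elements of the weighted space have a rotation invariant representative. -/
lemma exists_invariant_representative {𝕜 : Type} [RCLike 𝕜] (g : L2r 𝕜 Q F) :
    ∃ f : Phase → 𝕜, StronglyMeasurable f ∧ (∀ a b, invariants a = invariants b → f a = f b) ∧
      (g : Phase → 𝕜) =ᵐ[volume.restrict (Omega Q)] f := by
  obtain ⟨f, hm, hf⟩ := mem_lpMeas_iff_aestronglyMeasurable.1 g.2
  exact ⟨f, hm.mono radialSigma_le.out, fun a b hab => hm.factorsThrough hab,
    h.ae_weighted_iff.1 hf⟩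

/-- An element of the space is a class of functions. Its rotation invariant representative has a
radial density, to which the shell theorem applies, and the potential does not see the null set of
changes. -/
lemma hasGradientAt_potential_extend (g : L2r ℝ Q F) {x : E3} (hx : x ≠ 0) :
    HasGradientAt (potential (extend Q (g : Phase → ℝ)))
      ((massIn Q (g : Phase → ℝ) ‖x‖ / (4 * Real.pi * ‖x‖ ^ 3)) • x) x := by
  obtain ⟨f, hfm, hfi, hgf⟩ := h.exists_invariant_representative g
  have hgi := h.integrableOn_coe g.1
  have hfi' : IntegrableOn f (Omega Q) := hgi.congr hgf
  have hext : extend Q (g : Phase → ℝ) =ᵐ[volume] extend Q f := by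
    filter_upwards [(ae_restrict_iff' h.measurableSet_Omega).1 hgf] with z hz
    by_cases hm : z ∈ Omega Q
    · rw [extend, extend, indicator_of_mem hm, indicator_of_mem hm, hz hm]
    · rw [extend, extend, indicator_of_notMem hm, indicator_of_notMem hm]
  have hdens : density (extend Q (g : Phase → ℝ)) =ᵐ[volume] density (extend Q f) := by
    have := Measure.ae_ae_of_ae_prod hext
    filter_upwards [this] with x hx
    exact integral_congr_ae hx
  have hpot : potential (extend Q (g : Phase → ℝ)) = potential (extend Q f) := by
    funext y
    unfold potential
    congr 1
    refine integral_congr_ae ?_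
    filter_upwards [hdens] with y' hy'
    rw [hy']
  obtain ⟨R, hR, hρ, _⟩ := exists_radial_density (f := extend Q f)
    (hfm.measurable.indicator h.measurableSet_Omega) (fun A z => by
      have hm : ((A z.1, A z.2) : Phase) ∈ Omega Q ↔ z ∈ Omega Q := by
        simp only [Omega, mem_ofPred_eq, h.map_isometry A z]
      by_cases hz : z ∈ Omega Q
      · rw [extend, indicator_of_mem hz, indicator_of_mem (hm.2 hz)]
        exact hfi _ _ (invariants_map A z)
      · rw [extend, indicator_of_notMem hz, indicator_of_notMem (fun H => hz (hm.1 H))])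
  rw [hpot, massIn_congr hgf, ← h.ballMass_density_extend hfi']
  exact hasGradientAt_newton hR hρ ((h.integrable_extend hfi').integral_prod_left) hx

lemma ae_gradient_extend (g : L2r ℝ Q F) :
    gradient (potential (extend Q (g : Phase → ℝ))) =ᵐ[volume]
      fun x => (massIn Q (g : Phase → ℝ) ‖x‖ / (4 * Real.pi * ‖x‖ ^ 3)) • x := by
  filter_upwards [ae_fst_ne_zero] with x hx
  exact (h.hasGradientAt_potential_extend g hx).gradient

/-- The gravitational energy of `g` in terms of the mass within the radius `r`. -/
lemma lintegral_gradient_extend (g : L2r ℝ Q F) :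
    ∫⁻ x, ‖gradient (potential (extend Q (g : Phase → ℝ))) x‖ₑ ^ 2 =
      ENNReal.ofReal (1 / (4 * Real.pi)) *
        ∫⁻ r in Ioi (0 : ℝ), ENNReal.ofReal (massIn Q (g : Phase → ℝ) r ^ 2 / r ^ 2) := by
  have hpi := Real.pi_pos
  have hc := continuous_massIn (h.integrableOn_coe g.1)
  have e1 : ∀ᵐ x : E3, ‖gradient (potential (extend Q (g : Phase → ℝ))) x‖ₑ ^ 2 =
      ENNReal.ofReal (massIn Q (g : Phase → ℝ) ‖x‖ ^ 2 / (16 * Real.pi ^ 2 * ‖x‖ ^ 4)) := by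
    filter_upwards [h.ae_gradient_extend g, ae_fst_ne_zero] with x hx hx0
    have hr : 0 < ‖x‖ := norm_pos_iff.2 hx0
    rw [hx, ← ofReal_norm, ← ENNReal.ofReal_pow (norm_nonneg _), norm_smul, mul_pow,
      Real.norm_eq_abs, sq_abs]
    congr 1
    field_simp
    norm_num
  rw [lintegral_congr_ae e1, lintegral_radial
    (h := fun r => ENNReal.ofReal (massIn Q (g : Phase → ℝ) r ^ 2 / (16 * Real.pi ^ 2 * r ^ 4)))
    (by have := hc.measurable; fun_prop), ← lintegral_const_mul _
      (by have := hc.measurable; fun_prop), ← lintegral_const_mul _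
      (by have := hc.measurable; fun_prop)]
  refine setLIntegral_congr_fun measurableSet_Ioi fun r hr => ?_
  have hr' : (0 : ℝ) < r := hr
  rw [← ENNReal.ofReal_mul (by positivity), ← ENNReal.ofReal_mul (by positivity),
    ← ENNReal.ofReal_mul (by positivity)]
  congr 1
  field_simp
  ring

lemma sq_integral_le {ψ : Phase → ℝ} (hψ : AEStronglyMeasurable ψ (volume.restrict (Omega Q)))
    {C : ℝ} (hC : ∀ z ∈ Omega Q, |ψ z| ≤ C) (g : L2r ℝ Q F) :
    (∫ z in Omega Q, ψ z * (g : Phase → ℝ) z) ^ 2 ≤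
      (∫ z in Omega Q, ψ z ^ 2 * |dF Q F z|) * ‖g‖ ^ 2 := by
  obtain ⟨k, hk1, hk2⟩ := h.exists_pairing (𝕜 := ℝ) hψ hC
  have e1 : ‖k‖ ^ 2 = ∫ z in Omega Q, ψ z ^ 2 * |dF Q F z| := by
    rw [← real_inner_self_eq_norm_sq, (hk2 k).2]
    refine integral_congr_ae ?_
    filter_upwards [hk1] with z hz
    rw [hz, smul_eq_mul]
    simp only [RCLike.ofReal_real_eq_id, id]
    ring
  have e2 : ∫ z in Omega Q, ψ z * (g : Phase → ℝ) z = inner ℝ k g.1 := (hk2 g.1).2.symm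
  rw [← e1, e2, ← mul_pow, ← sq_abs]
  exact pow_le_pow_left₀ (abs_nonneg _) (abs_real_inner_le_norm _ _) 2

/-- By Cauchy–Schwarz `M(r)²` is at most `‖g‖²` times the integral of `|F'_e|` over `|x| < r`. After
Tonelli the `r`-integral is `∫_{|x|}^∞ dr / r² = 1/|x|`, and `|F'_e| / |x|` is integrable on the
bounded set `Ω`. -/
lemma exists_gradient_bound : ∃ K : ℝ≥0, ∀ g : L2r ℝ Q F,
    ∫⁻ x, ‖gradient (potential (extend Q (g : Phase → ℝ))) x‖ₑ ^ 2 ≤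
      K * ENNReal.ofReal (‖g‖ ^ 2) := by
  have hpi := Real.pi_pos
  have hdm := h.measurable_dF
  set D : ℝ≥0∞ := ∫⁻ z in Omega Q, ENNReal.ofReal (|dF Q F z| / ‖z.1‖)
  have hD : D < ⊤ := by
    refine lt_of_le_of_lt (b := ∫⁻ z in Omega Q, ENNReal.ofReal h.radius *
      ENNReal.ofReal (|dF Q F z| / ‖z.1‖ ^ 2)) ?_ ?_
    · refine lintegral_mono_ae ?_
      filter_upwards [ae_restrict_mem h.measurableSet_Omega, ae_restrict_of_ae ae_angMom_pos]
        with z hz hz'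
      rw [← ENNReal.ofReal_mul h.radius_pos.le]
      refine ENNReal.ofReal_le_ofReal ?_
      have hx : 0 < ‖z.1‖ := norm_pos_iff.2 (ne_zero_of_angMom_pos hz')
      have hle := (h.norm_fst_lt_radius hz).le
      rw [← mul_div_assoc, div_le_div_iff₀ hx (by positivity)]
      have := mul_le_mul_of_nonneg_left hle (mul_nonneg (abs_nonneg (dF Q F z)) hx.le)
      nlinarith
    · rw [lintegral_const_mul' _ _ ENNReal.ofReal_ne_top]
      exact ENNReal.mul_lt_top ENNReal.ofReal_lt_top h.lintegral_dF_div_lt_top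
  refine ⟨(ENNReal.ofReal (1 / (4 * Real.pi)) * D).toNNReal, fun g => ?_⟩
  rw [ENNReal.coe_toNNReal (ENNReal.mul_lt_top ENNReal.ofReal_lt_top hD).ne,
    h.lintegral_gradient_extend g, mul_assoc]
  refine mul_le_mul_right ?_ _
  have hcm : Measurable fun p : ℝ × Phase => cylinder p.1 p.2 := by
    have : (fun p : ℝ × Phase => cylinder p.1 p.2) =
        {p : ℝ × Phase | ‖p.2.1‖ < p.1}.indicator fun _ => 1 := rfl
    rw [this]
    exact measurable_const.indicator (measurableSet_lt (by fun_prop) (by fun_prop))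
  have step1 : ∀ r ∈ Ioi (0 : ℝ), ENNReal.ofReal (massIn Q (g : Phase → ℝ) r ^ 2 / r ^ 2) ≤
      ENNReal.ofReal (‖g‖ ^ 2) * ∫⁻ z in Omega Q,
        ENNReal.ofReal (1 / r ^ 2) * ENNReal.ofReal (cylinder r z * |dF Q F z|) := by
    intro r hr
    have hr' : (0 : ℝ) < r := hr
    have h1 := h.sq_integral_le (measurable_cylinder r).aestronglyMeasurable
      (fun z _ => abs_cylinder_le r z) g
    have hc2 : ∀ z, cylinder r z ^ 2 = cylinder r z := fun z => by
      unfold cylinder indicator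
      split_ifs <;> simp
    have hc0 : ∀ z, 0 ≤ cylinder r z := fun z => by
      rw [← hc2]; positivity
    simp only [hc2] at h1
    have hi : IntegrableOn (fun z => cylinder r z * |dF Q F z|) (Omega Q) :=
      h.integrableOn_dF.norm.bdd_mul (measurable_cylinder r).aestronglyMeasurable
        (Filter.Eventually.of_forall fun z => abs_cylinder_le r z)
    rw [lintegral_const_mul' _ _ ENNReal.ofReal_ne_top, ← ofReal_integral_eq_lintegral_ofReal hi
      (Filter.Eventually.of_forall fun z => mul_nonneg (hc0 z) (abs_nonneg _)),
      ← ENNReal.ofReal_mul (by positivity), ← ENNReal.ofReal_mul (by positivity)]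
    refine ENNReal.ofReal_le_ofReal ?_
    calc massIn Q (g : Phase → ℝ) r ^ 2 / r ^ 2
        ≤ ((∫ z in Omega Q, cylinder r z * |dF Q F z|) * ‖g‖ ^ 2) / r ^ 2 := by
          gcongr
          exact h1
      _ = _ := by ring
  refine (setLIntegral_mono' measurableSet_Ioi step1).trans ?_
  rw [lintegral_const_mul' _ _ ENNReal.ofReal_ne_top, mul_comm]
  refine mul_le_mul_left ?_ _
  rw [lintegral_lintegral_swap (f := fun r z => ENNReal.ofReal (1 / r ^ 2) *
    ENNReal.ofReal (cylinder r z * |dF Q F z|)) (by fun_prop)]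
  refine lintegral_mono_ae ?_
  filter_upwards [ae_restrict_of_ae ae_angMom_pos] with z hz
  have hx : 0 < ‖z.1‖ := norm_pos_iff.2 (ne_zero_of_angMom_pos hz)
  have e : ∀ r, ENNReal.ofReal (1 / r ^ 2) * ENNReal.ofReal (cylinder r z * |dF Q F z|) =
      (Ioi ‖z.1‖).indicator (fun r => ENNReal.ofReal (1 / r ^ 2) *
        ENNReal.ofReal |dF Q F z|) r := by
    intro r
    by_cases hr : ‖z.1‖ < r
    · rw [indicator_of_mem (mem_Ioi.2 hr), cylinder,
        indicator_of_mem (s := {z : Phase | ‖z.1‖ < r}) hr, one_mul]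
    · rw [indicator_of_notMem (by simpa using hr), cylinder,
        indicator_of_notMem (s := {z : Phase | ‖z.1‖ < r}) hr, zero_mul, ENNReal.ofReal_zero,
        mul_zero]
  simp only [e]
  refine (setLIntegral_le_lintegral _ _).trans ?_
  rw [lintegral_indicator measurableSet_Ioi, lintegral_mul_const' _ _ ENNReal.ofReal_ne_top,
    lintegral_inv_sq_Ioi_le hx, ← ENNReal.ofReal_mul (by positivity)]
  exact ENNReal.ofReal_le_ofReal (le_of_eq (by ring))

lemma memLp_gradient_extend (g : L2r ℝ Q F) :
    MemLp (gradient (potential (extend Q (g : Phase → ℝ)))) 2 := by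
  obtain ⟨K, hK⟩ := h.exists_gradient_bound
  have hc := continuous_massIn (h.integrableOn_coe g.1)
  refine ⟨AEStronglyMeasurable.congr ?_ (h.ae_gradient_extend g).symm, ?_⟩
  · have := hc.measurable
    exact Measurable.aestronglyMeasurable (by fun_prop)
  · rw [eLpNorm_lt_top_iff_lintegral_rpow_enorm_lt_top (by norm_num) (by norm_num)]
    simp only [ENNReal.toReal_ofNat, ENNReal.rpow_ofNat]
    exact (hK g).trans_lt (ENNReal.mul_lt_top ENNReal.coe_lt_top ENNReal.ofReal_lt_top)

lemma norm_sq_eq_integral (g : L2r ℝ Q F) :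
    ‖g‖ ^ 2 = ∫ z in Omega Q, (g : Phase → ℝ) z ^ 2 / |dF Q F z| := by
  have : ‖g‖ ^ 2 = inner ℝ g.1 g.1 := (real_inner_self_eq_norm_sq g.1).symm
  rw [this, L2.inner_def, h.integral_weighted]
  refine integral_congr_ae (Filter.Eventually.of_forall fun z => ?_)
  simp only [smul_eq_mul, RCLike.inner_apply, conj_trivial]
  ring

lemma integrableOn_sq_div (g : L2r ℝ Q F) :
    IntegrableOn (fun z => (g : Phase → ℝ) z ^ 2 / |dF Q F z|) (Omega Q) := by
  have hi := L2.integrable_inner (𝕜 := ℝ) g.1 g.1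
  refine ((h.integrable_weighted_iff).1 hi).congr (Filter.Eventually.of_forall fun z => ?_)
  simp only [smul_eq_mul, RCLike.inner_apply, conj_trivial]
  ring

omit h in
/-- The gravitational field as an element of `L²`. -/
def field (h : IsAdmissible Q F e₀) (g : L2r ℝ Q F) : Lp E3 2 (volume : Measure E3) :=
  (h.memLp_gradient_extend g).toLp _

lemma norm_field_sq (g : L2r ℝ Q F) :
    ‖h.field g‖ ^ 2 = ∫ x, ‖gradient (potential (extend Q (g : Phase → ℝ))) x‖ ^ 2 := by
  rw [← real_inner_self_eq_norm_sq, L2.inner_def]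
  refine integral_congr_ae ?_
  filter_upwards [(h.memLp_gradient_extend g).coeFn_toLp] with x hx
  rw [field, hx, real_inner_self_eq_norm_sq]

lemma antonov_eq (g : L2r ℝ Q F) :
    antonov Q F (g : Phase → ℝ) = ‖g‖ ^ 2 - ‖h.field g‖ ^ 2 := by
  rw [antonov, h.norm_sq_eq_integral, h.norm_field_sq]

lemma field_sub (f g : L2r ℝ Q F) : h.field (f - g) = h.field f - h.field g := by
  unfold field
  rw [← MemLp.toLp_sub]
  refine MemLp.toLp_congr _ _ ?_
  have hs : ((f - g : L2r ℝ Q F) : Phase → ℝ) =ᵐ[volume.restrict (Omega Q)]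
      (f : Phase → ℝ) - (g : Phase → ℝ) := h.absolutelyContinuous.ae_eq (Lp.coeFn_sub f.1 g.1)
  filter_upwards [h.ae_gradient_extend (f - g), h.ae_gradient_extend f,
    h.ae_gradient_extend g] with x h1 h2 h3
  rw [h1, Pi.sub_apply, h2, h3, massIn_congr hs, massIn_sub (h.integrableOn_coe f.1)
    (h.integrableOn_coe g.1), sub_div, sub_smul]

lemma ofReal_norm_field_sq (g : L2r ℝ Q F) : ENNReal.ofReal (‖h.field g‖ ^ 2) =
    ∫⁻ x, ‖gradient (potential (extend Q (g : Phase → ℝ))) x‖ₑ ^ 2 := by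
  rw [h.norm_field_sq, ofReal_integral_eq_lintegral_ofReal
    ((h.memLp_gradient_extend g).integrable_norm_pow (by norm_num))
    (Filter.Eventually.of_forall fun x => by positivity)]
  refine lintegral_congr fun x => ?_
  rw [ENNReal.ofReal_pow (norm_nonneg _), ofReal_norm]

lemma continuous_field : Continuous h.field := by
  obtain ⟨K, hK⟩ := h.exists_gradient_bound
  refine LipschitzWith.continuous (K := NNReal.sqrt K) (LipschitzWith.of_dist_le_mul fun f g => ?_)
  rw [dist_eq_norm, dist_eq_norm, ← h.field_sub]
  have h1 := hK (f - g)
  rw [← h.ofReal_norm_field_sq, ← ENNReal.ofReal_coe_nnreal, ← ENNReal.ofReal_mul K.coe_nonneg,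
    ENNReal.ofReal_le_ofReal_iff (by positivity)] at h1
  refine le_of_sq_le_sq ?_ (by positivity)
  rw [mul_pow, ← NNReal.coe_pow, NNReal.sq_sqrt]
  exact h1

theorem continuous_antonov : Continuous fun g : L2r ℝ Q F => antonov Q F (g : Phase → ℝ) := by
  simp only [h.antonov_eq]
  exact (continuous_norm.pow 2).sub (h.continuous_field.norm.pow 2)

end IsAdmissible

end VlasovPoisson
end

/-! ### The continuity equation and the field energy of `𝒯ξ`. -/

noncomputable section
namespace VlasovPoisson
open scoped ENNReal NNReal Topology

namespace IsAdmissible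

variable {Q : Phase → ℝ} {F : ℝ → ℝ → ℝ} {e₀ : ℝ} (h : IsAdmissible Q F e₀)
include h

section Field

variable {𝕜 : Type} [RCLike 𝕜]

lemma integrable_mul_comp_flow {χ : Phase → ℝ} (hχ : Measurable χ) {C : ℝ}
    (hC : ∀ z ∈ Omega Q, |χ z| ≤ C) {f : Phase → ℝ} (hf : IntegrableOn f (Omega Q))
    (hfm : Measurable f) (t : ℝ) :
    Integrable (fun p : ℝ × Phase => χ (h.flow p.1 p.2) * f p.2)
      ((volume.restrict (uIoc 0 t)).prod (volume.restrict (Omega Q))) := by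
  have hd : Integrable (fun p : ℝ × Phase => C * ‖f p.2‖)
      ((volume.restrict (uIoc 0 t)).prod (volume.restrict (Omega Q))) := by
    have hfin : IsFiniteMeasure (volume.restrict (uIoc (0:ℝ) t)) :=
      ⟨by rw [Measure.restrict_apply_univ]; simp [uIoc]⟩
    exact (hf.norm.const_mul C).comp_snd _
  refine hd.mono' ?_ ?_
  · exact ((hχ.comp h.continuous_flow.measurable).mul
      (hfm.comp measurable_snd)).aestronglyMeasurable
  · have hΩ : ∀ᵐ p ∂((volume.restrict (uIoc (0:ℝ) t)).prod (volume.restrict (Omega Q))),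
        p.2 ∈ Omega Q :=
      Measure.quasiMeasurePreserving_snd.ae (ae_restrict_mem h.measurableSet_Omega)
    filter_upwards [hΩ] with p hp
    rw [norm_mul]
    exact mul_le_mul_of_nonneg_right (hC _ (h.flow_mem_Omega.2 hp)) (norm_nonneg _)

/-- Integration by parts for functions that are differentiable along the flow. -/
lemma integral_mul_generator {ξ g : L2r ℝ Q F} (hξ : (h.koopman ℝ).IsGenerator ξ g)
    {χ χ' : Phase → ℝ} (hχ : Measurable χ) (hχ' : Measurable χ') {C : ℝ}
    (hC : ∀ z ∈ Omega Q, |χ z| ≤ C) {C' : ℝ} (hC' : ∀ z ∈ Omega Q, |χ' z| ≤ C')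
    (hd : ∀ z ∈ Omega Q, 0 < angMom z → ∀ t, χ (h.flow t z) - χ z =
      ∫ s in (0:ℝ)..t, χ' (h.flow s z)) :
    ∫ z in Omega Q, χ z * (g : Phase → ℝ) z = -∫ z in Omega Q, χ' z * (ξ : Phase → ℝ) z := by
  obtain ⟨k, _, hk⟩ := h.exists_pairing (𝕜 := ℝ) hχ.aestronglyMeasurable hC
  obtain ⟨k', _, hk'⟩ := h.exists_pairing (𝕜 := ℝ) hχ'.aestronglyMeasurable hC'
  set Λ : L2r ℝ Q F →L[ℝ] ℝ :=
    (innerSL ℝ k).comp (lpMeas ℝ ℝ radialSigma 2 (weighted Q F)).subtypeL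
  set Λ' : L2r ℝ Q F →L[ℝ] ℝ :=
    (innerSL ℝ k').comp (lpMeas ℝ ℝ radialSigma 2 (weighted Q F)).subtypeL
  have hΛ : ∀ w : L2r ℝ Q F, Λ w = ∫ z in Omega Q, χ z • (w : Phase → ℝ) z := fun w => (hk w.1).2
  have hΛ' : ∀ w : L2r ℝ Q F, Λ' w = ∫ z in Omega Q, χ' z • (w : Phase → ℝ) z :=
    fun w => (hk' w.1).2
  have hcξ := (h.koopman ℝ).continuous_apply ξ
  have hcg := (h.koopman ℝ).continuous_apply g
  have hξi := h.integrableOn_coe ξ.1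
  have hξm : Measurable (ξ : Phase → ℝ) := (Lp.stronglyMeasurable ξ.1).measurable
  -- Since `χ` is only a primitive of `χ'` along trajectories, the identity is proved after
  -- integration over `[0, t]`. Both sides are differentiable at `t = 0` by strong continuity of the
  -- group.
  have key : ∀ t, ∫ s in (0:ℝ)..t, Λ ((h.koopman ℝ).toFun s g) =
      -∫ s in (0:ℝ)..t, Λ' ((h.koopman ℝ).toFun s ξ) := by
    intro t
    have e1 : ∫ s in (0:ℝ)..t, Λ ((h.koopman ℝ).toFun s g) =
        Λ ((h.koopman ℝ).toFun t ξ) - Λ ξ := by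
      rw [← map_sub, hξ.sub_eq_integral]
      exact Λ.intervalIntegral_comp_comm (hcg.intervalIntegrable 0 t)
    have e2 : Λ ((h.koopman ℝ).toFun t ξ) - Λ ξ =
        ∫ z in Omega Q, (χ (h.flow (-t) z) - χ z) * (ξ : Phase → ℝ) z := by
      rw [hΛ, hΛ, h.integral_koopman, ← integral_sub]
      · refine integral_congr_ae (Filter.Eventually.of_forall fun z => ?_)
        simp only [smul_eq_mul]
        ring
      · refine hξi.bdd_mul (c := C) (hχ.comp
          (h.continuous_flow_apply (-t)).measurable).aestronglyMeasurable ?_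
        filter_upwards [ae_restrict_mem h.measurableSet_Omega] with z hz
        exact hC _ (h.flow_mem_Omega.2 hz)
      · exact (hk ξ.1).1
    have e3 : ∫ z in Omega Q, (χ (h.flow (-t) z) - χ z) * (ξ : Phase → ℝ) z =
        ∫ z in Omega Q, ∫ s in (0:ℝ)..(-t), χ' (h.flow s z) * (ξ : Phase → ℝ) z := by
      refine integral_congr_ae ?_
      filter_upwards [ae_restrict_mem h.measurableSet_Omega, ae_restrict_of_ae ae_angMom_pos]
        with z hz hl
      rw [hd z hz hl, ← intervalIntegral.integral_mul_const]
    have e4 : ∫ z in Omega Q, ∫ s in (0:ℝ)..(-t), χ' (h.flow s z) * (ξ : Phase → ℝ) z =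
        ∫ s in (0:ℝ)..(-t), ∫ z in Omega Q, χ' (h.flow s z) * (ξ : Phase → ℝ) z :=
      (intervalIntegral_integral_swap
        (h.integrable_mul_comp_flow hχ' hC' hξi hξm (-t))).symm
    rw [e1, e2, e3, e4]
    have e5 := intervalIntegral.integral_comp_neg (a := 0) (b := t)
      (fun s => ∫ z in Omega Q, χ' (h.flow s z) * (ξ : Phase → ℝ) z)
    rw [neg_zero] at e5
    rw [intervalIntegral.integral_symm, ← e5]
    congr 1
    refine intervalIntegral.integral_congr fun s _ => ?_
    have e6 := h.integral_koopman ξ χ' s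
    simp only [smul_eq_mul] at e6
    simp only [hΛ', smul_eq_mul]
    exact e6.symm
  have d1 : HasDerivAt (fun t => ∫ s in (0:ℝ)..t, Λ ((h.koopman ℝ).toFun s g)) (Λ g) 0 := by
    have hc := Λ.continuous.comp hcg
    have := intervalIntegral.integral_hasDerivAt_right (hc.intervalIntegrable 0 0)
      hc.stronglyMeasurable.stronglyMeasurableAtFilter hc.continuousAt
    simpa only [Function.comp_apply, (h.koopman ℝ).zero_apply] using this
  have d2 : HasDerivAt (fun t => ∫ s in (0:ℝ)..t, Λ' ((h.koopman ℝ).toFun s ξ)) (Λ' ξ) 0 := by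
    have hc := Λ'.continuous.comp hcξ
    have := intervalIntegral.integral_hasDerivAt_right (hc.intervalIntegrable 0 0)
      hc.stronglyMeasurable.stronglyMeasurableAtFilter hc.continuousAt
    simpa only [Function.comp_apply, (h.koopman ℝ).zero_apply] using this
  have := (d1.congr_of_eventuallyEq (Filter.Eventually.of_forall fun t => (key t).symm)).unique
    d2.neg
  rw [hΛ, hΛ'] at this
  simpa only [smul_eq_mul] using this

end Field

/-- The radial velocity `v·x/|x|`. -/
lemma abs_radialVelocity_le {z : Phase} (hz : z ∈ Omega Q) :
    |⟪z.1, z.2⟫ / ‖z.1‖| ≤ h.radius := by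
  rw [abs_div, abs_norm]
  refine (div_le_of_le_mul₀ (norm_nonneg _) h.radius_pos.le
    ((abs_real_inner_le_norm _ _).trans ?_))
  rw [mul_comm]
  exact mul_le_mul_of_nonneg_right (h.norm_snd_lt_radius hz).le (norm_nonneg _)

omit h in
lemma measurable_radialVelocity : Measurable fun z : Phase => ⟪z.1, z.2⟫ / ‖z.1‖ := by
  fun_prop

lemma integral_radial_mul_generator {ξ g : L2r ℝ Q F} (hξ : (h.koopman ℝ).IsGenerator ξ g)
    {X f : ℝ → ℝ} (hX : ∀ r, HasDerivAt X (f r) r) (hf : Continuous f) :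
    ∫ z in Omega Q, X ‖z.1‖ * (g : Phase → ℝ) z =
      -∫ z in Omega Q, (f ‖z.1‖ * (⟪z.1, z.2⟫ / ‖z.1‖)) * (ξ : Phase → ℝ) z := by
  have hXc : Continuous X := continuous_iff_continuousAt.2 fun r => (hX r).continuousAt
  obtain ⟨C, hC⟩ := (isCompact_Icc (a := (0:ℝ)) (b := h.radius)).exists_bound_of_continuousOn
    hXc.continuousOn
  obtain ⟨C', hC'⟩ := (isCompact_Icc (a := (0:ℝ)) (b := h.radius)).exists_bound_of_continuousOn
    hf.continuousOn
  refine h.integral_mul_generator hξ (χ := fun z => X ‖z.1‖)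
    (χ' := fun z => f ‖z.1‖ * (⟪z.1, z.2⟫ / ‖z.1‖)) (hXc.measurable.comp measurable_fst.norm)
    ((hf.measurable.comp measurable_fst.norm).mul measurable_radialVelocity) (C := C)
    (C' := C' * h.radius)
    (fun z hz => hC _ ⟨norm_nonneg _, (h.norm_fst_lt_radius hz).le⟩) (fun z hz => ?_)
    (fun z hz hl t => ?_)
  · rw [abs_mul]
    exact mul_le_mul (hC' _ ⟨norm_nonneg _, (h.norm_fst_lt_radius hz).le⟩)
      (h.abs_radialVelocity_le hz) (abs_nonneg _)
      ((norm_nonneg _).trans (hC' _ ⟨norm_nonneg z.1, (h.norm_fst_lt_radius hz).le⟩))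
  · have hd : ∀ s, HasDerivAt (fun s => X ‖(h.flow s z).1‖) (f ‖(h.flow s z).1‖ *
        (⟪(h.flow s z).1, (h.flow s z).2⟫ / ‖(h.flow s z).1‖)) s := fun s =>
      (hX _).comp s (h.hasDerivAt_norm_fst hl s)
    have hcf := h.continuous_flow_time z
    have hcont : Continuous fun s => f ‖(h.flow s z).1‖ *
        (⟪(h.flow s z).1, (h.flow s z).2⟫ / ‖(h.flow s z).1‖) := by
      refine (hf.comp hcf.fst.norm).mul ?_
      exact (hcf.fst.inner hcf.snd).div hcf.fst.norm fun s => (h.norm_fst_flow_pos hl s).ne'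
    rw [intervalIntegral.integral_eq_sub_of_hasDerivAt (fun s _ => hd s)
      (hcont.intervalIntegrable 0 t), h.flow_zero]

/-- The equation of continuity in integrated form. -/
lemma integral_mul_massIn {ξ g : L2r ℝ Q F} (hξ : (h.koopman ℝ).IsGenerator ξ g)
    {f : ℝ → ℝ} (hf : Continuous f) :
    ∫ s in (0:ℝ)..h.radius, f s * massIn Q (g : Phase → ℝ) s =
      ∫ z in Omega Q, (f ‖z.1‖ * (⟪z.1, z.2⟫ / ‖z.1‖)) * (ξ : Phase → ℝ) z := by
  set R := h.radius
  have hR := h.radius_pos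
  have hgi := h.integrableOn_coe g.1
  have hgm : Measurable (g : Phase → ℝ) := (Lp.stronglyMeasurable g.1).measurable
  obtain ⟨C, hC⟩ := (isCompact_Icc (a := (0:ℝ)) (b := R)).exists_bound_of_continuousOn
    hf.continuousOn
  -- By Tonelli the weight of a point in `∫ f M` is the integral of `f` from `|x|` to `R`. This
  -- weight is a function of the radius with derivative `-f`, so the integration by parts along the
  -- flow applies.
  have hX : ∀ r, HasDerivAt (fun r => ∫ s in r..R, f s) (-f r) r := fun r =>
    intervalIntegral.integral_hasDerivAt_left (hf.intervalIntegrable r R)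
      hf.stronglyMeasurable.stronglyMeasurableAtFilter hf.continuousAt
  have hid := h.integral_radial_mul_generator hξ hX hf.neg
  have e0 : -∫ z in Omega Q, (-f ‖z.1‖ * (⟪z.1, z.2⟫ / ‖z.1‖)) * (ξ : Phase → ℝ) z =
      ∫ z in Omega Q, (f ‖z.1‖ * (⟪z.1, z.2⟫ / ‖z.1‖)) * (ξ : Phase → ℝ) z := by
    rw [← integral_neg]
    refine integral_congr_ae (Filter.Eventually.of_forall fun z => ?_)
    simp only
    ring
  rw [← e0, ← hid]
  have hcm : Measurable fun p : ℝ × Phase => cylinder p.1 p.2 := by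
    have : (fun p : ℝ × Phase => cylinder p.1 p.2) =
        {p : ℝ × Phase | ‖p.2.1‖ < p.1}.indicator fun _ => 1 := rfl
    rw [this]
    exact measurable_const.indicator (measurableSet_lt (by fun_prop) (by fun_prop))
  have hint : Integrable (fun p : ℝ × Phase => f p.1 * (cylinder p.1 p.2 * (g : Phase → ℝ) p.2))
      ((volume.restrict (uIoc 0 R)).prod (volume.restrict (Omega Q))) := by
    have hfin : IsFiniteMeasure (volume.restrict (uIoc (0:ℝ) R)) :=
      ⟨by rw [Measure.restrict_apply_univ]; simp [uIoc]⟩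
    have hd : Integrable (fun p : ℝ × Phase => C * ‖(g : Phase → ℝ) p.2‖)
        ((volume.restrict (uIoc 0 R)).prod (volume.restrict (Omega Q))) :=
      (hgi.norm.const_mul C).comp_snd _
    refine hd.mono' ?_ ?_
    · have := hf.measurable
      exact Measurable.aestronglyMeasurable (by fun_prop)
    · have hI : ∀ᵐ p ∂((volume.restrict (uIoc (0:ℝ) R)).prod (volume.restrict (Omega Q))),
          p.1 ∈ uIoc 0 R :=
        Measure.quasiMeasurePreserving_fst.ae (ae_restrict_mem measurableSet_uIoc)
      filter_upwards [hI] with p hp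
      rw [uIoc_of_le hR.le] at hp
      rw [norm_mul, norm_mul]
      refine mul_le_mul (hC _ ⟨hp.1.le, hp.2⟩) (mul_le_of_le_one_left (norm_nonneg _)
        (abs_cylinder_le _ _)) (by positivity) ((norm_nonneg _).trans (hC _ ⟨hp.1.le, hp.2⟩))
  calc ∫ s in (0:ℝ)..R, f s * massIn Q (g : Phase → ℝ) s
      = ∫ s in (0:ℝ)..R, ∫ z in Omega Q, f s * (cylinder s z * (g : Phase → ℝ) z) := by
        refine intervalIntegral.integral_congr fun s _ => ?_
        simp only [massIn]
        rw [integral_const_mul]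
    _ = ∫ z in Omega Q, ∫ s in (0:ℝ)..R, f s * (cylinder s z * (g : Phase → ℝ) z) :=
        intervalIntegral_integral_swap hint
    _ = _ := by
        refine integral_congr_ae ?_
        filter_upwards [ae_restrict_mem h.measurableSet_Omega] with z hz
        have hzR : ‖z.1‖ ≤ R := (h.norm_fst_lt_radius hz).le
        have e1 : ∀ s, f s * (cylinder s z * (g : Phase → ℝ) z) =
            (Ioi ‖z.1‖).indicator f s * (g : Phase → ℝ) z := fun s => by
          by_cases hs : ‖z.1‖ < s
          · rw [indicator_of_mem (mem_Ioi.2 hs), cylinder,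
              indicator_of_mem (s := {z : Phase | ‖z.1‖ < s}) hs, one_mul]
          · rw [indicator_of_notMem (by simpa using hs), cylinder,
              indicator_of_notMem (s := {z : Phase | ‖z.1‖ < s}) hs]
            ring
        simp only [e1]
        rw [intervalIntegral.integral_mul_const]
        congr 1
        rw [intervalIntegral.integral_of_le hR.le, intervalIntegral.integral_of_le hzR,
          setIntegral_indicator measurableSet_Ioi]
        congr 2
        rw [Ioc_inter_Ioi, max_eq_right (norm_nonneg _)]

/-- Pairing with the constant function `1`, whose flow derivative is zero, shows that `𝒯ξ` has total
mass zero. -/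
lemma massIn_eq_zero_of_radius_le {ξ g : L2r ℝ Q F} (hξ : (h.koopman ℝ).IsGenerator ξ g) {r : ℝ}
    (hr : h.radius ≤ r) : massIn Q (g : Phase → ℝ) r = 0 := by
  have h1 := h.integral_radial_mul_generator hξ (X := fun _ => 1) (f := fun _ => 0)
    (fun r => hasDerivAt_const r 1) continuous_const
  simp only [one_mul, zero_mul, integral_zero, neg_zero] at h1
  rw [← h1, massIn]
  refine setIntegral_congr_fun h.measurableSet_Omega fun z hz => ?_
  rw [cylinder, indicator_of_mem (s := {z : Phase | ‖z.1‖ < r})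
    ((h.norm_fst_lt_radius hz).trans_le hr), one_mul]

lemma integrableOn_density_mul_sq_div (ξ : L2r ℝ Q F) :
    IntegrableOn (fun z => density Q z.1 * ((ξ : Phase → ℝ) z ^ 2 / |dF Q F z|)) (Omega Q) := by
  obtain ⟨C, hC⟩ := h.exists_density_bound
  refine (h.integrableOn_sq_div ξ).bdd_mul (c := C)
    (h.density_continuous.comp continuous_fst).aestronglyMeasurable
    (Filter.Eventually.of_forall fun z => ?_)
  rw [Real.norm_of_nonneg (h.density_nonneg _)]
  exact hC _

/-- Denote the left side by `I` and the integral on the right by `B`. With `f = M / (s² + δ)` the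
continuity equation writes `I` as an integral of `f u ξ`, where `u` is the radial velocity. Young's
inequality with weights `2π` and `1/(8π)` splits the integrand into the integrand of `B` and `f² u²
|F'_e| / ρ_Q`. The second moment bound removes `ρ_Q` from the latter and leaves `4π ∫ s² f² ds ≤
4πI`. Hence `I ≤ 2πB + I/2`; `δ` makes `I` finite in advance, which allows the absorption. -/
lemma integral_massIn_sq_le {ξ g : L2r ℝ Q F} (hξ : (h.koopman ℝ).IsGenerator ξ g) {δ : ℝ}
    (hδ : 0 < δ) :
    ∫ s in (0:ℝ)..h.radius, massIn Q (g : Phase → ℝ) s ^ 2 / (s ^ 2 + δ) ≤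
      4 * Real.pi * ∫ z in Omega Q, density Q z.1 * ((ξ : Phase → ℝ) z ^ 2 / |dF Q F z|) := by
  have hpi := Real.pi_pos
  have hR := h.radius_pos
  set R := h.radius
  have hM := continuous_massIn (h.integrableOn_coe g.1)
  set M := massIn Q (g : Phase → ℝ)
  set f : ℝ → ℝ := fun s => M s / (s ^ 2 + δ)
  have hf : Continuous f := hM.div (by fun_prop) fun s => by positivity
  have hdm := h.measurable_dF
  have hρm := h.density_continuous.measurable
  have hfm := hf.measurable
  set I := ∫ s in (0:ℝ)..R, M s ^ 2 / (s ^ 2 + δ)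
  have hIc : Continuous fun s => M s ^ 2 / (s ^ 2 + δ) :=
    (hM.pow 2).div (by fun_prop) fun s => by positivity
  have hI0 : 0 ≤ I := intervalIntegral.integral_nonneg hR.le fun s _ => by positivity
  have hI : I = ∫ z in Omega Q, (f ‖z.1‖ * (⟪z.1, z.2⟫ / ‖z.1‖)) * (ξ : Phase → ℝ) z := by
    rw [← h.integral_mul_massIn hξ hf]
    refine intervalIntegral.integral_congr fun s _ => ?_
    simp only [f]
    ring
  set K : Phase → ℝ := fun z => f ‖z.1‖ ^ 2 / density Q z.1 *
    (⟪z.1, z.2⟫ ^ 2 / ‖z.1‖ ^ 2 * |dF Q F z|)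
  have hKm : Measurable K := by fun_prop
  have hK0 : ∀ z, 0 ≤ K z := fun z =>
    mul_nonneg (div_nonneg (sq_nonneg _) (h.density_nonneg _)) (by positivity)
  have hKle : ∫⁻ z in Omega Q, ENNReal.ofReal (K z) ≤ ENNReal.ofReal (4 * Real.pi * I) := by
    rw [← lintegral_indicator h.measurableSet_Omega, Measure.volume_eq_prod, lintegral_prod _
      (hKm.ennreal_ofReal.indicator h.measurableSet_Omega).aemeasurable]
    have e1 : ∀ x v, (Omega Q).indicator (fun z => ENNReal.ofReal (K z)) (x, v) =
        ENNReal.ofReal (f ‖x‖ ^ 2 / density Q x) * (Omega Q).indicator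
          (fun z => ENNReal.ofReal (⟪z.1, z.2⟫ ^ 2 / ‖z.1‖ ^ 2 * |dF Q F z|)) (x, v) := by
      intro x v
      by_cases hv : ((x, v) : Phase) ∈ Omega Q
      · rw [indicator_of_mem hv, indicator_of_mem hv, ← ENNReal.ofReal_mul
          (div_nonneg (sq_nonneg _) (h.density_nonneg _))]
      · rw [indicator_of_notMem hv, indicator_of_notMem hv, mul_zero]
    have e2 : ∀ᵐ x : E3, (∫⁻ v, (Omega Q).indicator (fun z => ENNReal.ofReal (K z)) (x, v)) ≤
        (Iio R).indicator (fun r => ENNReal.ofReal (f r ^ 2)) ‖x‖ := by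
      filter_upwards [ae_fst_ne_zero] with x hx
      simp only [e1]
      rw [lintegral_const_mul' _ _ ENNReal.ofReal_ne_top]
      refine (mul_le_mul_right (h.lintegral_radialVelocity_sq_le hx) _).trans ?_
      rw [← ENNReal.ofReal_mul (div_nonneg (sq_nonneg _) (h.density_nonneg _))]
      by_cases hxR : ‖x‖ < R
      · rw [indicator_of_mem (mem_Iio.2 hxR)]
        refine ENNReal.ofReal_le_ofReal ?_
        -- Where `ρ_Q` vanishes the right-hand factor is zero, and the bound is trivial.
        rcases (h.density_nonneg x).eq_or_lt with h0 | h0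
        · rw [← h0, mul_zero]
          exact sq_nonneg _
        · rw [div_mul_cancel₀ _ h0.ne']
      · rw [h.density_eq_zero (not_lt.1 hxR), mul_zero, ENNReal.ofReal_zero]
        exact zero_le
    refine (lintegral_mono_ae e2).trans ?_
    rw [lintegral_radial (h := (Iio R).indicator fun r => ENNReal.ofReal (f r ^ 2))
      ((by fun_prop : Measurable fun r => ENNReal.ofReal (f r ^ 2)).indicator measurableSet_Iio),
      ENNReal.ofReal_mul (p := 4 * Real.pi) (by positivity)]
    refine mul_le_mul_right ?_ _
    rw [show I = ∫ s in Ioc 0 R, M s ^ 2 / (s ^ 2 + δ) from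
      intervalIntegral.integral_of_le hR.le, ofReal_integral_eq_lintegral_ofReal
      ((intervalIntegrable_iff_integrableOn_Ioc_of_le hR.le).1 (hIc.intervalIntegrable 0 R))
      (Filter.Eventually.of_forall fun s => by positivity),
      ← lintegral_indicator measurableSet_Ioi, ← lintegral_indicator measurableSet_Ioc]
    refine lintegral_mono fun s => ?_
    by_cases hs : 0 < s
    · rw [indicator_of_mem (mem_Ioi.2 hs)]
      by_cases hsR : s < R
      · rw [indicator_of_mem (mem_Iio.2 hsR), indicator_of_mem (mem_Ioc.2 ⟨hs, hsR.le⟩),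
          ← ENNReal.ofReal_mul (by positivity)]
        refine ENNReal.ofReal_le_ofReal ?_
        simp only [f]
        rw [div_pow, ← mul_div_assoc, div_le_div_iff₀ (by positivity) (by positivity)]
        have : 0 ≤ M s ^ 2 * (s ^ 2 + δ) * δ := by positivity
        nlinarith
      · rw [indicator_of_notMem (s := Iio R) (by simpa using hsR), mul_zero]
        exact zero_le
    · rw [indicator_of_notMem (by simpa using hs)]
      exact zero_le
  have hKi : IntegrableOn K (Omega Q) := by
    refine ⟨hKm.aestronglyMeasurable, ?_⟩
    rw [hasFiniteIntegral_iff_ofReal (Filter.Eventually.of_forall hK0)]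
    exact hKle.trans_lt ENNReal.ofReal_lt_top
  have hKI : ∫ z in Omega Q, K z ≤ 4 * Real.pi * I := by
    rw [← ENNReal.ofReal_le_ofReal_iff (by positivity), ofReal_integral_eq_lintegral_ofReal hKi
      (Filter.Eventually.of_forall hK0)]
    exact hKle
  have hBi := h.integrableOn_density_mul_sq_div ξ
  set B := ∫ z in Omega Q, density Q z.1 * ((ξ : Phase → ℝ) z ^ 2 / |dF Q F z|)
  have hle : I ≤ 2 * Real.pi * B + 1 / (8 * Real.pi) * ∫ z in Omega Q, K z := by
    rw [← integral_const_mul, ← integral_const_mul,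
      ← integral_add (hBi.const_mul _) (hKi.const_mul _), hI]
    have hsum : Integrable (fun z => 2 * Real.pi * (density Q z.1 *
        ((ξ : Phase → ℝ) z ^ 2 / |dF Q F z|)) + 1 / (8 * Real.pi) * K z)
        (volume.restrict (Omega Q)) := (hBi.const_mul _).add (hKi.const_mul _)
    refine (Real.le_norm_self _).trans (norm_integral_le_of_norm_le hsum ?_)
    filter_upwards [ae_restrict_mem h.measurableSet_Omega, ae_restrict_of_ae ae_angMom_pos]
      with z hz hl
    have hρ := h.density_pos hz
    have hd : 0 < |dF Q F z| := abs_pos.2 (h.dF_neg hz).ne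
    simp only [K]
    rw [Real.norm_eq_abs]
    set u := ⟪z.1, z.2⟫ / ‖z.1‖ with hu
    have hu2 : ⟪z.1, z.2⟫ ^ 2 / ‖z.1‖ ^ 2 = u ^ 2 := by rw [hu, div_pow]
    rw [hu2]
    set ρ := density Q z.1
    set d := |dF Q F z|
    set x := (ξ : Phase → ℝ) z
    set c := f ‖z.1‖
    have e : 2 * Real.pi * (ρ * (x ^ 2 / d)) + 1 / (8 * Real.pi) * (c ^ 2 / ρ * (u ^ 2 * d)) =
        ((4 * Real.pi * ρ * x) ^ 2 + (c * u * d) ^ 2) / (8 * Real.pi * ρ * d) := by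
      field_simp
      ring
    rw [e, le_div_iff₀ (by positivity), ← abs_of_pos (by positivity : 0 < 8 * Real.pi * ρ * d),
      ← abs_mul]
    refine abs_le.2 ⟨?_, ?_⟩
    · nlinarith [sq_nonneg (4 * Real.pi * ρ * x + c * u * d)]
    · nlinarith [sq_nonneg (4 * Real.pi * ρ * x - c * u * d)]
  have h8 : 1 / (8 * Real.pi) * (4 * Real.pi * I) = I / 2 := by
    field_simp
    ring
  have h9 : 1 / (8 * Real.pi) * ∫ z in Omega Q, K z ≤ I / 2 := by
    rw [← h8]
    gcongr
  linarith

/-- The gravitational energy of `𝒯 ξ` is controlled by the local density. -/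
theorem norm_field_sq_le {ξ g : L2r ℝ Q F} (hξ : (h.koopman ℝ).IsGenerator ξ g) :
    ‖h.field g‖ ^ 2 ≤
      ∫ z in Omega Q, density Q z.1 * ((ξ : Phase → ℝ) z ^ 2 / |dF Q F z|) := by
  have hpi := Real.pi_pos
  have hR := h.radius_pos
  have hM := continuous_massIn (h.integrableOn_coe g.1)
  set M := massIn Q (g : Phase → ℝ) with hMdef
  set B := ∫ z in Omega Q, density Q z.1 * ((ξ : Phase → ℝ) z ^ 2 / |dF Q F z|)
  have hB : 0 ≤ B := integral_nonneg fun z => mul_nonneg (h.density_nonneg _) (by positivity)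
  rw [← ENNReal.ofReal_le_ofReal_iff hB, h.ofReal_norm_field_sq, h.lintegral_gradient_extend]
  -- Fatou's lemma as `δ → 0`. Beyond the radius of `Ω` the mass of `g` vanishes, so the estimate on
  -- a bounded interval covers the half-line.
  have hmain : ∫⁻ r in Ioi (0 : ℝ), ENNReal.ofReal (M r ^ 2 / r ^ 2) ≤
      ENNReal.ofReal (4 * Real.pi * B) := by
    set δ : ℕ → ℝ := fun n => 1 / ((n : ℝ) + 1)
    have hδ : ∀ n, 0 < δ n := fun n => Nat.one_div_pos_of_nat
    have hlim : ∀ r ∈ Ioi (0 : ℝ), Filter.Tendsto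
        (fun n => ENNReal.ofReal (M r ^ 2 / (r ^ 2 + δ n))) Filter.atTop
        (𝓝 (ENNReal.ofReal (M r ^ 2 / r ^ 2))) := fun r hr => by
      have hr' : (0 : ℝ) < r := hr
      refine ENNReal.tendsto_ofReal (Filter.Tendsto.div tendsto_const_nhds ?_ (by positivity))
      simpa only [add_zero] using
        (tendsto_one_div_add_atTop_nhds_zero_nat (𝕜 := ℝ)).const_add (r ^ 2)
    have hbound : ∀ n, ∫⁻ r in Ioi (0 : ℝ), ENNReal.ofReal (M r ^ 2 / (r ^ 2 + δ n)) ≤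
        ENNReal.ofReal (4 * Real.pi * B) := fun n => by
      have hc : Continuous fun s => M s ^ 2 / (s ^ 2 + δ n) :=
        (hM.pow 2).div (by fun_prop) fun s => by have := hδ n; positivity
      refine le_trans (le_of_eq ?_) (ENNReal.ofReal_le_ofReal (h.integral_massIn_sq_le hξ (hδ n)))
      rw [intervalIntegral.integral_of_le hR.le, ofReal_integral_eq_lintegral_ofReal
        ((intervalIntegrable_iff_integrableOn_Ioc_of_le hR.le).1
          (hc.intervalIntegrable 0 h.radius))
        (Filter.Eventually.of_forall fun s => by have := hδ n; positivity),
        ← lintegral_indicator measurableSet_Ioi, ← lintegral_indicator measurableSet_Ioc]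
      refine lintegral_congr fun s => ?_
      by_cases hs : 0 < s
      · rw [indicator_of_mem (mem_Ioi.2 hs)]
        by_cases hsR : s ≤ h.radius
        · rw [indicator_of_mem (mem_Ioc.2 ⟨hs, hsR⟩)]
        · rw [indicator_of_notMem (s := Ioc 0 h.radius) (fun H => hsR H.2), hMdef,
            h.massIn_eq_zero_of_radius_le hξ (not_le.1 hsR).le]
          simp
      · rw [indicator_of_notMem (by simpa using hs),
          indicator_of_notMem (s := Ioc 0 h.radius) (fun H => hs H.1)]
    calc ∫⁻ r in Ioi (0 : ℝ), ENNReal.ofReal (M r ^ 2 / r ^ 2)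
        = ∫⁻ r in Ioi (0 : ℝ), Filter.liminf
            (fun n => ENNReal.ofReal (M r ^ 2 / (r ^ 2 + δ n))) Filter.atTop :=
          setLIntegral_congr_fun measurableSet_Ioi fun r hr => (hlim r hr).liminf_eq.symm
      _ ≤ Filter.liminf (fun n => ∫⁻ r in Ioi (0 : ℝ),
            ENNReal.ofReal (M r ^ 2 / (r ^ 2 + δ n))) Filter.atTop :=
          lintegral_liminf_le fun n => by have := hM.measurable; fun_prop
      _ ≤ ENNReal.ofReal (4 * Real.pi * B) :=
          Filter.liminf_le_of_frequently_le' (Filter.Frequently.of_forall hbound)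
  refine (mul_le_mul_right hmain _).trans ?_
  rw [← ENNReal.ofReal_mul (by positivity)]
  refine ENNReal.ofReal_le_ofReal (le_of_eq ?_)
  field_simp

end IsAdmissible

end VlasovPoisson
end

/-! ### The equation for `x·v` and time averages of odd functions. -/

noncomputable section
namespace VlasovPoisson
open scoped ENNReal NNReal Topology

/-- While `y` is positive it is concave, hence below its tangent at `0`, which vanishes at time `y 0
/ (-p 0)`. -/
lemma exists_zero_of_concave {y p V : ℝ → ℝ} (hy : ∀ t, HasDerivAt y (p t) t)
    (hp : ∀ t, HasDerivAt p (-(V t * y t)) t) (hV : ∀ t, 0 ≤ V t) (h0 : 0 < y 0)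
    (hp0 : p 0 < 0) : ∃ t, 0 ≤ t ∧ t * (-p 0) ≤ y 0 ∧ y t = 0 := by
  have hn : 0 < -p 0 := neg_pos.2 hp0
  set T := y 0 / (-p 0)
  have hT : T * (-p 0) = y 0 := div_mul_cancel₀ _ hn.ne'
  have hT0 : 0 ≤ T := (div_pos h0 hn).le
  have hyc : Continuous y := continuous_iff_continuousAt.2 fun t => (hy t).continuousAt
  by_cases hcon : ∃ t ∈ Icc 0 T, y t ≤ 0
  · obtain ⟨t, ht, hyt⟩ := hcon
    obtain ⟨s, hs, hs0⟩ := intermediate_value_Icc' ht.1 hyc.continuousOn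
      (show (0:ℝ) ∈ Icc (y t) (y 0) from ⟨hyt, h0.le⟩)
    refine ⟨s, hs.1, ?_, hs0⟩
    rw [← hT]
    exact mul_le_mul_of_nonneg_right (hs.2.trans ht.2) hn.le
  · push Not at hcon
    exfalso
    have h1 : ∀ t ∈ Icc 0 T, p t ≤ p 0 := fun t ht => by
      have := le_add_mul_of_hasDerivAt_le hp ht.1 (C := 0) fun u hu =>
        neg_nonpos.2 (mul_nonneg (hV u) (hcon u ⟨hu.1.le, hu.2.le.trans ht.2⟩).le)
      linarith
    have h2 := le_add_mul_of_hasDerivAt_le hy hT0 (C := p 0) fun u hu => h1 u ⟨hu.1.le, hu.2.le⟩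
    have h3 := hcon T ⟨hT0, le_rfl⟩
    linarith

namespace IsAdmissible

variable {Q : Phase → ℝ} {F : ℝ → ℝ → ℝ} {e₀ : ℝ} (h : IsAdmissible Q F e₀)
include h

omit h in
/-- The derivative of `x·v` along the flow. -/
def virial (h : IsAdmissible Q F e₀) (z : Phase) : ℝ := ‖z.2‖ ^ 2 - h.mean ‖z.1‖ * ‖z.1‖ ^ 2

omit h in
/-- The coefficient of the equation `y'' = -V y` for `y = x·v` along the flow. -/
def stiffness (h : IsAdmissible Q F e₀) (z : Phase) : ℝ := density Q z.1 + h.mean ‖z.1‖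

lemma stiffness_nonneg (z : Phase) : 0 ≤ h.stiffness z :=
  add_nonneg (h.density_nonneg _) (h.mean_nonneg (norm_nonneg _))

lemma exists_stiffness_bound : ∃ C, ∀ z, h.stiffness z ≤ C := by
  obtain ⟨C, hC⟩ := h.exists_density_bound
  obtain ⟨C', _, hC'⟩ := h.exists_mean_bound
  exact ⟨C + C', fun z => add_le_add (hC _) (hC' _ (norm_nonneg _))⟩

lemma measurable_mean : Measurable h.mean := by
  have hm : Monotone (ballMass (density Q)) := fun r s hrs => h.ballMass_mono hrs
  have := hm.measurable
  change Measurable fun r => ballMass (density Q) r / (4 * Real.pi * r ^ 3)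
  fun_prop

lemma measurable_virial : Measurable h.virial := by
  have := h.measurable_mean
  unfold virial
  fun_prop

lemma measurable_stiffness : Measurable h.stiffness := by
  have := h.measurable_mean
  have := h.density_continuous.measurable
  unfold stiffness
  fun_prop

lemma exists_virial_bound : ∃ C, ∀ z ∈ Omega Q, |h.virial z| ≤ C := by
  obtain ⟨C, hC0, hC⟩ := h.exists_mean_bound
  refine ⟨h.radius ^ 2 + C * h.radius ^ 2, fun z hz => ?_⟩
  have h1 := pow_le_pow_left₀ (norm_nonneg _) (h.norm_snd_lt_radius hz).le 2
  have h2 := pow_le_pow_left₀ (norm_nonneg _) (h.norm_fst_lt_radius hz).le 2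
  have h3 : h.mean ‖z.1‖ * ‖z.1‖ ^ 2 ≤ C * h.radius ^ 2 :=
    mul_le_mul (hC _ (norm_nonneg _)) h2 (by positivity) hC0
  have h4 : 0 ≤ h.mean ‖z.1‖ * ‖z.1‖ ^ 2 :=
    mul_nonneg (h.mean_nonneg (norm_nonneg _)) (by positivity)
  have h5 : 0 ≤ ‖z.2‖ ^ 2 := by positivity
  rw [abs_le]
  unfold virial
  constructor <;> linarith [sq_nonneg h.radius]

lemma abs_inner_le {z : Phase} (hz : z ∈ Omega Q) : |⟪z.1, z.2⟫| ≤ h.radius ^ 2 := by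
  rw [sq]
  exact (abs_real_inner_le_norm _ _).trans (mul_le_mul (h.norm_fst_lt_radius hz).le
    (h.norm_snd_lt_radius hz).le (norm_nonneg _) h.radius_pos.le)

/-- With `y = x·v`, the virial is `|v|²` minus the mass within `r` over `4πr`. Differentiating the
mass gives `-ρ_Q y`; the kinetic term `-2m y` and the derivative `m y` from the factor `1/r` leave
`-m y`. -/
lemma hasDerivAt_virial {z : Phase} (hz : 0 < angMom z) (t : ℝ) :
    HasDerivAt (fun t => h.virial (h.flow t z))
      (-(h.stiffness (h.flow t z) * ⟪(h.flow t z).1, (h.flow t z).2⟫)) t := by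
  obtain ⟨R, hR, hρ⟩ := h.exists_profile
  have hp := h.norm_fst_flow_pos hz t
  have hpi := Real.pi_pos
  have h1 := (((hasDerivAt_ballMass hR hρ hp).comp t (h.hasDerivAt_norm_fst hz t)).div
    ((h.hasDerivAt_norm_fst hz t).const_mul (4 * Real.pi)) (by positivity))
  refine ((h.hasDerivAt_normSq_snd t z).sub h1).congr_of_eventuallyEq
    (Filter.Eventually.of_forall fun s => ?_) |>.congr_deriv ?_
  · have hs := h.norm_fst_flow_pos hz s
    simp only [virial, mean, meanField, Pi.sub_apply, Pi.div_apply, Function.comp_apply]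
    field_simp
  · simp only [stiffness, mean, meanField, hρ, Function.comp_apply]
    field_simp
    ring

/-- A rotation invariant function that is odd in the velocity and bounded by `M |F'_e|`. -/
structure IsOddProfile (Q : Phase → ℝ) (F : ℝ → ℝ → ℝ) (M : ℝ) (η : Phase → ℝ) : Prop where
  measurable : Measurable η
  congr : ∀ a b, invariants a = invariants b → η a = η b
  odd : ∀ z : Phase, η (z.1, -z.2) = -η z
  bound : ∀ z ∈ Omega Q, 0 < angMom z → |η z| ≤ M * |dF Q F z|

omit h in
/-- The average of a function over the time interval `[-τ, τ]` of the flow. -/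
def timeAverage (h : IsAdmissible Q F e₀) (τ : ℝ) (η : Phase → ℝ) (z : Phase) : ℝ :=
  (2 * τ)⁻¹ * ∫ s in (-τ)..τ, η (h.flow s z)

omit h in
/-- The derivative along the flow of a time average. -/
def timeDifference (h : IsAdmissible Q F e₀) (τ : ℝ) (η : Phase → ℝ) (z : Phase) : ℝ :=
  (2 * τ)⁻¹ * (η (h.flow τ z) - η (h.flow (-τ) z))

section Average

variable {M : ℝ} {η : Phase → ℝ} (hη : IsOddProfile Q F M η) {τ : ℝ} (hτ : 0 < τ)
include hη

lemma abs_oddProfile_flow_le {z : Phase} (hz : z ∈ Omega Q) (hl : 0 < angMom z) (s : ℝ) :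
    |η (h.flow s z)| ≤ M * |dF Q F z| := by
  rw [← h.dF_flow hl s]
  exact hη.bound _ (h.flow_mem_Omega.2 hz) (by rwa [h.angMom_flow])

lemma intervalIntegrable_oddProfile {z : Phase} (hz : z ∈ Omega Q) (hl : 0 < angMom z) (a b : ℝ) :
    IntervalIntegrable (fun s => η (h.flow s z)) volume a b := by
  refine (intervalIntegrable_const (c := M * |dF Q F z|)).mono_fun'
    (hη.measurable.comp (h.continuous_flow_time z).measurable).aestronglyMeasurable
    (Filter.Eventually.of_forall fun s => h.abs_oddProfile_flow_le hη hz hl s)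

include hτ

/-- Velocity reversal reverses time, so averages over an interval symmetric about `0` remain odd.
The pointwise bound survives because `F'_e` is constant along trajectories. -/
lemma isOddProfile_timeAverage : IsOddProfile Q F M (h.timeAverage τ η) where
  measurable := by
    have : StronglyMeasurable fun p : Phase × ℝ => η (h.flow p.2 p.1) :=
      (hη.measurable.comp (h.continuous_flow.measurable.comp measurable_swap)).stronglyMeasurable
    unfold timeAverage
    simp only [intervalIntegral]
    exact ((this.integral_prod_right'.measurable).sub
      (this.integral_prod_right'.measurable)).const_mul _
  congr a b hab := by
    unfold timeAverage
    congr 1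
    exact intervalIntegral.integral_congr fun s _ => hη.congr _ _ (h.invariants_flow_congr hab s)
  odd z := by
    unfold timeAverage
    rw [← mul_neg, ← intervalIntegral.integral_neg]
    have := intervalIntegral.integral_comp_neg (a := -τ) (b := τ) fun s => -η (h.flow s z)
    rw [neg_neg] at this
    rw [← this]
    congr 1
    refine intervalIntegral.integral_congr fun s _ => ?_
    rw [h.flow_reverse, hη.odd]
  bound z hz hl := by
    have h1 := intervalIntegral.norm_integral_le_of_norm_le_const (a := -τ) (b := τ)
      (C := M * |dF Q F z|) (f := fun s => η (h.flow s z))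
      (fun s _ => h.abs_oddProfile_flow_le hη hz hl s)
    rw [Real.norm_eq_abs, sub_neg_eq_add, ← two_mul, abs_of_pos (by positivity : 0 < 2 * τ)] at h1
    unfold timeAverage
    rw [abs_mul, abs_of_pos (by positivity : 0 < (2 * τ)⁻¹)]
    calc _ ≤ (2 * τ)⁻¹ * (M * |dF Q F z| * (2 * τ)) := by gcongr
      _ = _ := by field_simp

omit hη hτ in
lemma timeAverage_flow (t : ℝ) (z : Phase) : h.timeAverage τ η (h.flow t z) =
    (2 * τ)⁻¹ * ∫ s in (t - τ)..(t + τ), η (h.flow s z) := by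
  unfold timeAverage
  simp only [← h.flow_add]
  rw [intervalIntegral.integral_comp_add_right (fun s => η (h.flow s z))]
  congr 2 <;> ring

omit hτ in
lemma continuous_timeAverage_flow {z : Phase} (hz : z ∈ Omega Q) (hl : 0 < angMom z) :
    Continuous fun t => h.timeAverage τ η (h.flow t z) := by
  have hi := h.intervalIntegrable_oddProfile hη hz hl
  have hc := intervalIntegral.continuous_primitive hi 0
  have e : (fun t => h.timeAverage τ η (h.flow t z)) = fun t => (2 * τ)⁻¹ *
      ((∫ s in (0:ℝ)..(t + τ), η (h.flow s z)) - ∫ s in (0:ℝ)..(t - τ), η (h.flow s z)) := by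
    funext t
    rw [h.timeAverage_flow, intervalIntegral.integral_interval_sub_left (hi _ _) (hi _ _)]
  rw [e]
  exact continuous_const.mul ((hc.comp (by fun_prop)).sub (hc.comp (by fun_prop)))

omit hη hτ in
lemma hasDerivAt_timeAverage {z : Phase} (hc : Continuous fun s => η (h.flow s z)) (t : ℝ) :
    HasDerivAt (fun t => h.timeAverage τ η (h.flow t z)) (h.timeDifference τ η (h.flow t z)) t := by
  have hd : ∀ b, HasDerivAt (fun u => ∫ s in (0:ℝ)..u, η (h.flow s z)) (η (h.flow b z)) b :=
    fun b => intervalIntegral.integral_hasDerivAt_right (hc.intervalIntegrable 0 b)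
      hc.stronglyMeasurable.stronglyMeasurableAtFilter hc.continuousAt
  have h1 := (((hd (t + τ)).comp_add_const t τ).sub ((hd (t - τ)).comp_sub_const t τ)).const_mul
    (2 * τ)⁻¹
  refine (h1.congr_of_eventuallyEq (Filter.Eventually.of_forall fun s => ?_)).congr_deriv ?_
  · simp only [Pi.sub_apply]
    rw [h.timeAverage_flow, intervalIntegral.integral_interval_sub_left
      (hc.intervalIntegrable _ _) (hc.intervalIntegrable _ _)]
  · rw [timeDifference, ← h.flow_add, ← h.flow_add]
    rw [add_comm τ, add_comm (-τ), ← sub_eq_add_neg]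

lemma abs_timeDifference_le {z : Phase} (hz : z ∈ Omega Q) (hl : 0 < angMom z) (s : ℝ) :
    |h.timeDifference τ η (h.flow s z)| ≤ τ⁻¹ * (M * |dF Q F z|) := by
  rw [timeDifference, abs_mul, abs_of_pos (by positivity : 0 < (2 * τ)⁻¹), ← h.flow_add,
    ← h.flow_add]
  have h1 := (abs_sub _ _).trans (add_le_add (h.abs_oddProfile_flow_le hη hz hl (τ + s))
    (h.abs_oddProfile_flow_le hη hz hl (-τ + s)))
  calc _ ≤ (2 * τ)⁻¹ * (M * |dF Q F z| + M * |dF Q F z|) := by gcongr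
    _ = _ := by field_simp; ring

omit hη hτ h in
lemma IsOddProfile.eq_zero (hη : IsOddProfile Q F M η) {z : Phase} (hz : ⟪z.1, z.2⟫ = 0) :
    η z = 0 := by
  have h1 := hη.congr (z.1, -z.2) z (by simp [invariants, hz])
  rw [hη.odd] at h1
  linarith

/-- An odd function with bounded derivative along the flow vanishes with `x·v`. -/
lemma abs_timeAverage_mul_virial_le {z : Phase} (hc : Continuous fun s => η (h.flow s z))
    (hz : z ∈ Omega Q) (hl : 0 < angMom z) :
    |h.timeAverage τ η z| * |h.virial z| ≤ τ⁻¹ * (M * |dF Q F z|) * |⟪z.1, z.2⟫| := by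
  have hA := h.isOddProfile_timeAverage hη hτ
  set C := τ⁻¹ * (M * |dF Q F z|) with hCdef
  have hlip : ∀ t, |h.timeAverage τ η (h.flow t z) - h.timeAverage τ η z| ≤ C * |t| := by
    intro t
    have := (convex_univ (𝕜 := ℝ) (E := ℝ)).norm_image_sub_le_of_norm_hasDerivWithin_le
      (f := fun t => h.timeAverage τ η (h.flow t z)) (C := C)
      (fun s _ => (h.hasDerivAt_timeAverage hc s).hasDerivWithinAt)
      (fun s _ => h.abs_timeDifference_le hη hτ hz hl s) (mem_univ (0:ℝ)) (mem_univ t)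
    simpa [h.flow_zero] using this
  have hC0 : 0 ≤ C := by simpa using (abs_nonneg _).trans (hlip 1)
  have hzero : ∀ t, ⟪(h.flow t z).1, (h.flow t z).2⟫ = 0 → |h.timeAverage τ η z| ≤ C * |t| := by
    intro t ht
    have := hlip t
    rwa [hA.eq_zero ht, zero_sub, abs_neg] at this
  have hfin : ∀ t, |t| * |h.virial z| ≤ |⟪z.1, z.2⟫| →
      ⟪(h.flow t z).1, (h.flow t z).2⟫ = 0 →
      |h.timeAverage τ η z| * |h.virial z| ≤ C * |⟪z.1, z.2⟫| := by
    intro t h1 h2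
    calc _ ≤ C * |t| * |h.virial z| := mul_le_mul_of_nonneg_right (hzero t h2) (abs_nonneg _)
      _ = C * (|t| * |h.virial z|) := by ring
      _ ≤ _ := mul_le_mul_of_nonneg_left h1 hC0
  have hyd : ∀ t, HasDerivAt (fun t => (⟪(h.flow t z).1, (h.flow t z).2⟫ : ℝ))
    (h.virial (h.flow t z)) t := fun t => h.hasDerivAt_inner t z
  have hpd := h.hasDerivAt_virial hl
  have hV := fun t => h.stiffness_nonneg (h.flow t z)
  rcases eq_or_ne (h.virial z) 0 with hp | hp
  · rw [hp, abs_zero, mul_zero]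
    positivity
  -- The direction of time is chosen according to the signs of `x·v` and of the virial, so that
  -- `|x·v|` starts to decrease. Concavity brings it to zero within the time `|x·v| / |virial|`.
  -- There the odd average vanishes, and its Lipschitz bound along the flow finishes the estimate.
  rcases lt_trichotomy (⟪z.1, z.2⟫ : ℝ) 0 with hy | hy | hy
  · rcases hp.lt_or_gt with hp | hp
    · obtain ⟨t, ht, h1, h2⟩ := exists_zero_of_concave
        (y := fun t => -⟪(h.flow (-t) z).1, (h.flow (-t) z).2⟫) (p := fun t => h.virial (h.flow (-t) z))
        (V := fun t => h.stiffness (h.flow (-t) z))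
        (fun t => ((hyd (-t)).scomp t (hasDerivAt_neg t)).neg.congr_deriv (by simp))
        (fun t => ((hpd (-t)).scomp t (hasDerivAt_neg t)).congr_deriv (by simp))
        (fun t => hV _) (by simpa [h.flow_zero] using hy) (by simpa [h.flow_zero] using hp)
      refine hfin (-t) ?_ (neg_eq_zero.1 h2)
      simp only [neg_zero, h.flow_zero] at h1
      rwa [abs_neg, abs_of_nonneg ht, abs_of_neg hp, abs_of_neg hy]
    · obtain ⟨t, ht, h1, h2⟩ := exists_zero_of_concave
        (y := fun t => -⟪(h.flow t z).1, (h.flow t z).2⟫) (p := fun t => -h.virial (h.flow t z))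
        (V := fun t => h.stiffness (h.flow t z))
        (fun t => (hyd t).neg) (fun t => (hpd t).neg.congr_deriv (by ring))
        hV (by simpa [h.flow_zero] using hy) (by simpa [h.flow_zero] using hp)
      refine hfin t ?_ (neg_eq_zero.1 h2)
      simp only [neg_neg, h.flow_zero] at h1
      rwa [abs_of_nonneg ht, abs_of_pos hp, abs_of_neg hy]
  · rw [hA.eq_zero hy, hy]
    simp
  · rcases hp.lt_or_gt with hp | hp
    · obtain ⟨t, ht, h1, h2⟩ := exists_zero_of_concave hyd hpd hV
        (by simpa [h.flow_zero] using hy) (by simpa [h.flow_zero] using hp)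
      refine hfin t ?_ h2
      simp only [h.flow_zero] at h1
      rwa [abs_of_nonneg ht, abs_of_neg hp, abs_of_pos hy]
    · obtain ⟨t, ht, h1, h2⟩ := exists_zero_of_concave
        (y := fun t => ⟪(h.flow (-t) z).1, (h.flow (-t) z).2⟫)
        (p := fun t => -h.virial (h.flow (-t) z))
        (V := fun t => h.stiffness (h.flow (-t) z))
        (fun t => ((hyd (-t)).scomp t (hasDerivAt_neg t)).congr_deriv (by simp))
        (fun t => ((hpd (-t)).scomp t (hasDerivAt_neg t)).neg.congr_deriv (by simp))
        (fun t => hV _) (by simpa [h.flow_zero] using hy) (by simpa [h.flow_zero] using hp)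
      refine hfin (-t) ?_ h2
      simp only [neg_zero, h.flow_zero, neg_neg] at h1
      rwa [abs_neg, abs_of_nonneg ht, abs_of_pos hp, abs_of_pos hy]

end Average

end IsAdmissible

end VlasovPoisson
end

/-! ### Jacobi's inequality by a regularized Riccati substitution. -/

noncomputable section
namespace VlasovPoisson
open scoped ENNReal NNReal Topology

section Riccati

variable {δ : ℝ}

/-- The regularization `y y' / (y² + δ)` of the logarithmic derivative of `y`. -/
def riccati (δ y p : ℝ) : ℝ := p * y / (y ^ 2 + δ)

/-- The derivative of `riccati` along a solution of `y'' = -V y`. -/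
def riccatiDeriv (δ y p V : ℝ) : ℝ :=
  (-(V * y) * y + p * p) / (y ^ 2 + δ) - 2 * y ^ 2 * p ^ 2 / (y ^ 2 + δ) ^ 2

/-- The regularization of `V` that comes from the Riccati equation. -/
def riccatiCoeff (δ y p V : ℝ) : ℝ :=
  V * y ^ 2 / (y ^ 2 + δ) - δ * p ^ 2 / (y ^ 2 + δ) ^ 2

lemma continuous_riccati (hδ : 0 < δ) :
    Continuous fun w : ℝ × ℝ × ℝ => riccati δ w.1 w.2.1 :=
  Continuous.div (by fun_prop) (by fun_prop) fun w => by positivity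

lemma continuous_riccatiDeriv (hδ : 0 < δ) :
    Continuous fun w : ℝ × ℝ × ℝ => riccatiDeriv δ w.1 w.2.1 w.2.2 :=
  (Continuous.div (by fun_prop) (by fun_prop) fun w => by positivity).sub
    (Continuous.div (by fun_prop) (by fun_prop) fun w => by positivity)

lemma continuous_riccatiCoeff (hδ : 0 < δ) :
    Continuous fun w : ℝ × ℝ × ℝ => riccatiCoeff δ w.1 w.2.1 w.2.2 :=
  (Continuous.div (by fun_prop) (by fun_prop) fun w => by positivity).sub
    (Continuous.div (by fun_prop) (by fun_prop) fun w => by positivity)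

lemma hasDerivAt_riccati (hδ : 0 < δ) {y p a : ℝ → ℝ} {V b d t : ℝ}
    (hy : HasDerivAt y (p t) t) (hp : HasDerivAt p (-(V * y t)) t) (ha : HasDerivAt a b t) :
    HasDerivAt (fun s => riccati δ (y s) (p s) * (a s * a s / d))
      (riccatiDeriv δ (y t) (p t) V * (a t * a t / d) +
        2 * (riccati δ (y t) (p t) * (a t * b / d))) t := by
  have hne : y t ^ 2 + δ ≠ 0 := by positivity
  have h1 : HasDerivAt (fun s => p s * y s) (-(V * y t) * y t + p t * p t) t := hp.mul hy
  have h2 : HasDerivAt (fun s => y s ^ 2 + δ) (2 * y t * p t) t :=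
    ((hy.pow 2).add_const δ).congr_deriv (by simp)
  have h3 : HasDerivAt (fun s => a s * a s / d) ((b * a t + a t * b) / d) t :=
    (ha.mul ha).div_const d
  refine ((h1.fun_div h2 hne).fun_mul h3).congr_deriv ?_
  simp only [riccati, riccatiDeriv]
  field_simp
  ring

/-- The expression is the square `(b - q a)² / d`, with `q` the regularized logarithmic derivative.
This forces the coefficient of `a²`: it is `-q' - q²`, which is `riccatiCoeff` and tends to `V` as
`δ → 0` where `y ≠ 0`. -/
lemma riccati_nonneg (hδ : 0 < δ) {y p V a b d : ℝ} (hd : 0 < d) :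
    0 ≤ 1 * (b * b / d) - riccatiCoeff δ y p V * (a * a / d) -
      (riccatiDeriv δ y p V * (a * a / d) + 2 * (riccati δ y p * (a * b / d))) := by
  have hne : y ^ 2 + δ ≠ 0 := by positivity
  have e : 1 * (b * b / d) - riccatiCoeff δ y p V * (a * a / d) -
      (riccatiDeriv δ y p V * (a * a / d) + 2 * (riccati δ y p * (a * b / d))) =
      (b - riccati δ y p * a) ^ 2 / d := by
    simp only [riccati, riccatiDeriv, riccatiCoeff]
    field_simp
    ring
  rw [e]
  positivity

end Riccati

namespace IsAdmissible

variable {Q : Phase → ℝ} {F : ℝ → ℝ → ℝ} {e₀ : ℝ} (h : IsAdmissible Q F e₀)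
include h

lemma integrableOn_of_abs_le {G : Phase → ℝ} (hG : Measurable G) {K : ℝ}
    (hK : ∀ z ∈ Omega Q, 0 < angMom z → |G z| ≤ K * |dF Q F z|) : IntegrableOn G (Omega Q) := by
  refine (h.integrableOn_dF.norm.const_mul K).mono' hG.aestronglyMeasurable ?_
  filter_upwards [ae_restrict_mem h.measurableSet_Omega, ae_restrict_of_ae ae_angMom_pos]
    with z hz hl using hK z hz hl

/-- The integral of a derivative along the flow vanishes. -/
lemma integral_eq_zero_of_flow_deriv {H G : Phase → ℝ} (hH : Measurable H) (hG : Measurable G)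
    {K K' : ℝ} (hK : ∀ z ∈ Omega Q, 0 < angMom z → |H z| ≤ K * |dF Q F z|)
    (hK' : ∀ z ∈ Omega Q, 0 < angMom z → |G z| ≤ K' * |dF Q F z|)
    (hd : ∀ z ∈ Omega Q, 0 < angMom z → H (h.flow 1 z) - H z = ∫ s in (0:ℝ)..1, G (h.flow s z)) :
    ∫ z in Omega Q, G z = 0 := by
  have hHi := h.integrableOn_of_abs_le hH hK
  have hHf : Integrable (fun z => H (h.flow 1 z)) (volume.restrict (Omega Q)) :=
    (h.measurePreserving_flow_Omega 1).integrable_comp_of_integrable hHi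
  have hint : Integrable (fun p : ℝ × Phase => G (h.flow p.1 p.2))
      ((volume.restrict (uIoc (0:ℝ) 1)).prod (volume.restrict (Omega Q))) := by
    have hfin : IsFiniteMeasure (volume.restrict (uIoc (0:ℝ) 1)) :=
      ⟨by rw [Measure.restrict_apply_univ]; simp [uIoc]⟩
    have hdom : Integrable (fun p : ℝ × Phase => K' * ‖dF Q F p.2‖)
        ((volume.restrict (uIoc (0:ℝ) 1)).prod (volume.restrict (Omega Q))) :=
      (h.integrableOn_dF.norm.const_mul K').comp_snd _
    refine hdom.mono' (hG.comp h.continuous_flow.measurable).aestronglyMeasurable ?_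
    have hΩ : ∀ᵐ p ∂((volume.restrict (uIoc (0:ℝ) 1)).prod (volume.restrict (Omega Q))),
        p.2 ∈ Omega Q ∧ 0 < angMom p.2 :=
      Measure.quasiMeasurePreserving_snd.ae
        ((ae_restrict_mem h.measurableSet_Omega).and (ae_restrict_of_ae ae_angMom_pos))
    filter_upwards [hΩ] with p hp
    rw [Real.norm_eq_abs (dF Q F p.2), ← h.dF_flow hp.2 p.1]
    exact hK' _ (h.flow_mem_Omega.2 hp.1) (by rw [h.angMom_flow]; exact hp.2)
  calc ∫ z in Omega Q, G z
      = ∫ s in (0:ℝ)..1, ∫ z in Omega Q, G (h.flow s z) := by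
        simp only [h.integral_comp_flow]
        simp
    _ = ∫ z in Omega Q, ∫ s in (0:ℝ)..1, G (h.flow s z) := intervalIntegral_integral_swap hint
    _ = ∫ z in Omega Q, (H (h.flow 1 z) - H z) := by
        refine integral_congr_ae ?_
        filter_upwards [ae_restrict_mem h.measurableSet_Omega, ae_restrict_of_ae ae_angMom_pos]
          with z hz hl using (hd z hz hl).symm
    _ = 0 := by
        rw [integral_sub hHf hHi, h.integral_comp_flow, sub_self]

lemma abs_mul_div_dF_le {c f g : Phase → ℝ} {C D E : ℝ} (hC : ∀ z ∈ Omega Q, |c z| ≤ C)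
    (hD : ∀ z ∈ Omega Q, 0 < angMom z → |f z| ≤ D * |dF Q F z|)
    (hE : ∀ z ∈ Omega Q, 0 < angMom z → |g z| ≤ E * |dF Q F z|) :
    ∀ z ∈ Omega Q, 0 < angMom z →
      |c z * (f z * g z / |dF Q F z|)| ≤ C * D * E * |dF Q F z| := by
  intro z hz hl
  have hd : 0 < |dF Q F z| := abs_pos.2 (h.dF_neg hz).ne
  rw [abs_mul, abs_div, abs_mul, abs_abs]
  have h1 : |f z| * |g z| / |dF Q F z| ≤ D * E * |dF Q F z| := by
    rw [div_le_iff₀ hd]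
    calc _ ≤ (D * |dF Q F z|) * (E * |dF Q F z|) := mul_le_mul (hD z hz hl) (hE z hz hl)
          (abs_nonneg _) ((abs_nonneg _).trans (hD z hz hl))
      _ = _ := by ring
  calc _ ≤ C * (D * E * |dF Q F z|) := mul_le_mul (hC z hz) h1 (by positivity)
        ((abs_nonneg _).trans (hC z hz))
    _ = _ := by ring

lemma continuous_stiffness_flow {z : Phase} (hl : 0 < angMom z) :
    Continuous fun t => h.stiffness (h.flow t z) := by
  refine (h.density_continuous.comp (h.continuous_flow_time z).fst).add ?_
  simp only [mean, meanField]
  refine Continuous.div ?_ (by have := (h.continuous_flow_time z).fst; fun_prop)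
    fun s => by have := h.norm_fst_flow_pos hl s; have := Real.pi_pos; positivity
  exact h.continuousOn_ballMass.comp_continuous (h.continuous_flow_time z).fst.norm
    fun s => h.norm_fst_flow_pos hl s

section Jacobi

variable {M : ℝ} {η : Phase → ℝ} (hη : IsOddProfile Q F M η) {τ : ℝ} (hτ : 0 < τ)
  (hc : ∀ z ∈ Omega Q, 0 < angMom z → Continuous fun s => η (h.flow s z))
include hη

lemma measurable_timeDifference : Measurable (h.timeDifference τ η) := by
  have h1 := hη.measurable.comp (h.continuous_flow_apply τ).measurable
  have h2 := hη.measurable.comp (h.continuous_flow_apply (-τ)).measurable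
  exact (h1.sub h2).const_mul _

include hτ hc

/-- The Riccati form of Jacobi's inequality, with the singularity regularized. -/
lemma integral_regularized_le {δ : ℝ} (hδ : 0 < δ) :
    ∫ z in Omega Q, riccatiCoeff δ ⟪z.1, z.2⟫ (h.virial z) (h.stiffness z) *
      (h.timeAverage τ η z * h.timeAverage τ η z / |dF Q F z|) ≤
    ∫ z in Omega Q, h.timeDifference τ η z * h.timeDifference τ η z / |dF Q F z| := by
  have hA := h.isOddProfile_timeAverage hη hτ
  obtain ⟨P, hP⟩ := h.exists_virial_bound
  obtain ⟨B, hB⟩ := h.exists_stiffness_bound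
  have ham := hA.measurable
  have hab := hA.bound
  have hbm := h.measurable_timeDifference hη (τ := τ)
  have hbb : ∀ z ∈ Omega Q, 0 < angMom z →
      |h.timeDifference τ η z| ≤ τ⁻¹ * M * |dF Q F z| := fun z hz hl => by
    have := h.abs_timeDifference_le hη hτ hz hl 0
    rw [h.flow_zero] at this
    linarith
  have had := fun z hz hl => h.hasDerivAt_timeAverage (τ := τ) (hc z hz hl)
  have hac := fun z hz hl => h.continuous_timeAverage_flow hη (τ := τ) (z := z) hz hl
  have hbc : ∀ z ∈ Omega Q, 0 < angMom z →
      Continuous fun s => h.timeDifference τ η (h.flow s z) := fun z hz hl => by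
    refine continuous_const.mul (Continuous.sub ?_ ?_)
    · simp only [← h.flow_add]
      exact (hc z hz hl).comp (continuous_const.add continuous_id)
    · simp only [← h.flow_add]
      exact (hc z hz hl).comp (continuous_const.add continuous_id)
  generalize h.timeAverage τ η = a at *
  generalize h.timeDifference τ η = b at *
  -- On `Ω` the triple of `x·v`, virial and stiffness stays in a compact box, on which the Riccati
  -- functions are bounded for fixed `δ`. All integrands are then bounded by multiples of the
  -- integrable function `|F'_e|`.
  set S : Set (ℝ × ℝ × ℝ) := Icc (-h.radius ^ 2) (h.radius ^ 2) ×ˢ Icc (-P) P ×ˢ Icc 0 B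
  have hS : IsCompact S := isCompact_Icc.prod (isCompact_Icc.prod isCompact_Icc)
  set w : Phase → ℝ × ℝ × ℝ := fun z => (⟪z.1, z.2⟫, h.virial z, h.stiffness z)
  have hw : ∀ z ∈ Omega Q, w z ∈ S := fun z hz =>
    ⟨abs_le.1 (h.abs_inner_le hz), abs_le.1 (hP z hz), h.stiffness_nonneg z, hB z⟩
  have hwm : Measurable w := by
    have := h.measurable_virial
    have := h.measurable_stiffness
    fun_prop
  obtain ⟨C₁, hC₁⟩ := hS.exists_bound_of_continuousOn (continuous_riccati hδ).continuousOn
  obtain ⟨C₂, hC₂⟩ := hS.exists_bound_of_continuousOn (continuous_riccatiDeriv hδ).continuousOn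
  obtain ⟨C₃, hC₃⟩ := hS.exists_bound_of_continuousOn (continuous_riccatiCoeff hδ).continuousOn
  have hqm := (continuous_riccati hδ).measurable.comp hwm
  have hqm' := (continuous_riccatiDeriv hδ).measurable.comp hwm
  have hkm := (continuous_riccatiCoeff hδ).measurable.comp hwm
  have hdm := h.measurable_dF
  have hq1 : ∀ z ∈ Omega Q, |riccati δ (w z).1 (w z).2.1| ≤ C₁ := fun z hz => hC₁ _ (hw z hz)
  have hq2 : ∀ z ∈ Omega Q, |riccatiDeriv δ (w z).1 (w z).2.1 (w z).2.2| ≤ C₂ :=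
    fun z hz => hC₂ _ (hw z hz)
  have hk1 : ∀ z ∈ Omega Q, |riccatiCoeff δ (w z).1 (w z).2.1 (w z).2.2| ≤ C₃ :=
    fun z hz => hC₃ _ (hw z hz)
  have hflow : ∀ z ∈ Omega Q, 0 < angMom z → ∀ t, HasDerivAt (fun s =>
      riccati δ (w (h.flow s z)).1 (w (h.flow s z)).2.1 *
        (a (h.flow s z) * a (h.flow s z) / |dF Q F z|))
      (riccatiDeriv δ (w (h.flow t z)).1 (w (h.flow t z)).2.1 (w (h.flow t z)).2.2 *
        (a (h.flow t z) * a (h.flow t z) / |dF Q F z|) +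
        2 * (riccati δ (w (h.flow t z)).1 (w (h.flow t z)).2.1 *
        (a (h.flow t z) * b (h.flow t z) / |dF Q F z|))) t := fun z hz hl t =>
    hasDerivAt_riccati hδ (h.hasDerivAt_inner t z) (h.hasDerivAt_virial hl t) (had z hz hl t)
  have hwc : ∀ z ∈ Omega Q, 0 < angMom z → Continuous fun t => w (h.flow t z) := fun z hz hl =>
    (continuous_iff_continuousAt.2 fun t => (h.hasDerivAt_inner t z).continuousAt).prodMk
      ((continuous_iff_continuousAt.2 fun t => (h.hasDerivAt_virial hl t).continuousAt).prodMk
        (h.continuous_stiffness_flow hl))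
  have hcont : ∀ z ∈ Omega Q, 0 < angMom z → Continuous fun t =>
      (riccatiDeriv δ (w (h.flow t z)).1 (w (h.flow t z)).2.1 (w (h.flow t z)).2.2 *
        (a (h.flow t z) * a (h.flow t z) / |dF Q F z|) +
        2 * (riccati δ (w (h.flow t z)).1 (w (h.flow t z)).2.1 *
        (a (h.flow t z) * b (h.flow t z) / |dF Q F z|))) := fun z hz hl =>
    (((continuous_riccatiDeriv hδ).comp (hwc z hz hl)).mul
      (((hac z hz hl).mul (hac z hz hl)).div_const _)).add
      (continuous_const.mul (((continuous_riccati hδ).comp (hwc z hz hl)).mul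
        (((hac z hz hl).mul (hbc z hz hl)).div_const _)))
  have hpos : ∀ z ∈ Omega Q, 0 ≤ 1 * (b z * b z / |dF Q F z|) -
      riccatiCoeff δ (w z).1 (w z).2.1 (w z).2.2 * (a z * a z / |dF Q F z|) -
      (riccatiDeriv δ (w z).1 (w z).2.1 (w z).2.2 * (a z * a z / |dF Q F z|) +
      2 * (riccati δ (w z).1 (w z).2.1 * (a z * b z / |dF Q F z|))) := fun z hz =>
    riccati_nonneg hδ (abs_pos.2 (h.dF_neg hz).ne)
  have hL : ∀ z, riccatiCoeff δ ⟪z.1, z.2⟫ (h.virial z) (h.stiffness z) =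
    riccatiCoeff δ (w z).1 (w z).2.1 (w z).2.2 := fun z => rfl
  simp only [hL]
  obtain ⟨q, hq⟩ : ∃ q : Phase → ℝ, q = fun z => riccati δ (w z).1 (w z).2.1 := ⟨_, rfl⟩
  obtain ⟨q', hq'⟩ : ∃ q' : Phase → ℝ, q' = fun z =>
    riccatiDeriv δ (w z).1 (w z).2.1 (w z).2.2 := ⟨_, rfl⟩
  obtain ⟨k, hk⟩ : ∃ k : Phase → ℝ, k = fun z =>
    riccatiCoeff δ (w z).1 (w z).2.1 (w z).2.2 := ⟨_, rfl⟩
  replace hqm : Measurable q := hq ▸ hqm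
  replace hqm' : Measurable q' := hq' ▸ hqm'
  replace hkm : Measurable k := hk ▸ hkm
  have e1 : ∀ z, riccati δ (w z).1 (w z).2.1 = q z := fun z => by rw [hq]
  have e2 : ∀ z, riccatiDeriv δ (w z).1 (w z).2.1 (w z).2.2 = q' z := fun z => by rw [hq']
  have e3 : ∀ z, riccatiCoeff δ (w z).1 (w z).2.1 (w z).2.2 = k z := fun z => by rw [hk]
  simp only [e1, e2, e3] at *
  clear hq hq' hk e1 e2 e3 hL
  have b1 := h.abs_mul_div_dF_le hq1 hab hab
  have b2 := h.abs_mul_div_dF_le hq2 hab hab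
  have b3 := h.abs_mul_div_dF_le hq1 hab hbb
  have b4 := h.abs_mul_div_dF_le hk1 hab hab
  have b5 := h.abs_mul_div_dF_le (c := fun _ => 1) (C := 1) (fun z _ => by simp) hbb hbb
  -- The cross terms form the flow derivative of `q a² / |F'_e|`, so they integrate to zero and only
  -- the two quadratic forms of the inequality remain.
  have hG := h.integral_eq_zero_of_flow_deriv
    (H := fun z => q z * (a z * a z / |dF Q F z|))
    (G := fun z => q' z * (a z * a z / |dF Q F z|) + 2 * (q z * (a z * b z / |dF Q F z|)))
    (K := C₁ * M * M) (K' := C₂ * M * M + 2 * (C₁ * M * (τ⁻¹ * M)))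
    (by fun_prop) (by fun_prop) b1
    (fun z hz hl => by
      refine (abs_add_le _ _).trans ?_
      rw [add_mul, abs_mul 2, abs_two, mul_assoc 2]
      exact add_le_add (b2 z hz hl) (mul_le_mul_of_nonneg_left (b3 z hz hl) zero_le_two))
    (fun z hz hl => by
      simp only [h.dF_flow hl]
      rw [intervalIntegral.integral_eq_sub_of_hasDerivAt (fun s _ => hflow z hz hl s)
        ((hcont z hz hl).intervalIntegrable 0 1), h.flow_zero])
  have i1 := h.integrableOn_of_abs_le (by fun_prop) b5
  have i2 := h.integrableOn_of_abs_le (by fun_prop) b4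
  have i3 := h.integrableOn_of_abs_le (by fun_prop) b2
  have i4 := (h.integrableOn_of_abs_le (by fun_prop) b3).const_mul 2
  have hsq := setIntegral_nonneg (μ := volume) h.measurableSet_Omega hpos
  have hsplit := integral_sub (i1.sub i2) (i3.add i4)
  simp only [Pi.sub_apply, Pi.add_apply] at hsplit
  rw [hsplit, hG, sub_zero, integral_sub i1 i2, sub_nonneg] at hsq
  simpa only [one_mul] using hsq

/-- Jacobi's inequality for functions that are regular along the flow. -/
lemma integral_stiffness_timeAverage_le :
    ∫ z in Omega Q, h.stiffness z * (h.timeAverage τ η z ^ 2 / |dF Q F z|) ≤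
    ∫ z in Omega Q, h.timeDifference τ η z ^ 2 / |dF Q F z| := by
  have hA := h.isOddProfile_timeAverage hη hτ
  obtain ⟨B, hB⟩ := h.exists_stiffness_bound
  set δ : ℕ → ℝ := fun n => 1 / ((n : ℝ) + 1)
  have hδ : ∀ n, 0 < δ n := fun n => Nat.one_div_pos_of_nat
  have hδ0 : Filter.Tendsto δ Filter.atTop (𝓝 0) := tendsto_one_div_add_atTop_nhds_zero_nat
  simp only [sq (h.timeAverage τ η _), sq (h.timeDifference τ η _)]
  refine le_of_tendsto (f := fun n : ℕ => ∫ z in Omega Q,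
      riccatiCoeff (δ n) ⟪z.1, z.2⟫ (h.virial z) (h.stiffness z) *
      (h.timeAverage τ η z * h.timeAverage τ η z / |dF Q F z|))
    (x := Filter.atTop) ?_
    (Filter.Eventually.of_forall fun n => h.integral_regularized_le hη hτ hc (hδ n))
  have hvm := h.measurable_virial
  have hsm := h.measurable_stiffness
  have ham := hA.measurable
  have hdm := h.measurable_dF
  simp only [riccatiCoeff, ← sq (h.timeAverage τ η _)]
  refine tendsto_integral_of_dominated_convergence
    (fun z => (B * M ^ 2 + (τ⁻¹ * M) ^ 2) * ‖dF Q F z‖)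
    (fun n => Measurable.aestronglyMeasurable (by fun_prop)) (h.integrableOn_dF.norm.const_mul _)
    (fun n => ?_) ?_
  · filter_upwards [ae_restrict_mem h.measurableSet_Omega, ae_restrict_of_ae ae_angMom_pos]
      with z hz hl
    have hd' : 0 < |dF Q F z| := abs_pos.2 (h.dF_neg hz).ne
    have h1 := hA.bound z hz hl
    have h2 := h.abs_timeAverage_mul_virial_le hη hτ (hc z hz hl) hz hl
    have hV0 := h.stiffness_nonneg z
    have hV := hB z
    have hn := hδ n
    have hn1 : δ n ≠ 0 := hn.ne'
    rw [Real.norm_eq_abs, Real.norm_eq_abs]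
    set a := h.timeAverage τ η z
    set y : ℝ := ⟪z.1, z.2⟫
    set d := |dF Q F z|
    have hyd : 0 < y ^ 2 + δ n := by positivity
    have h3 : a ^ 2 ≤ (M * d) ^ 2 := by
      rw [← sq_abs a]
      exact pow_le_pow_left₀ (abs_nonneg _) h1 2
    have h4 : a ^ 2 * h.virial z ^ 2 ≤ (τ⁻¹ * (M * d)) ^ 2 * y ^ 2 := by
      have := pow_le_pow_left₀ (by positivity) h2 2
      simpa only [mul_pow, sq_abs] using this
    have t1 : |h.stiffness z * y ^ 2 / (y ^ 2 + δ n) * (a ^ 2 / d)| ≤ B * M ^ 2 * d := by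
      rw [abs_of_nonneg (by positivity)]
      have : h.stiffness z * y ^ 2 / (y ^ 2 + δ n) ≤ B := by
        rw [div_le_iff₀ hyd]
        have := hV0.trans hV
        nlinarith [sq_nonneg y, mul_le_mul_of_nonneg_right hV (sq_nonneg y), mul_nonneg this hn.le]
      have h5 : a ^ 2 / d ≤ M ^ 2 * d := by
        rw [div_le_iff₀ hd']
        linarith
      calc _ ≤ B * (M ^ 2 * d) := mul_le_mul this h5 (by positivity) (hV0.trans hV)
        _ = _ := by ring
    -- The singular term is dominated uniformly in `δ` because the odd average vanishes with `y =
    -- x·v`: `a²` times the squared virial is at most a constant times `y²`, and `δ y² ≤ (y² + δ)²`.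
    have t2 : |δ n * h.virial z ^ 2 / (y ^ 2 + δ n) ^ 2 * (a ^ 2 / d)| ≤ (τ⁻¹ * M) ^ 2 * d := by
      rw [abs_of_nonneg (by positivity)]
      have e : δ n * h.virial z ^ 2 / (y ^ 2 + δ n) ^ 2 * (a ^ 2 / d) =
          δ n * (a ^ 2 * h.virial z ^ 2) / ((y ^ 2 + δ n) ^ 2 * d) := by
        field_simp
      rw [e, div_le_iff₀ (by positivity)]
      calc _ ≤ δ n * ((τ⁻¹ * (M * d)) ^ 2 * y ^ 2) := mul_le_mul_of_nonneg_left h4 hn.le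
        _ = (τ⁻¹ * M * d) ^ 2 * (δ n * y ^ 2) := by ring
        _ ≤ (τ⁻¹ * M * d) ^ 2 * (y ^ 2 + δ n) ^ 2 := by
            refine mul_le_mul_of_nonneg_left ?_ (sq_nonneg _)
            nlinarith [sq_nonneg (y ^ 2), mul_nonneg hn.le (sq_nonneg y), sq_nonneg (δ n)]
        _ = _ := by ring
    rw [sub_mul, add_mul]
    exact (abs_sub _ _).trans (add_le_add t1 t2)
  -- For `x·v ≠ 0` the coefficient converges to the stiffness, the term with the virial being of
  -- order `δ`.
  · filter_upwards [ae_restrict_of_ae ae_inner_ne_zero] with z hy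
    have hlim1 : Filter.Tendsto (fun n => (⟪z.1, z.2⟫ : ℝ) ^ 2 + δ n) Filter.atTop
        (𝓝 (⟪z.1, z.2⟫ ^ 2)) := by simpa using hδ0.const_add (⟪z.1, z.2⟫ ^ 2 : ℝ)
    have hy2 : (⟪z.1, z.2⟫ : ℝ) ^ 2 ≠ 0 := pow_ne_zero 2 hy
    have := (((tendsto_const_nhds (x := h.stiffness z * ⟪z.1, z.2⟫ ^ 2)).div hlim1 hy2).sub
      ((hδ0.mul_const (h.virial z ^ 2)).div (hlim1.pow 2) (pow_ne_zero 2 hy2))).mul_const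
      (h.timeAverage τ η z ^ 2 / |dF Q F z|)
    rwa [zero_mul, zero_div, sub_zero, mul_div_cancel_right₀ _ hy2] at this

end Jacobi

end IsAdmissible

end VlasovPoisson
end

/-! ### Jacobi's inequality for all odd functions in the domain. -/

noncomputable section
namespace VlasovPoisson
open scoped ENNReal NNReal Topology

namespace IsometryGroup

set_option linter.unusedSectionVars false

variable {𝕜 H : Type} [RCLike 𝕜] [NormedAddCommGroup H] [InnerProductSpace 𝕜 H]
  [NormedSpace ℝ H] [IsScalarTower ℝ 𝕜 H] [CompleteSpace H] (U : IsometryGroup 𝕜 H)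

/-- The average over the time interval `[-τ, τ]`. -/
def average (τ : ℝ) (f : H) : H := (2 * τ)⁻¹ • ∫ s in (-τ)..τ, U.toFun s f

/-- The symmetric difference quotient. -/
def difference (τ : ℝ) (f : H) : H := (2 * τ)⁻¹ • (U.toFun τ f - U.toFun (-τ) f)

lemma intervalIntegrable (f : H) (a b : ℝ) :
    IntervalIntegrable (fun s => U.toFun s f) volume a b :=
  (U.continuous_apply f).intervalIntegrable a b

lemma average_sub (τ : ℝ) (f g : H) : U.average τ (f - g) = U.average τ f - U.average τ g := by
  simp only [average, map_sub]
  rw [intervalIntegral.integral_sub (U.intervalIntegrable f _ _) (U.intervalIntegrable g _ _),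
    smul_sub]

lemma norm_average_le {τ : ℝ} (hτ : 0 < τ) (f : H) : ‖U.average τ f‖ ≤ ‖f‖ := by
  have h1 := intervalIntegral.norm_integral_le_of_norm_le_const (a := -τ) (b := τ) (C := ‖f‖)
    (f := fun s => U.toFun s f) (fun s _ => ((U.toFun s).norm_map f).le)
  rw [sub_neg_eq_add, ← two_mul, abs_of_pos (by positivity : 0 < 2 * τ)] at h1
  rw [average, norm_smul, Real.norm_of_nonneg (by positivity : 0 ≤ (2 * τ)⁻¹)]
  calc _ ≤ (2 * τ)⁻¹ * (‖f‖ * (2 * τ)) := by gcongr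
    _ = _ := by field_simp

lemma continuous_average {τ : ℝ} (hτ : 0 < τ) : Continuous (U.average τ) := by
  refine (LipschitzWith.of_dist_le_mul (K := 1) fun f g => ?_).continuous
  rw [dist_eq_norm, dist_eq_norm, ← U.average_sub, NNReal.coe_one, one_mul]
  exact U.norm_average_le hτ _

lemma continuous_difference (τ : ℝ) : Continuous (U.difference τ) :=
  ((U.toFun τ).continuous.sub (U.toFun (-τ)).continuous).const_smul _

lemma apply_average (τ t : ℝ) (f : H) :
    U.toFun t (U.average τ f) = U.average τ (U.toFun t f) := by
  have h1 := ((U.toFun t).toContinuousLinearMap.restrictScalars ℝ).intervalIntegral_comp_comm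
    (U.intervalIntegrable f (-τ) τ)
  have h2 := ((U.toFun t).toContinuousLinearMap.restrictScalars ℝ).map_smul (2 * τ)⁻¹
    (∫ s in (-τ)..τ, U.toFun s f)
  refine h2.trans ?_
  rw [average, ← h1]
  congr 1
  refine intervalIntegral.integral_congr fun s _ => ?_
  change U.toFun t (U.toFun s f) = U.toFun s (U.toFun t f)
  rw [← U.add_apply, ← U.add_apply, add_comm]

lemma average_smul (τ c : ℝ) (f : H) : U.average τ (c • f) = c • U.average τ f := by
  have h2 : ∀ s, U.toFun s (c • f) = c • U.toFun s f := fun s =>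
    ((U.toFun s).toContinuousLinearMap.restrictScalars ℝ).map_smul c f
  simp only [average, h2]
  rw [intervalIntegral.integral_smul, smul_comm]

lemma difference_average (τ : ℝ) (f : H) :
    U.difference τ (U.average τ f) = U.average τ (U.difference τ f) := by
  rw [difference, difference, average_smul, average_sub, apply_average, apply_average]

lemma IsGenerator.difference_eq {U : IsometryGroup 𝕜 H} {f g : H} (h : U.IsGenerator f g) (τ : ℝ) :
    U.difference τ f = U.average τ g := by
  rw [difference, average, intervalIntegral.integral_eq_sub_of_hasDerivAt
    (fun s _ => h.hasDerivAt s) (U.intervalIntegrable g _ _)]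

lemma tendsto_average (f : H) :
    Filter.Tendsto (fun n : ℕ => U.average (1 / ((n : ℝ) + 1)) f) Filter.atTop (𝓝 f) := by
  have hc := U.continuous_apply f
  have hd : HasDerivAt (fun u => ∫ s in (0:ℝ)..u, U.toFun s f) (U.toFun 0 f) 0 :=
    intervalIntegral.integral_hasDerivAt_right (hc.intervalIntegrable 0 0)
      hc.stronglyMeasurable.stronglyMeasurableAtFilter hc.continuousAt
  rw [U.zero_apply] at hd
  have hd' : HasDerivAt (fun u => ∫ s in (0:ℝ)..(-u), U.toFun s f) (-f) 0 := by
    have := HasDerivAt.scomp (0:ℝ) (h := fun u : ℝ => -u) (by simpa using hd) (hasDerivAt_neg 0)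
    simpa only [Function.comp_def, neg_smul, one_smul] using this
  have h2 := hd.sub hd'
  rw [sub_neg_eq_add, hasDerivAt_iff_tendsto_slope_zero] at h2
  have h3 : Filter.Tendsto (fun n : ℕ => 1 / ((n : ℝ) + 1)) Filter.atTop (𝓝[≠] 0) :=
    tendsto_nhdsWithin_iff.2 ⟨tendsto_one_div_add_atTop_nhds_zero_nat,
      Filter.Eventually.of_forall fun n => (Nat.one_div_pos_of_nat (n := n)).ne'⟩
  have h4 := (h2.comp h3).const_smul (2⁻¹ : ℝ)
  have e : (2⁻¹ : ℝ) • (f + f) = f := by rw [← two_smul ℝ f, smul_smul]; norm_num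
  rw [e] at h4
  refine h4.congr fun n => ?_
  simp only [Function.comp_apply, Pi.sub_apply, zero_add, neg_zero, intervalIntegral.integral_same,
    sub_zero]
  rw [average, smul_smul, ← mul_inv, intervalIntegral.integral_interval_sub_left
    (U.intervalIntegrable f _ _) (U.intervalIntegrable f _ _)]

end IsometryGroup

namespace IsAdmissible

variable {Q : Phase → ℝ} {F : ℝ → ℝ → ℝ} {e₀ : ℝ} (h : IsAdmissible Q F e₀)
include h

lemma inner_eq_integral (f g : L2r ℝ Q F) :
    ⟪f, g⟫ = ∫ z in Omega Q, (f : Phase → ℝ) z * (g : Phase → ℝ) z / |dF Q F z| := by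
  have : ⟪f, g⟫ = ⟪f.1, g.1⟫ := rfl
  rw [this, L2.inner_def, h.integral_weighted]
  refine integral_congr_ae (Filter.Eventually.of_forall fun z => ?_)
  simp only [smul_eq_mul, RCLike.inner_apply, conj_trivial]
  ring

/-- A quadratic form with bounded density is continuous. -/
lemma continuous_integral_mul_sq {w : Phase → ℝ} (hw : Measurable w) {C : ℝ}
    (hC : ∀ z ∈ Omega Q, |w z| ≤ C) : Continuous fun f : L2r ℝ Q F =>
      ∫ z in Omega Q, w z * ((f : Phase → ℝ) z ^ 2 / |dF Q F z|) := by
  have hm : MemLp w ∞ (weighted Q F) := memLp_top_of_bound hw.aestronglyMeasurable C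
    (h.ae_weighted_iff.2 ((ae_restrict_mem h.measurableSet_Omega).mono hC))
  set B := (ContinuousLinearMap.lsmul ℝ ℝ (E := ℝ)).holderL (weighted Q F) ∞ 2 2 (hm.toLp w)
  have hB : Continuous fun f : L2r ℝ Q F => ⟪f.1, B f.1⟫ :=
    continuous_subtype_val.inner (B.continuous.comp continuous_subtype_val)
  refine hB.congr fun f => ?_
  rw [L2.inner_def, h.integral_weighted]
  refine integral_congr_ae ?_
  filter_upwards [h.ae_weighted_iff.1 hm.coeFn_toLp, h.ae_weighted_iff.1
    ((ContinuousLinearMap.lsmul ℝ ℝ (E := ℝ)).coeFn_holder (r := 2) (hm.toLp w) f.1)] with z h1 h2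
  have h3 : (B f.1 : Phase → ℝ) z = w z * (f : Phase → ℝ) z := by
    rw [← h1]
    exact h2
  simp only [h3, smul_eq_mul, RCLike.inner_apply, conj_trivial]
  ring

lemma exists_L2r_eq {f : Phase → ℝ} (hm : Measurable f)
    (hf : ∀ a b, invariants a = invariants b → f a = f b)
    (hi : IntegrableOn (fun z => f z ^ 2 / |dF Q F z|) (Omega Q)) :
    ∃ e : L2r ℝ Q F, (e : Phase → ℝ) =ᵐ[volume.restrict (Omega Q)] f := by
  have hmem : MemLp f 2 (weighted Q F) := by
    rw [memLp_two_iff_integrable_sq hm.aestronglyMeasurable, h.integrable_weighted_iff]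
    refine hi.congr (Filter.Eventually.of_forall fun z => ?_)
    simp only [smul_eq_mul]
    ring
  refine ⟨⟨hmem.toLp f, ?_⟩, h.ae_weighted_iff.1 hmem.coeFn_toLp⟩
  rw [mem_lpMeas_iff_aestronglyMeasurable]
  refine ⟨f, ?_, hmem.coeFn_toLp⟩
  have e : f = (f ∘ invariantsSection) ∘ invariants := by
    funext z
    exact hf _ _ (invariants_invariantsSection z).symm
  rw [e]
  exact ((hm.comp measurable_invariantsSection).comp
    (comap_measurable invariants)).stronglyMeasurable

lemma sq_div_dF_le {z : Phase} (hz : z ∈ Omega Q) {x M : ℝ} (hx : |x| ≤ M * |dF Q F z|) :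
    |x ^ 2 / (|dF Q F z|)| ≤ M ^ 2 * |dF Q F z| := by
  have hd : 0 < |dF Q F z| := abs_pos.2 (h.dF_neg hz).ne
  rw [abs_of_nonneg (by positivity), div_le_iff₀ hd, ← sq_abs x]
  calc _ ≤ (M * |dF Q F z|) ^ 2 := pow_le_pow_left₀ (abs_nonneg _) hx 2
    _ = _ := by ring

lemma exists_L2r_eq_oddProfile {M : ℝ} {η : Phase → ℝ} (hη : IsOddProfile Q F M η) :
    ∃ e : L2r ℝ Q F, (e : Phase → ℝ) =ᵐ[volume.restrict (Omega Q)] η :=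
  h.exists_L2r_eq hη.measurable hη.congr (h.integrableOn_of_abs_le
    (by have := hη.measurable; have := h.measurable_dF; fun_prop)
    fun _ hz hl => h.sq_div_dF_le hz (hη.bound _ hz hl))

lemma difference_ae {e : L2r ℝ Q F} {η : Phase → ℝ}
    (he : (e : Phase → ℝ) =ᵐ[volume.restrict (Omega Q)] η) (τ : ℝ) :
    ((h.koopman ℝ).difference τ e : Phase → ℝ) =ᵐ[volume.restrict (Omega Q)]
      h.timeDifference τ η := by
  have h1 := h.ae_weighted_iff.1 (Lp.coeFn_smul (2 * τ)⁻¹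
    (((h.koopman ℝ).toFun τ e).1 - ((h.koopman ℝ).toFun (-τ) e).1))
  have h2 := h.ae_weighted_iff.1
    (Lp.coeFn_sub ((h.koopman ℝ).toFun τ e).1 ((h.koopman ℝ).toFun (-τ) e).1)
  have h5 := (h.measurePreserving_flow_Omega τ).quasiMeasurePreserving.ae_eq_comp he
  have h6 := (h.measurePreserving_flow_Omega (-τ)).quasiMeasurePreserving.ae_eq_comp he
  filter_upwards [h1, h2, h.koopman_ae τ e, h.koopman_ae (-τ) e, h5, h6] with z h1 h2 h3 h4 h5 h6
  refine h1.trans ?_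
  rw [Pi.smul_apply, h2, Pi.sub_apply, h3, h4, timeDifference, smul_eq_mul]
  simp only [Function.comp_apply] at h5 h6
  rw [h5, h6]

/-- The left side is a vector-valued integral, the right side a pointwise one. They are compared by
pairing with an arbitrary `k` and applying Fubini. -/
lemma average_ae {M : ℝ} {η : Phase → ℝ} (hη : IsOddProfile Q F M η) {τ : ℝ} (hτ : 0 < τ)
    {e : L2r ℝ Q F} (he : (e : Phase → ℝ) =ᵐ[volume.restrict (Omega Q)] η) :
    ((h.koopman ℝ).average τ e : Phase → ℝ) =ᵐ[volume.restrict (Omega Q)]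
      h.timeAverage τ η := by
  obtain ⟨e', he'⟩ := h.exists_L2r_eq_oddProfile (h.isOddProfile_timeAverage hη hτ)
  suffices h0 : (h.koopman ℝ).average τ e = e' by rw [h0]; exact he'
  refine ext_inner_left ℝ fun k => ?_
  have hkm : Measurable (k : Phase → ℝ) := (Lp.stronglyMeasurable k.1).measurable
  have hdm := h.measurable_dF
  have hle : -τ ≤ τ := by linarith
  have hint : Integrable (fun p : ℝ × Phase => (k : Phase → ℝ) p.2 * η (h.flow p.1 p.2) /
      |dF Q F p.2|) ((volume.restrict (uIoc (-τ) τ)).prod (volume.restrict (Omega Q))) := by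
    have hfin : IsFiniteMeasure (volume.restrict (uIoc (-τ) τ)) :=
      ⟨by rw [Measure.restrict_apply_univ]; simp [uIoc]⟩
    have hdom : Integrable (fun p : ℝ × Phase => M * ‖(k : Phase → ℝ) p.2‖)
        ((volume.restrict (uIoc (-τ) τ)).prod (volume.restrict (Omega Q))) :=
      ((h.integrableOn_coe k.1).norm.const_mul M).comp_snd _
    have hηm : Measurable fun p : ℝ × Phase => η (h.flow p.1 p.2) :=
      hη.measurable.comp h.continuous_flow.measurable
    have hdm' : Measurable fun p : ℝ × Phase => |dF Q F p.2| := by fun_prop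
    refine hdom.mono'
      (((hkm.comp measurable_snd).mul hηm).div hdm').aestronglyMeasurable ?_
    have hΩ : ∀ᵐ p ∂((volume.restrict (uIoc (-τ) τ)).prod (volume.restrict (Omega Q))),
        p.2 ∈ Omega Q ∧ 0 < angMom p.2 :=
      Measure.quasiMeasurePreserving_snd.ae
        ((ae_restrict_mem h.measurableSet_Omega).and (ae_restrict_of_ae ae_angMom_pos))
    filter_upwards [hΩ] with p hp
    have hd : 0 < |dF Q F p.2| := abs_pos.2 (h.dF_neg hp.1).ne
    have := h.abs_oddProfile_flow_le hη hp.1 hp.2 p.1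
    rw [norm_div, norm_mul, Real.norm_eq_abs (|_|), abs_abs, Real.norm_eq_abs (η _),
      div_le_iff₀ hd]
    calc _ ≤ ‖(k : Phase → ℝ) p.2‖ * (M * |dF Q F p.2|) :=
          mul_le_mul_of_nonneg_left this (norm_nonneg _)
      _ = _ := by ring
  have e1 : ⟪k, (h.koopman ℝ).average τ e⟫ =
      (2 * τ)⁻¹ * ∫ s in (-τ)..τ, ⟪k, (h.koopman ℝ).toFun s e⟫ := by
    rw [IsometryGroup.average, real_inner_smul_right]
    congr 1
    exact ((innerSL ℝ k).intervalIntegral_comp_comm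
      ((h.koopman ℝ).intervalIntegrable e (-τ) τ)).symm
  have e2 : ∀ s, ⟪k, (h.koopman ℝ).toFun s e⟫ =
      ∫ z in Omega Q, (k : Phase → ℝ) z * η (h.flow s z) / |dF Q F z| := fun s => by
    rw [h.inner_eq_integral]
    refine integral_congr_ae ?_
    filter_upwards [h.koopman_ae s e,
      (h.measurePreserving_flow_Omega s).quasiMeasurePreserving.ae_eq_comp he] with z h1 h2
    simp only [Function.comp_apply] at h2
    rw [h1, h2]
  rw [e1, h.inner_eq_integral]
  simp only [e2]
  rw [intervalIntegral_integral_swap hint, ← integral_const_mul]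
  refine integral_congr_ae ?_
  filter_upwards [he'] with z hz
  rw [hz, timeAverage]
  have : ∀ s, (k : Phase → ℝ) z * η (h.flow s z) / |dF Q F z| =
      ((k : Phase → ℝ) z / |dF Q F z|) * η (h.flow s z) := fun s => by ring
  simp only [this]
  rw [intervalIntegral.integral_const_mul]
  ring

/-- Two averages are taken because the regular form of Jacobi's inequality requires the function
being averaged to be continuous along trajectories; the first average provides that continuity. -/
lemma integral_stiffness_average_le {M : ℝ} {η : Phase → ℝ} (hη : IsOddProfile Q F M η) {τ : ℝ}
    (hτ : 0 < τ) {e : L2r ℝ Q F} (he : (e : Phase → ℝ) =ᵐ[volume.restrict (Omega Q)] η) :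
    ∫ z in Omega Q, h.stiffness z * (((h.koopman ℝ).average τ ((h.koopman ℝ).average τ e) :
      Phase → ℝ) z ^ 2 / |dF Q F z|) ≤
    ‖(h.koopman ℝ).difference τ ((h.koopman ℝ).average τ e)‖ ^ 2 := by
  have h1 := h.average_ae hη hτ he
  have hA := h.isOddProfile_timeAverage hη hτ
  have h2 := h.average_ae hA hτ h1
  have h3 := h.difference_ae h1 τ
  have key := h.integral_stiffness_timeAverage_le hA hτ
    fun z hz hl => h.continuous_timeAverage_flow hη hz hl
  rw [h.norm_sq_eq_integral]
  refine (le_of_eq ?_).trans (key.trans (le_of_eq ?_))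
  · refine integral_congr_ae ?_
    filter_upwards [h2] with z hz
    rw [hz]
  · refine integral_congr_ae ?_
    filter_upwards [h3] with z hz
    rw [hz]

lemma energy_congr {a b : Phase} (hab : invariants a = invariants b) :
    energy (potential Q) a = energy (potential Q) b := by
  simp only [invariants, Prod.mk.injEq] at hab
  obtain ⟨h1, h2, -⟩ := hab
  unfold energy
  rw [h2]
  congr 1
  by_cases ha : a.1 = 0
  · have hb : b.1 = 0 := by rwa [ha, norm_zero, eq_comm, norm_eq_zero] at h1
    rw [ha, hb]
  · have hb : b.1 ≠ 0 := by rwa [← norm_ne_zero_iff, ← h1, norm_ne_zero_iff]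
    rw [h.potential_eq_radial ha, h.potential_eq_radial hb, h1]

lemma dF_congr {a b : Phase} (hab : invariants a = invariants b) : dF Q F a = dF Q F b := by
  have : angMom a = angMom b := by
    simp only [invariants, Prod.mk.injEq] at hab
    rw [angMom_eq, angMom_eq, hab.1, hab.2.1, hab.2.2]
  simp only [dF, this, h.energy_congr hab]

omit h in
lemma dF_reverse (z : Phase) : dF Q F (z.1, -z.2) = dF Q F z := by
  simp [dF, angMom_eq, energy]

lemma measurePreserving_reverse_Omega : MeasurePreserving (fun z : Phase => ((z.1, -z.2) : Phase))
    (volume.restrict (Omega Q)) (volume.restrict (Omega Q)) := by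
  have := measurePreserving_reverse.restrict_preimage h.measurableSet_Omega
  have e : (fun z : Phase => ((z.1, -z.2) : Phase)) ⁻¹' Omega Q = Omega Q := by
    ext z
    exact h.reverse_mem_Omega
  rwa [e] at this

/-- Odd functions are limits of odd functions bounded by multiples of `|F'_e|`. -/
lemma exists_oddProfile_tendsto {ξ : L2r ℝ Q F} (hξ : IsOdd Q (ξ : Phase → ℝ)) :
    ∃ (η : ℕ → Phase → ℝ) (e : ℕ → L2r ℝ Q F), (∀ n : ℕ, IsOddProfile Q F n (η n)) ∧
      (∀ n, (e n : Phase → ℝ) =ᵐ[volume.restrict (Omega Q)] η n) ∧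
      Filter.Tendsto e Filter.atTop (𝓝 ξ) := by
  obtain ⟨f, hfm, hfc, hξf⟩ := h.exists_invariant_representative ξ
  have hfm' := hfm.measurable
  have hdm := h.measurable_dF
  -- Oddness of `ξ` holds only almost everywhere; the odd part of an invariant representative is odd
  -- at every point.
  set f₀ : Phase → ℝ := fun z => (f z - f (z.1, -z.2)) / 2 with hf₀
  have hf₀m : Measurable f₀ := by
    have : Measurable fun z : Phase => f (z.1, -z.2) := hfm'.comp (by fun_prop)
    fun_prop
  have hf₀c : ∀ a b, invariants a = invariants b → f₀ a = f₀ b := fun a b hab => by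
    simp only [hf₀]
    rw [hfc a b hab, hfc (a.1, -a.2) (b.1, -b.2)]
    simp only [invariants, Prod.mk.injEq, norm_neg, inner_neg_right, neg_inj] at hab ⊢
    exact hab
  have hξf₀ : (ξ : Phase → ℝ) =ᵐ[volume.restrict (Omega Q)] f₀ := by
    filter_upwards [hξf, h.measurePreserving_reverse_Omega.quasiMeasurePreserving.ae_eq_comp hξf, hξ] with z h1 h2 h3
    simp only [Function.comp_apply] at h2
    simp only [hf₀]
    rw [← h1, ← h2, h3]
    ring
  -- The truncation height `n |F'_e|` is rotation invariant and even in the velocity, so the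
  -- truncation stays an odd profile. It is positive on `Ω`, so at each point of `Ω` the truncation
  -- is eventually inactive.
  set η : ℕ → Phase → ℝ := fun n z => max (-(n * |dF Q F z|)) (min (f₀ z) (n * |dF Q F z|)) with hηd
  have hη : ∀ n : ℕ, IsOddProfile Q F n (η n) := fun n =>
    { measurable := by fun_prop
      congr := fun a b hab => by
        simp only [hηd]
        rw [hf₀c a b hab, h.dF_congr hab]
      odd := fun z => by
        have : f₀ (z.1, -z.2) = -f₀ z := by simp only [hf₀, neg_neg]; ring
        simp only [hηd]
        rw [this, dF_reverse]
        have hn : 0 ≤ n * |dF Q F z| := by positivity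
        rcases le_total (f₀ z) (n * |dF Q F z|) with ha | ha <;>
        rcases le_total (-(n * |dF Q F z|)) (f₀ z) with hb | hb <;>
        grind
      bound := fun z _ _ => by
        have hn : 0 ≤ n * |dF Q F z| := by positivity
        rw [abs_le]
        exact ⟨le_max_left _ _, max_le (by linarith) (min_le_right _ _)⟩ }
  choose e he using fun n => h.exists_L2r_eq_oddProfile (hη n)
  refine ⟨η, e, hη, he, ?_⟩
  rw [tendsto_iff_norm_sub_tendsto_zero]
  have hsq : ∀ n, ‖e n - ξ‖ ^ 2 = ∫ z in Omega Q, (η n z - f₀ z) ^ 2 / |dF Q F z| := fun n => by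
    rw [h.norm_sq_eq_integral]
    refine integral_congr_ae ?_
    filter_upwards [h.ae_weighted_iff.1 (Lp.coeFn_sub (e n).1 ξ.1), he n, hξf₀] with z h1 h2 h3
    have h4 : ((e n - ξ : L2r ℝ Q F) : Phase → ℝ) z = η n z - f₀ z := by
      rw [← h2, ← h3]
      exact h1
    rw [h4]
  have hlim : Filter.Tendsto (fun n => ∫ z in Omega Q, (η n z - f₀ z) ^ 2 / |dF Q F z|)
      Filter.atTop (𝓝 (∫ z in Omega Q, 0)) := by
    have hηm := fun n => (hη n).measurable
    have hi : IntegrableOn (fun z => f₀ z ^ 2 / |dF Q F z|) (Omega Q) :=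
      (h.integrableOn_sq_div ξ).congr (by filter_upwards [hξf₀] with z hz; rw [hz])
    refine tendsto_integral_of_dominated_convergence (fun z => f₀ z ^ 2 / |dF Q F z|)
      (fun n => Measurable.aestronglyMeasurable
        (by have := hηm n; fun_prop)) hi (fun n => Filter.Eventually.of_forall fun z => ?_) ?_
    · rw [Real.norm_of_nonneg (by positivity)]
      gcongr ?_ / _
      rw [sq_le_sq]
      have hn : 0 ≤ n * |dF Q F z| := by positivity
      simp only [hηd]
      rcases le_total (f₀ z) (n * |dF Q F z|) with ha | ha <;>
      rcases le_total (-(n * |dF Q F z|)) (f₀ z) with hb | hb <;>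
      grind
    · filter_upwards [ae_restrict_mem h.measurableSet_Omega] with z hz
      have hd : 0 < |dF Q F z| := abs_pos.2 (h.dF_neg hz).ne
      refine tendsto_const_nhds.congr' ?_
      obtain ⟨N, hN⟩ := exists_nat_ge (|f₀ z| / |dF Q F z|)
      filter_upwards [Filter.eventually_ge_atTop N] with n hn
      have h1 : |f₀ z| ≤ n * |dF Q F z| := by
        rw [← div_le_iff₀ hd]
        exact hN.trans (by exact_mod_cast hn)
      have h2 := abs_le.1 h1
      simp only [hηd]
      rw [min_eq_left h2.2, max_eq_right h2.1, sub_self]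
      simp
  rw [integral_zero] at hlim
  simp only [← hsq] at hlim
  have := (Real.continuous_sqrt.tendsto 0).comp hlim
  rw [Real.sqrt_zero] at this
  exact this.congr fun n => Real.sqrt_sq (norm_nonneg _)

/-- Jacobi's inequality for odd functions. -/
theorem integral_stiffness_le {ξ g : L2r ℝ Q F} (hg : (h.koopman ℝ).IsGenerator ξ g)
    (hξ : IsOdd Q (ξ : Phase → ℝ)) :
    ∫ z in Omega Q, h.stiffness z * ((ξ : Phase → ℝ) z ^ 2 / |dF Q F z|) ≤ ‖g‖ ^ 2 := by
  set U := h.koopman ℝ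
  obtain ⟨B, hB⟩ := h.exists_stiffness_bound
  have hcont := h.continuous_integral_mul_sq h.measurable_stiffness (C := B) fun z _ => by
    rw [abs_of_nonneg (h.stiffness_nonneg z)]
    exact hB z
  obtain ⟨η, e, hη, he, hlim⟩ := h.exists_oddProfile_tendsto hξ
  -- The difference quotient of `ξ` is the time average of `g`, and averages are contractions. The
  -- bound by `‖g‖²` is therefore uniform in `τ` and survives the limit `τ → 0`.
  have key : ∀ τ, 0 < τ → ∫ z in Omega Q, h.stiffness z *
      ((U.average τ (U.average τ ξ) : Phase → ℝ) z ^ 2 / |dF Q F z|) ≤ ‖g‖ ^ 2 := by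
    intro τ hτ
    have hA := U.continuous_average hτ
    have h1 : ∫ z in Omega Q, h.stiffness z *
        ((U.average τ (U.average τ ξ) : Phase → ℝ) z ^ 2 / |dF Q F z|) ≤
        ‖U.difference τ (U.average τ ξ)‖ ^ 2 :=
      le_of_tendsto_of_tendsto'
        (((hcont.comp (hA.comp hA)).tendsto ξ).comp hlim)
        (((((U.continuous_difference τ).comp hA).norm.pow 2).tendsto ξ).comp hlim)
        fun n => h.integral_stiffness_average_le (hη n) hτ (he n)
    refine h1.trans (pow_le_pow_left₀ (norm_nonneg _) ?_ 2)
    rw [U.difference_average, hg.difference_eq]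
    exact (U.norm_average_le hτ _).trans (U.norm_average_le hτ _)
  have hτ : ∀ n : ℕ, (0:ℝ) < 1 / ((n : ℝ) + 1) := fun n => Nat.one_div_pos_of_nat
  have hconv : Filter.Tendsto (fun n : ℕ => U.average (1 / ((n : ℝ) + 1))
      (U.average (1 / ((n : ℝ) + 1)) ξ)) Filter.atTop (𝓝 ξ) := by
    have h1 := U.tendsto_average ξ
    have h2 : Filter.Tendsto (fun n : ℕ => U.average (1 / ((n : ℝ) + 1))
        (U.average (1 / ((n : ℝ) + 1)) ξ) - U.average (1 / ((n : ℝ) + 1)) ξ)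
        Filter.atTop (𝓝 0) := by
      refine squeeze_zero_norm (fun n => ?_) (tendsto_iff_norm_sub_tendsto_zero.1 h1)
      rw [← U.average_sub]
      exact U.norm_average_le (hτ n) _
    simpa using h2.add h1
  exact le_of_tendsto ((hcont.tendsto ξ).comp hconv)
    (Filter.Eventually.of_forall fun n => key _ (hτ n))

end IsAdmissible

end VlasovPoisson
end

/-! ### Coercivity, velocity reversal and the case of equality. -/

noncomputable section
namespace VlasovPoisson
open scoped ENNReal NNReal Topology

namespace IsAdmissible

variable {Q : Phase → ℝ} {F : ℝ → ℝ → ℝ} {e₀ : ℝ} (h : IsAdmissible Q F e₀)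
include h

lemma radialDeriv_potential_div {x : E3} (hx : x ≠ 0) :
    radialDeriv (potential Q) x / ‖x‖ = h.mean ‖x‖ := by
  have hn : ‖x‖ ≠ 0 := norm_ne_zero_iff.2 hx
  rw [radialDeriv, (h.hasGradientAt_potential hx).hasFDerivAt.fderiv]
  simp only [InnerProductSpace.toDual_apply_apply, real_inner_smul_left, real_inner_smul_right,
    real_inner_self_eq_norm_sq]
  field_simp

lemma integrableOn_mean_mul_sq_div (ξ : L2r ℝ Q F) :
    IntegrableOn (fun z => h.mean ‖z.1‖ * ((ξ : Phase → ℝ) z ^ 2 / |dF Q F z|)) (Omega Q) := by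
  obtain ⟨C, _, hC⟩ := h.exists_mean_bound
  refine (h.integrableOn_sq_div ξ).bdd_mul (c := C)
    (h.measurable_mean.comp measurable_fst.norm).aestronglyMeasurable
    (Filter.Eventually.of_forall fun z => ?_)
  rw [Real.norm_of_nonneg (h.mean_nonneg (norm_nonneg _))]
  exact hC _ (norm_nonneg _)

lemma mul_radialDeriv_ae (ξ : Phase → ℝ) :
    (fun z => ξ z ^ 2 / |dF Q F z| * (radialDeriv (potential Q) z.1 / ‖z.1‖))
      =ᵐ[volume.restrict (Omega Q)] fun z => h.mean ‖z.1‖ * (ξ z ^ 2 / |dF Q F z|) := by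
  filter_upwards [ae_restrict_of_ae ae_inner_ne_zero] with z hz
  have hz : z.1 ≠ 0 := fun H => hz (by rw [H, inner_zero_left])
  rw [h.radialDeriv_potential_div hz, mul_comm]

/-- Antonov's coercivity estimate. -/
theorem integral_mean_le_antonov {ξ g : L2r ℝ Q F} (hg : (h.koopman ℝ).IsGenerator ξ g)
    (hξ : IsOdd Q (ξ : Phase → ℝ)) :
    ∫ z in Omega Q, h.mean ‖z.1‖ * ((ξ : Phase → ℝ) z ^ 2 / |dF Q F z|) ≤
      antonov Q F (g : Phase → ℝ) := by
  have h1 := h.integral_stiffness_le hg hξ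
  have h2 := h.norm_field_sq_le hg
  have h3 : ∫ z in Omega Q, h.stiffness z * ((ξ : Phase → ℝ) z ^ 2 / |dF Q F z|) =
      (∫ z in Omega Q, density Q z.1 * ((ξ : Phase → ℝ) z ^ 2 / |dF Q F z|)) +
      ∫ z in Omega Q, h.mean ‖z.1‖ * ((ξ : Phase → ℝ) z ^ 2 / |dF Q F z|) := by
    rw [← integral_add (h.integrableOn_density_mul_sq_div ξ) (h.integrableOn_mean_mul_sq_div ξ)]
    simp only [stiffness, add_mul]
  rw [h.antonov_eq]
  linarith

section Reversal

lemma measurePreserving_reverse_weighted :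
    MeasurePreserving (fun z : Phase => ((z.1, -z.2) : Phase)) (weighted Q F) (weighted Q F) := by
  have hm : Measurable fun z : Phase => ((z.1, -z.2) : Phase) := by fun_prop
  refine ⟨hm, Measure.ext fun s hs => ?_⟩
  rw [Measure.map_apply hm hs, weighted, withDensity_apply _ (hm hs), withDensity_apply _ hs,
    ← h.measurePreserving_reverse_Omega.setLIntegral_comp_preimage hs h.measurable_weight]
  simp only [dF_reverse]

omit h in
lemma measurable_reverse_radialSigma :
    Measurable[radialSigma, radialSigma] fun z : Phase => ((z.1, -z.2) : Phase) := by
  refine measurable_comap_iff.2 ?_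
  have : invariants ∘ (fun z : Phase => ((z.1, -z.2) : Phase)) =
      (fun p : ℝ × ℝ × ℝ => (p.1, p.2.1, -p.2.2)) ∘ invariants := by
    funext z
    simp [invariants]
  rw [this]
  exact Measurable.comp (by fun_prop) (comap_measurable _)

omit h in
/-- Reversal of the velocities, as an isometry of the weighted space. -/
def reversal (h : IsAdmissible Q F e₀) : L2r ℝ Q F →ₗᵢ[ℝ] L2r ℝ Q F where
  toFun f := ⟨Lp.compMeasurePreserving _ h.measurePreserving_reverse_weighted f.1, by
    rw [mem_lpMeas_iff_aestronglyMeasurable]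
    obtain ⟨f', h1, h2⟩ := mem_lpMeas_iff_aestronglyMeasurable.1 f.2
    refine ⟨f' ∘ fun z : Phase => ((z.1, -z.2) : Phase),
      h1.comp_measurable measurable_reverse_radialSigma, ?_⟩
    exact (Lp.coeFn_compMeasurePreserving _ _).trans
      (h.measurePreserving_reverse_weighted.quasiMeasurePreserving.ae_eq_comp h2)⟩
  map_add' f g := Subtype.ext (map_add _ _ _)
  map_smul' c f := Subtype.ext
    ((Lp.compMeasurePreservingₗ ℝ _ h.measurePreserving_reverse_weighted).map_smul c f.1)
  norm_map' f := Lp.norm_compMeasurePreserving f.1 h.measurePreserving_reverse_weighted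

lemma reversal_ae (f : L2r ℝ Q F) : (h.reversal f : Phase → ℝ) =ᵐ[volume.restrict (Omega Q)]
    fun z => (f : Phase → ℝ) (z.1, -z.2) :=
  h.ae_weighted_iff.1 (Lp.coeFn_compMeasurePreserving f.1 h.measurePreserving_reverse_weighted)

lemma L2r_ext {f g : L2r ℝ Q F}
    (hfg : (f : Phase → ℝ) =ᵐ[volume.restrict (Omega Q)] (g : Phase → ℝ)) : f = g :=
  Subtype.ext (Lp.ext (h.ae_weighted_iff.2 hfg))

lemma reversal_reversal (f : L2r ℝ Q F) : h.reversal (h.reversal f) = f := by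
  refine h.L2r_ext ?_
  filter_upwards [h.reversal_ae (h.reversal f),
    h.measurePreserving_reverse_Omega.quasiMeasurePreserving.ae_eq_comp (h.reversal_ae f)]
    with z h1 h2
  simp only [Function.comp_apply, neg_neg] at h2
  rw [h1, h2]

lemma koopman_reversal (t : ℝ) (f : L2r ℝ Q F) :
    (h.koopman ℝ).toFun t (h.reversal f) = h.reversal ((h.koopman ℝ).toFun (-t) f) := by
  refine h.L2r_ext ?_
  filter_upwards [h.koopman_ae t (h.reversal f), h.reversal_ae ((h.koopman ℝ).toFun (-t) f),
    (h.measurePreserving_flow_Omega t).quasiMeasurePreserving.ae_eq_comp (h.reversal_ae f),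
    h.measurePreserving_reverse_Omega.quasiMeasurePreserving.ae_eq_comp (h.koopman_ae (-t) f)]
    with z h1 h2 h3 h4
  simp only [Function.comp_apply] at h3 h4
  rw [h1, h2, h3, h4, h.flow_reverse, neg_neg]

/-- Reversal conjugates the flow to its inverse, so it anticommutes with the generator. Consequently
`𝒯` sends the odd part of `ξ` to the even part of `𝒯ξ`. -/
lemma isGenerator_reversal {ξ g : L2r ℝ Q F} (hg : (h.koopman ℝ).IsGenerator ξ g) :
    (h.koopman ℝ).IsGenerator (h.reversal ξ) (-h.reversal g) := by
  have h0 : HasDerivAt (fun t => (h.koopman ℝ).toFun t ξ) g (-0) := by rw [neg_zero]; exact hg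
  have h1 := h0.scomp (0:ℝ) (hasDerivAt_neg (0:ℝ))
  have h2 := h.reversal.toContinuousLinearMap.hasFDerivAt.comp_hasDerivAt (0:ℝ) h1
  refine (h2.congr_of_eventuallyEq (Filter.Eventually.of_forall fun t => ?_)).congr_deriv ?_
  · exact h.koopman_reversal t ξ
  · rw [neg_one_smul]
    exact h.reversal.map_neg g

/-- The projection onto odd functions. -/
lemma isOdd_sub_reversal (ξ : L2r ℝ Q F) :
    IsOdd Q (((2⁻¹ : ℝ) • (ξ - h.reversal ξ) : L2r ℝ Q F) : Phase → ℝ) := by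
  have e : h.reversal ((2⁻¹ : ℝ) • (ξ - h.reversal ξ)) = -((2⁻¹ : ℝ) • (ξ - h.reversal ξ)) := by
    rw [map_smul, map_sub, h.reversal_reversal, ← smul_neg, neg_sub]
  have h1 := h.reversal_ae ((2⁻¹ : ℝ) • (ξ - h.reversal ξ))
  rw [e] at h1
  have h2 := h.ae_weighted_iff.1 (Lp.coeFn_neg ((2⁻¹ : ℝ) • (ξ - h.reversal ξ) : L2r ℝ Q F).1)
  filter_upwards [h1, h2] with z h1 h2
  exact h1.symm.trans h2

lemma isGenerator_sub_reversal {ξ g : L2r ℝ Q F} (hg : (h.koopman ℝ).IsGenerator ξ g) :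
    (h.koopman ℝ).IsGenerator ((2⁻¹ : ℝ) • (ξ - h.reversal ξ))
      ((2⁻¹ : ℝ) • (g + h.reversal g)) := by
  have h1 := (HasDerivAt.sub hg (h.isGenerator_reversal hg)).const_smul (2⁻¹ : ℝ)
  rw [sub_neg_eq_add] at h1
  refine h1.congr_of_eventuallyEq (Filter.Eventually.of_forall fun t => ?_)
  simp only [map_smul, map_sub]
  rfl

/-- Even functions orthogonal to the kernel are limits of images of odd functions. -/
lemma exists_tendsto_of_even {g : L2r ℝ Q F} (hg : g ∈ (pker (h.transport ℝ))ᗮ)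
    (heven : IsEven Q (g : Phase → ℝ)) :
    ∃ ξ γ : ℕ → L2r ℝ Q F, (∀ n, (h.koopman ℝ).IsGenerator (ξ n) (γ n)) ∧
      (∀ n, IsOdd Q (ξ n : Phase → ℝ)) ∧ Filter.Tendsto γ Filter.atTop (𝓝 g) := by
  obtain ⟨γ, hγ, hlim⟩ := mem_closure_iff_seq_limit.1
    (IsometryGroup.mem_closure_range (T := h.transport ℝ) (U := h.koopman ℝ)
      h.mem_graph_transport_iff hg)
  choose ξ hξ using hγ
  have hξ' := fun n => (h.mem_graph_transport_iff _ _).1 (hξ n)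
  refine ⟨fun n => (2⁻¹ : ℝ) • (ξ n - h.reversal (ξ n)),
    fun n => (2⁻¹ : ℝ) • (γ n + h.reversal (γ n)), fun n => h.isGenerator_sub_reversal (hξ' n),
    fun n => h.isOdd_sub_reversal _, ?_⟩
  -- An even `g` is fixed by reversal, so the even parts of the approximating images still converge
  -- to `g`.
  have hR : h.reversal g = g := h.L2r_ext ((h.reversal_ae g).trans heven)
  have h1 := (hlim.add ((h.reversal.continuous.tendsto g).comp hlim)).const_smul (2⁻¹ : ℝ)
  rw [hR, ← two_smul ℝ g, smul_smul, inv_mul_cancel₀ two_ne_zero, one_smul] at h1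
  exact h1

end Reversal

/-- The density is positive near `z.1`, a boundary point of the ball, so some of this neighbourhood
lies inside the ball. -/
lemma ballMass_norm_pos {z : Phase} (hz : z ∈ Omega Q) (hx : z.1 ≠ 0) :
    0 < ballMass (density Q) ‖z.1‖ := by
  have hn : ‖z.1‖ ≠ 0 := norm_ne_zero_iff.2 hx
  unfold ballMass
  rw [setIntegral_pos_iff_support_of_nonneg_ae (Filter.Eventually.of_forall h.density_nonneg)
    h.density_integrable.integrableOn]
  have ho : IsOpen (Function.support (density Q) ∩ Metric.ball (0 : E3) ‖z.1‖) :=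
    (h.density_continuous.isOpen_support).inter Metric.isOpen_ball
  refine ho.measure_pos volume ?_
  have hcl : z.1 ∈ closure (Metric.ball (0 : E3) ‖z.1‖) := by
    rw [closure_ball _ hn]
    simp
  exact mem_closure_iff.1 hcl _ h.density_continuous.isOpen_support (h.density_pos hz).ne'

lemma exists_mean_lower_bound {ψ : Phase → ℝ} (hψ : IsTest (Omega Q ∩ {z | z.1 ≠ 0}) ψ) :
    ∃ c, 0 < c ∧ ∀ z ∈ tsupport ψ, c ≤ h.mean ‖z.1‖ := by
  have hpi := Real.pi_pos
  have hR := h.radius_pos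
  rcases (tsupport ψ).eq_empty_or_nonempty with he | hne
  · exact ⟨1, one_pos, fun z hz => by rw [he] at hz; exact hz.elim⟩
  obtain ⟨w, hw, hmin⟩ := hψ.2.1.isCompact.exists_isMinOn hne
    (f := fun z : Phase => ‖z.1‖) (by fun_prop)
  have hwpos := h.ballMass_norm_pos (hψ.2.2 hw).1 (hψ.2.2 hw).2
  refine ⟨ballMass (density Q) ‖w.1‖ / (4 * Real.pi * h.radius ^ 3), by positivity,
    fun z hz => ?_⟩
  have hz0 : 0 < ‖z.1‖ := norm_pos_iff.2 (hψ.2.2 hz).2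
  have h1 : ballMass (density Q) ‖w.1‖ ≤ ballMass (density Q) ‖z.1‖ := h.ballMass_mono (hmin hz)
  have h2 := (h.norm_fst_lt_radius (hψ.2.2 hz).1).le
  have h3 : 0 ≤ ballMass (density Q) ‖z.1‖ := hwpos.le.trans h1
  unfold mean meanField
  gcongr

/-- The functionals of the `γ n` tend to zero, hence by coercivity so do the integrals of `m ξ_n² /
|F'_e|`. On the support of a test function `ψ` avoiding `x = 0` the mean field `m` is bounded below,
so `∫ ψ γ_n = -∫ (𝒯ψ) ξ_n` tends to zero and `g` is orthogonal to `ψ`. Convergence of the `ξ_n`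
themselves is not needed. -/
lemma eq_zero_of_antonov_eq_zero {g : L2r ℝ Q F} {ξ γ : ℕ → L2r ℝ Q F}
    (hγ : ∀ n, (h.koopman ℝ).IsGenerator (ξ n) (γ n)) (hξ : ∀ n, IsOdd Q (ξ n : Phase → ℝ))
    (hlim : Filter.Tendsto γ Filter.atTop (𝓝 g)) (h0 : antonov Q F (g : Phase → ℝ) = 0) :
    g = 0 := by
  have hpi := Real.pi_pos
  have hq : Filter.Tendsto (fun n => antonov Q F (γ n : Phase → ℝ)) Filter.atTop (𝓝 0) := by
    rw [← h0]
    exact (h.continuous_antonov.tendsto g).comp hlim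
  have hopen : IsOpen (Omega Q ∩ {z : Phase | z.1 ≠ 0}) :=
    h.isOpen_Omega.inter (isOpen_ne_fun continuous_fst continuous_const)
  -- Removing `x = 0` costs only a null set and keeps supports away from the point where the lower
  -- bound of `m` could degenerate.
  have hae : (Omega Q ∩ {z : Phase | z.1 ≠ 0} : Set Phase) =ᵐ[volume] Omega Q := by
    filter_upwards [ae_inner_ne_zero] with z hz
    have hz : z.1 ≠ 0 := fun H => hz (by rw [H, inner_zero_left])
    exact propext ⟨fun H => H.1, fun H => ⟨H, hz⟩⟩
  have hres := Measure.restrict_congr_set hae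
  have key : ∀ ψ, IsTest (Omega Q ∩ {z | z.1 ≠ 0}) ψ →
      ∫ z in Omega Q ∩ {z | z.1 ≠ 0}, ψ z • (g : Phase → ℝ) z = 0 := by
    intro ψ hψ
    have hψ' : IsTest (Omega Q) ψ := ⟨hψ.1, hψ.2.1, hψ.2.2.trans inter_subset_left⟩
    obtain ⟨c, hc0, hc⟩ := h.exists_mean_lower_bound hψ
    obtain ⟨B, hB⟩ := exists_bound_of_hasCompactSupport hψ.1.continuous hψ.2.1
    obtain ⟨D, hD⟩ := exists_bound_of_hasCompactSupport (h.continuous_transportClassical hψ)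
      (hasCompactSupport_transportClassical hψ)
    obtain ⟨k, _, hk⟩ := h.exists_pairing (𝕜 := ℝ) hψ.1.continuous.aestronglyMeasurable
      fun z _ => hB z
    have hkc : Continuous fun f : L2r ℝ Q F => (inner ℝ k f.1 : ℝ) :=
      continuous_const.inner continuous_subtype_val
    have hconv := ((hkc.tendsto g).comp hlim).abs
    set A := ∫ z in Omega Q, ‖dF Q F z‖
    -- Young's inequality with a free parameter `s`: the limit `n → ∞` removes the Antonov term,
    -- after which `s → 0` removes the other.
    have hbound : ∀ s, 0 < s → ∀ n, |(inner ℝ k (γ n).1 : ℝ)| ≤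
        s * (D ^ 2 / c * A) + s⁻¹ * antonov Q F (γ n : Phase → ℝ) := by
      intro s hs n
      have hT := h.isWeakTransport_of_isGenerator (hγ n) ψ hψ'
      have e1 : (inner ℝ k (γ n).1 : ℝ) =
          -∫ z in Omega Q, transportClassical (potential Q) ψ z • (ξ n : Phase → ℝ) z := by
        rw [hT.2.2, neg_neg]
        exact (hk (γ n).1).2
      rw [e1, abs_neg]
      have hle : ∀ z ∈ Omega Q,
          ‖transportClassical (potential Q) ψ z • (ξ n : Phase → ℝ) z‖ ≤
          s * (D ^ 2 / c) * ‖dF Q F z‖ +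
          s⁻¹ * (h.mean ‖z.1‖ * ((ξ n : Phase → ℝ) z ^ 2 / |dF Q F z|)) := by
        intro z hz
        have hd : 0 < |dF Q F z| := abs_pos.2 (h.dF_neg hz).ne
        have hm := h.mean_nonneg (norm_nonneg z.1)
        rw [Real.norm_eq_abs (dF Q F z)]
        by_cases hzs : z ∈ tsupport ψ
        · have hcz := hc z hzs
          have hDz := hD z
          rw [norm_smul, Real.norm_eq_abs, Real.norm_eq_abs]
          have h1 : |transportClassical (potential Q) ψ z| * |(ξ n : Phase → ℝ) z| ≤
              D * |(ξ n : Phase → ℝ) z| := mul_le_mul_of_nonneg_right hDz (abs_nonneg _)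
          have h2 : s⁻¹ * (c * ((ξ n : Phase → ℝ) z ^ 2 / |dF Q F z|)) ≤
              s⁻¹ * (h.mean ‖z.1‖ * ((ξ n : Phase → ℝ) z ^ 2 / |dF Q F z|)) := by gcongr
          have h3 : D * |(ξ n : Phase → ℝ) z| ≤ s * (D ^ 2 / c) * |dF Q F z| +
              s⁻¹ * (c * ((ξ n : Phase → ℝ) z ^ 2 / |dF Q F z|)) := by
            rw [← sq_abs ((ξ n : Phase → ℝ) z)]
            set x := |(ξ n : Phase → ℝ) z|
            set d := |dF Q F z|
            have hD0 : 0 ≤ D := (abs_nonneg _).trans hDz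
            have hx0 : 0 ≤ x := abs_nonneg _
            have e : s * (D ^ 2 / c) * d + s⁻¹ * (c * (x ^ 2 / d)) - D * x =
                ((s * D * d - c * x) ^ 2 + s * D * d * c * x) / (s * c * d) := by
              field_simp
              ring
            have : 0 ≤ ((s * D * d - c * x) ^ 2 + s * D * d * c * x) / (s * c * d) := by
              positivity
            linarith
          linarith
        · have : transportClassical (potential Q) ψ z = 0 := by
            have hf : fderiv ℝ ψ z = 0 := by
              by_contra hne
              exact hzs (support_fderiv_subset ℝ hne)
            rw [transportClassical, hf]
            rfl
          rw [this, zero_smul, norm_zero]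
          positivity
      have hI1 := h.integrableOn_dF.norm.const_mul (s * (D ^ 2 / c))
      have hI2 := (h.integrableOn_mean_mul_sq_div (ξ n)).const_mul s⁻¹
      have h4 : ‖∫ z in Omega Q, transportClassical (potential Q) ψ z • (ξ n : Phase → ℝ) z‖ ≤
          ∫ z in Omega Q, (s * (D ^ 2 / c) * ‖dF Q F z‖ +
            s⁻¹ * (h.mean ‖z.1‖ * ((ξ n : Phase → ℝ) z ^ 2 / |dF Q F z|))) :=
        norm_integral_le_of_norm_le (hI1.add hI2)
          ((ae_restrict_mem h.measurableSet_Omega).mono hle)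
      rw [integral_add hI1 hI2, integral_const_mul, integral_const_mul] at h4
      have h5 := h.integral_mean_le_antonov (hγ n) (hξ n)
      have h6 := mul_le_mul_of_nonneg_left h5 (inv_pos.2 hs).le
      rw [Real.norm_eq_abs] at h4
      linarith
    have hlim' : ∀ s, 0 < s → |(inner ℝ k g.1 : ℝ)| ≤ s * (D ^ 2 / c * A) := fun s hs => by
      refine le_of_tendsto_of_tendsto' hconv ?_ (hbound s hs)
      simpa using (hq.const_mul s⁻¹).const_add (s * (D ^ 2 / c * A))
    have hzero : (inner ℝ k g.1 : ℝ) = 0 := by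
      have ht : Filter.Tendsto (fun s : ℝ => s * (D ^ 2 / c * A)) (𝓝[>] 0) (𝓝 0) := by
        have : Continuous fun s : ℝ => s * (D ^ 2 / c * A) := by fun_prop
        simpa using (this.tendsto 0).mono_left nhdsWithin_le_nhds
      exact abs_nonpos_iff.1 (ge_of_tendsto ht
        (eventually_mem_nhdsWithin.mono fun s hs => hlim' s hs))
    rw [hres]
    exact (hk g.1).2.symm.trans hzero
  have hg0 := ae_eq_zero_of_forall_test hopen
    ((h.integrableOn_coe g.1).mono_set inter_subset_left) key
  rw [hres] at hg0
  refine h.L2r_ext ?_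
  filter_upwards [hg0, h.ae_weighted_iff.1 (Lp.coeFn_zero ℝ 2 (weighted Q F))] with z h1 h2
  exact h1.trans h2.symm

omit h in
lemma antonov_nonneg_of_tendsto (h : IsAdmissible Q F e₀) {g : L2r ℝ Q F} {ξ γ : ℕ → L2r ℝ Q F}
    (hγ : ∀ n, (h.koopman ℝ).IsGenerator (ξ n) (γ n)) (hξ : ∀ n, IsOdd Q (ξ n : Phase → ℝ))
    (hlim : Filter.Tendsto γ Filter.atTop (𝓝 g)) : 0 ≤ antonov Q F (g : Phase → ℝ) :=
  ge_of_tendsto ((h.continuous_antonov.tendsto g).comp hlim)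
    (Filter.Eventually.of_forall fun n => (integral_nonneg fun z =>
      mul_nonneg (h.mean_nonneg (norm_nonneg _)) (by positivity)).trans
        (h.integral_mean_le_antonov (hγ n) (hξ n)))

lemma antonov_zero : antonov Q F ((0 : L2r ℝ Q F) : Phase → ℝ) = 0 := by
  have : h.field 0 = 0 := by
    have := h.field_sub 0 0
    rwa [sub_self, sub_self] at this
  rw [h.antonov_eq, this]
  simp

end IsAdmissible

end VlasovPoisson
end

theorem proposition5p1 (Q : Phase → ℝ) (F : ℝ → ℝ → ℝ) (e₀ : ℝ) (h : IsAdmissible Q F e₀) :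
    -- (i) `i𝒯` is self-adjoint, and the kernel of `𝒯` consists of the functions of `(e, ℓ)`
    (IsSelfAdjoint (Complex.I • h.transport ℂ) ∧
      (∀ f : L2r ℂ Q F, f ∈ pker (Complex.I • h.transport ℂ) ↔
        IsFunctionOfEnergyMomentum Q (f : Phase → ℂ)) ∧
      (∀ f : L2r ℝ Q F, f ∈ pker (h.transport ℝ) ↔
        IsFunctionOfEnergyMomentum Q (f : Phase → ℝ))) ∧
    -- (ii) the Antonov functional is well defined and continuous
    ((∀ g : L2r ℝ Q F,
        Integrable (extend Q (g : Phase → ℝ)) ∧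
        (∀ᵐ x : E3, DifferentiableAt ℝ (potential (extend Q (g : Phase → ℝ))) x) ∧
        MemLp (gradient (potential (extend Q (g : Phase → ℝ)))) 2) ∧
      Continuous (fun g : L2r ℝ Q F => antonov Q F (g : Phase → ℝ)) ∧
      -- and it is coercive on the image under `𝒯` of the odd functions
      ∀ ξ : (h.transport ℝ).domain, IsOdd Q ((ξ : L2r ℝ Q F) : Phase → ℝ) →
        IntegrableOn (fun z => ((ξ : L2r ℝ Q F) : Phase → ℝ) z ^ 2 / |dF Q F z| *
          (radialDeriv (potential Q) z.1 / ‖z.1‖)) (Omega Q) ∧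
        ∫ z in Omega Q, ((ξ : L2r ℝ Q F) : Phase → ℝ) z ^ 2 / |dF Q F z| *
          (radialDeriv (potential Q) z.1 / ‖z.1‖) ≤
          antonov Q F (h.transport ℝ ξ : Phase → ℝ)) ∧
    -- (iii) positivity on the even functions orthogonal to the kernel
    (∀ g : L2r ℝ Q F, g ∈ (pker (h.transport ℝ))ᗮ → IsEven Q (g : Phase → ℝ) →
      0 ≤ antonov Q F (g : Phase → ℝ) ∧ (antonov Q F (g : Phase → ℝ) = 0 ↔ g = 0)) := by
  refine ⟨⟨h.isSelfAdjoint_transport, fun f => ?_, h.mem_pker_transport_iff⟩,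
    ⟨fun g => ⟨h.integrable_extend (h.integrableOn_coe g.1), ?_, h.memLp_gradient_extend g⟩,
      h.continuous_antonov, fun ξ hξ => ?_⟩, fun g hg heven => ?_⟩
  · rw [IsAdmissible.pker_I_smul, h.mem_pker_transport_iff]
  · filter_upwards [ae_fst_ne_zero] with x hx
    exact (h.hasGradientAt_potential_extend g hx).hasFDerivAt.differentiableAt
  · have hgen := (h.mem_graph_transport_iff _ _).1 ((h.transport ℝ).mem_graph ξ)
    have hae := h.mul_radialDeriv_ae (ξ.1 : Phase → ℝ)
    refine ⟨(h.integrableOn_mean_mul_sq_div ξ.1).congr hae.symm, ?_⟩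
    rw [integral_congr_ae hae]
    exact h.integral_mean_le_antonov hgen hξ
  · obtain ⟨ξ, γ, hγ, hξ, hlim⟩ := h.exists_tendsto_of_even hg heven
    refine ⟨h.antonov_nonneg_of_tendsto hγ hξ hlim,
      fun h0 => h.eq_zero_of_antonov_eq_zero hγ hξ hlim h0, ?_⟩
    rintro rfl
    exact h.antonov_zero
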